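/- **Setting.** Let $M$ be a smooth $n$-manifold (Hausdorff, $\sigma$-compact) and let $E\to M$, $F\to M$ be smooth vector bundles of finite rank with smooth bundle maps $F\xrightarrow{t}E\xrightarrow{\rho}TM$ over the identity. Assume that the anchored bundle $(E,\rho)$ is involutive: locally, $[\rho(s),\rho(s')]=\rho(s'')$ for smooth sections. An *almost Lie bracket* on $(E,\rho)$ is an antisymmetric bracket on $\Gamma(E)$ with $[s,fs']=f[s,s']+(\rho(s)f)s'$ and $\rho([s,s'])=[\rho(s),\rho(s')]$. Let $g$ be a (pseudo-)Riemannian metric and $H$ a closed 3-form on $M$. We work locally on $M$: $x^i$ are coordinates on a chart, $e_a$ is a frame of $E$ and $f_I$ a frame of $F$ over it, $\rho_a=\rho(e_a)$, $t(f_I)=t_I^a e_a$, $[e_a,e_b]=C^c_{ab}e_c$, and $B$ is a 2-form on the chart domain with $dB=H$. The world-sheet $\Sigma$ is an oriented coordinate patch, i.e. an open subset of $\mathbb R^2$, with an arbitrary smooth metric of Euclidean or of Lorentzian signature and Hodge operator $*$. Put $$S_{0WZ}[X]=\int_\Sigma \tfrac12 g_{ij}\,dX^i\wedge *dX^j+X^*B,\qquad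 X\colon\Sigma\to M .$$ For a connection $\nabla$ on $E$, $\nabla e_a=\omega^b_a\otimes e_b$, for $\varphi\in\Omega^1(M,\mathrm{End}E)$, $\varphi(e_a)=\varphi^b_a\otimes e_b$, and for $\alpha\in\Omega^1(M,E^*)$, $\alpha_a=\alpha(e_a)$, put $$S_{1WZ}[X,A]=\int_\Sigma \tfrac12 g_{ij}\,DX^i\wedge *DX^j+X^*B+A^a\wedge X^*\alpha_a+\tfrac12\gamma_{ab}\,A^a\wedge A^b,$$ where $(X,A)$ are the components of a bundle map $a\colon T\Sigma\to E$, $DX^i=dX^i-\rho_a^i A^a$ and $\gamma_{ab}=\iota_{\rho_a}\alpha_b$. Consider the conditions $$\text{(1)}\quad \mathcal L_{\rho_a}g=\omega^b_a\vee\iota_{\rho_b}g+\varphi^b_a\vee\alpha_b,\qquad \text{(2)}\quad \iota_{\rho_a}H=d\alpha_a-\omega^b_a\wedge\alpha_b\pm\varphi^b_a\wedge\iota_{\rho_b}g,$$ $$\text{(3)}\quad \iota_{\rho_a}\alpha_b+\iota_{\rho_b}\alpha_a=0,\qquad \text{(4)}\quad \mathcal L_{\rho_a}\alpha_b=C^c_{ab}\alpha_c+\iota_{\rho_b}(d\alpha_a-\iota_{\rho_a}H),$$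 where $\beta\vee\eta=\beta\otimes\eta+\eta\otimes\beta$ and the upper (lower) sign is for Euclidean (Lorentzian) signature. For functions $\varepsilon^a$ and 1-forms $\lambda^I$ on $\Sigma$ let $$\delta_{(\varepsilon,\lambda)}X^i=\rho^i_a\varepsilon^a,\qquad \delta_{(\varepsilon,\lambda)}A^a=d\varepsilon^a+C^a_{bc}A^b\varepsilon^c+\omega^a_{bi}\varepsilon^b DX^i+\varphi^a_{bi}\varepsilon^b *DX^i+t^a_I\lambda^I .$$ A functional is called invariant if its first variation vanishes at all smooth fields, for parameters with compact support. **Theorem.** (A) The image of $\rho$ integrates to a (possibly singular) foliation: through every point of $M$ there is an integral manifold, i.e. an injectively immersed disc whose tangent spaces are the images of $\rho$. Moreover $(E,\rho)$ admits an almost Lie bracket. Fix the signature, any $g$, $H$, any almost Lie bracket, and suppose that $\nabla$, $\varphi$, $\alpha$ are such that (1)–(4) hold in all charts and frames. (B) Every point of $M$ has arbitrarily small charts with a frame $e_a$ and a primitive $B$ of $H$; and in every chart, with every frame and every primitive $B$, $S_{1WZ}$ is a gauging of $S_{0WZ}$ along the foliation: $S_{1WZ}[X,0]=S_{0WZ}[X]$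 (as densities), and $S_{1WZ}$ is invariant under $\delta_{(\varepsilon,0)}$, which lifts the arbitrary deformation $\delta X=\rho(\varepsilon)$ along the leaves, for every world-sheet patch. (C) Suppose in addition that $F\to E\to TM$ is exact on the level of sections and that $t^a_I\alpha_a=0$. Then $S_{1WZ}$ is invariant under all $\delta_{(\varepsilon,\lambda)}$. If moreover $g$ is Riemannian, then the following holds. Call a chart, with frames $e_a$, $f_I$ and a primitive $B$, *foliated* if its image is a product $P\times R$ of open sets, $R$ convex, such that the image of $\rho$ is spanned by the coordinate vector fields along $R$; then $P$ is the leaf space. Every point near which $\rho$ has constant rank has arbitrarily small foliated charts. On every foliated chart (in Euclidean signature: on every foliated chart on which the nondegeneracy condition (N) below holds): * the gauging is *strict*: there are on $P$ a smooth metric $g_Q$ (positive definite in Lorentzian signature, nondegenerate in Euclidean signature) and a smooth 2-form $B_Q$ such that, for every world-sheet patch, the map sending $(X,A)$ to the projection of $X$ to $P$ induces a bijection from solutions of the Euler–Lagrange equations of $S_{1WZ}$ modulo gauge equivalence onto solutions of the Euler–Lagrange equations of the ungauged model with target $(P,g_Q,B_Q)$. Here two configurations are gauge equivalent if they are joined by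 a smooth path generated by transformations $\delta_{(\varepsilon,\lambda)}$ (parameters unrestricted at the boundary of the patch); * the $\delta_{(\varepsilon,\lambda)}$ form a *complete* set of nontrivial gauge transformations: given any gauge transformation, that is, a variation $\delta_\eta(X,A)$ that is a linear differential operator in an arbitrary compactly supported function $\eta$ with coefficients depending smoothly on the fields, and that leaves $S_{1WZ}$ invariant, then at every solution $\delta_\eta(X,A)=\delta_{(\varepsilon,\lambda)}(X,A)$ for some compactly supported $\varepsilon$, $\lambda$. Condition (N), at $x\in M$, with $V=\mathrm{im}\,\rho_x$: (i) the Hermitian form $g+i\gamma$, $\gamma(\rho(s),\rho(s'))=\iota_{\rho(s)}\alpha(s')$, on $V\otimes\mathbb C$ is nondegenerate, and (ii) the symmetric bilinear form $(\rho(s),\rho(s'))\mapsto g(\rho(s),\rho(s'))-g^{-1}(\alpha(s),\alpha(s'))$ on $V$ is nondegenerate. (For instance, (N) holds if $|\alpha(s)|<|\rho(s)|$ whenever $\rho(s)\ne0$.) -/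

import Mathlib

open scoped Manifold ContDiff Topology Bundle Matrix
open MeasureTheory

noncomputable section

namespace GaugedSigma

/-! ### The world-sheet: oriented coordinate patches with a metric -/

/-- The signature of the world-sheet metric. -/
inductive Signature where
  | euclidean
  | lorentzian

/-- The sign `±`: upper sign for Euclidean, lower sign for Lorentzian signature. -/
def Signature.sign : Signature → ℝ
  | .euclidean => 1
  | .lorentzian => -1

abbrev Plane := EuclideanSpace ℝ (Fin 2)

/-- The partial derivative `∂f/∂x^i`. -/
def pd {ι : Type*} [Fintype ι] [DecidableEq ι] (i : ι) (f : EuclideanSpace ℝ ι → ℝ)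
    (x : EuclideanSpace ℝ ι) : ℝ :=
  fderiv ℝ f x (EuclideanSpace.single i 1)

/-- An oriented coordinate patch of a surface without boundary: an open subset of the plane (with
the orientation of the coordinates), with a smooth metric of the given signature. -/
structure Worldsheet (sig : Signature) where
  dom : Set Plane
  isOpen_dom : IsOpen dom
  metric : Plane → Matrix (Fin 2) (Fin 2) ℝ
  smooth : ∀ μ ν, ContDiffOn ℝ ∞ (fun σ => metric σ μ ν) dom
  symm : ∀ σ ∈ dom, (metric σ).IsSymm
  signature : ∀ σ ∈ dom, match sig with
    | .euclidean => (metric σ).PosDef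
    | .lorentzian => (metric σ).det < 0

/-- The coefficient of `dσ¹ ∧ dσ²` in the wedge product of two 1-forms. -/
def wedge (β η : Fin 2 → ℝ) : ℝ := β 0 * η 1 - β 1 * η 0

/-- The Hodge dual of a 1-form: `β ∧ ∗η = γ^{μν} β_μ η_ν √|det γ| dσ¹ ∧ dσ²`. -/
def hodge (γ : Matrix (Fin 2) (Fin 2) ℝ) (η : Fin 2 → ℝ) : Fin 2 → ℝ :=
  ![-(√|γ.det| * (γ⁻¹ *ᵥ η) 1), √|γ.det| * (γ⁻¹ *ᵥ η) 0]

/-- The 1-form `dX^i = X^* dx^i` on the world-sheet. -/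
def dX {ι : Type*} [Fintype ι] (X : Plane → EuclideanSpace ℝ ι) (i : ι) (σ : Plane) :
    Fin 2 → ℝ :=
  fun μ => pd μ (fun σ' => X σ' i) σ

/-- Smooth functions with compact support inside `D`. -/
def IsTest {V : Type*} [NormedAddCommGroup V] [NormedSpace ℝ V] (D : Set Plane)
    (f : Plane → V) : Prop :=
  ContDiff ℝ ∞ f ∧ HasCompactSupport f ∧ tsupport f ⊆ D

/-- The first variation at the configuration `a` in the direction `δ` of the functional with
Lagrangian density `L` over `D` vanishes. (`δ` has compact support, so only the difference of the
densities, which has compact support, is integrated.) -/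
def FirstVariationVanishes {Φ : Type*} [AddCommGroup Φ] [Module ℝ Φ] (D : Set Plane)
    (L : Φ → Plane → ℝ) (a δ : Φ) : Prop :=
  HasDerivAt (fun s : ℝ => ∫ σ in D, (L (a + s • δ) σ - L a σ)) 0 0

/-! ### The ungauged model `½ ∫ g_ij dX^i ∧ ∗dX^j + ∫ X^*B`, with `dB = H` -/

section Ungauged

variable {ι : Type*} [Fintype ι]

/-- Density of `½ ∫ g_ij dX^i ∧ ∗dX^j + ½ ∫ B_ij dX^i ∧ dX^j`. -/
def sigmaLagrangian (γ : Plane → Matrix (Fin 2) (Fin 2) ℝ)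
    (g B : EuclideanSpace ℝ ι → ι → ι → ℝ) (X : Plane → EuclideanSpace ℝ ι) (σ : Plane) : ℝ :=
  1 / 2 * ∑ i, ∑ j, g (X σ) i j * wedge (dX X i σ) (hodge (γ σ) (dX X j σ))
    + 1 / 2 * ∑ i, ∑ j, B (X σ) i j * wedge (dX X i σ) (dX X j σ)

/-- Solutions of the Euler-Lagrange equations of the ungauged model with target `U`. -/
structure IsSigmaSolution {sig : Signature} (W : Worldsheet sig) (U : Set (EuclideanSpace ℝ ι))
    (g B : EuclideanSpace ℝ ι → ι → ι → ℝ) (X : Plane → EuclideanSpace ℝ ι) : Prop where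
  smooth : ContDiffOn ℝ ∞ X W.dom
  mapsTo : Set.MapsTo X W.dom U
  stationary : ∀ ξ : Plane → EuclideanSpace ℝ ι, IsTest W.dom ξ →
    FirstVariationVanishes W.dom (sigmaLagrangian W.metric g B) X ξ

end Ungauged

/-! ### Local data of the gauged model, in a chart of `M` and a frame of `E` -/

/-- Components, over the image `dom` of a chart of `M` and with respect to a frame `e_a` of `E`. -/
structure LocalModel (n r : ℕ) where
  dom : Set (EuclideanSpace ℝ (Fin n))
  /-- `g x i j = g_ij` -/
  g : EuclideanSpace ℝ (Fin n) → Fin n → Fin n → ℝ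
  /-- `H x i j k = H_ijk` -/
  H : EuclideanSpace ℝ (Fin n) → Fin n → Fin n → Fin n → ℝ
  /-- `ρ x a i = ρ_a^i` -/
  ρ : EuclideanSpace ℝ (Fin n) → Fin r → Fin n → ℝ
  /-- `C x c a b = C^c_{ab}` -/
  C : EuclideanSpace ℝ (Fin n) → Fin r → Fin r → Fin r → ℝ
  /-- `conn x b a i = ω^b_{a i}` where `∇ e_a = ω^b_a ⊗ e_b` -/
  conn : EuclideanSpace ℝ (Fin n) → Fin r → Fin r → Fin n → ℝ
  /-- `φ x b a i = φ^b_{a i}` where `φ(e_a) = φ^b_a ⊗ e_b` -/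
  φ : EuclideanSpace ℝ (Fin n) → Fin r → Fin r → Fin n → ℝ
  /-- `α x a i = α_{a i}` -/
  α : EuclideanSpace ℝ (Fin n) → Fin r → Fin n → ℝ

/-- A field configuration `(X, A)`, i.e. a bundle map `a : TΣ → E`, in components:
`A σ a μ = A^a_μ(σ)`. Also used for variations `(δX, δA)`. -/
abbrev Config (n r : ℕ) := (Plane → EuclideanSpace ℝ (Fin n)) × (Plane → Fin r → Fin 2 → ℝ)

namespace LocalModel

variable {n r k : ℕ} (m : LocalModel n r)

/-- `(ι_{ρ_b} g)_i` -/
def ρg (x : EuclideanSpace ℝ (Fin n)) (b : Fin r) (i : Fin n) : ℝ := ∑ j, m.ρ x b j * m.g x j i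

/-- `(dα_a)_{ij}` -/
def dα (x : EuclideanSpace ℝ (Fin n)) (a : Fin r) (i j : Fin n) : ℝ :=
  pd i (fun y => m.α y a j) x - pd j (fun y => m.α y a i) x

/-- `(ι_{ρ_a} H)_{ij}` -/
def ρH (x : EuclideanSpace ℝ (Fin n)) (a : Fin r) (i j : Fin n) : ℝ := ∑ l, m.ρ x a l * m.H x l i j

/-- `γ_{ab} = ι_{ρ_a} α_b` -/
def γ (x : EuclideanSpace ℝ (Fin n)) (a b : Fin r) : ℝ := ∑ i, m.ρ x a i * m.α x b i

/-- `(L_{ρ_a} g)_{ij}` -/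
def lieG (x : EuclideanSpace ℝ (Fin n)) (a : Fin r) (i j : Fin n) : ℝ :=
  ∑ l, (m.ρ x a l * pd l (fun y => m.g y i j) x + m.g x l j * pd i (fun y => m.ρ y a l) x
    + m.g x l i * pd j (fun y => m.ρ y a l) x)

/-- `(L_{ρ_a} α_b)_i` -/
def lieα (x : EuclideanSpace ℝ (Fin n)) (a b : Fin r) (i : Fin n) : ℝ :=
  ∑ l, (m.ρ x a l * pd l (fun y => m.α y b i) x + m.α x b l * pd i (fun y => m.ρ y a l) x)

/-- `L_{ρ_a} g = ω^b_a ∨ ι_{ρ_b} g + φ^b_a ∨ α_b`. -/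
def MetricCondition : Prop :=
  ∀ x ∈ m.dom, ∀ a i j, m.lieG x a i j =
    ∑ b, (m.conn x b a i * m.ρg x b j + m.conn x b a j * m.ρg x b i)
      + ∑ b, (m.φ x b a i * m.α x b j + m.φ x b a j * m.α x b i)

/-- `ι_{ρ_a} H = dα_a - ω^b_a ∧ α_b ± φ^b_a ∧ ι_{ρ_b} g`. -/
def FluxCondition (sig : Signature) : Prop :=
  ∀ x ∈ m.dom, ∀ a i j, m.ρH x a i j = m.dα x a i j
    - ∑ b, (m.conn x b a i * m.α x b j - m.conn x b a j * m.α x b i)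
    + sig.sign * ∑ b, (m.φ x b a i * m.ρg x b j - m.φ x b a j * m.ρg x b i)

/-- `ι_{ρ_a} α_b` is antisymmetric in `a` and `b`. -/
def Isotropy : Prop := ∀ x ∈ m.dom, ∀ a b, m.γ x a b + m.γ x b a = 0

/-- `L_{ρ_a} α_b = C^c_{ab} α_c + ι_{ρ_b} (dα_a - ι_{ρ_a} H)`. -/
def Equivariance : Prop :=
  ∀ x ∈ m.dom, ∀ a b i, m.lieα x a b i =
    ∑ c, m.C x c a b * m.α x c i + ∑ l, m.ρ x b l * (m.dα x a l i - m.ρH x a l i)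

/-- `B` is a smooth 2-form on `dom` with `dB = H`. -/
structure IsPrimitive (B : EuclideanSpace ℝ (Fin n) → Fin n → Fin n → ℝ) : Prop where
  smooth : ∀ i j, ContDiffOn ℝ ∞ (fun x => B x i j) m.dom
  antisymm : ∀ x ∈ m.dom, ∀ i j, B x i j = -B x j i
  eq : ∀ x ∈ m.dom, ∀ i j l, m.H x i j l =
    pd i (fun y => B y j l) x + pd j (fun y => B y l i) x + pd l (fun y => B y i j) x

/-- The covariant derivative `DX^i = dX^i - ρ^i_a(X) A^a`. -/
def D (a : Config n r) (i : Fin n) (σ : Plane) : Fin 2 → ℝ :=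
  fun μ => dX a.1 i σ μ - ∑ b, m.ρ (a.1 σ) b i * a.2 σ b μ

/-- Density of the gauged functional
`½ ∫ g_ij DX^i ∧ ∗DX^j + ∫ X^*B + ∫ A^a ∧ α_a + ½ γ_ab A^a ∧ A^b`. -/
def gaugedLagrangian (h : Plane → Matrix (Fin 2) (Fin 2) ℝ)
    (B : EuclideanSpace ℝ (Fin n) → Fin n → Fin n → ℝ) (a : Config n r) (σ : Plane) : ℝ :=
  1 / 2 * ∑ i, ∑ j, m.g (a.1 σ) i j * wedge (m.D a i σ) (hodge (h σ) (m.D a j σ))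
    + 1 / 2 * ∑ i, ∑ j, B (a.1 σ) i j * wedge (dX a.1 i σ) (dX a.1 j σ)
    + ∑ b, wedge (a.2 σ b) (fun μ => ∑ i, m.α (a.1 σ) b i * dX a.1 i σ μ)
    + 1 / 2 * ∑ b, ∑ c, m.γ (a.1 σ) b c * wedge (a.2 σ b) (a.2 σ c)

/-- Smooth field configurations over `D` with values in `E` over the chart domain. -/
structure IsField (D : Set Plane) (a : Config n r) : Prop where
  smooth_fst : ContDiffOn ℝ ∞ a.1 D
  smooth_snd : ContDiffOn ℝ ∞ a.2 D
  mapsTo : Set.MapsTo a.1 D m.dom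

/-- Jointly smooth families of field configurations, parametrised by `T ⊆ ℝ`. -/
structure IsFieldFamily (T : Set ℝ) (D : Set Plane) (a : ℝ → Config n r) : Prop where
  smooth_fst : ContDiffOn ℝ ∞ (fun p : ℝ × Plane => (a p.1).1 p.2) (T ×ˢ D)
  smooth_snd : ContDiffOn ℝ ∞ (fun p : ℝ × Plane => (a p.1).2 p.2) (T ×ˢ D)
  mapsTo : ∀ s ∈ T, Set.MapsTo (a s).1 D m.dom

/-- Solutions of the Euler-Lagrange equations of the gauged model. -/
structure IsSolution {sig : Signature} (W : Worldsheet sig)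
    (B : EuclideanSpace ℝ (Fin n) → Fin n → Fin n → ℝ) (a : Config n r) : Prop where
  isField : m.IsField W.dom a
  stationary : ∀ δ : Config n r, IsTest W.dom δ.1 → IsTest W.dom δ.2 →
    FirstVariationVanishes W.dom (m.gaugedLagrangian W.metric B) a δ

/-- The gauge transformation with parameter `ε`:
`δX^i = ρ^i_a(X) ε^a`,
`δA^a = dε^a + C^a_{bc}(X) A^b ε^c + ω^a_{bi}(X) ε^b DX^i + φ^a_{bi}(X) ε^b ∗DX^i`. -/
def gaugeVariation (h : Plane → Matrix (Fin 2) (Fin 2) ℝ) (a : Config n r)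
    (ε : Plane → Fin r → ℝ) : Config n r :=
  (fun σ => WithLp.toLp 2 fun i => ∑ b, m.ρ (a.1 σ) b i * ε σ b,
   fun σ c μ => pd μ (fun σ' => ε σ' c) σ
    + ∑ b, ∑ d, m.C (a.1 σ) c b d * a.2 σ b μ * ε σ d
    + ∑ b, ∑ i, m.conn (a.1 σ) c b i * ε σ b * m.D a i σ μ
    + ∑ b, ∑ i, m.φ (a.1 σ) c b i * ε σ b * hodge (h σ) (m.D a i σ) μ)

/-- The translation `δX = 0`, `δA^a = t^a_I(X) λ^I`, where `t x I a = t^a_I`. -/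
def shiftVariation (t : EuclideanSpace ℝ (Fin n) → Fin k → Fin r → ℝ) (a : Config n r)
    (lam : Plane → Fin k → Fin 2 → ℝ) : Config n r :=
  (0, fun σ c μ => ∑ I, t (a.1 σ) I c * lam σ I μ)

/-- The gauged functional is a gauging, along the foliation generated by `ρ`, of the ungauged
functional with the same `g` and `B`: it reduces to the latter at `A = 0`, and it is invariant
under transformations lifting the arbitrary deformations `δX = ρ(ε)` along the leaves. -/
structure IsGauging (sig : Signature)
    (B : EuclideanSpace ℝ (Fin n) → Fin n → Fin n → ℝ) : Prop where
  reduces : ∀ (W : Worldsheet sig) (X : Plane → EuclideanSpace ℝ (Fin n)), ∀ σ ∈ W.dom,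
    m.gaugedLagrangian W.metric B (X, 0) σ = sigmaLagrangian W.metric m.g B X σ
  lifts : ∀ (W : Worldsheet sig) (a : Config n r) (ε : Plane → Fin r → ℝ) (σ : Plane) (i : Fin n),
    (m.gaugeVariation W.metric a ε).1 σ i = ∑ b, m.ρ (a.1 σ) b i * ε σ b
  invariant : ∀ (W : Worldsheet sig) (a : Config n r) (ε : Plane → Fin r → ℝ),
    m.IsField W.dom a → IsTest W.dom ε →
    FirstVariationVanishes W.dom (m.gaugedLagrangian W.metric B) a (m.gaugeVariation W.metric a ε)

/-- Invariance under all transformations with parameters `(ε, λ)`. -/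
def IsInvariant (sig : Signature) (B : EuclideanSpace ℝ (Fin n) → Fin n → Fin n → ℝ)
    (t : EuclideanSpace ℝ (Fin n) → Fin k → Fin r → ℝ) : Prop :=
  ∀ (W : Worldsheet sig) (a : Config n r) (ε : Plane → Fin r → ℝ) (lam : Plane → Fin k → Fin 2 → ℝ),
    m.IsField W.dom a → IsTest W.dom ε → IsTest W.dom lam →
    FirstVariationVanishes W.dom (m.gaugedLagrangian W.metric B) a
      (m.gaugeVariation W.metric a ε + shiftVariation t a lam)

/-- `a` and `a'` are joined, over `D`, by a path generated by infinitesimal gauge transformations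
(without boundary conditions on the parameters). -/
def GaugeEquivalent {sig : Signature} (W : Worldsheet sig)
    (t : EuclideanSpace ℝ (Fin n) → Fin k → Fin r → ℝ) (a a' : Config n r) : Prop :=
  ∃ (p : ℝ → Config n r) (ε : ℝ → Plane → Fin r → ℝ) (lam : ℝ → Plane → Fin k → Fin 2 → ℝ),
    m.IsFieldFamily (Set.Icc 0 1) W.dom p ∧
    ContDiffOn ℝ ∞ (fun q : ℝ × Plane => ε q.1 q.2) (Set.Icc 0 1 ×ˢ W.dom) ∧
    ContDiffOn ℝ ∞ (fun q : ℝ × Plane => lam q.1 q.2) (Set.Icc 0 1 ×ˢ W.dom) ∧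
    (∀ σ ∈ W.dom, (p 0).1 σ = a.1 σ ∧ (p 0).2 σ = a.2 σ) ∧
    (∀ σ ∈ W.dom, (p 1).1 σ = a'.1 σ ∧ (p 1).2 σ = a'.2 σ) ∧
    ∀ s ∈ Set.Icc (0 : ℝ) 1, ∀ σ ∈ W.dom,
      let δ := m.gaugeVariation W.metric (p s) (ε s) + shiftVariation t (p s) (lam s)
      HasDerivWithinAt (fun s' => (p s').1 σ) (δ.1 σ) (Set.Icc 0 1) s ∧
      HasDerivWithinAt (fun s' => (p s').2 σ) (δ.2 σ) (Set.Icc 0 1) s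

/-- The transversal coordinates `x^I`, which label the leaves. -/
def transversal (leaf : Finset (Fin n)) (x : EuclideanSpace ℝ (Fin n)) :
    EuclideanSpace ℝ {i : Fin n // i ∉ leaf} :=
  WithLp.toLp 2 fun i => x i

/-- The coordinates `x^α` along the leaves. -/
def tangential (leaf : Finset (Fin n)) (x : EuclideanSpace ℝ (Fin n)) :
    EuclideanSpace ℝ {i : Fin n // i ∈ leaf} :=
  WithLp.toLp 2 fun i => x i

/-- Coordinates adapted to the foliation: a product of a transversal domain and a convex plaque,
the leaves being given by `x^I = const`. The leaf space is `transversal leaf '' m.dom`. -/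
structure IsFoliated (leaf : Finset (Fin n)) : Prop where
  box : ∃ (P : Set (EuclideanSpace ℝ {i : Fin n // i ∉ leaf}))
    (R : Set (EuclideanSpace ℝ {i : Fin n // i ∈ leaf})),
    IsOpen P ∧ IsOpen R ∧ Convex ℝ R ∧
      m.dom = {x | transversal leaf x ∈ P ∧ tangential leaf x ∈ R}
  tangent : ∀ x ∈ m.dom, ∀ v : Fin n → ℝ,
    (∃ c : Fin r → ℝ, ∀ i, v i = ∑ a, c a * m.ρ x a i) ↔ ∀ i ∉ leaf, v i = 0

/-- The dynamics of the gauged model modulo gauge transformations is the one of an ungauged model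
on the leaf space `Q`: there are a metric and a 2-form on `Q` such that `(X, A) ↦ π ∘ X` induces a
bijection from gauge classes of solutions to solutions, for every world-sheet patch. -/
def IsStrict (sig : Signature) (B : EuclideanSpace ℝ (Fin n) → Fin n → Fin n → ℝ)
    (t : EuclideanSpace ℝ (Fin n) → Fin k → Fin r → ℝ) (leaf : Finset (Fin n)) : Prop :=
  ∃ gQ BQ : EuclideanSpace ℝ {i : Fin n // i ∉ leaf} →
      {i : Fin n // i ∉ leaf} → {i : Fin n // i ∉ leaf} → ℝ,
    (∀ I J, ContDiffOn ℝ ∞ (fun y => gQ y I J) (transversal leaf '' m.dom)) ∧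
    (∀ I J, ContDiffOn ℝ ∞ (fun y => BQ y I J) (transversal leaf '' m.dom)) ∧
    (∀ y ∈ transversal leaf '' m.dom, (Matrix.of (gQ y)).IsSymm ∧ (Matrix.of (gQ y)).det ≠ 0 ∧
      (sig = .lorentzian → (Matrix.of (gQ y)).PosDef) ∧ ∀ I J, BQ y I J = -BQ y J I) ∧
    ∀ W : Worldsheet sig,
      (∀ a : Config n r, m.IsSolution W B a →
        IsSigmaSolution W (transversal leaf '' m.dom) gQ BQ (fun σ => transversal leaf (a.1 σ))) ∧
      (∀ Y, IsSigmaSolution W (transversal leaf '' m.dom) gQ BQ Y →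
        ∃ a : Config n r, m.IsSolution W B a ∧ ∀ σ ∈ W.dom, transversal leaf (a.1 σ) = Y σ) ∧
      (∀ a a' : Config n r, m.IsSolution W B a → m.IsSolution W B a' →
        (m.GaugeEquivalent W t a a' ↔
          ∀ σ ∈ W.dom, transversal leaf (a.1 σ) = transversal leaf (a'.1 σ)))

/-- An infinitesimal gauge transformation of the gauged functional: a variation depending linearly
on an arbitrary function `η` on the world-sheet and on finitely many of its derivatives, with
coefficients depending smoothly on the fields, which leaves the functional invariant. -/
structure GaugeTransformation {sig : Signature} (W : Worldsheet sig)
    (B : EuclideanSpace ℝ (Fin n) → Fin n → Fin n → ℝ) where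
  order : ℕ
  /-- `coeff a p q` is the coefficient of `∂₁^p ∂₂^q η` at the field configuration `a`. -/
  coeff : Config n r → ℕ → ℕ → Config n r
  smooth_fst : ∀ a : ℝ → Config n r, m.IsFieldFamily Set.univ W.dom a → ∀ p q,
    ContDiffOn ℝ ∞ (fun z : ℝ × Plane => (coeff (a z.1) p q).1 z.2) (Set.univ ×ˢ W.dom)
  smooth_snd : ∀ a : ℝ → Config n r, m.IsFieldFamily Set.univ W.dom a → ∀ p q,
    ContDiffOn ℝ ∞ (fun z : ℝ × Plane => (coeff (a z.1) p q).2 z.2) (Set.univ ×ˢ W.dom)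
  /-- The variation `δ_η a`. -/
  variation : Config n r → (Plane → ℝ) → Config n r
  variation_fst : ∀ a η σ, (variation a η).1 σ =
    ∑ p ∈ Finset.range (order + 1), ∑ q ∈ Finset.range (order + 1),
      ((pd 0)^[p] ((pd 1)^[q] η)) σ • (coeff a p q).1 σ
  variation_snd : ∀ a η σ, (variation a η).2 σ =
    ∑ p ∈ Finset.range (order + 1), ∑ q ∈ Finset.range (order + 1),
      ((pd 0)^[p] ((pd 1)^[q] η)) σ • (coeff a p q).2 σ
  invariant : ∀ a η, m.IsField W.dom a → IsTest W.dom η →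
    FirstVariationVanishes W.dom (m.gaugedLagrangian W.metric B) a (variation a η)

/-- Up to trivial gauge transformations, i.e. those vanishing on solutions, every gauge
transformation is one of those with parameters `(ε, λ)`. -/
def IsComplete (sig : Signature) (B : EuclideanSpace ℝ (Fin n) → Fin n → Fin n → ℝ)
    (t : EuclideanSpace ℝ (Fin n) → Fin k → Fin r → ℝ) : Prop :=
  ∀ (W : Worldsheet sig) (T : m.GaugeTransformation W B) (a : Config n r) (η : Plane → ℝ),
    m.IsSolution W B a → IsTest W.dom η →
    ∃ (ε : Plane → Fin r → ℝ) (lam : Plane → Fin k → Fin 2 → ℝ),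
      IsTest W.dom ε ∧ IsTest W.dom lam ∧
      ∀ σ ∈ W.dom,
        (T.variation a η).1 σ = (m.gaugeVariation W.metric a ε + shiftVariation t a lam).1 σ ∧
        (T.variation a η).2 σ = (m.gaugeVariation W.metric a ε + shiftVariation t a lam).2 σ

end LocalModel

/-! ### Global data on the target manifold -/

section Global

variable {n r k : ℕ} {M : Type*} [TopologicalSpace M] [ChartedSpace (EuclideanSpace ℝ (Fin n)) M]

/-- A (pseudo-)Riemannian metric on `M`. -/
structure PseudoMetric (n : ℕ) (M : Type*) [TopologicalSpace M]
    [ChartedSpace (EuclideanSpace ℝ (Fin n)) M] [IsManifold (𝓡 n) ∞ M] where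
  inner : ∀ x : M, TangentSpace (𝓡 n) x →L[ℝ] TangentSpace (𝓡 n) x →L[ℝ] ℝ
  symm : ∀ x v w, inner x v w = inner x w v
  nondegenerate : ∀ x v, (∀ w, inner x v w = 0) → v = 0
  smooth : ContMDiff (𝓡 n)
    ((𝓡 n).prod 𝓘(ℝ, EuclideanSpace ℝ (Fin n) →L[ℝ] EuclideanSpace ℝ (Fin n) →L[ℝ] ℝ)) ∞
    (fun x => Bundle.TotalSpace.mk'
      (EuclideanSpace ℝ (Fin n) →L[ℝ] EuclideanSpace ℝ (Fin n) →L[ℝ] ℝ) x (inner x))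

/-- The coordinate vector field `∂_i` of the chart `κ`, at the point with coordinates `y`. -/
def coordVec (κ : OpenPartialHomeomorph M (EuclideanSpace ℝ (Fin n)))
    (y : EuclideanSpace ℝ (Fin n)) (i : Fin n) : TangentSpace (𝓡 n) (κ.symm y) :=
  mfderiv (𝓡 n) (𝓡 n) κ.symm y (EuclideanSpace.single i (1 : ℝ) : EuclideanSpace ℝ (Fin n))

/-- A closed 3-form on `M`. -/
structure ClosedThreeForm (n : ℕ) (M : Type*) [TopologicalSpace M]
    [ChartedSpace (EuclideanSpace ℝ (Fin n)) M] [IsManifold (𝓡 n) ∞ M] where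
  form : ∀ x : M, TangentSpace (𝓡 n) x →L[ℝ] TangentSpace (𝓡 n) x →L[ℝ]
    TangentSpace (𝓡 n) x →L[ℝ] ℝ
  alt₁₂ : ∀ x v w, form x v v w = 0
  alt₂₃ : ∀ x v w, form x v w w = 0
  smooth : ∀ κ ∈ IsManifold.maximalAtlas (𝓡 n) ∞ M, ∀ i j l : Fin n,
    ContDiffOn ℝ ∞ (fun y => form (κ.symm y) (coordVec κ y i) (coordVec κ y j) (coordVec κ y l))
      κ.target
  closed : ∀ κ ∈ IsManifold.maximalAtlas (𝓡 n) ∞ M, ∀ y ∈ κ.target, ∀ i j l q : Fin n,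
    let comp (i j l : Fin n) (z : EuclideanSpace ℝ (Fin n)) : ℝ :=
      form (κ.symm z) (coordVec κ z i) (coordVec κ z j) (coordVec κ z l)
    pd i (comp j l q) y - pd j (comp i l q) y + pd l (comp i j q) y - pd q (comp i j l) y = 0

section Bundles

variable
  {E : M → Type*} [TopologicalSpace (Bundle.TotalSpace (EuclideanSpace ℝ (Fin r)) E)]
  [∀ x, AddCommGroup (E x)] [∀ x, Module ℝ (E x)] [∀ x, TopologicalSpace (E x)]
  [∀ x, IsTopologicalAddGroup (E x)] [∀ x, ContinuousSMul ℝ (E x)]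
  [FiberBundle (EuclideanSpace ℝ (Fin r)) E] [VectorBundle ℝ (EuclideanSpace ℝ (Fin r)) E]
  {F : M → Type*} [TopologicalSpace (Bundle.TotalSpace (EuclideanSpace ℝ (Fin k)) F)]
  [∀ x, AddCommGroup (F x)] [∀ x, Module ℝ (F x)] [∀ x, TopologicalSpace (F x)]
  [∀ x, IsTopologicalAddGroup (F x)] [∀ x, ContinuousSMul ℝ (F x)]
  [FiberBundle (EuclideanSpace ℝ (Fin k)) F] [VectorBundle ℝ (EuclideanSpace ℝ (Fin k)) F]

/-- The image of the anchor is involutive: locally, `[ρ(s), ρ(s')] = ρ(s'')`. -/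
def IsInvolutive (ρ : ∀ x : M, E x →L[ℝ] TangentSpace (𝓡 n) x) : Prop :=
  ∀ s s' : ContMDiffSection (𝓡 n) (EuclideanSpace ℝ (Fin r)) ∞ E, ∀ x : M,
    ∃ s'' : ContMDiffSection (𝓡 n) (EuclideanSpace ℝ (Fin r)) ∞ E, ∀ᶠ y in 𝓝 x,
      VectorField.mlieBracket (𝓡 n) (fun z => ρ z (s z)) (fun z => ρ z (s' z)) y = ρ y (s'' y)

/-- The image of the anchor integrates to a (singular) foliation: through every point passes an
integral manifold, i.e. an injectively immersed disc whose tangent spaces are the images of `ρ`. -/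
def IsIntegrable (ρ : ∀ x : M, E x →L[ℝ] TangentSpace (𝓡 n) x) : Prop :=
  ∀ x : M, ∃ (d : ℕ) (f : EuclideanSpace ℝ (Fin d) → M), f 0 = x ∧
    ContMDiffOn (𝓡 d) (𝓡 n) ∞ f (Metric.ball 0 1) ∧ Set.InjOn f (Metric.ball 0 1) ∧
    ∀ u ∈ Metric.ball (0 : EuclideanSpace ℝ (Fin d)) 1,
      Function.Injective (mfderiv (𝓡 d) (𝓡 n) f u) ∧
      Set.range (mfderiv (𝓡 d) (𝓡 n) f u) = Set.range (ρ (f u))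

/-- A point with a neighbourhood on which the rank of the anchor is constant. -/
def IsRegular (ρ : ∀ x : M, E x →L[ℝ] TangentSpace (𝓡 n) x) (x : M) : Prop :=
  ∀ᶠ y in 𝓝 x, Module.finrank ℝ (LinearMap.range (ρ y).toLinearMap) =
    Module.finrank ℝ (LinearMap.range (ρ x).toLinearMap)

/-- A compatible almost Lie algebroid structure on the anchored bundle `(E, ρ)`: an antisymmetric
bracket on smooth sections with the Leibniz rule, mapped by `ρ` to the Lie bracket of vector fields.
As for Mathlib's covariant derivatives, the bracket is a map on all set-theoretic sections, subject
to conditions at the points where its arguments are smooth. -/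
structure IsAlmostLieBracket (ρ : ∀ x : M, E x →L[ℝ] TangentSpace (𝓡 n) x)
    (br : (∀ x, E x) → (∀ x, E x) → ∀ x, E x) : Prop where
  smooth : ∀ s s' x,
    ContMDiffAt (𝓡 n) ((𝓡 n).prod 𝓘(ℝ, EuclideanSpace ℝ (Fin r))) ∞
      (fun y => Bundle.TotalSpace.mk' (EuclideanSpace ℝ (Fin r)) y (s y)) x →
    ContMDiffAt (𝓡 n) ((𝓡 n).prod 𝓘(ℝ, EuclideanSpace ℝ (Fin r))) ∞
      (fun y => Bundle.TotalSpace.mk' (EuclideanSpace ℝ (Fin r)) y (s' y)) x →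
    ContMDiffAt (𝓡 n) ((𝓡 n).prod 𝓘(ℝ, EuclideanSpace ℝ (Fin r))) ∞
      (fun y => Bundle.TotalSpace.mk' (EuclideanSpace ℝ (Fin r)) y (br s s' y)) x
  antisymm : ∀ s s' x,
    ContMDiffAt (𝓡 n) ((𝓡 n).prod 𝓘(ℝ, EuclideanSpace ℝ (Fin r))) ∞
      (fun y => Bundle.TotalSpace.mk' (EuclideanSpace ℝ (Fin r)) y (s y)) x →
    ContMDiffAt (𝓡 n) ((𝓡 n).prod 𝓘(ℝ, EuclideanSpace ℝ (Fin r))) ∞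
      (fun y => Bundle.TotalSpace.mk' (EuclideanSpace ℝ (Fin r)) y (s' y)) x →
    br s s' x = -br s' s x
  add : ∀ s s' s'' x,
    ContMDiffAt (𝓡 n) ((𝓡 n).prod 𝓘(ℝ, EuclideanSpace ℝ (Fin r))) ∞
      (fun y => Bundle.TotalSpace.mk' (EuclideanSpace ℝ (Fin r)) y (s y)) x →
    ContMDiffAt (𝓡 n) ((𝓡 n).prod 𝓘(ℝ, EuclideanSpace ℝ (Fin r))) ∞
      (fun y => Bundle.TotalSpace.mk' (EuclideanSpace ℝ (Fin r)) y (s' y)) x →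
    ContMDiffAt (𝓡 n) ((𝓡 n).prod 𝓘(ℝ, EuclideanSpace ℝ (Fin r))) ∞
      (fun y => Bundle.TotalSpace.mk' (EuclideanSpace ℝ (Fin r)) y (s'' y)) x →
    br s (s' + s'') x = br s s' x + br s s'' x
  leibniz : ∀ s s' (f : M → ℝ) x,
    ContMDiffAt (𝓡 n) ((𝓡 n).prod 𝓘(ℝ, EuclideanSpace ℝ (Fin r))) ∞
      (fun y => Bundle.TotalSpace.mk' (EuclideanSpace ℝ (Fin r)) y (s y)) x →
    ContMDiffAt (𝓡 n) ((𝓡 n).prod 𝓘(ℝ, EuclideanSpace ℝ (Fin r))) ∞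
      (fun y => Bundle.TotalSpace.mk' (EuclideanSpace ℝ (Fin r)) y (s' y)) x →
    ContMDiffAt (𝓡 n) 𝓘(ℝ, ℝ) ∞ f x →
    br s (fun y => f y • s' y) x =
      f x • br s s' x + (show ℝ from mfderiv (𝓡 n) 𝓘(ℝ, ℝ) f x (ρ x (s x))) • s' x
  map_anchor : ∀ s s' x,
    ContMDiffAt (𝓡 n) ((𝓡 n).prod 𝓘(ℝ, EuclideanSpace ℝ (Fin r))) ∞
      (fun y => Bundle.TotalSpace.mk' (EuclideanSpace ℝ (Fin r)) y (s y)) x →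
    ContMDiffAt (𝓡 n) ((𝓡 n).prod 𝓘(ℝ, EuclideanSpace ℝ (Fin r))) ∞
      (fun y => Bundle.TotalSpace.mk' (EuclideanSpace ℝ (Fin r)) y (s' y)) x →
    ρ x (br s s' x) =
      VectorField.mlieBracket (𝓡 n) (fun y => ρ y (s y)) (fun y => ρ y (s' y)) x

/-- The sequence `F → E → TM` is exact on the level of sections. -/
def IsExactOnSections (t : ∀ x : M, F x →L[ℝ] E x)
    (ρ : ∀ x : M, E x →L[ℝ] TangentSpace (𝓡 n) x) : Prop :=
  (∀ x v, ρ x (t x v) = 0) ∧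
  ∀ s : ContMDiffSection (𝓡 n) (EuclideanSpace ℝ (Fin r)) ∞ E, (∀ x, ρ x (s x) = 0) →
    ∃ f : ContMDiffSection (𝓡 n) (EuclideanSpace ℝ (Fin k)) ∞ F, ∀ x, t x (f x) = s x

/-- Nondegeneracy needed in Euclidean signature. First: the Hermitian form `g + iγ` on the
complexified tangent space of the leaf, `γ(ρ(s), ρ(s')) = ι_{ρ(s)} α(s')`, is nondegenerate (so that
the operator `g ∗ + γ` acting on gauge fields is). Second: the symmetric form
`g(ρ(s), ρ(s')) - g⁻¹(α(s), α(s'))` on the tangent space of the leaf is nondegenerate (so that the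
reduced metric is); here `Y` is the vector with `g(Y, ·) = α(s)`.
Both hold for example if `|α(s)| < |ρ(s)|` whenever `ρ(s) ≠ 0`. -/
structure LeafNondegenerate [IsManifold (𝓡 n) ∞ M] (g : PseudoMetric n M)
    (ρ : ∀ x : M, E x →L[ℝ] TangentSpace (𝓡 n) x)
    (α : ∀ x : M, E x →L[ℝ] TangentSpace (𝓡 n) x →L[ℝ] ℝ) (x : M) : Prop where
  hermitian : ∀ s s' : E x,
    (∀ w : E x, g.inner x (ρ x w) (ρ x s) = α x s' (ρ x w) ∧
      g.inner x (ρ x w) (ρ x s') = -α x s (ρ x w)) → ρ x s = 0 ∧ ρ x s' = 0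
  reduced : ∀ (s : E x) (Y : TangentSpace (𝓡 n) x), (∀ v, g.inner x Y v = α x s v) →
    (∀ w : E x, g.inner x (ρ x w) (ρ x s) = α x w Y) → ρ x s = 0

/-- The components of all structures in the chart `κ` of `M` and the frame `e` of `E`. -/
def localModel [IsManifold (𝓡 n) ∞ M] [ContMDiffVectorBundle ∞ (EuclideanSpace ℝ (Fin r)) E (𝓡 n)]
    (g : PseudoMetric n M) (H : ClosedThreeForm n M)
    (ρ : ∀ x : M, E x →L[ℝ] TangentSpace (𝓡 n) x)
    (br : (∀ x, E x) → (∀ x, E x) → ∀ x, E x)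
    (nabla : CovariantDerivative (𝓡 n) (EuclideanSpace ℝ (Fin r)) E)
    (φ : ∀ x : M, TangentSpace (𝓡 n) x →L[ℝ] E x →L[ℝ] E x)
    (α : ∀ x : M, E x →L[ℝ] TangentSpace (𝓡 n) x →L[ℝ] ℝ)
    (κ : OpenPartialHomeomorph M (EuclideanSpace ℝ (Fin n)))
    {e : Fin r → ∀ x, E x}
    (he : IsLocalFrameOn (𝓡 n) (EuclideanSpace ℝ (Fin r)) ∞ e κ.source) : LocalModel n r where
  dom := κ.target
  g y i j := g.inner (κ.symm y) (coordVec κ y i) (coordVec κ y j)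
  H y i j l := H.form (κ.symm y) (coordVec κ y i) (coordVec κ y j) (coordVec κ y l)
  ρ y a i := (show EuclideanSpace ℝ (Fin n) from
    mfderiv (𝓡 n) (𝓡 n) κ (κ.symm y) (ρ (κ.symm y) (e a (κ.symm y)))) i
  C y c a b := he.coeff c (κ.symm y) (br (e a) (e b) (κ.symm y))
  conn y b a i := he.coeff b (κ.symm y) (nabla (e a) (κ.symm y) (coordVec κ y i))
  φ y b a i := he.coeff b (κ.symm y) (φ (κ.symm y) (coordVec κ y i) (e a (κ.symm y)))
  α y a i := α (κ.symm y) (e a (κ.symm y)) (coordVec κ y i)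

/-- The components `t^a_I` of `t : F → E` in the chart `κ` and the frames `f` of `F`, `e` of `E`. -/
def localShift [IsManifold (𝓡 n) ∞ M]
    (t : ∀ x : M, F x →L[ℝ] E x) (κ : OpenPartialHomeomorph M (EuclideanSpace ℝ (Fin n)))
    {e : Fin r → ∀ x, E x}
    (he : IsLocalFrameOn (𝓡 n) (EuclideanSpace ℝ (Fin r)) ∞ e κ.source)
    (f : Fin k → ∀ x, F x) (y : EuclideanSpace ℝ (Fin n)) (I : Fin k) (a : Fin r) : ℝ :=
  he.coeff a (κ.symm y) (t (κ.symm y) (f I (κ.symm y)))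

end Bundles

end Global

end GaugedSigma

end

open GaugedSigma

/-!
# Gauging sigma models with Wess-Zumino term along singular foliations

**Gauge invariance.** In a chart and a frame the data of the model become smooth families of
linear maps on an open set of a vector space (`Geo`, obtained from the global data by `localModel`
and `toGeo`). The Lagrangian density is a function `lag` of the jet `(x, ∂x, A)`. Its variation
along a gauge transformation is the exterior derivative of the 1-form `(ι_{ρ(ε)} B + α(ε))(dX)`
(`dlag_gauge`): the terms with `φ` from the conditions on `L_ρ g` and on `ι_ρ H` cancel because the
Hodge operator squares to minus the determinant `s = ±1` of the inverse metric density, and the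
antisymmetry of `γ` and the condition on `L_ρ α` cancel what is left. For parameters with compact
support the first variation is the integral of an exact form, hence zero.

**Foliations.** Integral curves on the unit interval are the solutions of an integral equation in a
Banach space of continuous curves, so by the inverse function theorem they depend smoothly on
initial values and parameters. Flowing along lifts of constant fields to the image of the anchor
gives coordinates in which this image is a coordinate plane, on the leaf through a given point and,
if the rank is constant, everywhere (`exists_rectification`). Involutivity makes the lifts commute
where this is needed. Almost Lie brackets exist locally and form an affine space, so a partition of
unity glues them (`exists_isAlmostLieBracket`). Primitives of `H` come from the Poincaré lemma
(`exists_primitive`).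

**Strictness.** On a foliated chart the equation of motion of `A` is a linear algebraic equation for
the covariant derivative `DX`, solvable because of the nondegeneracy of the leaves. For Riemannian
`g` this is automatic in Lorentzian signature, where the Hodge operator is an involution and `γ` is
antisymmetric. A `Reduction` consists of the solution `wc` and what it depends on. Completing the
square (`lag_eq`) writes the density as that of an ungauged model plus a quadratic form in the
deviation `dev` of `DX` from `wc`; so solutions are the configurations with `dev = 0` whose `X`
solves the reduced equations. The reduced metric and 3-form are gauge invariant and horizontal, so
they descend to the leaf space (`LeafSpace`). Solutions with the same projection are joined by
straight lines in the convex leaves: the velocity is `ρ(ε)` for a smooth `ε`, `dev = 0` determines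
`A` up to the kernel of `ρ`, and by exactness that kernel is the image of `t`.

**Completeness.** A gauge transformation maps solutions to solutions to first order. So its
component transversal to the leaves, a linear differential operator in `η`, takes values in the
solutions of the linearized reduced equations. For `η = (ℓ · (z - z0))^(d+2) / (d+2)!` near `z0`,
where `d` is the order of the operator, the equations at `z0` reduce to principal symbols:
`k(ℓ, ℓ) g` annihilates the symbol of the operator at `ℓ`. As `k(ℓ, ℓ) ≠ 0` for almost all `ℓ`, the
leading coefficients vanish, and by descending induction on `d` all of them (`coeff_eq_zero`). Hence
the variation of `X` is `ρ(ε)`. Subtracting the gauge transformation with parameter `ε` leaves a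
variation of `A` alone which preserves `dev = 0`; it lies in the kernel of `ρ`, the image of `t`.
-/

noncomputable section

set_option synthInstance.maxHeartbeats 200000
set_option maxSynthPendingDepth 3
set_option linter.unusedSectionVars false

namespace GaugedSigma

open Finset (sum_congr range sum_add_distrib sum_sub_distrib mul_sum sum_comm smul_sum sum_neg_distrib)
open EuclideanSpace (single proj)
open ContinuousLinearMap (fst snd const comp_apply inr inl flipₗᵢ id_apply le_opNorm)
open Set (MapsTo Icc IccExtend)
open WithLp (toLp)
open Metric (ball isOpen_ball)
open IsManifold (maximalAtlas chart_mem_maximalAtlas)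
open VectorField (mpullback mlieBracket lieBracket)
open Filter (eventually_of_mem)
open Bundle (TotalSpace)

-- Model spaces with Euclidean norm, smooth maps, derivatives, and continuous linear maps.
local notation "ℰ" => EuclideanSpace ℝ
local notation:max "𝔼" n:max => EuclideanSpace ℝ (Fin n)
local notation "C∞" => ContDiffOn ℝ ∞
local notation "𝒟" => fderiv ℝ
local notation:25 V:26 "⊸" W:25 => V →L[ℝ] W

section

variable {V W : Type*} [NormedAddCommGroup V] [NormedSpace ℝ V]
  [NormedAddCommGroup W] [NormedSpace ℝ W]

/-! ### Derivatives of smooth maps -/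

section Calculus

variable {V W G : Type*} [NormedAddCommGroup V] [NormedSpace ℝ V] [NormedAddCommGroup W]
  [NormedSpace ℝ W] [NormedAddCommGroup G] [NormedSpace ℝ G] {f : V → W} {U : Set V} {x : V}

lemma _root_.ContDiffAt.diffAt (h : ContDiffAt ℝ ∞ f x) : DifferentiableAt ℝ f x :=
  h.differentiableAt (by simp)

lemma _root_.ContDiffOn.fderivAt (hf : C∞ f U) (hU : IsOpen U) (hx : x ∈ U) :
    HasFDerivAt f (𝒟 f x) x :=
  (hf.contDiffAt (hU.mem_nhds hx)).diffAt.hasFDerivAt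

lemma _root_.ContDiffOn.diffAt (hf : C∞ f U) (hU : IsOpen U) (hx : x ∈ U) :
    DifferentiableAt ℝ f x := (hf.fderivAt hU hx).differentiableAt

lemma _root_.ContDiffOn.smooth_fderiv (hf : C∞ f U) (hU : IsOpen U) : C∞ (𝒟 f) U :=
  hf.fderiv_of_isOpen hU (by simp)

lemma _root_.ContDiffOn.comp_deriv (hf : C∞ f U) (hU : IsOpen U) {y : ℝ → V} {v : V} {s : ℝ}
    (hs : y s ∈ U) (hy : HasDerivAt y v s) :
    HasDerivAt (fun t => f (y t)) (𝒟 f (y s) v) s :=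
  HasFDerivAt.comp_hasDerivAt s (hf.fderivAt hU hs) hy

lemma _root_.ContDiffOn.clm₂ {Z : Type*} [NormedAddCommGroup Z] [NormedSpace ℝ Z]
    {c : V → W ⊸ Z ⊸ G} {g : V → Z} (hc : C∞ c U) (hf : C∞ f U)
    (hg : C∞ g U) : C∞ (fun x => c x (f x) (g x)) U := (hc.clm_apply hf).clm_apply hg

lemma _root_.HasDerivAt.clm₂ {c : ℝ → V ⊸ W ⊸ G} {c' : V ⊸ W ⊸ G} {y : ℝ → V} {z : ℝ → W}
    {y' : V} {z' : W} {t : ℝ} (h : HasDerivAt c c' t) (hy : HasDerivAt y y' t)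
    (hz : HasDerivAt z z' t) : HasDerivAt (fun t => c t (y t) (z t))
      ((c' (y t) + c t y') (z t) + c t (y t) z') t := (h.clm_apply hy).clm_apply hz

lemma _root_.HasDerivAt.fst' {u : ℝ → V × W} {p : V × W} {s : ℝ} (h : HasDerivAt u p s) :
    HasDerivAt (fun t => (u t).1) p.1 s := (fst ℝ V W).hasFDerivAt.comp_hasDerivAt s h

lemma _root_.HasDerivAt.snd' {u : ℝ → V × W} {p : V × W} {s : ℝ} (h : HasDerivAt u p s) :
    HasDerivAt (fun t => (u t).2) p.2 s := (snd ℝ V W).hasFDerivAt.comp_hasDerivAt s h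

lemma _root_.HasFDerivAt.app {c : V → W ⊸ G} {c' : V ⊸ W ⊸ G} (h : HasFDerivAt c c' x) (w : W) :
    HasFDerivAt (fun y => c y w) (c'.flip w) x := by
  simpa using h.clm_apply (hasFDerivAt_const w x)

/-- Functions which agree on an open set have the same derivative there. -/
lemma _root_.HasFDerivAt.eq_of_eqOn {g : V → W} {f' g' : V ⊸ W} (hf : HasFDerivAt f f' x)
    (hg : HasFDerivAt g g' x) (hU : IsOpen U) (hx : x ∈ U) (h : ∀ y ∈ U, f y = g y) (ξ : V) :
    f' ξ = g' ξ :=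
  DFunLike.congr_fun (hf.unique (hg.congr_of_eventuallyEq (eventually_of_mem (hU.mem_nhds hx) h))) ξ

lemma fderiv_symm {g : V → V ⊸ V ⊸ ℝ} (hg : C∞ g U) (hU : IsOpen U)
    (h : ∀ y ∈ U, ∀ u v, g y u v = g y v u) (hx : x ∈ U) (ξ u v : V) :
    𝒟 g x ξ u v = 𝒟 g x ξ v u :=
  have h0 := hg.fderivAt hU hx
  ((h0.app u).app v).eq_of_eqOn ((h0.app v).app u) hU hx (fun y hy => h y hy u v) ξ

lemma fderiv_antisymm {b : V → V ⊸ V ⊸ ℝ} (hb : C∞ b U) (hU : IsOpen U)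
    (h : ∀ y ∈ U, ∀ u v, b y u v = -b y v u) (hx : x ∈ U) (ξ u v : V) :
    𝒟 b x ξ u v = -𝒟 b x ξ v u :=
  have h0 := hb.fderivAt hU hx
  ((h0.app u).app v).eq_of_eqOn ((h0.app v).app u).neg hU hx (fun y hy => h y hy u v) ξ

end Calculus

lemma integral_congr_on {D : Set Plane} (hD : IsOpen D) {f g : Plane → ℝ}
    (h : ∀ z ∈ D, f z = g z) : ∫ z in D, f z = ∫ z in D, g z :=
  setIntegral_congr_fun hD.measurableSet h

/-! ### Gauge invariance of the Lagrangian density -/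

/-- The inverse density `√|det h| h^{μν}` of a world-sheet metric at a point, by its entries
`k⁰⁰, k⁰¹, k¹¹`. -/
structure Conf where
  c00 : ℝ
  c01 : ℝ
  c11 : ℝ

/-- The determinant of an inverse metric density; it is the sign of the signature. -/
def Conf.det (k : Conf) : ℝ := k.c00 * k.c11 - k.c01 * k.c01

/-- The Hodge operator on vector-valued 1-forms `w = w1 dz¹ + w2 dz²`. -/
def Conf.star (k : Conf) (w : V × V) : V × V :=
  (-(k.c01 • w.1 + k.c11 • w.2), k.c00 • w.1 + k.c01 • w.2)

/-- The contraction `k^{μν} b(u_μ, v_ν)`, i.e. `b(u ∧ ∗v)`. -/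
def Conf.kin (k : Conf) (b : V ⊸ V ⊸ ℝ) (u v : V × V) : ℝ :=
  k.c00 * b u.1 v.1 + k.c01 * (b u.1 v.2 + b u.2 v.1) + k.c11 * b u.2 v.2

/-- The data of a gauged sigma model over an open subset of a vector space, with all tensors
written as functions with values in spaces of continuous (multi)linear maps. `R` is the anchor in a
frame, `Al` is `α`, `C` the structure functions of the bracket, `Om` the connection form and `Ph`
the form `φ`. -/
structure Geo (V W : Type*) [NormedAddCommGroup V] [NormedSpace ℝ V]
    [NormedAddCommGroup W] [NormedSpace ℝ W] where
  dom : Set V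
  G : V → V ⊸ V ⊸ ℝ
  B : V → V ⊸ V ⊸ ℝ
  R : V → W ⊸ V
  Al : V → W ⊸ V ⊸ ℝ
  C : V → W ⊸ W ⊸ W
  Om : V → V ⊸ W ⊸ W
  Ph : V → V ⊸ W ⊸ W

/-- The exterior derivative of a field of bilinear forms, as a trilinear expression. -/
def extD (B : V → V ⊸ V ⊸ ℝ) (x u v w : V) : ℝ := 𝒟 B x u v w + 𝒟 B x v w u + 𝒟 B x w u v

namespace Geo

variable (m : Geo V W)

/-- Smoothness of the data entering the Lagrangian. -/
structure IsSmooth : Prop where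
  isOpen_dom : IsOpen m.dom
  smooth_G : C∞ m.G m.dom
  smooth_B : C∞ m.B m.dom
  smooth_R : C∞ m.R m.dom
  smooth_Al : C∞ m.Al m.dom

/-- Smoothness and algebraic identities of the data, together with the conditions under which the
gauged functional is gauge invariant; `s` is the sign `±` of the signature. -/
structure IsGauged (s : ℝ) : Prop extends m.IsSmooth where
  smooth_C : C∞ m.C m.dom
  smooth_Om : C∞ m.Om m.dom
  smooth_Ph : C∞ m.Ph m.dom
  symm_G : ∀ x ∈ m.dom, ∀ u v, m.G x u v = m.G x v u
  antisymm_B : ∀ x ∈ m.dom, ∀ u v, m.B x u v = -m.B x v u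
  antisymm_C : ∀ x ∈ m.dom, ∀ a b, m.C x a b = -m.C x b a
  bracket : ∀ x ∈ m.dom, ∀ a b, 𝒟 m.R x (m.R x a) b - 𝒟 m.R x (m.R x b) a = m.R x (m.C x a b)
  metric : ∀ x ∈ m.dom, ∀ a u v,
    𝒟 m.G x (m.R x a) u v + m.G x (𝒟 m.R x u a) v + m.G x u (𝒟 m.R x v a) =
      m.G x (m.R x (m.Om x u a)) v + m.G x (m.R x (m.Om x v a)) u
        + m.Al x (m.Ph x u a) v + m.Al x (m.Ph x v a) u
  flux : ∀ x ∈ m.dom, ∀ a u v, extD m.B x (m.R x a) u v = 𝒟 m.Al x u a v - 𝒟 m.Al x v a u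
      - (m.Al x (m.Om x u a) v - m.Al x (m.Om x v a) u)
      + s * (m.G x (m.R x (m.Ph x u a)) v - m.G x (m.R x (m.Ph x v a)) u)
  isotropy : ∀ x ∈ m.dom, ∀ a b, m.Al x b (m.R x a) + m.Al x a (m.R x b) = 0
  equivariance : ∀ x ∈ m.dom, ∀ a b v, 𝒟 m.Al x (m.R x a) b v + m.Al x b (𝒟 m.R x v a) =
      m.Al x (m.C x a b) v + 𝒟 m.Al x (m.R x b) a v - 𝒟 m.Al x v a (m.R x b)
        - extD m.B x (m.R x a) (m.R x b) v

/-- The covariant derivative `u - ρ(A)`. -/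
def cov (x : V) (u : V × V) (A : W × W) : V × V := (u.1 - m.R x A.1, u.2 - m.R x A.2)

/-- The gauged Lagrangian density on jets `(x, ∂x, A)`. -/
def lag (k : Conf) (x : V) (u : V × V) (A : W × W) : ℝ :=
  1 / 2 * k.kin (m.G x) (m.cov x u A) (m.cov x u A) + 1 / 2 * (m.B x u.1 u.2 - m.B x u.2 u.1)
    + (m.Al x A.1 u.2 - m.Al x A.2 u.1)
    + 1 / 2 * (m.Al x A.2 (m.R x A.1) - m.Al x A.1 (m.R x A.2))

/-- The derivative of `cov`. -/
def dcov (x : V) (A : W × W) (ξ : V) (p : V × V) (δ : W × W) : V × V :=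
  (p.1 - (𝒟 m.R x ξ A.1 + m.R x δ.1), p.2 - (𝒟 m.R x ξ A.2 + m.R x δ.2))

/-- The derivative of the Lagrangian density in the direction of the jet `(ξ, p, δ)`. -/
def dlag (k : Conf) (x : V) (u : V × V) (A : W × W) (ξ : V) (p : V × V) (δ : W × W) : ℝ :=
  1 / 2 * (k.kin (𝒟 m.G x ξ) (m.cov x u A) (m.cov x u A)
      + k.kin (m.G x) (m.dcov x A ξ p δ) (m.cov x u A)
      + k.kin (m.G x) (m.cov x u A) (m.dcov x A ξ p δ))
    + 1 / 2 * (𝒟 m.B x ξ u.1 u.2 + m.B x p.1 u.2 + m.B x u.1 p.2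
      - (𝒟 m.B x ξ u.2 u.1 + m.B x p.2 u.1 + m.B x u.2 p.1))
    + (𝒟 m.Al x ξ A.1 u.2 + m.Al x δ.1 u.2 + m.Al x A.1 p.2
      - (𝒟 m.Al x ξ A.2 u.1 + m.Al x δ.2 u.1 + m.Al x A.2 p.1))
    + 1 / 2 * (𝒟 m.Al x ξ A.2 (m.R x A.1) + m.Al x δ.2 (m.R x A.1)
        + m.Al x A.2 (𝒟 m.R x ξ A.1 + m.R x δ.1)
      - (𝒟 m.Al x ξ A.1 (m.R x A.2) + m.Al x δ.1 (m.R x A.2)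
        + m.Al x A.1 (𝒟 m.R x ξ A.2 + m.R x δ.2)))

/-- The jet of the gauge variation of `A`. -/
def gaugeA (k : Conf) (x : V) (u : V × V) (A : W × W) (ε : W) (e : W × W) : W × W :=
  (e.1 + m.C x A.1 ε + m.Om x (m.cov x u A).1 ε + m.Ph x (k.star (m.cov x u A)).1 ε,
   e.2 + m.C x A.2 ε + m.Om x (m.cov x u A).2 ε + m.Ph x (k.star (m.cov x u A)).2 ε)

/-- The jet of the derivative of the gauge variation `R ε` of `x`. -/
def gaugeP (x : V) (u : V × V) (ε : W) (e : W × W) : V × V :=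
  (𝒟 m.R x u.1 ε + m.R x e.1, 𝒟 m.R x u.2 ε + m.R x e.2)

variable {m} {s : ℝ}

namespace IsSmooth

variable (h : m.IsSmooth)
include h

lemma differentiableAt_G {x : V} (hx : x ∈ m.dom) : DifferentiableAt ℝ m.G x :=
  h.smooth_G.diffAt h.isOpen_dom hx

lemma differentiableAt_B {x : V} (hx : x ∈ m.dom) : DifferentiableAt ℝ m.B x :=
  h.smooth_B.diffAt h.isOpen_dom hx

lemma differentiableAt_R {x : V} (hx : x ∈ m.dom) : DifferentiableAt ℝ m.R x :=
  h.smooth_R.diffAt h.isOpen_dom hx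

lemma differentiableAt_Al {x : V} (hx : x ∈ m.dom) : DifferentiableAt ℝ m.Al x :=
  h.smooth_Al.diffAt h.isOpen_dom hx

end IsSmooth

namespace IsGauged

variable (h : m.IsGauged s)
include h

lemma antisymm_fderiv_B {x : V} (hx : x ∈ m.dom) (ξ u v : V) : 𝒟 m.B x ξ u v = -𝒟 m.B x ξ v u :=
  fderiv_antisymm h.smooth_B h.isOpen_dom h.antisymm_B hx ξ u v

/-- The covariant derivative transforms homogeneously under gauge transformations. -/
lemma dcov_gauge {x : V} (hx : x ∈ m.dom) (k : Conf) (u : V × V) (A : W × W) (ε : W) (e : W × W) :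
    let w := m.cov x u A
    m.dcov x A (m.R x ε) (m.gaugeP x u ε e) (m.gaugeA k x u A ε e) =
      (𝒟 m.R x w.1 ε - m.R x (m.Om x w.1 ε) - m.R x (m.Ph x (k.star w).1 ε),
       𝒟 m.R x w.2 ε - m.R x (m.Om x w.2 ε) - m.R x (m.Ph x (k.star w).2 ε)) := by
  intro w
  have b1 := h.bracket x hx A.1 ε
  have b2 := h.bracket x hx A.2 ε
  refine Prod.ext ?_ ?_
  · simp only [dcov, gaugeP, gaugeA, map_add]
    rw [← b1]
    have : u.1 = w.1 + m.R x A.1 := by simp [w, cov]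
    rw [this]
    simp only [map_add, _root_.add_apply]
    simp only [w]
    abel
  · simp only [dcov, gaugeP, gaugeA, map_add]
    rw [← b2]
    have : u.2 = w.2 + m.R x A.2 := by simp [w, cov]
    rw [this]
    simp only [map_add, _root_.add_apply]
    simp only [w]
    abel

/-- The gauge variation of the kinetic term, before the use of the flux condition. -/
lemma kin_gauge {x : V} (hx : x ∈ m.dom) (k : Conf) (ε : W) (w : V × V) :
    let d : V × V := (𝒟 m.R x w.1 ε - m.R x (m.Om x w.1 ε) - m.R x (m.Ph x (k.star w).1 ε),
       𝒟 m.R x w.2 ε - m.R x (m.Om x w.2 ε) - m.R x (m.Ph x (k.star w).2 ε))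
    1 / 2 * (k.kin (𝒟 m.G x (m.R x ε)) w w + k.kin (m.G x) d w + k.kin (m.G x) w d) =
      k.c00 * m.Al x (m.Ph x w.1 ε) w.1 + k.c01 * (m.Al x (m.Ph x w.1 ε) w.2
        + m.Al x (m.Ph x w.2 ε) w.1) + k.c11 * m.Al x (m.Ph x w.2 ε) w.2
      + k.det * (m.G x (m.R x (m.Ph x w.2 ε)) w.1 - m.G x (m.R x (m.Ph x w.1 ε)) w.2) := by
  intro d
  obtain ⟨w1, w2⟩ := w
  have m11 := h.metric x hx ε w1 w1
  have m12 := h.metric x hx ε w1 w2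
  have m21 := h.metric x hx ε w2 w1
  have m22 := h.metric x hx ε w2 w2
  have sy := h.symm_G x hx
  simp only [d, Conf.kin, Conf.star, Conf.det, map_sub, map_add, map_neg, map_smul,
    _root_.sub_apply, _root_.add_apply, _root_.neg_apply,
    _root_.smul_apply, smul_eq_mul]
  simp only [sy w1 (𝒟 m.R x _ ε), sy w2 (𝒟 m.R x _ ε), sy w1 (m.R x _), sy w2 (m.R x _)] at *
  linear_combination k.c00 / 2 * m11 + k.c01 / 2 * m12 + k.c01 / 2 * m21 + k.c11 / 2 * m22

set_option maxHeartbeats 4000000 in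
/-- **Gauge invariance on jets**: the gauge variation of the Lagrangian density is the exterior
derivative of the 1-form `B(ρ(ε), dX) + α(ε)(dX)`. -/
lemma dlag_gauge {x : V} (hx : x ∈ m.dom) (k : Conf) (hk : k.det = s) (u : V × V) (A : W × W)
    (ε : W) (e : W × W) :
    m.dlag k x u A (m.R x ε) (m.gaugeP x u ε e) (m.gaugeA k x u A ε e) =
      (𝒟 m.B x u.1 (m.R x ε) u.2 + m.B x (𝒟 m.R x u.1 ε + m.R x e.1) u.2
        + 𝒟 m.Al x u.1 ε u.2 + m.Al x e.1 u.2)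
      - (𝒟 m.B x u.2 (m.R x ε) u.1 + m.B x (𝒟 m.R x u.2 ε + m.R x e.2) u.1
        + 𝒟 m.Al x u.2 ε u.1 + m.Al x e.2 u.1) := by
  rw [dlag, h.dcov_gauge hx k u A ε e, h.kin_gauge hx k ε, hk]
  obtain ⟨u1, u2⟩ := u
  obtain ⟨A1, A2⟩ := A
  obtain ⟨e1, e2⟩ := e
  have aB := h.antisymm_fderiv_B hx
  obtain ⟨w1, hw1⟩ : ∃ w, w = u1 - m.R x A1 := ⟨_, rfl⟩
  obtain ⟨w2, hw2⟩ : ∃ w, w = u2 - m.R x A2 := ⟨_, rfl⟩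
  obtain rfl : u1 = w1 + m.R x A1 := by simp [hw1]
  obtain rfl : u2 = w2 + m.R x A2 := by simp [hw2]
  have aB := h.antisymm_fderiv_B hx
  have aB' := h.antisymm_B x hx
  have aC := h.antisymm_C x hx
  have iso := h.isotropy x hx
  have f12 := h.flux x hx ε w1 w2
  have q1 := h.equivariance x hx ε A1 w2
  have q2 := h.equivariance x hx ε A2 w1
  have q3 := h.equivariance x hx ε A1 (m.R x A2)
  have q4 := h.equivariance x hx ε A2 (m.R x A1)
  have b1 := congrArg (m.Al x A2) (h.bracket x hx A1 ε)
  have b2 := congrArg (m.Al x A1) (h.bracket x hx A2 ε)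
  have cov1 : m.cov x (w1 + m.R x A1, w2 + m.R x A2) (A1, A2) = (w1, w2) := by simp [cov]
  have i1 := iso e1 A2
  have i2 := iso e2 A1
  have i5 := iso (m.Om x w1 ε) A2
  have i6 := iso (m.Om x w2 ε) A1
  have i7 := iso (m.Ph x w1 ε) A2
  have i8 := iso (m.Ph x w2 ε) A1
  have i9 := iso (m.Ph x w1 ε) A1
  have i10 := iso (m.Ph x w2 ε) A2
  simp only [extD] at f12 q1 q2 q3 q4
  rw [aC ε A1] at q1 q3
  rw [aC ε A2] at q2 q4
  clear h hx hk hw1 hw2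
  simp only [cov1, gaugeA, gaugeP, Conf.star] at *
  clear cov1
  generalize 𝒟 m.B x = dB at *
  generalize 𝒟 m.R x = dR at *
  generalize 𝒟 m.Al x = dAl at *
  generalize m.B x = B at *
  generalize m.R x = R at *
  generalize m.Al x = Al at *
  generalize m.G x = G at *
  generalize m.C x = C at *
  generalize m.Om x = Om at *
  generalize m.Ph x = Ph at *
  simp only [map_sub, map_add, map_neg, map_smul, smul_eq_mul,
    _root_.add_apply, _root_.neg_apply, _root_.smul_apply] at *
  -- Only the values matter from here on; plain functions are cheaper atoms for `ring`.
  obtain ⟨B', hB⟩ : ∃ B' : V → V → ℝ, ∀ u v, B u v = B' u v := ⟨_, fun _ _ => rfl⟩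
  obtain ⟨G', hG⟩ : ∃ G' : V → V → ℝ, ∀ u v, G u v = G' u v := ⟨_, fun _ _ => rfl⟩
  obtain ⟨dB', hdB⟩ : ∃ B' : V → V → V → ℝ, ∀ u v w, dB u v w = B' u v w := ⟨_, fun _ _ _ => rfl⟩
  obtain ⟨dR', hdR⟩ : ∃ R' : V → W → V, ∀ u v, dR u v = R' u v := ⟨_, fun _ _ => rfl⟩
  obtain ⟨dAl', hdAl⟩ : ∃ f : V → W → V → ℝ, ∀ u v w, dAl u v w = f u v w := ⟨_, fun _ _ _ => rfl⟩
  obtain ⟨Al', hAl⟩ : ∃ f : W → V → ℝ, ∀ u v, Al u v = f u v := ⟨_, fun _ _ => rfl⟩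
  obtain ⟨R', hR⟩ : ∃ f : W → V, ∀ u, R u = f u := ⟨_, fun _ => rfl⟩
  obtain ⟨C', hC⟩ : ∃ f : W → W → W, ∀ u v, C u v = f u v := ⟨_, fun _ _ => rfl⟩
  obtain ⟨Om', hOm⟩ : ∃ f : V → W → W, ∀ u v, Om u v = f u v := ⟨_, fun _ _ => rfl⟩
  obtain ⟨Ph', hPh⟩ : ∃ f : V → W → W, ∀ u v, Ph u v = f u v := ⟨_, fun _ _ => rfl⟩
  simp only [hB, hG, hdB, hdR, hdAl, hAl, hR, hC, hOm, hPh] at *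
  clear hB hG hdB hdR hdAl hAl hR hC hOm hPh
  linear_combination f12 + q1 - q2 + 1 / 2 * q3 - 1 / 2 * q4
    - 1 / 2 * (aB' (dR' w1 ε) w2 + aB' (dR' (R' A1) ε) w2 + aB' (R' e1) w2
      + aB' (dR' w1 ε) (R' A2) + aB' (dR' (R' A1) ε) (R' A2) + aB' (R' e1) (R' A2))
    + 1 / 2 * (aB' (dR' w2 ε) w1 + aB' (dR' (R' A2) ε) w1 + aB' (R' e2) w1
      + aB' (dR' w2 ε) (R' A1) + aB' (dR' (R' A2) ε) (R' A1) + aB' (R' e2) (R' A1))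
    - 1 / 2 * aB (R' ε) w1 w2 + 1 / 2 * aB (R' ε) w1 (R' A2) - 1 / 2 * aB (R' ε) (R' A1) w2
    - aB w1 (R' ε) w2 - aB (R' A1) (R' ε) w2 + aB (R' A2) (R' ε) w1
    - 1 / 2 * aB (R' A1) (R' ε) (R' A2) + 1 / 2 * aB (R' A2) (R' ε) (R' A1)
    - 1 / 2 * i1 + 1 / 2 * i2 + 1 / 2 * i5 - 1 / 2 * i6 - 1 / 2 * b1 + 1 / 2 * b2
    - k.c01 / 2 * i7 - k.c11 / 2 * i10 - k.c00 / 2 * i9 - k.c01 / 2 * i8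

end IsGauged
end Geo

section Variational

/-! ### Calculus of variations in the plane -/

/-- The partial derivative of a vector-valued function on the plane. -/
def pdv {V : Type*} [NormedAddCommGroup V] [NormedSpace ℝ V] (μ : Fin 2) (f : Plane → V)
    (z : Plane) : V :=
  𝒟 f z (single μ 1)

/-- The 1-jet part `(∂₁f, ∂₂f)` of a vector-valued function on the plane. -/
def grad {V : Type*} [NormedAddCommGroup V] [NormedSpace ℝ V] (f : Plane → V) (z : Plane) : V × V :=
  (pdv 0 f z, pdv 1 f z)

variable {V : Type*} [NormedAddCommGroup V] [NormedSpace ℝ V]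

/-- Differentiation under the integral sign for a family of functions over an open set `D` that
changes only inside a compact subset of `D`. -/
lemma hasDerivAt_integral_variation {D K : Set Plane} (hK : IsCompact K) (hKD : K ⊆ D)
    (hD : IsOpen D)
    {Ω : Set (ℝ × Plane)} (hΩ : IsOpen Ω) (hDΩ : ∀ z ∈ D, ((0 : ℝ), z) ∈ Ω)
    {f : ℝ → Plane → ℝ} (hf : ContDiffOn ℝ 1 (fun p : ℝ × Plane => f p.1 p.2) Ω)
    {f' : Plane → ℝ} (hf' : ∀ z ∈ D, HasDerivAt (fun s => f s z) (f' z) 0)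
    (hout : ∀ s, ∀ z ∈ D, z ∉ K → f s z = f 0 z) :
    HasDerivAt (fun s => ∫ z in D, (f s z - f 0 z)) (∫ z in D, f' z) 0 := by
  set F : ℝ × Plane → ℝ := fun p => f p.1 p.2
  have hKm := hK.measurableSet
  have e1 : ∀ g : Plane → ℝ, (∀ z ∈ D, z ∉ K → g z = 0) → ∫ z in D, g z = ∫ z in K, g z := by
    intro g hg
    refine setIntegral_eq_of_subset_of_forall_sdiff_eq_zero hD.measurableSet hKD ?_
    rintro z ⟨h1, h2⟩
    exact hg z h1 h2
  have hf'0 : ∀ z ∈ D, z ∉ K → f' z = 0 := by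
    intro z h1 h2
    have : HasDerivAt (fun s => f s z) 0 0 := by
      have e : (fun s => f s z) = fun _ => f 0 z := by
        funext s
        exact hout s z h1 h2
      rw [e]
      exact hasDerivAt_const _ _
    exact (hf' z h1).unique this
  rw [e1 f' hf'0]
  have e2 : (fun s => ∫ z in D, (f s z - f 0 z)) = fun s => ∫ z in K, (f s z - f 0 z) := by
    funext s
    exact e1 _ fun z h1 h2 => by rw [hout s z h1 h2, sub_self]
  rw [e2]
  obtain ⟨u, v, hu, hv, h0u, hKv, huv⟩ := generalized_tube_lemma (isCompact_singleton)
    hK hΩ (by rintro ⟨a, z⟩ ⟨ha, hz⟩; obtain rfl : a = 0 := ha; exact hDΩ z (hKD hz))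
  obtain ⟨δ, hδ, hball⟩ := Metric.isOpen_iff.1 hu 0 (h0u rfl)
  have hsub : ∀ s ∈ Metric.closedBall (0 : ℝ) (δ / 2), ∀ z ∈ K, (s, z) ∈ Ω := fun s hs z hz =>
    huv ⟨hball (Metric.closedBall_subset_ball (by linarith) hs), hKv hz⟩
  have hcd : ContinuousOn (fun p => 𝒟 F p (1, 0)) Ω :=
    (hf.continuousOn_fderiv_of_isOpen hΩ le_rfl).clm_apply continuousOn_const
  have hslice : ∀ s ∈ Metric.closedBall (0 : ℝ) (δ / 2),
      ContinuousOn (fun z => f s z) K ∧ ContinuousOn (fun z => 𝒟 F (s, z) (1, 0)) K := by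
    intro s hs
    have hc : ContinuousOn (fun z : Plane => (s, z)) K := by fun_prop
    exact ⟨hf.continuousOn.comp hc fun z hz => hsub s hs z hz,
      hcd.comp hc fun z hz => hsub s hs z hz⟩
  obtain ⟨C, hC⟩ := ((isCompact_closedBall (0 : ℝ) (δ / 2)).prod hK).exists_bound_of_continuousOn
    (hcd.mono fun p hp => hsub p.1 hp.1 p.2 hp.2)
  have hderiv : ∀ s, ∀ z, (s, z) ∈ Ω → HasDerivAt (fun s' => f s' z) (𝒟 F (s, z) (1, 0)) s := by
    intro s z h
    have h1 := ((hf.contDiffAt (hΩ.mem_nhds h)).differentiableAt (by simp)).hasFDerivAt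
    exact h1.comp_hasDerivAt s ((hasDerivAt_id s).prodMk (hasDerivAt_const s z))
  have h0mem : (0 : ℝ) ∈ Metric.closedBall (0 : ℝ) (δ / 2) :=
    Metric.mem_closedBall_self (by linarith)
  have key := hasDerivAt_integral_of_dominated_loc_of_deriv_le (μ := volume.restrict K)
   
    (s := Metric.closedBall (0 : ℝ) (δ / 2)) (bound := fun _ => C)
    (Metric.closedBall_mem_nhds _ (by linarith))
    (by
      filter_upwards [Metric.closedBall_mem_nhds (0 : ℝ) (half_pos hδ)] with s hs
      exact ((hslice s hs).1.sub (hslice 0 h0mem).1).aestronglyMeasurable hKm)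
    (by simp)
    ((hslice 0 h0mem).2.aestronglyMeasurable hKm)
    (by
      filter_upwards [ae_restrict_mem hKm] with z hz s hs
      exact hC (s, z) ⟨hs, hz⟩)
    (by
      have : IsFiniteMeasure (volume.restrict K) := ⟨by simpa using hK.measure_lt_top⟩
      exact integrable_const C)
    (by
      filter_upwards [ae_restrict_mem hKm] with z hz s hs
      exact (hderiv s z (hsub s hs z hz)).sub_const _)
  have e3 : ∫ z in K, f' z = ∫ z in K, 𝒟 F (0, z) (1, 0) := by
    refine setIntegral_congr_fun hKm fun z hz => ?_
    exact (hf' z (hKD hz)).unique (hderiv 0 z (hDΩ z (hKD hz)))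
  rw [e3]
  exact key.2

/-- A function that is smooth on the open set `D` and vanishes outside a compact subset of `D` is a
test function. -/
lemma isTest_on {D K : Set Plane} (hD : IsOpen D) (hK : IsCompact K) (hKD : K ⊆ D)
    {f : Plane → V} (hf : C∞ f D) (h0 : ∀ z, z ∉ K → f z = 0) : IsTest D f := by
  have hts : tsupport f ⊆ K := by
    refine closure_minimal ?_ hK.isClosed
    intro z hz
    by_contra hc
    exact hz (h0 z hc)
  refine ⟨?_, hK.of_isClosed_subset (isClosed_tsupport f) hts, hts.trans hKD⟩
  rw [contDiff_iff_contDiffAt]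
  intro z
  by_cases hz : z ∈ K
  · exact hf.contDiffAt (hD.mem_nhds (hKD hz))
  · refine (contDiffAt_const (c := (0 : V))).congr_of_eventuallyEq ?_
    filter_upwards [hK.isClosed.isOpen_compl.mem_nhds hz] with y hy
    exact h0 y hy

lemma IsTest.contDiff {D : Set Plane} {f : Plane → V} (h : IsTest D f) : ContDiff ℝ ∞ f := h.1

lemma pdv_eq_zero_of_notMem {f : Plane → V} {z : Plane} (hz : z ∉ tsupport f) (μ : Fin 2) :
    pdv μ f z = 0 := by
  have h := notMem_tsupport_iff_eventuallyEq.1 hz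
  simp [pdv, h.fderiv_eq]

lemma grad_eq_zero_of_notMem {f : Plane → V} {z : Plane} (hz : z ∉ tsupport f) : grad f z = 0 := by
  simp [grad, pdv_eq_zero_of_notMem hz]

lemma smooth_pdv {D : Set Plane} (hD : IsOpen D) {f : Plane → V} (hf : C∞ f D)
    (μ : Fin 2) : C∞ (pdv μ f) D :=
  (hf.smooth_fderiv hD).clm_apply contDiffOn_const

lemma contDiff_pdv {f : Plane → V} (hf : ContDiff ℝ ∞ f) (μ : Fin 2) : ContDiff ℝ ∞ (pdv μ f) :=
  (hf.fderiv_right (by simp)).clm_apply contDiff_const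

lemma smooth_grad {D : Set Plane} (hD : IsOpen D) {f : Plane → V} (hf : C∞ f D) : C∞ (grad f) D :=
  (smooth_pdv hD hf 0).prodMk (smooth_pdv hD hf 1)

/-- The integral of a partial derivative of a test function vanishes. -/
lemma integral_pdv_eq_zero {D : Set Plane} {f : Plane → ℝ} (hf : IsTest D f)
    (μ : Fin 2) : ∫ z in D, pdv μ f z = 0 := by
  rw [setIntegral_eq_integral_of_forall_compl_eq_zero fun z hz =>
    pdv_eq_zero_of_notMem (fun h => hz (hf.2.2 h)) μ]
  have hc : HasCompactSupport (fun z => pdv μ f z) := by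
    refine hf.2.1.of_isClosed_subset (isClosed_tsupport _) ?_
    refine closure_minimal ?_ (isClosed_tsupport f)
    intro z hz
    by_contra h
    exact hz (pdv_eq_zero_of_notMem h μ)
  have := integral_mul_fderiv_eq_neg_fderiv_mul_of_integrable (μ := (volume : Measure Plane))
    (f := fun _ => (1 : ℝ)) (by simp)
    (by
      simp only [one_mul]
      exact (contDiff_pdv hf.1 μ).continuous.integrable_of_hasCompactSupport hc)
    (by simpa using (hf.1.continuous.integrable_of_hasCompactSupport hf.2.1))
    (fun _ _ => by fun_prop) (fun _ _ => (hf.1.differentiable (by simp)).differentiableAt)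
  simpa [pdv] using this

/-- The fundamental lemma of the calculus of variations. -/
lemma eq_zero_of_integral_smul_eq_zero {D : Set Plane} (hD : IsOpen D) {g : Plane → ℝ}
    (hg : ContinuousOn g D)
    (h : ∀ θ : Plane → ℝ, IsTest D θ → ∫ z in D, θ z * g z = 0) : ∀ z ∈ D, g z = 0 := by
  have h1 : ∀ᵐ x ∂(volume : Measure Plane), x ∈ D → g x = 0 := by
    refine hD.ae_eq_zero_of_integral_contDiff_smul_eq_zero
      (hg.locallyIntegrableOn hD.measurableSet) ?_
    intro θ h1 h2 h3
    rw [← h θ ⟨h1, h2, h3⟩]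
    symm
    refine setIntegral_eq_integral_of_forall_compl_eq_zero fun z hz => ?_
    rw [image_eq_zero_of_notMem_tsupport (fun h => hz (h3 h)), zero_mul]
  have h2 := (ae_restrict_iff' hD.measurableSet).2 h1
  exact fun z hz => Measure.eqOn_open_of_ae_eq h2 hD hg continuousOn_const hz

/-- A smooth cut-off function which is `1` near a given compact set. -/
lemma exists_isTest_eq_one {D : Set Plane} (hD : IsOpen D) {K : Set Plane} (hK : IsCompact K)
    (hKD : K ⊆ D) : ∃ θ : Plane → ℝ, IsTest D θ ∧ ∀ᶠ z in 𝓝ˢ K, θ z = 1 := by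
  obtain ⟨L, hL, hKL, hLD⟩ := exists_compact_between hK hD hKD
  obtain ⟨L', hL', hLL', hLD'⟩ := exists_compact_between hL hD hLD
  have hd : Disjoint (interior L')ᶜ L := Set.disjoint_left.2 fun x hx hx' => hx (hLL' hx')
  obtain ⟨f, h0, h1, -⟩ := exists_contMDiffMap_zero_one_of_isClosed 𝓘(ℝ, Plane)
    isOpen_interior.isClosed_compl hL.isClosed hd
  refine ⟨f, ?_, ?_⟩
  · refine isTest_on hD hL' hLD' f.contMDiff.contDiff.contDiffOn fun z hz => ?_
    exact h0 fun h => hz (interior_subset h)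
  · rw [eventually_nhdsSet_iff_exists]
    exact ⟨interior L, isOpen_interior, hKL, fun z hz => h1 (interior_subset hz)⟩

lemma grad_add_smul {D : Set Plane} (hD : IsOpen D) {X ξ : Plane → V}
    (hX : C∞ X D) (hξ : ContDiff ℝ ∞ ξ) (s : ℝ) {z : Plane} (hz : z ∈ D) :
    grad (X + s • ξ) z = grad X z + s • grad ξ z := by
  have h1 := hX.fderivAt hD hz
  have h2 := ((hξ.differentiable (by simp)) z).hasFDerivAt
  have h3 := (h1.add (h2.const_smul s)).fderiv
  simp only [grad, pdv, h3]
  simp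

lemma hasDerivAt_add_smul (a b : V) : HasDerivAt (fun s : ℝ => a + s • b) b 0 := by
  simpa using ((hasDerivAt_id (0 : ℝ)).smul_const b).const_add a

/-- One-parameter families of functions on `D` are functions on `ℝ × D`. -/
abbrev cyl (D : Set Plane) : Set (ℝ × Plane) := {q | q.2 ∈ D}

lemma smooth_snd {D : Set Plane} {f : Plane → V} (hf : C∞ f D) :
    C∞ (fun q : ℝ × Plane => f q.2) (cyl D) :=
  hf.comp contDiffOn_snd fun _ hq => hq

lemma _root_.ContDiffOn.slice {D : Set Plane} {f : ℝ × Plane → V} (hf : C∞ f (cyl D)) (τ : ℝ) :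
    C∞ (fun z => f (τ, z)) D :=
  hf.comp (contDiffOn_const.prodMk contDiffOn_id) fun _ hz => hz

end Variational

namespace Geo

variable {m : Geo V W}

/-- A smooth field of inverse metric densities. -/
structure _root_.GaugedSigma.SmoothConf {Z : Type*} [NormedAddCommGroup Z] [NormedSpace ℝ Z]
    (S : Set Z) (k : Z → Conf) : Prop where
  c00 : C∞ (fun z => (k z).c00) S
  c01 : C∞ (fun z => (k z).c01) S
  c11 : C∞ (fun z => (k z).c11) S

/-- A smooth field of inverse metric densities of determinant `s`. -/
structure _root_.GaugedSigma.IsConf (s : ℝ) (D : Set Plane) (κ : Plane → Conf) : Prop where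
  isOpen : IsOpen D
  smooth : SmoothConf D κ
  det : ∀ σ ∈ D, (κ σ).det = s

lemma _root_.GaugedSigma.SmoothConf.mono {Z : Type*} [NormedAddCommGroup Z] [NormedSpace ℝ Z]
    {S T : Set Z} {k : Z → Conf} (h : SmoothConf S k) (hT : T ⊆ S) : SmoothConf T k :=
  ⟨h.c00.mono hT, h.c01.mono hT, h.c11.mono hT⟩

lemma _root_.GaugedSigma.SmoothConf.snd {D : Set Plane} {κ : Plane → Conf} (h : SmoothConf D κ) :
    SmoothConf (cyl D) fun q => κ q.2 :=
  ⟨smooth_snd h.c00, smooth_snd h.c01, smooth_snd h.c11⟩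

/-- The density of the first variation at `(X, A)` in the direction `(ξ, δ)`. -/
def firstVar (m : Geo V W) (κ : Plane → Conf) (X : Plane → V) (A : Plane → W × W) (ξ : Plane → V)
    (δ : Plane → W × W) (z : Plane) : ℝ :=
  m.dlag (κ z) (X z) (grad X z) (A z) (ξ z) (grad ξ z) (δ z)

lemma smooth_kin {Z : Type*} [NormedAddCommGroup Z] [NormedSpace ℝ Z] {S : Set Z}
    {k : Z → Conf} (h0 : SmoothConf S k)
    {b : Z → V ⊸ V ⊸ ℝ} (hb : C∞ b S)
    {u v : Z → V × V} (hu : C∞ u S) (hv : C∞ v S) :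
    C∞ (fun z => (k z).kin (b z) (u z) (v z)) S := by
  unfold Conf.kin
  have := hu.fst; have := hu.snd; have := hv.fst; have := hv.snd
  have hh : ∀ {p q : Z → V}, C∞ p S → C∞ q S → C∞ (fun z => b z (p z) (q z)) S :=
    fun hp hq => hb.clm₂ hp hq
  exact ((h0.c00.mul (hh ‹_› ‹_›)).add (h0.c01.mul ((hh ‹_› ‹_›).add (hh ‹_› ‹_›)))).add
    (h0.c11.mul (hh ‹_› ‹_›))

namespace IsSmooth

variable (h : m.IsSmooth)
include h

lemma smooth_cov {Z : Type*} [NormedAddCommGroup Z] [NormedSpace ℝ Z] {S : Set Z}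
    {x : Z → V} {u : Z → V × V} {A : Z → W × W}
    (hx : C∞ x S) (hu : C∞ u S) (hA : C∞ A S)
    (hm : MapsTo x S m.dom) : C∞ (fun z => m.cov (x z) (u z) (A z)) S := by
  have hR := h.smooth_R.comp hx hm
  exact (hu.fst.sub (hR.clm_apply hA.fst)).prodMk (hu.snd.sub (hR.clm_apply hA.snd))

lemma smooth_lag {Z : Type*} [NormedAddCommGroup Z] [NormedSpace ℝ Z] {S : Set Z}
    {k : Z → Conf} (h0 : SmoothConf S k)
    {x : Z → V} {u : Z → V × V} {A : Z → W × W}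
    (hx : C∞ x S) (hu : C∞ u S) (hA : C∞ A S)
    (hm : MapsTo x S m.dom) :
    C∞ (fun z => m.lag (k z) (x z) (u z) (A z)) S := by
  have hR := (h.smooth_R).comp hx hm
  have hG := (h.smooth_G).comp hx hm
  have hB := (h.smooth_B).comp hx hm
  have hAl := (h.smooth_Al).comp hx hm
  have hc := h.smooth_cov hx hu hA hm
  have hk := smooth_kin h0 hG hc hc
  have hBB : ∀ {p q : Z → V}, C∞ p S → C∞ q S → C∞ (fun z => m.B (x z) (p z) (q z)) S :=
    fun hp hq => hB.clm₂ hp hq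
  have hAA : ∀ {p : Z → W} {q : Z → V}, C∞ p S → C∞ q S → C∞ (fun z => m.Al (x z) (p z) (q z)) S :=
    fun hp hq => hAl.clm₂ hp hq
  exact (((contDiffOn_const.mul hk).add (contDiffOn_const.mul
    ((hBB hu.fst hu.snd).sub (hBB hu.snd hu.fst)))).add
    ((hAA hA.fst hu.snd).sub (hAA hA.snd hu.fst))).add
    (contDiffOn_const.mul ((hAA hA.snd (hR.clm_apply hA.fst)).sub
      (hAA hA.fst (hR.clm_apply hA.snd))))

/-- `dlag` is the derivative of the Lagrangian density along curves of jets. -/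
lemma hasDerivAt_lag {k : Conf} {x : ℝ → V} {u : ℝ → V × V} {A : ℝ → W × W} {s0 : ℝ}
    {ξ : V} {p : V × V} {δ : W × W} (hx : HasDerivAt x ξ s0) (hu : HasDerivAt u p s0)
    (hA : HasDerivAt A δ s0) (hm : x s0 ∈ m.dom) :
    HasDerivAt (fun s => m.lag k (x s) (u s) (A s)) (m.dlag k (x s0) (u s0) (A s0) ξ p δ) s0 := by
  have hR := h.smooth_R.comp_deriv h.isOpen_dom hm hx
  have hG := h.smooth_G.comp_deriv h.isOpen_dom hm hx
  have hB := h.smooth_B.comp_deriv h.isOpen_dom hm hx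
  have hAl := h.smooth_Al.comp_deriv h.isOpen_dom hm hx
  have hu1 := hu.fst'
  have hu2 := hu.snd'
  have hA1 := hA.fst'
  have hA2 := hA.snd'
  have hc1 := HasDerivAt.sub hu1 (hR.clm_apply hA1)
  have hc2 := HasDerivAt.sub hu2 (hR.clm_apply hA2)
  have hk := ((hG.clm₂ hc1 hc1).const_mul k.c00).add
    (((hG.clm₂ hc1 hc2).add (hG.clm₂ hc2 hc1)).const_mul k.c01)
    |>.add ((hG.clm₂ hc2 hc2).const_mul k.c11)
  have := (((hk.const_mul (1 / 2)).add (((hB.clm₂ hu1 hu2).sub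
    (hB.clm₂ hu2 hu1)).const_mul (1 / 2))).add
    ((hAl.clm₂ hA1 hu2).sub (hAl.clm₂ hA2 hu1))).add
    (((hAl.clm₂ hA2 (hR.clm_apply hA1)).sub (hAl.clm₂ hA1 (hR.clm_apply hA2))).const_mul (1 / 2))
  refine this.congr_deriv ?_
  simp only [dlag, Conf.kin, cov, dcov, _root_.add_apply, Pi.sub_apply]
  ring

/-- The first variation of the gauged functional is the integral of `firstVar`. -/
lemma hasDerivAt_integral_lag {s : ℝ} {D : Set Plane} {κ : Plane → Conf} (hκ : IsConf s D κ)
    {X : Plane → V} {A : Plane → W × W} (hX : C∞ X D) (hA : C∞ A D)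
    (hm : MapsTo X D m.dom) {ξ : Plane → V} {δ : Plane → W × W}
    (hξ : IsTest D ξ) (hδ : IsTest D δ) :
    HasDerivAt (fun s : ℝ => ∫ z in D, (m.lag (κ z) ((X + s • ξ) z) (grad (X + s • ξ) z)
        ((A + s • δ) z) - m.lag (κ z) (X z) (grad X z) (A z)))
      (∫ z in D, m.firstVar κ X A ξ δ z) 0 := by
  have hD := hκ.isOpen
  set Ω : Set (ℝ × Plane) := {p | p.2 ∈ D ∧ X p.2 + p.1 • ξ p.2 ∈ m.dom}
  have hS : IsOpen (cyl D) := hD.preimage continuous_snd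
  have hX' := smooth_snd hX
  have hA' := smooth_snd hA
  have hgX' := smooth_snd (smooth_grad hD hX)
  have hξ' : ContDiff ℝ ∞ (fun p : ℝ × Plane => ξ p.2) := hξ.1.comp contDiff_snd
  have hδ' : ContDiff ℝ ∞ (fun p : ℝ × Plane => δ p.2) := hδ.1.comp contDiff_snd
  have hgξ' : ContDiff ℝ ∞ (fun p : ℝ × Plane => grad ξ p.2) :=
    ((contDiff_pdv hξ.1 0).prodMk (contDiff_pdv hξ.1 1)).comp contDiff_snd
  have hc : C∞ (fun p : ℝ × Plane => X p.2 + p.1 • ξ p.2)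
      (cyl D) := hX'.add (contDiffOn_fst.smul hξ'.contDiffOn)
  have hΩ : IsOpen Ω := hc.continuousOn.isOpen_inter_preimage hS h.isOpen_dom
  have hΩS : Ω ⊆ cyl D := fun p hp => hp.1
  have hsm : ContDiffOn ℝ 1 (fun p : ℝ × Plane => m.lag (κ p.2) (X p.2 + p.1 • ξ p.2)
      (grad X p.2 + p.1 • grad ξ p.2) (A p.2 + p.1 • δ p.2)) Ω := by
    refine ContDiffOn.of_le (n := ∞) ?_ (by exact_mod_cast le_top)
    exact h.smooth_lag (hκ.smooth.snd.mono hΩS)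
      (hc.mono hΩS) ((hgX'.add (contDiffOn_fst.smul hgξ'.contDiffOn)).mono hΩS)
      ((hA'.add (contDiffOn_fst.smul hδ'.contDiffOn)).mono hΩS) fun p hp => hp.2
  have key := hasDerivAt_integral_variation (D := D) (K := tsupport ξ ∪ tsupport δ)
    (hξ.2.1.isCompact.union hδ.2.1) (Set.union_subset hξ.2.2 hδ.2.2) hD hΩ
    (fun z hz => ⟨hz, by simpa using hm hz⟩)
    (f := fun s z => m.lag (κ z) (X z + s • ξ z) (grad X z + s • grad ξ z) (A z + s • δ z)) hsm
    (f' := m.firstVar κ X A ξ δ) (by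
      intro z hz
      have := h.hasDerivAt_lag (k := κ z) (hasDerivAt_add_smul (X z) (ξ z))
        (hasDerivAt_add_smul (grad X z) (grad ξ z)) (hasDerivAt_add_smul (A z) (δ z))
        (by simpa using hm hz)
      simpa [firstVar] using this)
    (by
      intro s z hz hn
      rw [Set.mem_union, not_or] at hn
      simp [image_eq_zero_of_notMem_tsupport hn.1, image_eq_zero_of_notMem_tsupport hn.2,
        grad_eq_zero_of_notMem hn.1])
  refine key.congr_of_eventuallyEq (Filter.Eventually.of_forall fun s => ?_)
  refine integral_congr_on hD fun z hz => ?_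
  simp only [grad_add_smul hD hX hξ.1 s hz]
  simp

end IsSmooth

end Geo

/-! ### Reduction of the gauged Lagrangian along a foliation -/

section Sigma

variable {V : Type*} [NormedAddCommGroup V] [NormedSpace ℝ V]

/-- The Lagrangian density of a sigma model with metric `g` and 2-form `b`, on a pair of vectors. -/
def slag (k : Conf) (g b : V ⊸ V ⊸ ℝ) (w : V × V) : ℝ :=
  1 / 2 * k.kin g w w + 1 / 2 * (b w.1 w.2 - b w.2 w.1)

/-- The derivative of the density `slag` for point-dependent `g` and `b`. -/
def dslag (k : Conf) (g b : V → V ⊸ V ⊸ ℝ) (x ξ : V) (w p : V × V) : ℝ :=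
  1 / 2 * (k.kin (𝒟 g x ξ) w w + k.kin (g x) p w + k.kin (g x) w p)
    + 1 / 2 * (𝒟 b x ξ w.1 w.2 + b x p.1 w.2 + b x w.1 p.2
      - (𝒟 b x ξ w.2 w.1 + b x p.2 w.1 + b x w.2 p.1))

lemma hasDerivAt_slag {k : Conf} {g b : V → V ⊸ V ⊸ ℝ} {x : ℝ → V} {w : ℝ → V × V}
    {s0 : ℝ} {ξ : V} {p : V × V} (hg : DifferentiableAt ℝ g (x s0))
    (hb : DifferentiableAt ℝ b (x s0)) (hx : HasDerivAt x ξ s0) (hw : HasDerivAt w p s0) :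
    HasDerivAt (fun s => slag k (g (x s)) (b (x s)) (w s)) (dslag k g b (x s0) ξ (w s0) p) s0 := by
  have hG0 := hg.hasFDerivAt
  have hG : HasDerivAt (fun s => g (x s)) (𝒟 g (x s0) ξ) s0 :=
    HasFDerivAt.comp_hasDerivAt (l := g) s0 hG0 hx
  have hB0 := hb.hasFDerivAt
  have hB : HasDerivAt (fun s => b (x s)) (𝒟 b (x s0) ξ) s0 :=
    HasFDerivAt.comp_hasDerivAt (l := b) s0 hB0 hx
  have hu1 := hw.fst'
  have hu2 := hw.snd'
  have hk := ((hG.clm₂ hu1 hu1).const_mul k.c00).add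
    (((hG.clm₂ hu1 hu2).add (hG.clm₂ hu2 hu1)).const_mul k.c01)
    |>.add ((hG.clm₂ hu2 hu2).const_mul k.c11)
  have := (hk.const_mul (1 / 2)).add (((hB.clm₂ hu1 hu2).sub (hB.clm₂ hu2 hu1)).const_mul (1 / 2))
  refine this.congr_deriv ?_
  simp only [dslag, Conf.kin, _root_.add_apply]
  ring

/-- The Euler-Lagrange form of the derivative of a sigma model density: up to the exterior
derivative of `b(ξ, dX)`, it depends on `b` only through `db`. -/
lemma dslag_eq {k : Conf} {g b : V → V ⊸ V ⊸ ℝ} {x : V}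
    (hg : ∀ u v, g x u v = g x v u) (hb : ∀ u v, b x u v = -b x v u)
    (hdb : ∀ ξ u v, 𝒟 b x ξ u v = -𝒟 b x ξ v u) (ξ : V) (w p : V × V) :
    dslag k g b x ξ w p = 1 / 2 * k.kin (𝒟 g x ξ) w w + k.kin (g x) w p + extD b x ξ w.1 w.2
      + ((𝒟 b x w.1 ξ w.2 + b x p.1 w.2) - (𝒟 b x w.2 ξ w.1 + b x p.2 w.1)) := by
  simp only [dslag, Conf.kin, extD]
  linear_combination k.c00 / 2 * hg p.1 w.1 + k.c01 / 2 * hg p.1 w.2 + k.c01 / 2 * hg p.2 w.1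
    + k.c11 / 2 * hg p.2 w.2 - 1 / 2 * hdb ξ w.2 w.1 + 1 / 2 * hb w.1 p.2 - 1 / 2 * hb w.2 p.1
    - hdb w.1 w.2 ξ

/-- Pull-back of a continuous bilinear form by continuous linear maps. -/
def pull (g : V ⊸ V ⊸ ℝ) (p q : V ⊸ V) : V ⊸ V ⊸ ℝ := ((g ∘L p).flip ∘L q).flip

@[simp] lemma pull_apply (g : V ⊸ V ⊸ ℝ) (p q : V ⊸ V) (u v : V) :
    pull g p q u v = g (p u) (q v) := rfl

lemma smooth_flip {S : Set V} {b : V → V ⊸ V ⊸ ℝ} (hb : C∞ b S) : C∞ (fun x => (b x).flip) S := by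
  have h : IsBoundedLinearMap ℝ fun f : V ⊸ V ⊸ ℝ => f.flip :=
    ⟨⟨fun _ _ => rfl, fun _ _ => rfl⟩, 1, one_pos, fun f => by rw [ContinuousLinearMap.opNorm_flip,
      one_mul]⟩
  have h2 : ContDiff ℝ ∞ fun f : V ⊸ V ⊸ ℝ => f.flip := h.contDiff
  exact h2.comp_contDiffOn hb

lemma smooth_pull {S : Set V} {g : V → V ⊸ V ⊸ ℝ} {p q : V → V ⊸ V}
    (hg : C∞ g S) (hp : C∞ p S) (hq : C∞ q S) :
    C∞ (fun x => pull (g x) (p x) (q x)) S :=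
  smooth_flip ((smooth_flip (hg.clm_comp hp)).clm_comp hq)

end Sigma

/-- Data for integrating out the gauge fields on a foliated chart: the projection `t` onto the
tangent space of the leaves, a right inverse `Rp` of the anchor, and the operators `N`, `M` for
which `w = N(dX) + ∗M(dX)` is the value of the covariant derivative determined by the equation of
motion of the gauge fields. The last property is nondegeneracy of that equation. -/
structure Reduction (m : Geo V W) (s : ℝ) where
  t : V ⊸ V
  Rp : V → V ⊸ W
  N : V → V ⊸ V
  M : V → V ⊸ V
  smooth_Rp : C∞ Rp m.dom
  smooth_N : C∞ N m.dom
  smooth_M : C∞ M m.dom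
  t_t : ∀ v, t (t v) = t v
  t_R : ∀ x ∈ m.dom, ∀ a, t (m.R x a) = m.R x a
  R_Rp : ∀ x ∈ m.dom, ∀ v, m.R x (Rp x v) = t v
  Al_ker : ∀ x ∈ m.dom, ∀ a, m.R x a = 0 → m.Al x a = 0
  t_N : ∀ x ∈ m.dom, ∀ u, t (N x u - u) = N x u - u
  t_M : ∀ x ∈ m.dom, ∀ u, t (M x u) = M x u
  crit₁ : ∀ x ∈ m.dom, ∀ v u, m.G x (t v) (N x u) = m.Al x (Rp x v) (M x u)
  crit₂ : ∀ x ∈ m.dom, ∀ v u, -(s * m.G x (t v) (M x u)) = m.Al x (Rp x v) (N x u)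
  nondeg : ∀ x ∈ m.dom, ∀ y z, t y = y → t z = z →
    (∀ v, m.G x (t v) y = m.Al x (Rp x v) z ∧ -(s * m.G x (t v) z) = m.Al x (Rp x v) y) →
      y = 0 ∧ z = 0

namespace Reduction

variable {m : Geo V W} {s : ℝ} (r : Reduction m s)

/-- The bilinear form `α` read on tangent vectors of the leaves. -/
def al (x : V) : V ⊸ V ⊸ ℝ := m.Al x ∘L r.Rp x

/-- A 2-form that agrees with `-α` when its first argument is tangent to the leaves. -/
def bb (x : V) : V ⊸ V ⊸ ℝ := (r.al x).flip ∘L (ContinuousLinearMap.id ℝ V - r.t) - r.al x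

/-- The reduced metric. -/
def gq (x : V) : V ⊸ V ⊸ ℝ := pull (m.G x) (r.N x) (r.N x) - s • pull (m.G x) (r.M x) (r.M x)

/-- The reduced 2-form. -/
def bt (x : V) : V ⊸ V ⊸ ℝ :=
  m.B x - r.bb x + (pull (r.bb x) (r.N x) (r.N x) - s • pull (m.G x) (r.N x) (r.M x))

/-- The on-shell value of the covariant derivative. -/
def wc (k : Conf) (x : V) (u : V × V) : V × V :=
  (r.N x u.1, r.N x u.2) + k.star (r.M x u.1, r.M x u.2)

/-- The deviation of the covariant derivative from its on-shell value. -/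
def dev (k : Conf) (x : V) (u : V × V) (A : W × W) : V × V := m.cov x u A - r.wc k x u

/-- The derivative of `wc`. -/
def dwc (k : Conf) (x : V) (u : V × V) (ξ : V) (p : V × V) : V × V :=
  (𝒟 r.N x ξ u.1 + r.N x p.1, 𝒟 r.N x ξ u.2 + r.N x p.2)
    + k.star (𝒟 r.M x ξ u.1 + r.M x p.1, 𝒟 r.M x ξ u.2 + r.M x p.2)

/-- The derivative of `dev`. -/
def ddev (k : Conf) (x : V) (u : V × V) (A : W × W) (ξ : V) (p : V × V) (δ : W × W) : V × V :=
  m.dcov x A ξ p δ - r.dwc k x u ξ p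

lemma al_apply (x u v : V) : r.al x u v = m.Al x (r.Rp x u) v := rfl

lemma bb_apply (x u v : V) : r.bb x u v = r.al x v (u - r.t u) - r.al x u v := by simp [bb]

lemma gq_apply (x u v : V) :
    r.gq x u v = m.G x (r.N x u) (r.N x v) - s * m.G x (r.M x u) (r.M x v) := by
  simp [gq]

lemma bt_apply (x u v : V) : r.bt x u v = m.B x u v - r.bb x u v
    + (r.bb x (r.N x u) (r.N x v) - s * m.G x (r.N x u) (r.M x v)) := by
  simp [bt]

variable (h : m.IsGauged s)

section pointwise

variable {x : V} (hx : x ∈ m.dom)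
include hx

lemma Al_eq (a : W) : m.Al x a = r.al x (m.R x a) := by
  have : m.R x (a - r.Rp x (m.R x a)) = 0 := by rw [map_sub, r.R_Rp x hx, r.t_R x hx, sub_self]
  have := r.Al_ker x hx _ this
  rw [map_sub, sub_eq_zero] at this
  exact this

lemma al_t (u : V) : r.al x (r.t u) = r.al x u := by
  have h1 := r.Al_eq hx (r.Rp x u)
  rw [r.R_Rp x hx] at h1
  exact h1.symm

lemma N_t (u : V) : r.N x (r.t u) = 0 ∧ r.M x (r.t u) = 0 := by
  refine r.nondeg x hx _ _ ?_ (r.t_M x hx _) fun v => ⟨r.crit₁ x hx v _, r.crit₂ x hx v _⟩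
  have := r.t_N x hx (r.t u)
  rw [map_sub, r.t_t] at this
  simpa using this

lemma bb_t (u v : V) : r.bb x (r.t u) v = -r.al x u v := by
  rw [bb_apply, r.t_t, sub_self, map_zero, r.al_t hx, zero_sub]

lemma gq_t (u v : V) : r.gq x (r.t u) v = 0 := by simp [gq_apply, r.N_t hx]

lemma G_M_N (u v : V) : m.G x (r.M x u) (r.N x v) = r.al x (r.M x u) (r.M x v) := by
  have := r.crit₁ x hx (r.M x u) v
  rwa [r.t_M x hx] at this

lemma al_M_N (u v : V) : r.al x (r.M x u) (r.N x v) = -(s * m.G x (r.M x u) (r.M x v)) := by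
  have := r.crit₂ x hx (r.M x u) v
  rw [r.t_M x hx] at this
  exact this.symm

/-- The on-shell covariant derivative is critical for tangential variations. -/
lemma crit_wc (k : Conf) (hk : k.det = s) (u : V × V) {v : V × V} (hv1 : r.t v.1 = v.1)
    (hv2 : r.t v.2 = v.2) :
    k.kin (m.G x) v (r.wc k x u) + r.bb x v.1 (r.wc k x u).2 - r.bb x v.2 (r.wc k x u).1 = 0 := by
  obtain ⟨v1, v2⟩ := v
  obtain ⟨u1, u2⟩ := u
  simp only at hv1 hv2
  have c1 := fun v u => r.crit₁ x hx v u
  have c2 := fun v u => r.crit₂ x hx v u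
  have b1 := r.bb_t hx v1
  have b2 := r.bb_t hx v2
  rw [hv1] at b1
  rw [hv2] at b2
  have e11 := c1 v1 u1; have e12 := c1 v1 u2; have e21 := c1 v2 u1; have e22 := c1 v2 u2
  have f11 := c2 v1 u1; have f12 := c2 v1 u2; have f21 := c2 v2 u1; have f22 := c2 v2 u2
  rw [hv1] at e11 e12 f11 f12
  rw [hv2] at e21 e22 f21 f22
  simp only [← al_apply] at *
  simp only [wc, Conf.kin, Conf.star, Prod.fst_add, Prod.snd_add, b1, b2, map_add, map_neg,
    map_smul, smul_eq_mul]
  simp only [Conf.det] at hk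
  clear c1 c2 b1 b2
  linear_combination k.c00 * e11 + k.c01 * e12 + k.c01 * e21 + k.c11 * e22 + f12 - f21
    - (m.G x v1 (r.M x u2) - m.G x v2 (r.M x u1)) * hk

lemma bt_R (ε : W) (v : V) : r.bt x (m.R x ε) v = m.B x (m.R x ε) v + m.Al x ε v := by
  have ht := r.t_R x hx ε
  have hN := r.N_t hx (m.R x ε)
  rw [ht] at hN
  have := r.bb_t hx (m.R x ε) v
  rw [ht] at this
  rw [bt_apply, hN.1, this, ← r.Al_eq hx]
  simp

include h

lemma al_antisymm (u v : V) : r.al x u (r.t v) = -r.al x v (r.t u) := by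
  have := h.isotropy x hx (r.Rp x u) (r.Rp x v)
  rw [r.R_Rp x hx, r.R_Rp x hx, ← al_apply, ← al_apply] at this
  linarith

lemma bb_antisymm (u v : V) : r.bb x u v = -r.bb x v u := by
  have := r.al_antisymm h hx u v
  simp only [bb_apply, map_sub]
  linarith

lemma al_M_M (u v : V) : r.al x (r.M x u) (r.M x v) = -r.al x (r.M x v) (r.M x u) := by
  have := r.al_antisymm h hx (r.M x u) (r.M x v)
  rwa [r.t_M x hx, r.t_M x hx] at this

lemma gq_symm (u v : V) : r.gq x u v = r.gq x v u := by
  rw [gq_apply, gq_apply, h.symm_G x hx (r.N x u), h.symm_G x hx (r.M x u)]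

lemma bt_antisymm (u v : V) : r.bt x u v = -r.bt x v u := by
  have h1 := r.bb_antisymm h hx u v
  have h2 := r.bb_antisymm h hx (r.N x u) (r.N x v)
  have h3 := h.antisymm_B x hx u v
  have h4 := r.G_M_N hx u v
  have h5 := r.G_M_N hx v u
  have h6 := r.al_M_M h hx u v
  have h7 := h.symm_G x hx (r.N x v) (r.M x u)
  have h8 := h.symm_G x hx (r.N x u) (r.M x v)
  rw [bt_apply, bt_apply]
  linear_combination h3 - h1 + h2 - s * (h4 + h5 + h6 + h7 + h8)

/-- Completion of the square: the reduced Lagrangian density. -/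
lemma slag_wc (k : Conf) (hk : k.det = s) (u : V × V) : slag k (m.G x) (r.bb x) (r.wc k x u) =
      1 / 2 * k.kin (r.gq x) u u + 1 / 2 * ((r.bb x (r.N x u.1) (r.N x u.2)
        - s * m.G x (r.N x u.1) (r.M x u.2)) - (r.bb x (r.N x u.2) (r.N x u.1)
        - s * m.G x (r.N x u.2) (r.M x u.1))) := by
  have hs1 : r.t (k.star (r.M x u.1, r.M x u.2)).1 = (k.star (r.M x u.1, r.M x u.2)).1 := by
    simp [Conf.star, r.t_M x hx]
  have hs2 : r.t (k.star (r.M x u.1, r.M x u.2)).2 = (k.star (r.M x u.1, r.M x u.2)).2 := by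
    simp [Conf.star, r.t_M x hx]
  have c := r.crit_wc hx k hk u hs1 hs2
  have P : ∀ u v, r.bb x (r.N x u) (r.M x v) = -(s * m.G x (r.M x v) (r.M x u)) := fun u v => by
    have h1 := r.bb_t hx (r.M x v) (r.N x u)
    rw [r.t_M x hx, r.al_M_N hx] at h1
    rw [r.bb_antisymm h hx, h1, neg_neg]
  have P11 := P u.1 u.1
  have P12 := P u.1 u.2
  have P21 := P u.2 u.1
  have P22 := P u.2 u.2
  simp only [slag, wc, Conf.kin, Conf.star, Prod.fst_add, Prod.snd_add, map_add, map_neg,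
    map_smul, smul_eq_mul, _root_.add_apply, _root_.neg_apply, _root_.smul_apply, gq_apply] at c ⊢
  simp only [Conf.det] at hk
  clear P hs1 hs2
  linear_combination 1 / 2 * c
    - 1 / 2 * (m.G x (r.N x u.1) (r.M x u.2) - m.G x (r.N x u.2) (r.M x u.1)) * hk
    + 1 / 2 * (k.c00 * P11 + k.c01 * P12 + k.c01 * P21 + k.c11 * P22)

/-- The Lagrangian density splits into the reduced density and a quadratic form in the deviation
of the covariant derivative from its on-shell value. -/
lemma lag_eq (k : Conf) (hk : k.det = s) (u : V × V) (A : W × W) :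
    m.lag k x u A = slag k (r.gq x) (r.bt x) u + slag k (m.G x) (r.bb x) (r.dev k x u A) := by
  obtain ⟨w, hw⟩ : ∃ w, w = m.cov x u A := ⟨_, rfl⟩
  have hw1 : m.R x A.1 = u.1 - w.1 := by simp [hw, Geo.cov]
  have hw2 : m.R x A.2 = u.2 - w.2 := by simp [hw, Geo.cov]
  have t1 : r.t (u.1 - w.1) = u.1 - w.1 := by rw [← hw1, r.t_R x hx]
  have t2 : r.t (u.2 - w.2) = u.2 - w.2 := by rw [← hw2, r.t_R x hx]
  have y1 : r.t (r.dev k x u A).1 = (r.dev k x u A).1 := by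
    have : (r.dev k x u A).1 = -(u.1 - w.1) - (r.N x u.1 - u.1)
        - (k.star (r.M x u.1, r.M x u.2)).1 := by
      simp only [dev, wc, ← hw, Prod.fst_sub, Prod.fst_add]
      abel
    rw [this, map_sub, map_sub, map_neg, t1, r.t_N x hx]
    simp [Conf.star, r.t_M x hx]
  have y2 : r.t (r.dev k x u A).2 = (r.dev k x u A).2 := by
    have : (r.dev k x u A).2 = -(u.2 - w.2) - (r.N x u.2 - u.2)
        - (k.star (r.M x u.1, r.M x u.2)).2 := by
      simp only [dev, wc, ← hw, Prod.snd_sub, Prod.snd_add]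
      abel
    rw [this, map_sub, map_sub, map_neg, t2, r.t_N x hx]
    simp [Conf.star, r.t_M x hx]
  have c := r.crit_wc hx k hk u y1 y2
  have sl := r.slag_wc h hx k hk u
  have e : w = r.wc k x u + r.dev k x u A := by simp [dev, hw]
  have sy := h.symm_G x hx
  have an := r.bb_antisymm h hx
  have hsum : slag k (m.G x) (r.bb x) w = slag k (m.G x) (r.bb x) (r.wc k x u)
      + slag k (m.G x) (r.bb x) (r.dev k x u A) := by
    rw [e]
    generalize r.dev k x u A = y at *
    generalize r.wc k x u = z at *
    have s11 := sy z.1 y.1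
    have s12 := sy z.1 y.2
    have s21 := sy z.2 y.1
    have s22 := sy z.2 y.2
    have a12 := an y.1 z.2
    have a21 := an y.2 z.1
    simp only [slag, Conf.kin, Prod.fst_add, Prod.snd_add, map_add, _root_.add_apply] at *
    clear sy an sl y1 y2 t1 t2
    linear_combination c + k.c00 / 2 * s11 + k.c01 / 2 * s12 + k.c01 / 2 * s21 + k.c11 / 2 * s22
      - 1 / 2 * a12 + 1 / 2 * a21
  have hB := h.antisymm_B x hx
  have h1 : m.lag k x u A = slag k (m.G x) (r.bb x) w + (m.B x u.1 u.2 - r.bb x u.1 u.2) := by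
    have b1 : r.bb x u.1 u.2 = r.al x u.2 (w.1 - r.t w.1) - r.al x u.1 u.2 := by
      rw [bb_apply]
      rw [map_sub] at t1
      have : u.1 - r.t u.1 = w.1 - r.t w.1 := by
        rw [show r.t w.1 = r.t u.1 - (u.1 - w.1) by rw [← t1]; abel]
        abel
      rw [this]
    have b2 := r.bb_apply x w.1 w.2
    have b3 := an w.1 w.2
    have hB1 := hB u.1 u.2
    have q2 := r.al_antisymm h hx (u.2 - w.2) w.1
    have q3 := r.al_antisymm h hx (u.1 - w.1) (u.2 - w.2)
    rw [t1, t2] at q3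
    rw [t2] at q2
    simp only [Geo.lag, ← hw, slag, r.Al_eq hx, hw1, hw2]
    clear sy an hB sl c e hsum t1 t2 y1 y2 hw hw1 hw2
    simp only [map_sub, _root_.sub_apply] at *
    linear_combination -1/2*hB1 + 1/2*b3 + b1 - b2 - 1/2*q3 - q2
  rw [h1, hsum, sl]
  have hB1 := hB u.1 u.2
  have a1 := an u.1 u.2
  conv_rhs => rw [show slag k (r.gq x) (r.bt x) u = 1 / 2 * k.kin (r.gq x) u u
    + 1 / 2 * (r.bt x u.1 u.2 - r.bt x u.2 u.1) from rfl, r.bt_apply, r.bt_apply]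
  linear_combination 1 / 2 * hB1 - 1 / 2 * a1

end pointwise
end Reduction

lemma Geo.IsSmooth.hasDerivAt_cov {m : Geo V W} (h : m.IsSmooth) {x : ℝ → V} {u : ℝ → V × V}
    {A : ℝ → W × W} {s0 : ℝ} {ξ : V} {p : V × V} {δ : W × W} (hx : HasDerivAt x ξ s0)
    (hu : HasDerivAt u p s0) (hA : HasDerivAt A δ s0) (hm : x s0 ∈ m.dom) :
    HasDerivAt (fun s => m.cov (x s) (u s) (A s)) (m.dcov (x s0) (A s0) ξ p δ) s0 := by
  have hR := h.smooth_R.comp_deriv h.isOpen_dom hm hx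
  have hu1 := hu.fst'
  have hu2 := hu.snd'
  have hA1 := hA.fst'
  have hA2 := hA.snd'
  exact (hu1.sub (hR.clm_apply hA1)).prodMk (hu2.sub (hR.clm_apply hA2))

namespace Reduction

variable {m : Geo V W} {s : ℝ} (r : Reduction m s)

lemma smooth_al (h : m.IsSmooth) : C∞ r.al m.dom := h.smooth_Al.clm_comp r.smooth_Rp

lemma smooth_bb (h : m.IsSmooth) : C∞ r.bb m.dom :=
  ((smooth_flip (r.smooth_al h)).clm_comp contDiffOn_const).sub (r.smooth_al h)

lemma smooth_gq (h : m.IsSmooth) : C∞ r.gq m.dom :=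
  (smooth_pull h.smooth_G r.smooth_N r.smooth_N).sub
    ((smooth_pull h.smooth_G r.smooth_M r.smooth_M).const_smul s)

lemma smooth_bt (h : m.IsSmooth) : C∞ r.bt m.dom := (h.smooth_B.sub (r.smooth_bb h)).add
    ((smooth_pull (r.smooth_bb h) r.smooth_N r.smooth_N).sub
      ((smooth_pull h.smooth_G r.smooth_N r.smooth_M).const_smul s))

lemma _root_.GaugedSigma.Geo.IsSmooth.differentiableAt_on {F : Type*}
    [NormedAddCommGroup F] [NormedSpace ℝ F] (h : m.IsSmooth) {f : V → F}
    (hf : C∞ f m.dom) {x : V} (hx : x ∈ m.dom) : DifferentiableAt ℝ f x :=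
  hf.diffAt h.isOpen_dom hx

lemma hasDerivAt_star (k : Conf) {v : ℝ → V × V} {p : V × V} {s0 : ℝ} (hv : HasDerivAt v p s0) :
    HasDerivAt (fun s => k.star (v s)) (k.star p) s0 := by
  have hu1 := hv.fst'
  have hu2 := hv.snd'
  exact (((hu1.const_smul k.c01).add (hu2.const_smul k.c11)).neg).prodMk
    ((hu1.const_smul k.c00).add (hu2.const_smul k.c01))

lemma hasDerivAt_dev (h : m.IsSmooth) (k : Conf) {x : ℝ → V} {u : ℝ → V × V}
    {A : ℝ → W × W} {s0 : ℝ} {ξ : V} {p : V × V} {δ : W × W} (hx : HasDerivAt x ξ s0)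
    (hu : HasDerivAt u p s0) (hA : HasDerivAt A δ s0) (hm : x s0 ∈ m.dom) :
    HasDerivAt (fun s => r.dev k (x s) (u s) (A s)) (r.ddev k (x s0) (u s0) (A s0) ξ p δ) s0 := by
  have hN := r.smooth_N.comp_deriv h.isOpen_dom hm hx
  have hM := r.smooth_M.comp_deriv h.isOpen_dom hm hx
  have hu1 := hu.fst'
  have hu2 := hu.snd'
  exact (h.hasDerivAt_cov hx hu hA hm).sub (((hN.clm_apply hu1).prodMk (hN.clm_apply hu2)).add
      (hasDerivAt_star k ((hM.clm_apply hu1).prodMk (hM.clm_apply hu2))))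

lemma dlag_eq (h : m.IsGauged s) {x : V} (hx : x ∈ m.dom) (k : Conf) (hk : k.det = s)
    (u : V × V) (A : W × W) (ξ : V) (p : V × V) (δ : W × W) :
    m.dlag k x u A ξ p δ = dslag k r.gq r.bt x ξ u p
      + dslag k m.G r.bb x ξ (r.dev k x u A) (r.ddev k x u A ξ p δ) := by
  have hs := h.toIsSmooth
  have h1 := hasDerivAt_add_smul x ξ
  have h2 := hasDerivAt_add_smul u p
  have h3 := hasDerivAt_add_smul A δ
  have hm : x + (0 : ℝ) • ξ ∈ m.dom := by simpa
  have a := hs.hasDerivAt_lag (k := k) h1 h2 h3 hm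
  have b := hasDerivAt_slag (k := k) (hs.differentiableAt_on (r.smooth_gq hs) hm)
    (hs.differentiableAt_on (r.smooth_bt hs) hm) h1 h2
  have c := hasDerivAt_slag (k := k) (hs.differentiableAt_G hm)
    (hs.differentiableAt_on (r.smooth_bb hs) hm) h1
    (r.hasDerivAt_dev hs k h1 h2 h3 hm)
  have ev : (fun τ : ℝ => m.lag k (x + τ • ξ) (u + τ • p) (A + τ • δ)) =ᶠ[𝓝 0]
      ((fun τ : ℝ => slag k (r.gq (x + τ • ξ)) (r.bt (x + τ • ξ)) (u + τ • p)) +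
        fun τ : ℝ => slag k (m.G (x + τ • ξ)) (r.bb (x + τ • ξ))
          (r.dev k (x + τ • ξ) (u + τ • p) (A + τ • δ))) := by
    filter_upwards [h1.continuousAt.preimage_mem_nhds (h.isOpen_dom.mem_nhds hm)] with τ hτ
    exact r.lag_eq h hτ k hk _ _
  have := a.unique ((b.add c).congr_of_eventuallyEq ev)
  simpa using this

/-- Tangency is preserved by differentiation. -/
lemma t_fderiv_R (h : m.IsSmooth) {x : V} (hx : x ∈ m.dom) (ξ : V) (a : W) :
    r.t (𝒟 m.R x ξ a) = 𝒟 m.R x ξ a := by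
  have h0 := (h.differentiableAt_R hx).hasFDerivAt
  have h1 := h0.app a
  have h2 := r.t.hasFDerivAt.comp x h1
  have h3 := eventually_of_mem (h.isOpen_dom.mem_nhds hx) fun y hy => r.t_R y hy a
  have := DFunLike.congr_fun (h2.unique (h1.congr_of_eventuallyEq h3)) ξ
  simpa using this

lemma t_fderiv_N (h : m.IsSmooth) {x : V} (hx : x ∈ m.dom) (ξ u : V) :
    r.t (𝒟 r.N x ξ u) = 𝒟 r.N x ξ u := by
  have h0 := (h.differentiableAt_on r.smooth_N hx).hasFDerivAt
  have h1 := (h0.app u).sub_const u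
  have h2 := r.t.hasFDerivAt.comp x h1
  have h3 := eventually_of_mem (h.isOpen_dom.mem_nhds hx) fun y hy => r.t_N y hy u
  have := DFunLike.congr_fun (h2.unique (h1.congr_of_eventuallyEq h3)) ξ
  simpa using this

lemma t_fderiv_M (h : m.IsSmooth) {x : V} (hx : x ∈ m.dom) (ξ u : V) :
    r.t (𝒟 r.M x ξ u) = 𝒟 r.M x ξ u := by
  have h0 := (h.differentiableAt_on r.smooth_M hx).hasFDerivAt
  have h1 := h0.app u
  have h2 := r.t.hasFDerivAt.comp x h1
  have h3 := eventually_of_mem (h.isOpen_dom.mem_nhds hx) fun y hy => r.t_M y hy u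
  have := DFunLike.congr_fun (h2.unique (h1.congr_of_eventuallyEq h3)) ξ
  simpa using this

lemma t_ddev (h : m.IsSmooth) {x : V} (hx : x ∈ m.dom) (k : Conf) (u : V × V) (A : W × W) (ξ : V)
    (p : V × V) (δ : W × W) :
    r.t (r.ddev k x u A ξ p δ).1 = (r.ddev k x u A ξ p δ).1 ∧
      r.t (r.ddev k x u A ξ p δ).2 = (r.ddev k x u A ξ p δ).2 := by
  have hN : ∀ v, r.t v - r.t (r.N x v) = v - r.N x v := fun v => by
    have := r.t_N x hx v
    rw [map_sub] at this
    rw [← neg_sub, this, neg_sub]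
  have e1 := hN p.1
  have e2 := hN p.2
  constructor
  · simp only [ddev, Geo.dcov, dwc, Conf.star, Prod.fst_sub, Prod.fst_add, map_sub, map_add,
      map_neg, map_smul, r.t_fderiv_R h hx, r.t_R x hx, r.t_fderiv_N h hx, r.t_fderiv_M h hx,
      r.t_M x hx]
    rw [show r.t p.1 = r.t (r.N x p.1) + (p.1 - r.N x p.1) by rw [← e1]; abel]
    abel
  · simp only [ddev, Geo.dcov, dwc, Conf.star, Prod.snd_sub, Prod.snd_add, map_sub, map_add,
      map_smul, r.t_fderiv_R h hx, r.t_R x hx, r.t_fderiv_N h hx, r.t_fderiv_M h hx,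
      r.t_M x hx]
    rw [show r.t p.2 = r.t (r.N x p.2) + (p.2 - r.N x p.2) by rw [← e2]; abel]
    abel

/-- The gauge field determined by its equation of motion, up to the kernel of the anchor. -/
def onshell (k : Conf) (x : V) (u : V × V) : W × W :=
  (r.Rp x (u.1 - (r.wc k x u).1), r.Rp x (u.2 - (r.wc k x u).2))

lemma t_sub_wc {x : V} (hx : x ∈ m.dom) (k : Conf) (u : V × V) :
    r.t (u.1 - (r.wc k x u).1) = u.1 - (r.wc k x u).1 ∧
      r.t (u.2 - (r.wc k x u).2) = u.2 - (r.wc k x u).2 := by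
  have hN : ∀ v, r.t v - r.t (r.N x v) = v - r.N x v := fun v => by
    have := r.t_N x hx v
    rw [map_sub] at this
    rw [← neg_sub, this, neg_sub]
  have e1 := hN u.1
  have e2 := hN u.2
  constructor
  · simp only [wc, Conf.star, Prod.fst_add, map_sub, map_add, map_neg, map_smul, r.t_M x hx]
    rw [← sub_sub, e1]
    abel
  · simp only [wc, Conf.star, Prod.snd_add, map_sub, map_add, map_smul, r.t_M x hx]
    rw [← sub_sub, e2]
    abel

lemma dev_onshell {x : V} (hx : x ∈ m.dom) (k : Conf) (u : V × V) :
    r.dev k x u (r.onshell k x u) = 0 := by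
  have := r.t_sub_wc hx k u
  ext <;> simp [dev, onshell, Geo.cov, r.R_Rp x hx, this.1, this.2, -map_sub]

lemma dev_sub {x : V} (k : Conf) (u : V × V) (A η : W × W) :
    r.dev k x u (A - η) = r.dev k x u A + (m.R x η.1, m.R x η.2) := by
  ext <;> simp [dev, Geo.cov] <;> abel

lemma t_dev {x : V} (hx : x ∈ m.dom) (k : Conf) (u : V × V) (A : W × W) :
    r.t (r.dev k x u A).1 = (r.dev k x u A).1 ∧ r.t (r.dev k x u A).2 = (r.dev k x u A).2 := by
  have h1 := r.t_sub_wc hx k u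
  have e1 : (r.dev k x u A).1 = (u.1 - (r.wc k x u).1) - m.R x A.1 := by
    simp only [dev, Geo.cov, Prod.fst_sub]; abel
  have e2 : (r.dev k x u A).2 = (u.2 - (r.wc k x u).2) - m.R x A.2 := by
    simp only [dev, Geo.cov, Prod.snd_sub]; abel
  constructor
  · rw [e1, map_sub, h1.1, r.t_R x hx]
  · rw [e2, map_sub, h1.2, r.t_R x hx]

lemma dslag_zero (k : Conf) (g b : V → V ⊸ V ⊸ ℝ) (x ξ : V) (p : V × V) :
    dslag k g b x ξ 0 p = 0 := by
  simp [dslag, Conf.kin]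

/-- The polarization of the quadratic form `slag`. -/
def pf (k : Conf) (x : V) (y z : V × V) : ℝ := k.kin (m.G x) y z + (r.bb x y.1 z.2 - r.bb x y.2 z.1)

section
variable (h : m.IsGauged s) {x : V} (hx : x ∈ m.dom)
include h hx

/-- The quadratic form `slag` is nondegenerate on tangential vectors. -/
lemma eq_zero_of_pf {k : Conf} (hk : k.det = s) {z : V × V} (hz1 : r.t z.1 = z.1)
    (hz2 : r.t z.2 = z.2) (hpf : ∀ η : W × W, r.pf k x (m.R x η.1, m.R x η.2) z = 0) : z = 0 := by
  have key : ∀ v, k.c00 * m.G x (r.t v) z.1 + k.c01 * m.G x (r.t v) z.2 - m.Al x (r.Rp x v) z.2 = 0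
      ∧ k.c01 * m.G x (r.t v) z.1 + k.c11 * m.G x (r.t v) z.2 + m.Al x (r.Rp x v) z.1 = 0 := by
    intro v
    have h1 := hpf (r.Rp x v, 0)
    have h2 := hpf (0, r.Rp x v)
    have b1 := r.bb_t hx v z.1
    have b2 := r.bb_t hx v z.2
    simp only [pf, Conf.kin, r.R_Rp x hx, map_zero, _root_.zero_apply] at h1 h2
    rw [r.bb_t hx, al_apply] at h1 h2
    constructor <;> linarith
  have n1 := r.nondeg x hx (k.star z).1 z.1 (by simp [Conf.star, hz1, hz2]) hz1 fun v => by
    obtain ⟨k1, k2⟩ := key v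
    simp only [Conf.star, map_neg, map_add, map_smul, smul_eq_mul]
    simp only [Conf.det] at hk
    constructor
    · linear_combination -k2
    · linear_combination -k.c11 * k1 + k.c01 * k2 + m.G x (r.t v) z.1 * hk
  have n2 := r.nondeg x hx (k.star z).2 z.2 (by simp [Conf.star, hz1, hz2]) hz2 fun v => by
    obtain ⟨k1, k2⟩ := key v
    simp only [Conf.star, map_add, map_smul, smul_eq_mul]
    simp only [Conf.det] at hk
    constructor
    · linear_combination k1
    · linear_combination k.c01 * k1 - k.c00 * k2 + m.G x (r.t v) z.2 * hk
  exact Prod.ext n1.2 n2.2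

lemma kin_symm (k : Conf) (y z : V × V) : k.kin (m.G x) y z = k.kin (m.G x) z y := by
  simp only [Conf.kin]
  rw [h.symm_G x hx y.1 z.1, h.symm_G x hx y.1 z.2, h.symm_G x hx y.2 z.1, h.symm_G x hx y.2 z.2]
  ring

lemma dslag_bb (k : Conf) (ξ : V) (y z : V × V) :
    dslag k m.G r.bb x ξ y z = slag k (𝒟 m.G x ξ) (𝒟 r.bb x ξ) y + r.pf k x y z := by
  have e1 := kin_symm h hx k y z
  have e2 := r.bb_antisymm h hx y.1 z.2
  have e3 := r.bb_antisymm h hx y.2 z.1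
  simp only [dslag, slag, pf]
  linear_combination -1 / 2 * e1 - 1 / 2 * e2 + 1 / 2 * e3

lemma antisymm_fderiv_bt (ξ u v : V) : 𝒟 r.bt x ξ u v = -𝒟 r.bt x ξ v u :=
  fderiv_antisymm (r.smooth_bt h.toIsSmooth) h.isOpen_dom (fun _ hy => r.bt_antisymm h hy) hx ξ u v

lemma symm_fderiv_gq (ξ u v : V) : 𝒟 r.gq x ξ u v = 𝒟 r.gq x ξ v u :=
  fderiv_symm (r.smooth_gq h.toIsSmooth) h.isOpen_dom (fun _ hy => r.gq_symm h hy) hx ξ u v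

lemma fderiv_bt_R (ε : W) (ξ v : V) : 𝒟 r.bt x ξ (m.R x ε) v + r.bt x (𝒟 m.R x ξ ε) v =
      𝒟 m.B x ξ (m.R x ε) v + m.B x (𝒟 m.R x ξ ε) v + 𝒟 m.Al x ξ ε v := by
  have hs := h.toIsSmooth
  have hb := (hs.differentiableAt_on (r.smooth_bt hs) hx).hasFDerivAt
  have hB := (hs.differentiableAt_B hx).hasFDerivAt
  have hA := (hs.differentiableAt_Al hx).hasFDerivAt
  have hR := (hs.differentiableAt_R hx).hasFDerivAt.app ε
  have h1 := (hb.clm_apply hR).app v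
  have h2 := ((hB.clm_apply hR).app v).add ((hA.app ε).app v)
  have h3 := eventually_of_mem (h.isOpen_dom.mem_nhds hx) fun y hy => r.bt_R hy ε v
  have := DFunLike.congr_fun (h1.unique (h2.congr_of_eventuallyEq h3)) ξ
  simp at this
  linarith

/-- The reduced Lagrangian density has the same gauge variation as the gauged one. -/
lemma dslag_gauge (k : Conf) (hk : k.det = s) (u : V × V) (A : W × W) (ε : W) (e : W × W) :
    dslag k r.gq r.bt x (m.R x ε) u (m.gaugeP x u ε e) =
      m.dlag k x u A (m.R x ε) (m.gaugeP x u ε e) (m.gaugeA k x u A ε e) := by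
  have h1 := h.dlag_gauge hx k hk u (r.onshell k x u) ε e
  rw [r.dlag_eq h hx k hk, r.dev_onshell hx, dslag_zero, add_zero, ← h.dlag_gauge hx k hk u A] at h1
  exact h1

/-- Gauge invariance of the reduced metric and of the reduced 3-form. -/
lemma reduced_gauge (k : Conf) (hk : k.det = s) (u : V × V) (ε : W) :
    1 / 2 * k.kin (𝒟 r.gq x (m.R x ε)) u u + extD r.bt x (m.R x ε) u.1 u.2 = 0 := by
  have h1 := r.dslag_gauge h hx k hk u 0 ε 0
  rw [h.dlag_gauge hx k hk, dslag_eq (r.gq_symm h hx) (r.bt_antisymm h hx)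
    (r.antisymm_fderiv_bt h hx)] at h1
  have g0 : ∀ ξ v, r.gq x v (𝒟 m.R x ξ ε) = 0 := fun ξ v => by
    rw [r.gq_symm h hx, ← r.t_fderiv_R h.toIsSmooth hx, r.gq_t hx]
  have b1 := r.fderiv_bt_R h hx ε u.1 u.2
  have b2 := r.fderiv_bt_R h hx ε u.2 u.1
  have hkin : k.kin (r.gq x) u (m.gaugeP x u ε 0) = 0 := by simp [Conf.kin, Geo.gaugeP, g0]
  rw [hkin] at h1
  simp only [Geo.gaugeP, Prod.fst_zero, Prod.snd_zero, map_zero, add_zero, _root_.zero_apply] at h1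
  linarith

lemma fderiv_gq_R (ε : W) : 𝒟 r.gq x (m.R x ε) = 0 := by
  have d : ∀ u, 𝒟 r.gq x (m.R x ε) u u = 0 := fun u => by
    have := r.reduced_gauge h hx ⟨1, 0, s⟩ (by simp [Conf.det]) (u, 0) ε
    have b := r.antisymm_fderiv_bt h hx u (m.R x ε) 0
    simpa [Conf.kin, extD] using this
  ext u v
  have h1 := d (u + v)
  have h2 := r.symm_fderiv_gq h hx (m.R x ε) u v
  simp only [map_add, _root_.add_apply, d] at h1
  simp only [_root_.zero_apply]
  linarith

lemma extDeriv_bt_R (ε : W) (u v : V) : extD r.bt x (m.R x ε) u v = 0 := by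
  have := r.reduced_gauge h hx ⟨1, 0, s⟩ (by simp [Conf.det]) (u, v) ε
  rw [r.fderiv_gq_R h hx] at this
  simpa [Conf.kin] using this

/-- The equation of motion of the gauge fields is gauge invariant. -/
lemma ddev_gauge {k : Conf} (hk : k.det = s) {u : V × V} {A : W × W} (hA : r.dev k x u A = 0)
    (ε : W) (e : W × W) :
    r.ddev k x u A (m.R x ε) (m.gaugeP x u ε e) (m.gaugeA k x u A ε e) = 0 := by
  have ht := r.t_ddev h.toIsSmooth hx k u A (m.R x ε) (m.gaugeP x u ε e) (m.gaugeA k x u A ε e)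
  refine r.eq_zero_of_pf h hx hk ht.1 ht.2 fun η => ?_
  -- Off shell, the quadratic part of the Lagrangian density is invariant; its terms linear
  -- in the deviation `η` give the claim.
  have key : ∀ A', dslag k m.G r.bb x (m.R x ε) (r.dev k x u A')
      (r.ddev k x u A' (m.R x ε) (m.gaugeP x u ε e) (m.gaugeA k x u A' ε e)) = 0 := fun A' => by
    have := r.dlag_eq h hx k hk u A' (m.R x ε) (m.gaugeP x u ε e) (m.gaugeA k x u A' ε e)
    rw [r.dslag_gauge h hx k hk u A'] at this
    linarith
  have k1 := key (A - η)
  have k2 := key (A + η)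
  have lin : r.ddev k x u (A - η) (m.R x ε) (m.gaugeP x u ε e) (m.gaugeA k x u (A - η) ε e)
      + r.ddev k x u (A + η) (m.R x ε) (m.gaugeP x u ε e) (m.gaugeA k x u (A + η) ε e)
      = (2 : ℝ) • r.ddev k x u A (m.R x ε) (m.gaugeP x u ε e) (m.gaugeA k x u A ε e) := by
    rw [two_smul]
    ext <;> simp only [ddev, Geo.dcov, Geo.gaugeA, Geo.cov, Conf.star, Prod.fst_add, Prod.fst_sub,
      Prod.snd_add, Prod.snd_sub, map_add, map_sub, map_neg, map_smul, _root_.add_apply,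
      _root_.sub_apply, _root_.neg_apply, _root_.smul_apply, smul_sub, smul_add] <;> abel
  have d2 : r.dev k x u (A + η) = -(m.R x η.1, m.R x η.2) := by
    have := r.dev_sub (x := x) k u A (-η)
    rw [sub_neg_eq_add] at this
    rw [this, hA]
    simp
  rw [r.dev_sub, hA, zero_add, dslag_bb r h hx] at k1
  rw [d2, dslag_bb r h hx] at k2
  generalize r.ddev k x u (A - η) _ _ _ = z1 at *
  generalize r.ddev k x u (A + η) _ _ _ = z2 at *
  generalize r.ddev k x u A _ _ _ = z at *
  obtain rfl : z = (1 / 2 : ℝ) • (z1 + z2) := by rw [lin, smul_smul]; norm_num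
  clear lin ht key
  simp only [pf, slag, Conf.kin, Prod.fst_add, Prod.snd_add, Prod.smul_fst, Prod.smul_snd,
    Prod.fst_neg, Prod.snd_neg, map_add, map_neg, map_smul, _root_.neg_apply,
    smul_eq_mul] at *
  linarith

end

end Reduction

/-! ### Stationary configurations -/

section Test

variable {D : Set Plane}

lemma IsTest.eq_zero {f : Plane → V} (_ : IsTest D f) {z : Plane} (hz : z ∉ tsupport f) :
    f z = 0 := image_eq_zero_of_notMem_tsupport hz

lemma isTest_zero : IsTest D (0 : Plane → V) := ⟨contDiff_const, HasCompactSupport.zero, by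
    rw [show tsupport (0 : Plane → V) = ∅ by simp [tsupport]]; exact Set.empty_subset _⟩

lemma IsTest.clm_apply {f : Plane → V} (hf : IsTest D f) (hD : IsOpen D) {L : Plane → V ⊸ W}
    (hL : C∞ L D) : IsTest D fun z => L z (f z) :=
  isTest_on hD hf.2.1 hf.2.2 (hL.clm_apply hf.1.contDiffOn) fun z hz => by
    rw [hf.eq_zero hz, map_zero]

lemma IsTest.clm_const {f : Plane → V} (hf : IsTest D f) (hD : IsOpen D) (L : V ⊸ W) :
    IsTest D fun z => L (f z) := hf.clm_apply hD contDiffOn_const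

lemma IsTest.smul_const {θ : Plane → ℝ} (hθ : IsTest D θ) (hD : IsOpen D) (v : V) :
    IsTest D fun z => θ z • v := by
  simpa using hθ.clm_const hD (ContinuousLinearMap.toSpanSingleton ℝ v)

lemma IsTest.add {f g : Plane → V} (hf : IsTest D f) (hg : IsTest D g) : IsTest D (f + g) :=
  ⟨hf.1.add hg.1, hf.2.1.add hg.2.1, (tsupport_add f g).trans (Set.union_subset hf.2.2 hg.2.2)⟩

lemma IsTest.prodMk {f : Plane → V} {g : Plane → W} (hf : IsTest D f) (hg : IsTest D g)
    (hD : IsOpen D) : IsTest D fun z => (f z, g z) := by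
  have := (hf.clm_const hD (inl ℝ V W)).add (hg.clm_const hD (inr ℝ V W))
  convert this using 2
  simp

lemma IsTest.pdv {f : Plane → V} (hf : IsTest D f) (hD : IsOpen D) (μ : Fin 2) :
    IsTest D (pdv μ f) :=
  isTest_on hD hf.2.1 hf.2.2 (contDiff_pdv hf.1 μ).contDiffOn fun _ hz => pdv_eq_zero_of_notMem hz μ

lemma IsTest.integrableOn {f : Plane → ℝ} (hf : IsTest D f) : IntegrableOn f D :=
  (hf.1.continuous.integrable_of_hasCompactSupport hf.2.1).integrableOn

lemma pdv_comm {f : Plane → V} (hD : IsOpen D) (hf : C∞ f D) {z : Plane}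
    (hz : z ∈ D) (μ ν : Fin 2) : pdv μ (pdv ν f) z = pdv ν (pdv μ f) z := by
  have h1 := hf.contDiffAt (hD.mem_nhds hz)
  have hs := h1.isSymmSndFDerivAt (by
    rw [minSmoothness_of_isRCLikeNormedField]; exact WithTop.coe_le_coe.2 (le_top : (2 : ℕ∞) ≤ ⊤))
  have hd := (hf.smooth_fderiv hD).fderivAt hD hz
  have e : ∀ μ ν : Fin 2, GaugedSigma.pdv μ (GaugedSigma.pdv ν f) z =
      𝒟 (𝒟 f) z (single μ 1) (single ν 1) := by
    intro μ ν
    have := (hd.clm_apply (hasFDerivAt_const (single ν (1 : ℝ) : Plane) z)).fderiv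
    have h2 : GaugedSigma.pdv μ (GaugedSigma.pdv ν f) z = 𝒟 (fun y => 𝒟 f y
      (single ν 1)) z (single μ 1) := rfl
    rw [h2, this]
    simp
  rw [e, e, hs]

/-- The integral of the exterior derivative of the 1-form `β(dX)` vanishes. -/
lemma integral_curl_eq_zero (hD : IsOpen D) {X : Plane → V} (hX : C∞ X D)
    {β : Plane → V ⊸ ℝ} (hβ : IsTest D β) :
    ∫ z in D, (pdv 0 β z (pdv 1 X z) - pdv 1 β z (pdv 0 X z)) = 0 := by
  have ht : ∀ μ, IsTest D fun z => β z (pdv μ X z) := fun μ =>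
    isTest_on hD hβ.2.1 hβ.2.2 (hβ.1.contDiffOn.clm_apply (smooth_pdv hD hX μ))
      fun z hz => by rw [hβ.eq_zero hz]; rfl
  have e : ∀ z ∈ D, ∀ μ ν, pdv μ (fun z => β z (pdv ν X z)) z =
      pdv μ β z (pdv ν X z) + β z (pdv μ (pdv ν X) z) := by
    intro z hz μ ν
    have h1 := hβ.1.contDiffOn.fderivAt hD hz
    have h2 := (smooth_pdv hD hX ν).fderivAt hD hz
    have := (h1.clm_apply h2).fderiv
    rw [show pdv μ (fun z => β z (pdv ν X z)) z = 𝒟 (fun z => β z (pdv ν X z)) z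
      (single μ 1) from rfl, this]
    simp [pdv, add_comm]
  have h0 := integral_pdv_eq_zero (ht 1) 0
  have h1 := integral_pdv_eq_zero (ht 0) 1
  have : ∫ z in D, (pdv 0 (fun z => β z (pdv 1 X z)) z - pdv 1 (fun z => β z (pdv 0 X z)) z) = 0 := by
    rw [integral_sub ((ht 1).pdv hD 0).integrableOn ((ht 0).pdv hD 1).integrableOn, h0, h1, sub_zero]
  rw [← this]
  refine integral_congr_on hD fun z hz => ?_
  simp only [e z hz, pdv_comm hD hX hz 0 1]
  ring

/-- A 1-form whose divergence pairing with test functions vanishes has the strong divergence. -/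
lemma eq_of_integral_weak (hD : IsOpen D) {a : Plane → ℝ} {b : Fin 2 → Plane → ℝ}
    (ha : C∞ a D) (hb : ∀ μ, C∞ (b μ) D)
    (h : ∀ θ : Plane → ℝ, IsTest D θ →
      ∫ z in D, (a z * θ z + b 0 z * pdv 0 θ z + b 1 z * pdv 1 θ z) = 0) :
    ∀ z ∈ D, a z = pdv 0 (b 0) z + pdv 1 (b 1) z := by
  have hg := ha.sub ((smooth_pdv hD (hb 0) 0).add (smooth_pdv hD (hb 1) 1))
  intro z hz
  refine sub_eq_zero.1 (eq_zero_of_integral_smul_eq_zero hD hg.continuousOn (fun θ hθ => ?_) z hz)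
  have ht : ∀ μ, IsTest D fun z => b μ z * θ z := fun μ =>
    isTest_on hD hθ.2.1 hθ.2.2 ((hb μ).mul hθ.1.contDiffOn)
      fun z hz => by rw [hθ.eq_zero hz, mul_zero]
  have e : ∀ z ∈ D, ∀ μ, pdv μ (fun z => b μ z * θ z) z =
      pdv μ (b μ) z * θ z + b μ z * pdv μ θ z := by
    intro z hz μ
    have h1 := (hb μ).fderivAt hD hz
    have h2 := hθ.1.contDiffOn.fderivAt hD hz
    have := (h1.mul h2).fderiv
    rw [show pdv μ (fun z => b μ z * θ z) z = 𝒟 (b μ * θ) z (single μ 1) from rfl, this]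
    simp [pdv, add_comm, mul_comm]
  have i0 := ((ht 0).pdv hD 0).integrableOn
  have i1 := ((ht 1).pdv hD 1).integrableOn
  have hw : IntegrableOn (fun z => a z * θ z + b 0 z * pdv 0 θ z + b 1 z * pdv 1 θ z) D := by
    refine (isTest_on hD hθ.2.1 hθ.2.2 (((ha.mul hθ.1.contDiffOn).add
      ((hb 0).mul (contDiff_pdv hθ.1 0).contDiffOn)).add
      ((hb 1).mul (contDiff_pdv hθ.1 1).contDiffOn)) fun z hz => ?_).integrableOn
    rw [hθ.eq_zero hz, pdv_eq_zero_of_notMem hz, pdv_eq_zero_of_notMem hz]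
    ring
  have i01 : IntegrableOn (fun z => pdv 0 (fun z => b 0 z * θ z) z
      + pdv 1 (fun z => b 1 z * θ z) z) D := i0.add i1
  have key : ∫ z in D, ((a z * θ z + b 0 z * pdv 0 θ z + b 1 z * pdv 1 θ z)
      - (pdv 0 (fun z => b 0 z * θ z) z + pdv 1 (fun z => b 1 z * θ z) z)) = 0 := by
    rw [integral_sub hw i01, h θ hθ, integral_add i0 i1, integral_pdv_eq_zero (ht 0),
      integral_pdv_eq_zero (ht 1)]
    simp
  rw [← key]
  refine integral_congr_on hD fun z hz => ?_
  simp only [e z hz]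
  ring

end Test

namespace Geo

/-- Smooth configurations over `D`. -/
structure IsField (m : Geo V W) (D : Set Plane) (X : Plane → V) (A : Plane → W × W) : Prop where
  smooth_X : C∞ X D
  smooth_A : C∞ A D
  mapsTo : MapsTo X D m.dom

/-- The first variation vanishes for all compactly supported variations. -/
def IsStationary (m : Geo V W) (κ : Plane → Conf) (D : Set Plane) (X : Plane → V)
    (A : Plane → W × W) : Prop :=
  ∀ ξ δ, IsTest D ξ → IsTest D δ → ∫ z in D, m.firstVar κ X A ξ δ z = 0

/-- The gauge variation of `A`. -/
def gaugeVarA (m : Geo V W) (κ : Plane → Conf) (X : Plane → V) (A : Plane → W × W) (ε : Plane → W)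
    (z : Plane) : W × W :=
  m.gaugeA (κ z) (X z) (grad X z) (A z) (ε z) (grad ε z)

variable {m : Geo V W} {s : ℝ} {D : Set Plane} {κ : Plane → Conf} {X : Plane → V}
  {A : Plane → W × W}

lemma IsSmooth.grad_R (h : m.IsSmooth) (hD : IsOpen D) (hf : m.IsField D X A) {ε : Plane → W}
    (hε : C∞ ε D) {z : Plane} (hz : z ∈ D) :
    grad (fun z => m.R (X z) (ε z)) z = m.gaugeP (X z) (grad X z) (ε z) (grad ε z) := by
  have h1 := hf.smooth_X.fderivAt hD hz
  have h2 := hε.fderivAt hD hz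
  have h0 := (h.differentiableAt_R (hf.mapsTo hz)).hasFDerivAt
  have h3 := HasFDerivAt.comp z h0 h1
  have := (h3.clm_apply h2).fderiv
  simp only [Function.comp_def] at this
  simp only [grad, pdv, gaugeP, this]
  simp [add_comm]

/-- The gauged functional is gauge invariant. -/
lemma IsGauged.integral_gauge (h : m.IsGauged s) (hκ : IsConf s D κ) (hf : m.IsField D X A)
    {ε : Plane → W} (hε : IsTest D ε) :
    ∫ z in D, m.firstVar κ X A (fun z => m.R (X z) (ε z)) (m.gaugeVarA κ X A ε) z = 0 := by
  have hs := h.toIsSmooth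
  have hD := hκ.isOpen
  have hB := hs.smooth_B.comp hf.smooth_X hf.mapsTo
  have hR := hs.smooth_R.comp hf.smooth_X hf.mapsTo
  have hA := hs.smooth_Al.comp hf.smooth_X hf.mapsTo
  have hβ : IsTest D fun z => m.B (X z) (m.R (X z) (ε z)) + m.Al (X z) (ε z) :=
    ((hε.clm_apply hD hR).clm_apply hD hB).add (hε.clm_apply hD hA)
  rw [← integral_curl_eq_zero hD hf.smooth_X hβ]
  refine integral_congr_on hD fun z hz => ?_
  have hx := hf.mapsTo hz
  have hXd := hf.smooth_X.fderivAt hD hz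
  have hεd := hε.1.contDiffOn.fderivAt hD hz
  have hB0 := (hs.differentiableAt_B hx).hasFDerivAt
  have hBd := HasFDerivAt.comp (g := m.B) z hB0 hXd
  have hR0 := (hs.differentiableAt_R hx).hasFDerivAt
  have hRd := HasFDerivAt.comp z hR0 hXd
  have hA0 := (hs.differentiableAt_Al hx).hasFDerivAt
  have hAd := HasFDerivAt.comp (g := m.Al) z hA0 hXd
  have hd := ((hBd.clm_apply (hRd.clm_apply hεd)).add (hAd.clm_apply hεd)).fderiv
  have e : ∀ μ, pdv μ (fun z => m.B (X z) (m.R (X z) (ε z)) + m.Al (X z) (ε z)) z =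
      𝒟 m.B (X z) (pdv μ X z) (m.R (X z) (ε z))
        + m.B (X z) (𝒟 m.R (X z) (pdv μ X z) (ε z) + m.R (X z) (pdv μ ε z))
        + 𝒟 m.Al (X z) (pdv μ X z) (ε z) + m.Al (X z) (pdv μ ε z) := by
    intro μ
    have : pdv μ (fun z => m.B (X z) (m.R (X z) (ε z)) + m.Al (X z) (ε z)) z = 
      𝒟 ((fun y => (m.B ∘ X) y ((m.R ∘ X) y (ε y))) + fun y => (m.Al ∘ X) y (ε y)) z
        (single μ 1) := rfl
    rw [this, hd]
    simp [pdv]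
    abel
  simp only [firstVar, gaugeVarA, hs.grad_R hD hf hε.1.contDiffOn hz]
  rw [h.dlag_gauge hx _ (hκ.det z hz), e, e]
  simp [grad]

/-- The Lagrangian density does not depend on `A` in the directions killed by `ρ` and `α`. -/
lemma dlag_add_of_ker {k : Conf} {x : V} {u : V × V} {A : W × W} {ξ : V} {p : V × V}
    {δ z : W × W} (h1 : m.R x z.1 = 0) (h2 : m.R x z.2 = 0) (h3 : m.Al x z.1 = 0)
    (h4 : m.Al x z.2 = 0) : m.dlag k x u A ξ p (δ + z) = m.dlag k x u A ξ p δ := by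
  simp [dlag, dcov, h1, h2, h3, h4]

end Geo

section Smoothness

variable {Z : Type*} [NormedAddCommGroup Z] [NormedSpace ℝ Z] {S : Set Z} {m : Geo V W} {s : ℝ}
  (r : Reduction m s) {k : Z → Conf} (h0 : SmoothConf S k)
include h0

lemma smooth_star {v : Z → V × V} (hv : C∞ v S) : C∞ (fun z => (k z).star (v z)) S :=
  (((h0.c01.smul hv.fst).add (h0.c11.smul hv.snd)).neg).prodMk
    ((h0.c00.smul hv.fst).add (h0.c01.smul hv.snd))

namespace Reduction

lemma smooth_wc {x : Z → V} {u : Z → V × V} (hx : C∞ x S) (hu : C∞ u S) (hm : MapsTo x S m.dom) :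
    C∞ (fun z => r.wc (k z) (x z) (u z)) S := by
  have hN := r.smooth_N.comp hx hm
  have hM := r.smooth_M.comp hx hm
  exact ((hN.clm_apply hu.fst).prodMk (hN.clm_apply hu.snd)).add
    (smooth_star h0 ((hM.clm_apply hu.fst).prodMk (hM.clm_apply hu.snd)))

lemma smooth_onshell {x : Z → V} {u : Z → V × V} (hx : C∞ x S)
    (hu : C∞ u S) (hm : MapsTo x S m.dom) :
    C∞ (fun z => r.onshell (k z) (x z) (u z)) S := by
  have hR := r.smooth_Rp.comp hx hm
  have hw := r.smooth_wc h0 hx hu hm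
  exact (hR.clm_apply (hu.fst.sub hw.fst)).prodMk (hR.clm_apply (hu.snd.sub hw.snd))

lemma smooth_dev (h : m.IsSmooth) {x : Z → V} {u : Z → V × V} {A : Z → W × W} (hx : C∞ x S)
    (hu : C∞ u S) (hA : C∞ A S) (hm : MapsTo x S m.dom) :
    C∞ (fun z => r.dev (k z) (x z) (u z) (A z)) S :=
  (h.smooth_cov hx hu hA hm).sub (r.smooth_wc h0 hx hu hm)

omit r h0 in
lemma _root_.GaugedSigma.Geo.IsSmooth.smooth_fderiv (h : m.IsSmooth) {F : Type*}
    [NormedAddCommGroup F] [NormedSpace ℝ F] {f : V → F} (hf : C∞ f m.dom) {x ξ : Z → V}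
    (hx : C∞ x S) (hξ : C∞ ξ S) (hm : MapsTo x S m.dom) :
    C∞ (fun z => 𝒟 f (x z) (ξ z)) S :=
  ((hf.smooth_fderiv h.isOpen_dom).comp hx hm).clm_apply hξ

lemma smooth_ddev (h : m.IsSmooth) {x ξ : Z → V} {u p : Z → V × V} {A δ : Z → W × W}
    (hx : C∞ x S) (hu : C∞ u S) (hA : C∞ A S)
    (hξ : C∞ ξ S) (hp : C∞ p S) (hδ : C∞ δ S)
    (hm : MapsTo x S m.dom) :
    C∞ (fun z => r.ddev (k z) (x z) (u z) (A z) (ξ z) (p z) (δ z)) S := by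
  have hR := h.smooth_R.comp hx hm
  have hN := r.smooth_N.comp hx hm
  have hM := r.smooth_M.comp hx hm
  have dR := h.smooth_fderiv h.smooth_R hx hξ hm
  have dN := h.smooth_fderiv r.smooth_N hx hξ hm
  have dM := h.smooth_fderiv r.smooth_M hx hξ hm
  refine ContDiffOn.sub ?_ (ContDiffOn.add ?_ (smooth_star h0 ?_))
  · exact (hp.fst.sub ((dR.clm_apply hA.fst).add (hR.clm_apply hδ.fst))).prodMk
      (hp.snd.sub ((dR.clm_apply hA.snd).add (hR.clm_apply hδ.snd)))
  · exact ((dN.clm_apply hu.fst).add (hN.clm_apply hp.fst)).prodMk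
      ((dN.clm_apply hu.snd).add (hN.clm_apply hp.snd))
  · exact ((dM.clm_apply hu.fst).add (hM.clm_apply hp.fst)).prodMk
      ((dM.clm_apply hu.snd).add (hM.clm_apply hp.snd))

lemma smooth_pf (h : m.IsSmooth) {x : Z → V} {y z : Z → V × V} (hx : C∞ x S)
    (hy : C∞ y S) (hz : C∞ z S) (hm : MapsTo x S m.dom) :
    C∞ (fun q => r.pf (k q) (x q) (y q) (z q)) S := by
  have hb := (r.smooth_bb h).comp hx hm
  exact (Geo.smooth_kin h0 (h.smooth_G.comp hx hm) hy hz).add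
    ((hb.clm₂ hy.fst hz.snd).sub (hb.clm₂ hy.snd hz.fst))

end Reduction

lemma smooth_dslag {U : Set V} (hU : IsOpen U) {g b : V → V ⊸ V ⊸ ℝ}
    (hg : C∞ g U) (hb : C∞ b U) {x ξ : Z → V} {u p : Z → V × V}
    (hx : C∞ x S) (hξ : C∞ ξ S) (hu : C∞ u S)
    (hp : C∞ p S) (hm : MapsTo x S U) :
    C∞ (fun z => dslag (k z) g b (x z) (ξ z) (u z) (p z)) S := by
  have hB := hb.comp hx hm
  have hG := hg.comp hx hm
  have dG := ((hg.smooth_fderiv hU).comp hx hm).clm_apply hξ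
  have dB := ((hb.smooth_fderiv hU).comp hx hm).clm_apply hξ
  have hh : ∀ {c : Z → V ⊸ V ⊸ ℝ} {v w : Z → V}, C∞ c S → C∞ v S →
      C∞ w S → C∞ (fun z => c z (v z) (w z)) S :=
    fun hc hv hw => hc.clm₂ hv hw
  refine (contDiffOn_const.mul (((Geo.smooth_kin h0 dG hu hu).add
    (Geo.smooth_kin h0 hG hp hu)).add (Geo.smooth_kin h0 hG hu hp))).add
    (contDiffOn_const.mul ((((hh dB hu.fst hu.snd).add (hh hB hp.fst hu.snd)).add
      (hh hB hu.fst hp.snd)).sub (((hh dB hu.snd hu.fst).add (hh hB hp.snd hu.fst)).add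
      (hh hB hu.snd hp.fst))))

end Smoothness

namespace Reduction

variable {m : Geo V W} {s : ℝ} (r : Reduction m s) {D : Set Plane} {κ : Plane → Conf}
  {X : Plane → V} {A : Plane → W × W}

lemma pf_symm (h : m.IsGauged s) {x : V} (hx : x ∈ m.dom) (k : Conf) (y z : V × V) :
    r.pf k x y z = r.pf k x z y := by
  rw [pf, pf, kin_symm h hx, r.bb_antisymm h hx y.1, r.bb_antisymm h hx y.2]
  ring

/-- Solutions are the configurations whose gauge field satisfies its algebraic equation of motion
and whose first component is stationary for the reduced functional. -/
lemma isStationary_iff (h : m.IsGauged s) (hκ : IsConf s D κ) (hf : m.IsField D X A) :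
    m.IsStationary κ D X A ↔ (∀ z ∈ D, r.dev (κ z) (X z) (grad X z) (A z) = 0) ∧ ∀ ξ, IsTest D ξ →
        ∫ z in D, dslag (κ z) r.gq r.bt (X z) (ξ z) (grad X z) (grad ξ z) = 0 := by
  have hD := hκ.isOpen
  have hs := h.toIsSmooth
  have hg := smooth_grad hD hf.smooth_X
  constructor
  · intro H
    have hdev : ∀ z ∈ D, r.dev (κ z) (X z) (grad X z) (A z) = 0 := by
      intro z hz
      have ht := r.t_dev (hf.mapsTo hz) (κ z) (grad X z) (A z)
      refine r.eq_zero_of_pf h (hf.mapsTo hz) (hκ.det z hz) ht.1 ht.2 fun η => ?_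
      have hc : C∞ (fun z => r.pf (κ z) (X z) (m.R (X z) η.1, m.R (X z) η.2)
          (r.dev (κ z) (X z) (grad X z) (A z))) D := by
        have hR := hs.smooth_R.comp hf.smooth_X hf.mapsTo
        exact r.smooth_pf hκ.smooth hs hf.smooth_X
          ((hR.clm_apply contDiffOn_const).prodMk (hR.clm_apply contDiffOn_const))
          (r.smooth_dev hκ.smooth hs hf.smooth_X hg hf.smooth_A hf.mapsTo) hf.mapsTo
      refine eq_zero_of_integral_smul_eq_zero hD hc.continuousOn (fun θ hθ => ?_) z hz
      have := H 0 (fun z => θ z • (-η)) isTest_zero (hθ.smul_const hD _)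
      rw [← this]
      refine integral_congr_on hD fun z hz => ?_
      have hx := hf.mapsTo hz
      have g0 : grad (0 : Plane → V) z = 0 := by simp [grad, pdv]
      simp only [Geo.firstVar, Pi.zero_apply, g0]
      rw [r.dlag_eq h hx _ (hκ.det z hz), dslag_bb r h hx, r.pf_symm h hx]
      simp [dslag, slag, Conf.kin, ddev, Geo.dcov, dwc, Conf.star, pf]
      ring
    refine ⟨hdev, fun ξ hξ => ?_⟩
    rw [← H ξ 0 hξ isTest_zero]
    refine integral_congr_on hD fun z hz => ?_
    simp only [Geo.firstVar]
    rw [r.dlag_eq h (hf.mapsTo hz) _ (hκ.det z hz), hdev z hz, dslag_zero, add_zero]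
  · rintro ⟨H1, H2⟩ ξ δ hξ hδ
    rw [← H2 ξ hξ]
    refine integral_congr_on hD fun z hz => ?_
    simp only [Geo.firstVar]
    rw [r.dlag_eq h (hf.mapsTo hz) _ (hκ.det z hz), H1 z hz, dslag_zero, add_zero]

end Reduction

/-! ### Gauge equivalence of solutions over the same leaf -/

section Families

variable {F : Type*} [NormedAddCommGroup F] [NormedSpace ℝ F] {Ω : Set (ℝ × Plane)}

lemma hasDerivAt_family (hΩ : IsOpen Ω) {f : ℝ × Plane → F} (hf : C∞ f Ω)
    {s : ℝ} {z : Plane} (hq : (s, z) ∈ Ω) :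
    HasDerivAt (fun s => f (s, z)) (𝒟 f (s, z) (1, 0)) s := by
  have h1 := hf.fderivAt hΩ hq
  have h2 := (hasDerivAt_id s).prodMk (hasDerivAt_const s z)
  exact h1.comp_hasDerivAt s h2

lemma pdv_family (hΩ : IsOpen Ω) {f : ℝ × Plane → F} (hf : C∞ f Ω)
    {s : ℝ} {z : Plane} (hq : (s, z) ∈ Ω) (μ : Fin 2) :
    pdv μ (fun z => f (s, z)) z = 𝒟 f (s, z) (0, single μ 1) := by
  have h1 := hf.fderivAt hΩ hq
  have h2 : HasFDerivAt (fun z : Plane => (s, z)) (inr ℝ ℝ Plane) z := hasFDerivAt_prodMk_right s z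
  have h3 := (h1.comp z h2).fderiv
  rw [pdv, show (fun z => f (s, z)) = f ∘ fun z => (s, z) from rfl, h3]
  simp

lemma smooth_family_fderiv (hΩ : IsOpen Ω) {f : ℝ × Plane → F} (hf : C∞ f Ω)
    (v : ℝ × Plane) : C∞ (fun q => 𝒟 f q v) Ω :=
  (hf.smooth_fderiv hΩ).clm_apply contDiffOn_const

lemma smooth_grad_family (hΩ : IsOpen Ω) {f : ℝ × Plane → F} (hf : C∞ f Ω) :
    C∞ (fun q : ℝ × Plane => grad (fun z => f (q.1, z)) q.2) Ω :=
  ((smooth_family_fderiv hΩ hf (0, single 0 1)).prodMk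
    (smooth_family_fderiv hΩ hf (0, single 1 1))).congr fun q hq => by
      simp only [grad, pdv_family hΩ hf (show (q.1, q.2) ∈ Ω from hq)]

/-- The derivative of the jet of a family is the jet of the derivative. -/
lemma hasDerivAt_grad_family (hΩ : IsOpen Ω) {f : ℝ × Plane → F} (hf : C∞ f Ω)
    {s : ℝ} {z : Plane} (hq : (s, z) ∈ Ω) :
    HasDerivAt (fun s => grad (fun z => f (s, z)) z) (grad (fun z => 𝒟 f (s, z) (1, 0)) z) s := by
  have h1 := hf.contDiffAt (hΩ.mem_nhds hq)
  have hs := h1.isSymmSndFDerivAt (by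
    rw [minSmoothness_of_isRCLikeNormedField]; exact WithTop.coe_le_coe.2 (le_top : (2 : ℕ∞) ≤ ⊤))
  have hd := (hf.smooth_fderiv hΩ).fderivAt hΩ hq
  have e : ∀ v w, 𝒟 (fun q => 𝒟 f q w) (s, z) v = 𝒟 (𝒟 f) (s, z) v w := by
    intro v w
    have := (hd.app w).fderiv
    rw [this]
    simp
  have h2 := fun v => hasDerivAt_family hΩ (smooth_family_fderiv hΩ hf v) hq
  have hev := (Continuous.prodMk_left z).continuousAt.preimage_mem_nhds (hΩ.mem_nhds hq)
  refine (((h2 (0, single 0 1)).prodMk (h2 (0, single 1 1))).congr_of_eventuallyEq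
    (by filter_upwards [hev] with s' hs'; simp only [grad, pdv_family hΩ hf hs'])).congr_deriv ?_
  simp only [grad, pdv_family hΩ (smooth_family_fderiv hΩ hf (1, 0)) hq, e]
  exact Prod.ext (hs _ _) (hs _ _)

end Families

namespace Geo

variable {Z : Type*} [NormedAddCommGroup Z] [NormedSpace ℝ Z] {S : Set Z} {m : Geo V W} {s : ℝ}

lemma IsGauged.smooth_gaugeA (h : m.IsGauged s) {k : Z → Conf} (h0 : SmoothConf S k)
    {x : Z → V} {u : Z → V × V} {A : Z → W × W} {ε : Z → W} {e : Z → W × W}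
    (hx : C∞ x S) (hu : C∞ u S) (hA : C∞ A S)
    (hε : C∞ ε S) (he : C∞ e S) (hm : MapsTo x S m.dom) :
    C∞ (fun z => m.gaugeA (k z) (x z) (u z) (A z) (ε z) (e z)) S := by
  have hw := h.toIsSmooth.smooth_cov hx hu hA hm
  have hsw := smooth_star h0 hw
  have hC := h.smooth_C.comp hx hm
  have hO := h.smooth_Om.comp hx hm
  have hP := h.smooth_Ph.comp hx hm
  exact (((he.fst.add (hC.clm₂ hA.fst hε)).add (hO.clm₂ hw.fst hε)).add (hP.clm₂ hsw.fst hε)).prodMk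
    (((he.snd.add (hC.clm₂ hA.snd hε)).add (hO.clm₂ hw.snd hε)).add (hP.clm₂ hsw.snd hε))

end Geo

namespace Reduction

variable {m : Geo V W} {s : ℝ} (r : Reduction m s) {D : Set Plane} {κ : Plane → Conf}
  {X X' : Plane → V} {A A' : Plane → W × W}

/-- The component of a pair of vectors in the kernel of the anchor. -/
def kerPart (x : V) (a : W × W) : W × W := (a.1 - r.Rp x (m.R x a.1), a.2 - r.Rp x (m.R x a.2))

lemma R_kerPart {x : V} (hx : x ∈ m.dom) (a : W × W) :
    m.R x (r.kerPart x a).1 = 0 ∧ m.R x (r.kerPart x a).2 = 0 := by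
  simp [kerPart, r.R_Rp x hx, r.t_R x hx]

lemma smooth_kerPart {Z : Type*} [NormedAddCommGroup Z] [NormedSpace ℝ Z] {S : Set Z}
    (h : m.IsSmooth) {x : Z → V} {a : Z → W × W} (hx : C∞ x S)
    (ha : C∞ a S) (hm : MapsTo x S m.dom) :
    C∞ (fun z => r.kerPart (x z) (a z)) S := by
  have hR := h.smooth_R.comp hx hm
  have hRp := r.smooth_Rp.comp hx hm
  exact (ha.fst.sub (hRp.clm_apply (hR.clm_apply ha.fst))).prodMk
    (ha.snd.sub (hRp.clm_apply (hR.clm_apply ha.snd)))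

lemma dev_onshell_add_kerPart {x : V} (hx : x ∈ m.dom) (k : Conf) (u : V × V) (a : W × W) :
    r.dev k x u (r.onshell k x u + r.kerPart x a) = 0 := by
  have := r.dev_sub (x := x) k u (r.onshell k x u) (-r.kerPart x a)
  rw [sub_neg_eq_add, r.dev_onshell hx] at this
  rw [this]
  simp [r.R_kerPart hx a]

/-- On shell, a gauge field is determined up to the kernel of the anchor. -/
lemma onshell_add_kerPart {x : V} {k : Conf} {u : V × V} {a : W × W} (ha : r.dev k x u a = 0) :
    r.onshell k x u + r.kerPart x a = a := by
  have h1 : u.1 - (r.wc k x u).1 = m.R x a.1 := by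
    have := congrArg Prod.fst ha
    simp only [dev, Geo.cov, Prod.fst_sub, Prod.fst_zero] at this
    rw [sub_eq_zero] at this
    rw [← this]; abel
  have h2 : u.2 - (r.wc k x u).2 = m.R x a.2 := by
    have := congrArg Prod.snd ha
    simp only [dev, Geo.cov, Prod.snd_sub, Prod.snd_zero] at this
    rw [sub_eq_zero] at this
    rw [← this]; abel
  ext <;> simp [onshell, kerPart, h1, h2]

lemma R_eq_of_ddev_eq {x : V} {k : Conf} {u : V × V} {a : W × W} {ξ : V} {p : V × V}
    {δ δ' : W × W} (hd : r.ddev k x u a ξ p δ = r.ddev k x u a ξ p δ') :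
    m.R x (δ - δ').1 = 0 ∧ m.R x (δ - δ').2 = 0 := by
  have h1 := congrArg Prod.fst hd
  have h2 := congrArg Prod.snd hd
  simp only [ddev, Geo.dcov, Prod.fst_sub, Prod.snd_sub, sub_left_inj, sub_right_inj,
    add_right_inj] at h1 h2
  simp [h1, h2]

/-- Solutions with the same projection to the leaf space are joined by a path generated by gauge
transformations and translations of `A` along the kernel of the anchor. -/
lemma exists_gauge_path (h : m.IsGauged s) (hκ : IsConf s D κ) (hf : m.IsField D X A)
    (hf' : m.IsField D X' A') (hd : ∀ σ ∈ D, r.dev (κ σ) (X σ) (grad X σ) (A σ) = 0)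
    (hd' : ∀ σ ∈ D, r.dev (κ σ) (X' σ) (grad X' σ) (A' σ) = 0)
    (ht : ∀ σ ∈ D, r.t (X' σ - X σ) = X' σ - X σ)
    (hseg : ∀ σ ∈ D, ∀ τ ∈ Icc (0 : ℝ) 1, X σ + τ • (X' σ - X σ) ∈ m.dom) :
    ∃ (Ω : Set (ℝ × Plane)) (x : ℝ × Plane → V) (a : ℝ × Plane → W × W) (ε : ℝ × Plane → W)
      (z : ℝ × Plane → W × W), IsOpen Ω ∧ Icc 0 1 ×ˢ D ⊆ Ω ∧ C∞ x Ω ∧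
      C∞ a Ω ∧ C∞ ε Ω ∧ C∞ z Ω ∧ MapsTo x Ω m.dom ∧
      (∀ σ ∈ D, x (0, σ) = X σ ∧ a (0, σ) = A σ ∧ x (1, σ) = X' σ ∧ a (1, σ) = A' σ) ∧
      ∀ τ ∈ Icc (0 : ℝ) 1, ∀ σ ∈ D,
        m.R (x (τ, σ)) (z (τ, σ)).1 = 0 ∧ m.R (x (τ, σ)) (z (τ, σ)).2 = 0 ∧
        HasDerivAt (fun τ => x (τ, σ)) (m.R (x (τ, σ)) (ε (τ, σ))) τ ∧
        HasDerivAt (fun τ => a (τ, σ)) (m.gaugeVarA κ (fun σ => x (τ, σ)) (fun σ => a (τ, σ))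
          (fun σ => ε (τ, σ)) σ + z (τ, σ)) τ := by
  have hs := h.toIsSmooth
  have hD := hκ.isOpen
  have hX := hf.smooth_X
  have hX' := hf'.smooth_X
  set x : ℝ × Plane → V := fun q => X q.2 + q.1 • (X' q.2 - X q.2) with hxdef
  have hS : IsOpen (cyl D) := hD.preimage continuous_snd
  have hx0 := (smooth_snd hX).add (contDiffOn_fst.smul ((smooth_snd hX').sub (smooth_snd hX)))
  set Ω : Set (ℝ × Plane) := cyl D ∩ x ⁻¹' m.dom
  have hΩ : IsOpen Ω := hx0.continuousOn.isOpen_inter_preimage hS h.isOpen_dom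
  have hΩD : Ω ⊆ cyl D := Set.inter_subset_left
  have hx : C∞ x Ω := hx0.mono hΩD
  have hm : MapsTo x Ω m.dom := fun q hq => hq.2
  have k0 := hκ.smooth.snd.mono hΩD
  have hu := smooth_grad_family hΩ hx
  set u : ℝ × Plane → V × V := fun q => grad (fun σ => x (q.1, σ)) q.2 with hudef
  set b : ℝ × Plane → W × W := fun q => A q.2 + q.1 • (A' q.2 - A q.2) with hbdef
  have hb : C∞ b Ω := ((smooth_snd hf.smooth_A).add
    (contDiffOn_fst.smul ((smooth_snd hf'.smooth_A).sub (smooth_snd hf.smooth_A)))).mono hΩD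
  set a : ℝ × Plane → W × W := fun q =>
    r.onshell (κ q.2) (x q) (u q) + r.kerPart (x q) (b q) with hadef
  have ha : C∞ a Ω := (r.smooth_onshell k0 hx hu hm).add (r.smooth_kerPart hs hx hb hm)
  set ε : ℝ × Plane → W := fun q => r.Rp (x q) (X' q.2 - X q.2) with hεdef
  have hε : C∞ ε Ω := (r.smooth_Rp.comp hx hm).clm_apply
    (((smooth_snd hX').sub (smooth_snd hX)).mono hΩD)
  set e : ℝ × Plane → W × W := fun q => grad (fun σ => ε (q.1, σ)) q.2 with hedef
  have he : C∞ e Ω := smooth_grad_family hΩ hε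
  set z : ℝ × Plane → W × W := fun q => 𝒟 a q (1, 0) -
    m.gaugeA (κ q.2) (x q) (u q) (a q) (ε q) (e q) with hzdef
  have hz : C∞ z Ω := (smooth_family_fderiv hΩ ha (1, 0)).sub (h.smooth_gaugeA k0 hx hu ha hε he hm)
  refine ⟨Ω, x, a, ε, z, hΩ, fun q hq => ⟨hq.2, hseg _ hq.2 _ hq.1⟩, hx, ha, hε, hz, hm, ?_, ?_⟩
  · intro σ hσ
    have g0 : u (0, σ) = grad X σ := by simp [hudef, hxdef]
    have g1 : u (1, σ) = grad X' σ := by simp [hudef, hxdef]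
    have x0 : x (0, σ) = X σ := by simp [hxdef]
    have x1 : x (1, σ) = X' σ := by simp [hxdef]
    have b0 : b (0, σ) = A σ := by simp [hbdef]
    have b1 : b (1, σ) = A' σ := by simp [hbdef]
    refine ⟨x0, ?_, x1, ?_⟩
    · simp only [hadef, g0, x0, b0]
      exact r.onshell_add_kerPart (hd σ hσ)
    · simp only [hadef, g1, x1, b1]
      exact r.onshell_add_kerPart (hd' σ hσ)
  · intro τ hτ σ hσ
    have hq : (τ, σ) ∈ Ω := ⟨hσ, hseg _ hσ _ hτ⟩
    have hxq := hm hq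
    have hRε : m.R (x (τ, σ)) (ε (τ, σ)) = X' σ - X σ := by
      simp only [hεdef]
      rw [r.R_Rp _ hxq, ht σ hσ]
    have dx : HasDerivAt (fun τ => x (τ, σ)) (X' σ - X σ) τ := by
      simpa [hxdef] using ((hasDerivAt_id τ).smul_const (X' σ - X σ)).const_add (X σ)
    have da := hasDerivAt_family hΩ ha hq
    have du := hasDerivAt_grad_family hΩ hx hq
    have hD' := hD.mem_nhds hσ
    -- the fields at fixed `τ`
    have hfτ : m.IsField D (fun σ => x (τ, σ)) (fun σ => a (τ, σ)) :=
      ⟨hx.comp (contDiffOn_const.prodMk contDiffOn_id) fun σ' hσ' => ⟨hσ', hseg _ hσ' _ hτ⟩,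
        ha.comp (contDiffOn_const.prodMk contDiffOn_id) fun σ' hσ' => ⟨hσ', hseg _ hσ' _ hτ⟩,
        fun σ' hσ' => hseg _ hσ' _ hτ⟩
    have hετ : C∞ (fun σ => ε (τ, σ)) D :=
      hε.comp (contDiffOn_const.prodMk contDiffOn_id) fun σ' hσ' => ⟨hσ', hseg _ hσ' _ hτ⟩
    have hp : grad (fun σ => 𝒟 x (τ, σ) (1, 0)) σ =
        m.gaugeP (x (τ, σ)) (u (τ, σ)) (ε (τ, σ)) (e (τ, σ)) := by
      rw [← hs.grad_R hD hfτ hετ hσ]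
      have : (fun σ => 𝒟 x (τ, σ) (1, 0)) =ᶠ[𝓝 σ] fun σ => m.R (x (τ, σ)) (ε (τ, σ)) := by
        filter_upwards [hD'] with σ' hσ'
        have hq' : (τ, σ') ∈ Ω := ⟨hσ', hseg _ hσ' _ hτ⟩
        have d1 : HasDerivAt (fun τ => x (τ, σ')) (X' σ' - X σ') τ := by
          simpa [hxdef] using ((hasDerivAt_id τ).smul_const (X' σ' - X σ')).const_add (X σ')
        rw [(hasDerivAt_family hΩ hx hq').unique d1]
        simp only [hεdef]
        rw [r.R_Rp _ (hm hq'), ht σ' hσ']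
      simp only [grad, pdv, this.fderiv_eq]
    have hdd := r.hasDerivAt_dev hs (κ σ) dx du da hxq
    have hev := (Continuous.prodMk_left σ).continuousAt.preimage_mem_nhds (hΩ.mem_nhds hq)
    have h0 : r.ddev (κ σ) (x (τ, σ)) (u (τ, σ)) (a (τ, σ)) (X' σ - X σ)
        (grad (fun σ => 𝒟 x (τ, σ) (1, 0)) σ) (𝒟 a (τ, σ) (1, 0)) = 0 := by
      refine hdd.unique ((hasDerivAt_const τ (0 : V × V)).congr_of_eventuallyEq ?_)
      filter_upwards [hev] with τ' hτ'
      exact r.dev_onshell_add_kerPart (hm hτ') (κ σ) (u (τ', σ)) (b (τ', σ))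
    have h1 := r.ddev_gauge h hxq (hκ.det σ hσ)
      (r.dev_onshell_add_kerPart hxq (κ σ) (u (τ, σ)) (b (τ, σ))) (ε (τ, σ)) (e (τ, σ))
    rw [hp, ← hRε] at h0
    have hz0 := r.R_eq_of_ddev_eq (h0.trans h1.symm)
    refine ⟨hz0.1, hz0.2, by rw [hRε]; exact dx, ?_⟩
    refine da.congr_deriv ?_
    simp only [hzdef, Geo.gaugeVarA, hudef, hedef]
    abel

end Reduction

/-! ### Linearized sigma models -/

/-- A smooth symmetric bilinear form `g` and a smooth 2-form `b` on an open set. -/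
structure IsSigma (U : Set V) (g b : V → V ⊸ V ⊸ ℝ) : Prop where
  isOpen : IsOpen U
  smooth_g : C∞ g U
  smooth_b : C∞ b U
  symm : ∀ x ∈ U, ∀ u v, g x u v = g x v u
  antisymm : ∀ x ∈ U, ∀ u v, b x u v = -b x v u

lemma Reduction.isSigma {m : Geo V W} {s : ℝ} (r : Reduction m s) (h : m.IsGauged s) :
    IsSigma m.dom r.gq r.bt :=
  ⟨h.isOpen_dom, r.smooth_gq h.toIsSmooth, r.smooth_bt h.toIsSmooth,
    fun _ hx => r.gq_symm h hx, fun _ hx => r.bt_antisymm h hx⟩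

/-- The Euler-Lagrange form of the variation of the density of a sigma model. -/
def el (k : Conf) (g b : V → V ⊸ V ⊸ ℝ) (x ξ : V) (u p : V × V) : ℝ :=
  1 / 2 * k.kin (𝒟 g x ξ) u u + k.kin (g x) u p + extD b x ξ u.1 u.2

/-- The part of the linearization of `el` which multiplies the undifferentiated variation `v`
of `x`. -/
def jacA (k : Conf) (g b : V → V ⊸ V ⊸ ℝ) (x ξ : V) (u p : V × V) (v : V) : ℝ :=
  1 / 2 * k.kin (𝒟 (𝒟 g) x v ξ) u u + k.kin (𝒟 g x v) u p
    + (𝒟 (𝒟 b) x v ξ u.1 u.2 + 𝒟 (𝒟 b) x v u.1 u.2 ξ + 𝒟 (𝒟 b) x v u.2 ξ u.1)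

/-- The part of the linearization of `el` which multiplies the variation `q` of `u`. -/
def jacB (k : Conf) (g b : V → V ⊸ V ⊸ ℝ) (x ξ : V) (u p : V × V) (q : V × V) : ℝ :=
  k.kin (𝒟 g x ξ) u q + k.kin (g x) q p + extD b x ξ q.1 u.2 + extD b x ξ u.1 q.2

namespace IsSigma

variable {U : Set V} {g b : V → V ⊸ V ⊸ ℝ} (h : IsSigma U g b)
include h

lemma symm_fderiv {x : V} (hx : x ∈ U) (ξ u v : V) : 𝒟 g x ξ u v = 𝒟 g x ξ v u :=
  fderiv_symm h.smooth_g h.isOpen h.symm hx ξ u v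

lemma antisymm_fderiv {x : V} (hx : x ∈ U) (ξ u v : V) : 𝒟 b x ξ u v = -𝒟 b x ξ v u :=
  fderiv_antisymm h.smooth_b h.isOpen h.antisymm hx ξ u v

lemma kin_symm {x : V} (hx : x ∈ U) (k : Conf) (y z : V × V) :
    k.kin (g x) y z = k.kin (g x) z y := by
  simp only [Conf.kin]
  rw [h.symm x hx y.1 z.1, h.symm x hx y.1 z.2, h.symm x hx y.2 z.1, h.symm x hx y.2 z.2]
  ring

lemma kin_fderiv_symm {x : V} (hx : x ∈ U) (k : Conf) (ξ : V) (y z : V × V) :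
    k.kin (𝒟 g x ξ) y z = k.kin (𝒟 g x ξ) z y := by
  simp only [Conf.kin]
  rw [h.symm_fderiv hx ξ y.1 z.1, h.symm_fderiv hx ξ y.1 z.2, h.symm_fderiv hx ξ y.2 z.1,
    h.symm_fderiv hx ξ y.2 z.2]
  ring

section Smooth

variable {Z : Type*} [NormedAddCommGroup Z] [NormedSpace ℝ Z] {S : Set Z} {k : Z → Conf}
  (h0 : SmoothConf S k) {x ξ : Z → V} {u p : Z → V × V}
  (hx : C∞ x S) (hξ : C∞ ξ S) (hu : C∞ u S)
  (hp : C∞ p S) (hm : MapsTo x S U)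
include hx hm

lemma smooth_ext {v w : Z → V} (hξ : C∞ ξ S) (hv : C∞ v S)
    (hw : C∞ w S) : C∞ (fun z => extD b (x z) (ξ z) (v z) (w z)) S := by
  have hB := (h.smooth_b.smooth_fderiv h.isOpen).comp hx hm
  exact (((hB.clm₂ hξ hv).clm_apply hw).add ((hB.clm₂ hv hw).clm_apply hξ)).add
    ((hB.clm₂ hw hξ).clm_apply hv)

include hξ hu hp h0

lemma smooth_el : C∞ (fun z => el (k z) g b (x z) (ξ z) (u z) (p z)) S := by
  have dG := ((h.smooth_g.smooth_fderiv h.isOpen).comp hx hm).clm_apply hξ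
  exact ((contDiffOn_const.mul (Geo.smooth_kin h0 dG hu hu)).add
    (Geo.smooth_kin h0 (h.smooth_g.comp hx hm) hu hp)).add
    (h.smooth_ext hx hm hξ hu.fst hu.snd)

lemma smooth_jacB {q : Z → V × V} (hq : C∞ q S) :
    C∞ (fun z => jacB (k z) g b (x z) (ξ z) (u z) (p z) (q z)) S := by
  have dG := ((h.smooth_g.smooth_fderiv h.isOpen).comp hx hm).clm_apply hξ
  exact (((Geo.smooth_kin h0 dG hu hq).add (Geo.smooth_kin h0 (h.smooth_g.comp hx hm) hq hp)).add
    (h.smooth_ext hx hm hξ hq.fst hu.snd)).add (h.smooth_ext hx hm hξ hu.fst hq.snd)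

lemma smooth_jacA (v : V) : C∞ (fun z => jacA (k z) g b (x z) (ξ z) (u z) (p z) v) S := by
  have G1 := h.smooth_g.smooth_fderiv h.isOpen
  have B1 := h.smooth_b.smooth_fderiv h.isOpen
  have dG := (G1.comp hx hm).clm_apply (contDiffOn_const (c := v))
  have ddG := ((G1.smooth_fderiv h.isOpen).comp hx hm).clm_apply (contDiffOn_const (c := v))
  have ddB := ((B1.smooth_fderiv h.isOpen).comp hx hm).clm_apply (contDiffOn_const (c := v))
  exact ((contDiffOn_const.mul (Geo.smooth_kin h0 (ddG.clm_apply hξ) hu hu)).add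
    (Geo.smooth_kin h0 dG hu hp)).add
    ((((ddB.clm₂ hξ hu.fst).clm_apply hu.snd).add
    ((ddB.clm₂ hu.fst hu.snd).clm_apply hξ)).add
    ((ddB.clm₂ hu.snd hξ).clm_apply hu.fst))

end Smooth

set_option maxHeartbeats 1000000 in
/-- The linearization of the Euler-Lagrange form, with `jacA` and `jacB` as coefficients. -/
lemma hasDerivAt_el {k : Conf} {x ξ : ℝ → V} {u p : ℝ → V × V} {s0 : ℝ} {v ξ' : V}
    {q p' : V × V} (hx : HasDerivAt x v s0) (hξ : HasDerivAt ξ ξ' s0) (hu : HasDerivAt u q s0)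
    (hp : HasDerivAt p p' s0) (hm : x s0 ∈ U) :
    HasDerivAt (fun s => el k g b (x s) (ξ s) (u s) (p s))
      (jacA k g b (x s0) (ξ s0) (u s0) (p s0) v + jacB k g b (x s0) (ξ s0) (u s0) (p s0) q
        + el k g b (x s0) ξ' (u s0) p') s0 := by
  have G := h.smooth_g.comp_deriv h.isOpen hm hx
  have dG := (h.smooth_g.smooth_fderiv h.isOpen).comp_deriv h.isOpen hm hx
  have dB := (h.smooth_b.smooth_fderiv h.isOpen).comp_deriv h.isOpen hm hx
  have hu1 := hu.fst'
  have hu2 := hu.snd'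
  have hp1 := hp.fst'
  have hp2 := hp.snd'
  have K : ∀ {c : ℝ → V ⊸ V ⊸ ℝ} {c' : V ⊸ V ⊸ ℝ} {y1 y2 z1 z2 : ℝ → V}
      {y1' y2' z1' z2' : V}, HasDerivAt c c' s0 → HasDerivAt y1 y1' s0 → HasDerivAt y2 y2' s0 →
      HasDerivAt z1 z1' s0 → HasDerivAt z2 z2' s0 →
      HasDerivAt (fun s => k.kin (c s) (y1 s, y2 s) (z1 s, z2 s))
        (k.kin c' (y1 s0, y2 s0) (z1 s0, z2 s0) + k.kin (c s0) (y1', y2') (z1 s0, z2 s0)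
          + k.kin (c s0) (y1 s0, y2 s0) (z1', z2')) s0 := by
    intro c c' y1 y2 z1 z2 y1' y2' z1' z2' hc h1 h2 h3 h4
    have := ((hc.clm₂ h1 h3).const_mul k.c00).add
      (((hc.clm₂ h1 h4).add (hc.clm₂ h2 h3)).const_mul k.c01)
      |>.add ((hc.clm₂ h2 h4).const_mul k.c11)
    refine this.congr_deriv ?_
    simp only [Conf.kin, _root_.add_apply]
    ring
  have t1 := (K (dG.clm_apply hξ) hu1 hu2 hu1 hu2).const_mul (1 / 2)
  have t2 := K G hu1 hu2 hp1 hp2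
  have t3 := ((dB.clm₂ hξ hu1).clm_apply hu2).add ((dB.clm₂ hu1 hu2).clm_apply hξ) |>.add
    ((dB.clm₂ hu2 hξ).clm_apply hu1)
  refine ((t1.add t2).add t3).congr_deriv ?_
  have e1 := h.kin_fderiv_symm hm k (ξ s0) q (u s0)
  simp only [jacA, jacB, el, extD, Conf.kin, _root_.add_apply] at *
  linear_combination 1 / 2 * e1

variable {D : Set Plane} {κ : Plane → Conf} {s : ℝ} (hκ : IsConf s D κ) {X : Plane → V}
  (hX : C∞ X D) (hm : MapsTo X D U)

include hκ hX hm

/-- The first variation differs from `el` by the exterior derivative of `b(ξ, dX)`. -/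
lemma integral_dslag_eq {ξ : Plane → V} (hξ : IsTest D ξ) :
    ∫ z in D, dslag (κ z) g b (X z) (ξ z) (grad X z) (grad ξ z) =
      ∫ z in D, el (κ z) g b (X z) (ξ z) (grad X z) (grad ξ z) := by
  have hD := hκ.isOpen
  have hβ : IsTest D fun z => b (X z) (ξ z) := hξ.clm_apply hD (h.smooth_b.comp hX hm)
  have hg := smooth_grad hD hX
  have hgξ := smooth_grad hD hξ.1.contDiffOn
  have i1 : IntegrableOn (fun z => el (κ z) g b (X z) (ξ z) (grad X z) (grad ξ z)) D := by
    refine (isTest_on hD hξ.2.1 hξ.2.2 (h.smooth_el hκ.smooth hX hξ.1.contDiffOn hg hgξ hm) fun z hz => ?_).integrableOn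
    rw [hξ.eq_zero hz, grad_eq_zero_of_notMem hz]
    simp [el, Conf.kin, extD]
  have hdβ : ∀ μ ν, IsTest D fun z => pdv μ (fun z => b (X z) (ξ z)) z (pdv ν X z) := fun μ ν =>
    isTest_on hD hβ.2.1 hβ.2.2 (((hβ.pdv hD μ).1.contDiffOn).clm_apply
      (smooth_pdv hD hX ν)) fun z hz => by rw [pdv_eq_zero_of_notMem hz]; rfl
  have i2 : IntegrableOn (fun z => pdv 0 (fun z => b (X z) (ξ z)) z (pdv 1 X z)
      - pdv 1 (fun z => b (X z) (ξ z)) z (pdv 0 X z)) D :=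
    (hdβ 0 1).integrableOn.sub (hdβ 1 0).integrableOn
  have hsum := integral_add i1 i2
  rw [integral_curl_eq_zero hD hX hβ, add_zero] at hsum
  rw [← hsum]
  refine integral_congr_on hD fun z hz => ?_
  have hx := hm hz
  have hXd := hX.fderivAt hD hz
  have hξd := hξ.1.contDiffOn.fderivAt hD hz
  have b0 := h.smooth_b.fderivAt h.isOpen hx
  have hbd := (HasFDerivAt.comp z b0 hXd).clm_apply hξd
  have e : ∀ μ, pdv μ (fun z => b (X z) (ξ z)) z =
      𝒟 b (X z) (pdv μ X z) (ξ z) + b (X z) (pdv μ ξ z) := by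
    intro μ
    rw [show pdv μ (fun z => b (X z) (ξ z)) z = 𝒟 (fun y => (b ∘ X) y (ξ y)) z
        (single μ 1) from rfl, hbd.fderiv]
    simp [pdv, add_comm]
  simp only [e]
  rw [dslag_eq (h.symm _ hx) (h.antisymm _ hx) (h.antisymm_fderiv hx)]
  simp [el, grad]

/-- The weak form of the linearized equations of motion. -/
lemma integral_jac_eq_zero {ξ : ℝ × Plane → V} (hξ : C∞ ξ (cyl D))
    {K : Set Plane} (hK : IsCompact K) (hKD : K ⊆ D) (h0 : ∀ q : ℝ × Plane, q.2 ∉ K → ξ q = 0)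
    {v : Plane → V} (hv : IsTest D v)
    (hin : ∀ τ ∈ Icc (-1 : ℝ) 1, ∀ σ ∈ D, X σ + τ • v σ ∈ U)
    (hsol : ∀ ζ, IsTest D ζ → ∫ σ in D, dslag (κ σ) g b (X σ) (ζ σ) (grad X σ) (grad ζ σ) = 0)
    (hfam : ∀ τ : ℝ, ∫ σ in D, dslag (κ σ) g b (X σ + Real.sin τ • v σ) (ξ (τ, σ))
      (grad (fun σ => X σ + Real.sin τ • v σ) σ) (grad (fun σ => ξ (τ, σ)) σ) = 0) :
    ∫ σ in D, (jacA (κ σ) g b (X σ) (ξ (0, σ)) (grad X σ) (grad (fun σ => ξ (0, σ)) σ) (v σ)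
      + jacB (κ σ) g b (X σ) (ξ (0, σ)) (grad X σ) (grad (fun σ => ξ (0, σ)) σ) (grad v σ)) = 0 := by
  have hD := hκ.isOpen
  have hS : IsOpen (cyl D) := hD.preimage continuous_snd
  set S := cyl D
  set x : ℝ × Plane → V := fun q => X q.2 + Real.sin q.1 • v q.2 with hxdef
  have hx : C∞ x S := (smooth_snd hX).add
    ((Real.contDiff_sin.comp contDiff_fst).contDiffOn.smul (hv.1.comp contDiff_snd).contDiffOn)
  have hmx : MapsTo x S U := fun q hq => hin _ ⟨Real.neg_one_le_sin _, Real.sin_le_one _⟩ _ hq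
  have hu := smooth_grad_family hS hx
  have hp := smooth_grad_family hS hξ
  have hξt : ∀ τ, IsTest D fun σ => ξ (τ, σ) := fun τ =>
    isTest_on hD hK hKD (hξ.slice _) fun σ hσ => h0 _ hσ
  have hxτ : ∀ τ, C∞ (fun σ => x (τ, σ)) D := fun τ => hx.slice _
  have hts : ∀ τ, ∀ σ ∉ K, σ ∉ tsupport fun σ => ξ (τ, σ) := fun τ σ hσ hc => hσ
    (closure_minimal (fun y hy => by by_contra hc; exact hy (h0 _ hc)) hK.isClosed hc)
  set f : ℝ → Plane → ℝ := fun τ σ => el (κ σ) g b (x (τ, σ)) (ξ (τ, σ))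
    (grad (fun σ => x (τ, σ)) σ) (grad (fun σ => ξ (τ, σ)) σ) with hf
  have hfz : ∀ τ, ∀ σ ∉ K, f τ σ = 0 := by
    intro τ σ hσ
    simp only [hf]
    rw [h0 (τ, σ) hσ, grad_eq_zero_of_notMem (hts τ σ hσ)]
    simp [el, Conf.kin, extD]
  have hsm := h.smooth_el hκ.smooth.snd hx hξ hu hp hmx
  have hfi : ∀ τ, ∫ σ in D, f τ σ = 0 := fun τ => by
    rw [← hfam τ, h.integral_dslag_eq hκ (hxτ τ) (fun σ hσ => hmx (show (τ, σ) ∈ S from hσ)) (hξt τ)]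
  have hx0 : ∀ σ, x (0, σ) = X σ := fun σ => by simp [hxdef]
  set ξ' : Plane → V := fun σ => 𝒟 ξ (0, σ) (1, 0) with hξ'
  have hξ't : IsTest D ξ' := by
    refine isTest_on hD hK hKD ((smooth_family_fderiv hS hξ (1, 0)).slice _) fun σ hσ => ?_
    have : ξ =ᶠ[𝓝 ((0 : ℝ), σ)] fun _ => 0 := by
      filter_upwards [(hK.isClosed.isOpen_compl.preimage continuous_snd).mem_nhds
        (show ((0 : ℝ), σ) ∈ Prod.snd ⁻¹' Kᶜ from hσ)] with q hq
      exact h0 q hq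
    simp [hξ', this.fderiv_eq]
  have hder : ∀ σ ∈ D, HasDerivAt (fun τ => f τ σ)
      (jacA (κ σ) g b (X σ) (ξ (0, σ)) (grad X σ) (grad (fun σ => ξ (0, σ)) σ) (v σ)
      + jacB (κ σ) g b (X σ) (ξ (0, σ)) (grad X σ) (grad (fun σ => ξ (0, σ)) σ) (grad v σ)
      + el (κ σ) g b (X σ) (ξ' σ) (grad X σ) (grad ξ' σ)) 0 := by
    intro σ hσ
    have hq : ((0 : ℝ), σ) ∈ S := hσ
    have dxv : ∀ σ, HasDerivAt (fun τ => x (τ, σ)) (v σ) 0 := fun σ => by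
      have := ((Real.hasDerivAt_sin 0).smul_const (v σ)).const_add (X σ)
      rw [Real.cos_zero, one_smul] at this
      exact this
    have du := hasDerivAt_grad_family hS hx hq
    have ev : (fun σ => 𝒟 x ((0 : ℝ), σ) (1, 0)) =ᶠ[𝓝 σ] v := by
      filter_upwards [hD.mem_nhds hσ] with σ' hσ'
      exact (hasDerivAt_family hS hx (show ((0 : ℝ), σ') ∈ S from hσ')).unique (dxv σ')
    have e1 : grad (fun σ => 𝒟 x ((0 : ℝ), σ) (1, 0)) σ = grad v σ := by
      simp only [grad, pdv, ev.fderiv_eq]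
    rw [e1] at du
    have := h.hasDerivAt_el (k := κ σ) (dxv σ) (hasDerivAt_family hS hξ hq) du
      (hasDerivAt_grad_family hS hξ hq) (hmx hq)
    simpa only [hx0] using this
  have main := hasDerivAt_integral_variation hK hKD hD hS (fun σ hσ => hσ)
    (hsm.of_le (by simp)) hder (fun τ σ _ hσ => by rw [hfz τ σ hσ, hfz 0 σ hσ])
  have hint : ∀ τ, IntegrableOn (f τ) D := fun τ =>
    (isTest_on hD hK hKD (hsm.slice _) fun σ hσ => hfz τ σ hσ).integrableOn
  have hconst : (fun τ => ∫ σ in D, (f τ σ - f 0 σ)) = fun _ => 0 := by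
    funext τ
    rw [integral_sub (hint τ) (hint 0), hfi, hfi, sub_zero]
  rw [hconst] at main
  have hz := main.unique (hasDerivAt_const 0 (0 : ℝ))
  have hs := hsol ξ' hξ't
  rw [h.integral_dslag_eq hκ hX hm hξ't] at hs
  have hg := smooth_grad hD hX
  have iel : IntegrableOn (fun σ => el (κ σ) g b (X σ) (ξ' σ) (grad X σ) (grad ξ' σ)) D := by
    refine (isTest_on hD hξ't.2.1 hξ't.2.2 (h.smooth_el hκ.smooth hX hξ't.1.contDiffOn hg (smooth_grad hD hξ't.1.contDiffOn) hm)
      fun σ hσ => ?_).integrableOn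
    rw [hξ't.eq_zero hσ, grad_eq_zero_of_notMem hσ]
    simp [el, Conf.kin, extD]
  have itot : IntegrableOn (fun σ => jacA (κ σ) g b (X σ) (ξ (0, σ)) (grad X σ)
      (grad (fun σ => ξ (0, σ)) σ) (v σ)
      + jacB (κ σ) g b (X σ) (ξ (0, σ)) (grad X σ) (grad (fun σ => ξ (0, σ)) σ) (grad v σ)
      + el (κ σ) g b (X σ) (ξ' σ) (grad X σ) (grad ξ' σ)) D := by
    have hd : C∞ (fun q : ℝ × Plane => f q.1 q.2) S := hsm
    have h1 := (smooth_family_fderiv hS hd (1, 0)).comp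
      (contDiffOn_const.prodMk contDiffOn_id) fun σ (hσ : σ ∈ D) => (show ((0 : ℝ), σ) ∈ S from hσ)
    refine IntegrableOn.congr_fun (isTest_on hD hK hKD h1 fun σ hσ => ?_).integrableOn
      (fun σ hσ => ?_) hD.measurableSet
    · have : (fun q : ℝ × Plane => f q.1 q.2) =ᶠ[𝓝 ((0 : ℝ), σ)] fun _ => 0 := by
        filter_upwards [(hK.isClosed.isOpen_compl.preimage continuous_snd).mem_nhds
          (show ((0 : ℝ), σ) ∈ Prod.snd ⁻¹' Kᶜ from hσ)] with q hq
        exact hfz _ _ hq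
      simp [Function.comp, this.fderiv_eq]
    · exact (hasDerivAt_family hS hd (show ((0 : ℝ), σ) ∈ S from hσ)).unique (hder σ hσ)
  have htot := integral_sub itot iel
  rw [hz, hs, sub_zero] at htot
  refine Eq.trans ?_ htot
  congr 1
  funext σ
  ring

end IsSigma

lemma jacA_smul (k : Conf) (g b : V → V ⊸ V ⊸ ℝ) (x ξ : V) (u p : V × V) (v : V) (c : ℝ) :
    jacA k g b x (c • ξ) u (c • p) v = c * jacA k g b x ξ u p v := by
  simp only [jacA, Conf.kin, map_smul, _root_.smul_apply, smul_eq_mul, Prod.smul_fst, Prod.smul_snd]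
  ring

lemma jacA_smul_right (k : Conf) (g b : V → V ⊸ V ⊸ ℝ) (x ξ : V) (u p : V × V) (v : V)
    (c : ℝ) : jacA k g b x ξ u p (c • v) = c * jacA k g b x ξ u p v := by
  simp only [jacA, Conf.kin, map_smul, _root_.smul_apply, smul_eq_mul]
  ring

lemma jacB_smul (k : Conf) (g b : V → V ⊸ V ⊸ ℝ) (x ξ : V) (u p q : V × V) (c : ℝ) :
    jacB k g b x (c • ξ) u (c • p) q = c * jacB k g b x ξ u p q := by
  simp only [jacB, extD, Conf.kin, map_smul, _root_.smul_apply, smul_eq_mul, Prod.smul_fst,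
    Prod.smul_snd]
  ring

lemma jacB_smul_right (k : Conf) (g b : V → V ⊸ V ⊸ ℝ) (x ξ : V) (u p : V × V) (φ : V)
    (c d : ℝ) : jacB k g b x ξ u p (c • φ, d • φ) =
      jacB k g b x ξ u p (φ, 0) * c + jacB k g b x ξ u p (0, φ) * d := by
  simp only [jacB, extD, Conf.kin, map_smul, _root_.smul_apply, smul_eq_mul, map_zero,
    _root_.zero_apply]
  ring

lemma grad_smul_const {θ : Plane → ℝ} {z : Plane} (hθ : DifferentiableAt ℝ θ z) (φ : V) :
    grad (fun z => θ z • φ) z = (pdv 0 θ z • φ, pdv 1 θ z • φ) := by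
  simp [grad, pdv, (hθ.hasFDerivAt.smul_const φ).fderiv]

/-- The linear function `ℓ · (z - z0)`. -/
def lin (ℓ : Fin 2 → ℝ) (z0 z : Plane) : ℝ := ℓ 0 * (z 0 - z0 0) + ℓ 1 * (z 1 - z0 1)

@[simp] lemma lin_self (ℓ : Fin 2 → ℝ) (z0 : Plane) : lin ℓ z0 z0 = 0 := by simp [lin]

lemma hasFDerivAt_lin (ℓ : Fin 2 → ℝ) (z0 z : Plane) : HasFDerivAt (lin ℓ z0)
    (ℓ 0 • proj (𝕜 := ℝ) (0 : Fin 2) + ℓ 1 • proj (𝕜 := ℝ) (1 : Fin 2) : Plane ⊸ ℝ) z := by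
  have h0 := (proj 0 : Plane ⊸ ℝ).hasFDerivAt (x := z)
  have h1 := (proj 1 : Plane ⊸ ℝ).hasFDerivAt (x := z)
  exact ((h0.sub_const (z0 0)).const_mul (ℓ 0)).add ((h1.sub_const (z0 1)).const_mul (ℓ 1))

lemma contDiff_lin (ℓ : Fin 2 → ℝ) (z0 : Plane) : ContDiff ℝ ∞ (lin ℓ z0) := by
  unfold lin
  have h0 := (proj 0 : Plane ⊸ ℝ).contDiff (n := ∞)
  have h1 := (proj 1 : Plane ⊸ ℝ).contDiff (n := ∞)
  exact (contDiff_const.mul (h0.sub contDiff_const)).add (contDiff_const.mul (h1.sub contDiff_const))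

lemma pdv_lin (ℓ : Fin 2 → ℝ) (z0 z : Plane) (μ : Fin 2) : pdv μ (lin ℓ z0) z = ℓ μ := by
  rw [pdv, (hasFDerivAt_lin ℓ z0 z).fderiv]
  fin_cases μ <;> simp

/-- The divided power `(ℓ · (z - z0))^j / j!`. -/
def divPow (ℓ : Fin 2 → ℝ) (z0 : Plane) (j : ℕ) (z : Plane) : ℝ :=
  lin ℓ z0 z ^ j / (j.factorial : ℝ)

lemma contDiff_divPow (ℓ : Fin 2 → ℝ) (z0 : Plane) (j : ℕ) : ContDiff ℝ ∞ (divPow ℓ z0 j) :=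
  ((contDiff_lin ℓ z0).pow j).div_const _

lemma pd_divPow (ℓ : Fin 2 → ℝ) (z0 z : Plane) (j : ℕ) (c : ℝ) (i : Fin 2) :
    pd i (fun z => c * divPow ℓ z0 (j + 1) z) z = c * ℓ i * divPow ℓ z0 j z := by
  have h := (((hasFDerivAt_lin ℓ z0 z).pow (j + 1)).mul_const ((j + 1).factorial : ℝ)⁻¹).const_mul c
  have e : (fun z => c * divPow ℓ z0 (j + 1) z) =
      fun z => c * (lin ℓ z0 z ^ (j + 1) * ((j + 1).factorial : ℝ)⁻¹) := rfl
  have h2 := pdv_lin ℓ z0 z i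
  rw [pdv, (hasFDerivAt_lin ℓ z0 z).fderiv] at h2
  rw [pd, e, h.fderiv]
  simp only [_root_.smul_apply, smul_eq_mul, h2, divPow, Nat.factorial_succ, Nat.cast_mul]
  have : (j.factorial : ℝ) ≠ 0 := by positivity
  have : ((j + 1 : ℕ) : ℝ) ≠ 0 := by positivity
  field_simp
  push_cast
  rw [nsmul_eq_mul]
  push_cast
  ring

lemma pd_iterate_divPow (ℓ : Fin 2 → ℝ) (z0 : Plane) (i : Fin 2) (p : ℕ) :
    ∀ (j : ℕ) (c : ℝ) (η : Plane → ℝ), η =ᶠ[𝓝 z0] (fun z => c * divPow ℓ z0 (j + p) z) →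
      (pd i)^[p] η =ᶠ[𝓝 z0] fun z => c * ℓ i ^ p * divPow ℓ z0 j z := by
  induction p with
  | zero => intro j c η h; simpa using h
  | succ p ih =>
    intro j c η h
    rw [Function.iterate_succ_apply]
    have h1 : pd i η =ᶠ[𝓝 z0] fun z => c * ℓ i * divPow ℓ z0 (j + p) z := by
      filter_upwards [h.eventuallyEq_nhds] with z hz
      rw [← pd_divPow, pd, pd, hz.fderiv_eq]
      rfl
    refine (ih j _ _ h1).trans (Filter.EventuallyEq.of_eq ?_)
    funext z
    ring

lemma pd_iterate_zero_of_eventually {η : Plane → ℝ} {z0 : Plane} (i : Fin 2) (p : ℕ)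
    (h : η =ᶠ[𝓝 z0] fun _ => 0) : (pd i)^[p] η =ᶠ[𝓝 z0] fun _ => 0 := by
  induction p generalizing η with
  | zero => simpa using h
  | succ p ih =>
    rw [Function.iterate_succ_apply]
    refine ih ?_
    filter_upwards [h.eventuallyEq_nhds] with z hz
    rw [pd, hz.fderiv_eq]
    simp

lemma contDiff_pd_iterate {η : Plane → ℝ} (h : ContDiff ℝ ∞ η) (i : Fin 2) (p : ℕ) :
    ContDiff ℝ ∞ ((pd i)^[p] η) := by
  induction p generalizing η with
  | zero => simpa using h
  | succ p ih =>
    rw [Function.iterate_succ_apply]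
    exact ih (contDiff_pdv h i)

/-- The linear differential operator with coefficients `c p q` applied to `η`. -/
def diffOp (N : ℕ) (c : ℕ → ℕ → Plane → V) (η : Plane → ℝ) (z : Plane) : V :=
  ∑ p ∈ range (N + 1), ∑ q ∈ range (N + 1), ((pd 0)^[p] ((pd 1)^[q] η)) z • c p q z

namespace IsSigma

variable {U : Set V} {g b : V → V ⊸ V ⊸ ℝ} (h : IsSigma U g b)
include h

variable {D : Set Plane} {κ : Plane → Conf} {s : ℝ} (hκ : IsConf s D κ) {X : Plane → V}
  (hX : C∞ X D) (hm : MapsTo X D U)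
include hκ hX hm

/-- The strong form of the linearized equations of motion. -/
lemma jac_strong {ξ : Plane → V} (hξ : C∞ ξ D) (φ : V) (hw : ∀ θ : Plane → ℝ, IsTest D θ →
      ∫ z in D, (jacA (κ z) g b (X z) (ξ z) (grad X z) (grad ξ z) (θ z • φ)
        + jacB (κ z) g b (X z) (ξ z) (grad X z) (grad ξ z) (grad (fun z => θ z • φ) z)) = 0) :
    ∀ z ∈ D, jacA (κ z) g b (X z) (ξ z) (grad X z) (grad ξ z) φ =
      pdv 0 (fun z => jacB (κ z) g b (X z) (ξ z) (grad X z) (grad ξ z) (φ, 0)) z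
        + pdv 1 (fun z => jacB (κ z) g b (X z) (ξ z) (grad X z) (grad ξ z) (0, φ)) z := by
  have hD := hκ.isOpen
  have hg := smooth_grad hD hX
  have hgξ := smooth_grad hD hξ
  have hb : ∀ q : V × V, C∞
      (fun z => jacB (κ z) g b (X z) (ξ z) (grad X z) (grad ξ z) q) D := fun q =>
    h.smooth_jacB hκ.smooth hX hξ hg hgξ hm contDiffOn_const
  have := eq_of_integral_weak hD
    (b := ![fun z => jacB (κ z) g b (X z) (ξ z) (grad X z) (grad ξ z) (φ, 0),
      fun z => jacB (κ z) g b (X z) (ξ z) (grad X z) (grad ξ z) (0, φ)])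
    (h.smooth_jacA hκ.smooth hX hξ hg hgξ hm φ)
    (fun μ => by fin_cases μ; exacts [hb _, hb _]) (fun θ hθ => by
      rw [← hw θ hθ]
      refine integral_congr_on hD fun z hz => ?_
      simp only [grad_smul_const (hθ.1.differentiable (by simp) z) φ, jacA_smul_right,
        jacB_smul_right]
      simp only [Matrix.cons_val_zero, Matrix.cons_val_one]
      ring)
  simpa using this

/-- The principal symbol of the linearized equations of motion. -/
lemma symbol_eq_zero {ξ f : Plane → V} (hf : C∞ f D) {ℓ : Fin 2 → ℝ} {z0 : Plane}
    (hz0 : z0 ∈ D) (hξf : ξ =ᶠ[𝓝 z0] fun z => lin ℓ z0 z ^ 2 • f z) (φ : V)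
    (hs : jacA (κ z0) g b (X z0) (ξ z0) (grad X z0) (grad ξ z0) φ =
      pdv 0 (fun z => jacB (κ z) g b (X z) (ξ z) (grad X z) (grad ξ z) (φ, 0)) z0
        + pdv 1 (fun z => jacB (κ z) g b (X z) (ξ z) (grad X z) (grad ξ z) (0, φ)) z0) :
    ((κ z0).c00 * ℓ 0 ^ 2 + 2 * (κ z0).c01 * (ℓ 0 * ℓ 1) + (κ z0).c11 * ℓ 1 ^ 2)
      * g (X z0) φ (f z0) = 0 := by
  have hD := hκ.isOpen
  have hg := smooth_grad hD hX
  set p' : Plane → V × V := fun z => ((2 * ℓ 0) • f z + lin ℓ z0 z • pdv 0 f z,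
    (2 * ℓ 1) • f z + lin ℓ z0 z • pdv 1 f z) with hp'
  have hl := (contDiff_lin ℓ z0).contDiffOn (s := D)
  have hp's : C∞ p' D := ((contDiffOn_const.smul hf).add (hl.smul (smooth_pdv hD hf 0))).prodMk
      ((contDiffOn_const.smul hf).add (hl.smul (smooth_pdv hD hf 1)))
  have hgr : ∀ᶠ z in 𝓝 z0, ξ z = lin ℓ z0 z • (lin ℓ z0 z • f z) ∧
      grad ξ z = lin ℓ z0 z • p' z := by
    filter_upwards [hξf.eventuallyEq_nhds, hD.mem_nhds hz0] with z hz hzD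
    obtain ⟨Lc, hLc⟩ : ∃ Lc, HasFDerivAt (lin ℓ z0) Lc z := ⟨_, hasFDerivAt_lin ℓ z0 z⟩
    have h1 := ((hLc.pow 2).smul (hf.fderivAt hD hzD)).fderiv
    have h1' : 𝒟 (fun z => lin ℓ z0 z ^ 2 • f z) z = _ := h1
    have h2 : ∀ μ, pdv μ ξ z = lin ℓ z0 z • ((2 * ℓ μ) • f z + lin ℓ z0 z • pdv μ f z) := by
      intro μ
      have h3 := pdv_lin ℓ z0 z μ
      rw [pdv, hLc.fderiv] at h3
      rw [pdv, hz.fderiv_eq]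
      rw [h1']
      simp only [_root_.add_apply, _root_.smul_apply, ContinuousLinearMap.smulRight_apply, h3,
        pdv, smul_add, smul_smul, smul_eq_mul]
      rw [add_comm]
      congr 2
      · rw [nsmul_eq_mul]; push_cast; ring
      · ring
    refine ⟨by rw [hz.eq_of_nhds, smul_smul, sq], ?_⟩
    ext <;> simp [grad, h2, hp']
  have e0 := hgr.self_of_nhds
  simp only [lin_self] at e0
  rw [e0.1, e0.2, jacA_smul, zero_mul] at hs
  have key : ∀ (q : V × V) (μ : Fin 2),
      pdv μ (fun z => jacB (κ z) g b (X z) (ξ z) (grad X z) (grad ξ z) q) z0 =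
        ℓ μ * jacB (κ z0) g b (X z0) 0 (grad X z0) ((2 * ℓ 0) • f z0, (2 * ℓ 1) • f z0) q := by
    intro q μ
    have hlf : C∞ (fun z => lin ℓ z0 z • f z) D := hl.smul hf
    have hb := h.smooth_jacB hκ.smooth hX hlf hg hp's hm (contDiffOn_const (c := q))
    have hd := ((hasFDerivAt_lin ℓ z0 z0).mul (hb.fderivAt hD hz0)).fderiv
    have hev : (fun z => jacB (κ z) g b (X z) (ξ z) (grad X z) (grad ξ z) q) =ᶠ[𝓝 z0]
        (lin ℓ z0 * fun z => jacB (κ z) g b (X z) (lin ℓ z0 z • f z) (grad X z) (p' z) q) := by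
      filter_upwards [hgr] with z hz
      rw [hz.1, hz.2, jacB_smul]
      rfl
    have h3 := pdv_lin ℓ z0 z0 μ
    rw [pdv, (hasFDerivAt_lin ℓ z0 z0).fderiv] at h3
    rw [pdv, hev.fderiv_eq, hd]
    simp only [lin_self, zero_smul, zero_add, _root_.smul_apply, h3, hp', smul_eq_mul, add_zero]
    ring
  rw [key, key] at hs
  have e1 := h.symm _ (hm hz0) φ (f z0)
  simp only [jacB, Conf.kin, extD, map_zero, map_smul, _root_.zero_apply, smul_eq_mul]
    at hs
  linear_combination -1 / 2 * hs

/-- A linear differential operator with values in solutions of the linearized equations of motion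
vanishes if the principal symbol of these equations is nondegenerate on its values. -/
lemma coeff_eq_zero {N : ℕ} {c : ℕ → ℕ → Plane → V} (hc : ∀ p q, C∞ (c p q) D) (hdet : s ≠ 0)
    (hnd : ∀ (f : ℕ → ℕ → ℝ), ∀ σ ∈ D, (∀ φ, g (X σ) φ (∑ p ∈ range (N + 1), ∑ q ∈ range (N + 1),
        f p q • c p q σ) = 0) →
      ∑ p ∈ range (N + 1), ∑ q ∈ range (N + 1), f p q • c p q σ = 0)
    (hs : ∀ η, IsTest D η → ∀ φ, ∀ σ ∈ D,
      jacA (κ σ) g b (X σ) (diffOp N c η σ) (grad X σ) (grad (diffOp N c η) σ) φ =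
      pdv 0 (fun σ => jacB (κ σ) g b (X σ) (diffOp N c η σ) (grad X σ)
        (grad (diffOp N c η) σ) (φ, 0)) σ
        + pdv 1 (fun σ => jacB (κ σ) g b (X σ) (diffOp N c η σ) (grad X σ)
          (grad (diffOp N c η) σ) (0, φ)) σ) :
    ∀ p ∈ range (N + 1), ∀ q ∈ range (N + 1), ∀ σ ∈ D, c p q σ = 0 := by
  have hD := hκ.isOpen
  have main : ∀ n d : ℕ, 2 * N < d + n → ∀ p ∈ range (N + 1), ∀ q ∈ range (N + 1),
      d ≤ p + q → ∀ σ ∈ D, c p q σ = 0 := by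
    intro n
    induction n with
    | zero =>
      intro d hd p hp q hq hpq
      simp only [Finset.mem_range] at hp hq
      omega
    | succ n ih =>
      intro d hd
      have ih' := ih (d + 1) (by omega)
      -- the top-order symbol vanishes in all but finitely many directions
      have top : ∀ σ0 ∈ D, ∀ τ : ℝ, ((κ σ0).c00 + 2 * (κ σ0).c01 * τ + (κ σ0).c11 * τ ^ 2) ≠ 0 →
          ∑ p ∈ range (N + 1), ∑ q ∈ range (N + 1),
            (if p + q = d then τ ^ q else 0) • c p q σ0 = 0 := by
        intro σ0 hσ0 τ hτ
        set ℓ : Fin 2 → ℝ := ![1, τ] with hℓ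
        obtain ⟨θ, hθ, hθ1⟩ := exists_isTest_eq_one hD isCompact_singleton
          (Set.singleton_subset_iff.2 hσ0)
        rw [nhdsSet_singleton] at hθ1
        set η : Plane → ℝ := fun σ => θ σ * divPow ℓ σ0 (d + 2) σ with hη
        have hηt : IsTest D η := isTest_on hD hθ.2.1 hθ.2.2
          (hθ.1.mul (contDiff_divPow _ _ _)).contDiffOn fun σ hσ => by simp [hη, hθ.eq_zero hσ]
        have hη1 : η =ᶠ[𝓝 σ0] fun σ => 1 * divPow ℓ σ0 (d + 2) σ := by
          filter_upwards [hθ1] with σ hσ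
          simp [hη, hσ]
        set f : Plane → V := fun σ => ∑ p ∈ range (N + 1), ∑ q ∈ range (N + 1),
          (if p + q ≤ d then τ ^ q * lin ℓ σ0 σ ^ (d - (p + q)) /
            ((d - (p + q) + 2).factorial : ℝ) else 0) • c p q σ with hf
        have hfs : C∞ f D := by
          refine ContDiffOn.sum fun p _ => ContDiffOn.sum fun q _ => ContDiffOn.smul ?_ (hc p q)
          split_ifs
          · exact ((contDiff_const.mul ((contDiff_lin ℓ σ0).pow _)).div_const _).contDiffOn
          · exact contDiffOn_const
        have hw : diffOp N c η =ᶠ[𝓝 σ0] fun σ => lin ℓ σ0 σ ^ 2 • f σ := by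
          have hpq : ∀ p q : ℕ, p + q ≤ d → ((pd 0)^[p] ((pd 1)^[q] η)) =ᶠ[𝓝 σ0]
              fun σ => τ ^ q * divPow ℓ σ0 (d - (p + q) + 2) σ := by
            intro p q hpq
            have h1 := pd_iterate_divPow ℓ σ0 1 q (d - (p + q) + 2 + p) 1 η (by
              rw [show d - (p + q) + 2 + p + q = d + 2 by omega]; exact hη1)
            have h2 := pd_iterate_divPow ℓ σ0 0 p (d - (p + q) + 2) _ _ h1
            simpa [hℓ] using h2
          have hall : ∀ᶠ σ in 𝓝 σ0, ∀ p ∈ range (N + 1), ∀ q ∈ range (N + 1),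
              p + q ≤ d → (pd 0)^[p] ((pd 1)^[q] η) σ = τ ^ q * divPow ℓ σ0 (d - (p + q) + 2) σ := by
            rw [Filter.eventually_all_finset]
            intro p _
            rw [Filter.eventually_all_finset]
            intro q _
            rw [Filter.eventually_imp_distrib_left]
            exact hpq p q
          filter_upwards [hall, hD.mem_nhds hσ0] with σ hσ hσD
          simp only [diffOp, hf, smul_sum]
          refine sum_congr rfl fun p hp => sum_congr rfl fun q hq => ?_
          by_cases hd' : p + q ≤ d
          · rw [hσ p hp q hq hd', if_pos hd', smul_smul]
            congr 1
            simp only [divPow]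
            ring
          · rw [ih' p hp q hq (by omega) σ hσD, smul_zero, smul_zero, smul_zero]
        have hf0 : f σ0 = ∑ p ∈ range (N + 1), ∑ q ∈ range (N + 1),
            (if p + q = d then τ ^ q / 2 else 0) • c p q σ0 := by
          simp only [hf]
          refine sum_congr rfl fun p hp => sum_congr rfl fun q hq => ?_
          congr 1
          rcases lt_trichotomy (p + q) d with h1 | h1 | h1
          · rw [if_pos h1.le, if_neg h1.ne, lin_self, zero_pow (by omega)]
            simp
          · rw [if_pos h1.le, if_pos h1, lin_self, h1]
            simp
          · rw [if_neg (by omega), if_neg (by omega)]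
        have hsym : ∀ φ, g (X σ0) φ (f σ0) = 0 := fun φ => by
          have := h.symbol_eq_zero hκ hX hm hfs hσ0 hw φ (hs η hηt φ σ0 hσ0)
          simp only [hℓ, Matrix.cons_val_zero, Matrix.cons_val_one, one_pow, mul_one, one_mul]
            at this
          exact (mul_eq_zero.1 this).resolve_left hτ
        rw [hf0] at hsym
        have := hnd _ σ0 hσ0 hsym
        have h2 := congrArg (fun z => (2 : ℝ) • z) this
        simp only [smul_sum, smul_smul, smul_zero] at h2
        rw [← h2]
        refine sum_congr rfl fun p hp => sum_congr rfl fun q hq => ?_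
        congr 1
        split_ifs <;> ring
      intro p hp q hq hpq σ0 hσ0
      rcases hpq.lt_or_eq with hlt | heq
      · exact ih' p hp q hq hlt σ0 hσ0
      rw [← Module.forall_dual_apply_eq_zero_iff ℝ]
      intro L
      set P : Polynomial ℝ := ∑ p ∈ range (N + 1), ∑ q ∈ range (N + 1),
        Polynomial.C (if p + q = d then L (c p q σ0) else 0) * Polynomial.X ^ q with hP
      set Q : Polynomial ℝ := Polynomial.C (κ σ0).c00 + Polynomial.C (2 * (κ σ0).c01) * Polynomial.X
        + Polynomial.C (κ σ0).c11 * Polynomial.X ^ 2 with hQ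
      have hPQ : Q * P = 0 := by
        refine Polynomial.funext fun τ => ?_
        by_cases hτ : ((κ σ0).c00 + 2 * (κ σ0).c01 * τ + (κ σ0).c11 * τ ^ 2) = 0
        · simp [hQ, hτ]
        · have := congrArg L (top σ0 hσ0 τ hτ)
          simp only [map_sum, map_smul, map_zero, smul_eq_mul] at this
          have h3 : P.eval τ = 0 := by
            rw [← this, hP, Polynomial.eval_finsetSum]
            refine sum_congr rfl fun p _ => ?_
            rw [Polynomial.eval_finsetSum]
            refine sum_congr rfl fun q _ => ?_
            rw [Polynomial.eval_mul, Polynomial.eval_C, Polynomial.eval_pow, Polynomial.eval_X]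
            split_ifs <;> ring
          simp [h3]
      have hQ0 : Q ≠ 0 := by
        intro h0
        have e0 : (κ σ0).c00 = 0 := by
          have := congrArg (fun R => Polynomial.coeff R 0) h0
          simpa [hQ] using this
        have e1 : (κ σ0).c01 = 0 := by
          have := congrArg (fun R => Polynomial.coeff R 1) h0
          simpa [hQ, Polynomial.coeff_X_pow, Polynomial.coeff_C] using this
        apply hdet
        rw [← hκ.det σ0 hσ0, Conf.det, e0, e1]
        ring
      have hP0 : P = 0 := (mul_eq_zero.1 hPQ).resolve_left hQ0
      have := congrArg (fun R => Polynomial.coeff R q) hP0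
      simp only [hP, Polynomial.finsetSum_coeff, Polynomial.coeff_C_mul, Polynomial.coeff_X_pow,
        Polynomial.coeff_zero, mul_ite, mul_one, mul_zero, Finset.sum_ite_eq, hq, if_true] at this
      rw [Finset.sum_eq_single p] at this
      · simpa [heq] using this
      · intro p' _ hne
        rw [if_neg (by omega)]
      · intro hp'; exact absurd hp hp'
  intro p hp q hq
  exact main (2 * N + 1) 0 (by omega) p hp q hq (Nat.zero_le _)

end IsSigma

/-! ### Completeness of the gauge transformations -/

lemma pd_iterate_eq_zero {η : Plane → ℝ} {z : Plane} (hz : z ∉ tsupport η) (p q : ℕ) :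
    (pd 0)^[p] ((pd 1)^[q] η) z = 0 :=
  (pd_iterate_zero_of_eventually 0 p (pd_iterate_zero_of_eventually 1 q
    (notMem_tsupport_iff_eventuallyEq.1 hz))).self_of_nhds

lemma diffOp_eq_zero {N : ℕ} {c : ℕ → ℕ → Plane → V} {η : Plane → ℝ} {z : Plane}
    (hz : z ∉ tsupport η) : diffOp N c η z = 0 :=
  Finset.sum_eq_zero fun p _ => Finset.sum_eq_zero fun q _ => by
    rw [pd_iterate_eq_zero hz, zero_smul]

lemma smooth_diffOp_family {D : Set Plane} {N : ℕ} {C : ℕ → ℕ → ℝ × Plane → V}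
    (hC : ∀ p q, C∞ (C p q) (cyl D)) {η : Plane → ℝ}
    (hη : ContDiff ℝ ∞ η) :
    C∞ (fun z : ℝ × Plane => diffOp N (fun p q σ => C p q (z.1, σ)) η z.2) (cyl D) :=
  ContDiffOn.sum fun p _ => ContDiffOn.sum fun q _ => ContDiffOn.smul
    (((contDiff_pd_iterate (contDiff_pd_iterate hη 1 q) 0 p).comp contDiff_snd).contDiffOn) (hC p q)

lemma isTest_diffOp {D : Set Plane} (hD : IsOpen D) {N : ℕ} {c : ℕ → ℕ → Plane → V}
    (hc : ∀ p q, C∞ (c p q) D) {η : Plane → ℝ} (hη : IsTest D η) :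
    IsTest D (diffOp N c η) :=
  isTest_on hD hη.2.1 hη.2.2 (ContDiffOn.sum fun p _ => ContDiffOn.sum fun q _ =>
    ContDiffOn.smul ((contDiff_pd_iterate (contDiff_pd_iterate hη.1 1 q) 0 p).contDiffOn) (hc p q))
    fun _ hz => diffOp_eq_zero hz

lemma exists_small_variation {D : Set Plane} (hD : IsOpen D) {U : Set V} (hU : IsOpen U)
    {X v : Plane → V} (hX : C∞ X D) (hm : MapsTo X D U) (hv : IsTest D v) :
    ∃ c : ℝ, 0 < c ∧ ∀ τ ∈ Icc (-1 : ℝ) 1, ∀ z ∈ D, X z + τ • (c • v z) ∈ U := by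
  have hS : IsOpen (cyl D) := hD.preimage continuous_snd
  have hc := ((smooth_snd hX).add (contDiffOn_fst.smul (smooth_snd hv.1.contDiffOn))).continuousOn
  have hΩ := hc.isOpen_inter_preimage hS hU
  obtain ⟨u, w, hu, -, h0u, hKw, huw⟩ := generalized_tube_lemma (s := {(0 : ℝ)})
    isCompact_singleton hv.2.1 hΩ (by
      rintro ⟨τ, z⟩ ⟨rfl, hz⟩
      refine ⟨hv.2.2 hz, ?_⟩
      simpa using hm (hv.2.2 hz))
  obtain ⟨e, he, hb⟩ := Metric.isOpen_iff.1 hu 0 (h0u rfl)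
  refine ⟨e / 2, by positivity, fun τ hτ z hz => ?_⟩
  by_cases hs : z ∈ tsupport v
  · have hmem : τ * (e / 2) ∈ u := hb (by
      rw [Metric.mem_ball, dist_zero_right, Real.norm_eq_abs, abs_mul,
        abs_of_pos (show (0 : ℝ) < e / 2 by positivity)]
      have := abs_le.2 hτ
      nlinarith [abs_nonneg τ])
    have := (huw (Set.mk_mem_prod hmem (hKw hs))).2
    simpa [smul_smul] using this
  · rw [hv.eq_zero hs]
    simpa using hm hz

namespace Reduction

variable {m : Geo V W} {s : ℝ} (r : Reduction m s) {D : Set Plane} {κ : Plane → Conf}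
  {X : Plane → V} {A : Plane → W × W}

lemma el_sub_t (h : m.IsGauged s) {x : V} (hx : x ∈ m.dom) (k : Conf) (ξ : V) (u p : V × V) :
    el k r.gq r.bt x (ξ - r.t ξ) u (p.1 - r.t p.1, p.2 - r.t p.2) = el k r.gq r.bt x ξ u p := by
  have g1 : 𝒟 r.gq x (r.t ξ) = 0 := by rw [← r.R_Rp x hx]; exact r.fderiv_gq_R h hx _
  have g2 : ∀ u v, extD r.bt x (r.t ξ) u v = 0 := by
    rw [← r.R_Rp x hx]; exact r.extDeriv_bt_R h hx _
  have g3 : ∀ u v, r.gq x u (r.t v) = 0 := fun u v => by rw [r.gq_symm h hx, r.gq_t hx]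
  have g4 := g2 u.1 u.2
  simp only [el, extD, map_sub, g1, sub_zero, Conf.kin, g3, _root_.sub_apply] at *
  linear_combination -g4

/-- The data, at a configuration `(X, A)`, of a variation which is a linear differential operator
and leaves the functional invariant: its coefficients `c`, `e` at `(X, A)` extend smoothly to
families of configurations. -/
def IsInvariantVariation (m : Geo V W) (κ : Plane → Conf) (D : Set Plane) (X : Plane → V)
    (A : Plane → W × W) (N : ℕ) (c : ℕ → ℕ → Plane → V) (e : ℕ → ℕ → Plane → W × W) : Prop :=
  ∀ (x : ℝ × Plane → V) (a : ℝ × Plane → W × W), C∞ x (cyl D) →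
    C∞ a (cyl D) → MapsTo x (cyl D) m.dom →
    (∀ z, x (0, z) = X z) → (∀ z, a (0, z) = A z) →
    ∃ (C : ℕ → ℕ → ℝ × Plane → V) (E : ℕ → ℕ → ℝ × Plane → W × W), (∀ p q, C∞ (C p q) (cyl D)) ∧
      (∀ p q, C∞ (E p q) (cyl D)) ∧
      (∀ p q z, C p q (0, z) = c p q z) ∧ (∀ p q z, E p q (0, z) = e p q z) ∧
      ∀ τ η, IsTest D η → ∫ z in D, m.firstVar κ (fun z => x (τ, z)) (fun z => a (τ, z))
        (diffOp N (fun p q z => C p q (τ, z)) η) (diffOp N (fun p q z => E p q (τ, z)) η) z = 0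

variable {N : ℕ} {c : ℕ → ℕ → Plane → V} {e : ℕ → ℕ → Plane → W × W}

lemma grad_sub_t {ξ : Plane → V} {z : Plane} (hξ : DifferentiableAt ℝ ξ z) :
    grad (fun z => ξ z - r.t (ξ z)) z =
      ((grad ξ z).1 - r.t (grad ξ z).1, (grad ξ z).2 - r.t (grad ξ z).2) := by
  have h1 := hξ.hasFDerivAt
  have h2 := r.t.hasFDerivAt.comp z h1
  have h3 : 𝒟 (fun z => ξ z - r.t (ξ z)) z = _ := (h1.sub h2).fderiv
  simp [grad, pdv, h3]

/-- On shell, invariant variations act along the leaves. -/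
lemma transversal_eq_zero (h : m.IsGauged s) (hs0 : s ≠ 0) (hκ : IsConf s D κ)
    (hnd : ∀ x ∈ m.dom, ∀ u, (∀ v, r.gq x v u = 0) → r.t u = u)
    (hf : m.IsField D X A) (hst : m.IsStationary κ D X A)
    (hT : IsInvariantVariation m κ D X A N c e) :
    ∀ p ∈ range (N + 1), ∀ q ∈ range (N + 1), ∀ σ ∈ D, r.t (c p q σ) = c p q σ := by
  have hs := h.toIsSmooth
  have hD := hκ.isOpen
  obtain ⟨hdev, hsol⟩ := (r.isStationary_iff h hκ hf).1 hst
  have hsig := r.isSigma h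
  obtain ⟨C0, -, hC₀, -, hc0, -, -⟩ := hT (fun q => X q.2) (fun q => A q.2)
    (smooth_snd hf.smooth_X) (smooth_snd hf.smooth_A) (fun q hq => hf.mapsTo hq)
    (fun _ => rfl) (fun _ => rfl)
  have hc : ∀ p q, C∞ (c p q) D := fun p q => ((hC₀ p q).slice _).congr fun σ _ => (hc0 p q σ).symm
  have key := hsig.coeff_eq_zero hκ hf.smooth_X hf.mapsTo (N := N)
    (c := fun p q σ => c p q σ - r.t (c p q σ))
    (fun p q => (hc p q).sub (r.t.contDiff.comp_contDiffOn (hc p q))) hs0 ?_ ?_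
  · intro p hp q hq σ hσ
    exact (sub_eq_zero.1 (key p hp q hq σ hσ)).symm
  · intro f σ hσ hφ
    have h1 := hnd _ (hf.mapsTo hσ) _ hφ
    rw [← h1]
    simp only [map_sum, map_smul, map_sub, r.t_t, sub_self, smul_zero, Finset.sum_const_zero]
  · intro η hη φ
    have hop : ∀ c : ℕ → ℕ → Plane → V, diffOp N (fun p q σ => c p q σ - r.t (c p q σ)) η =
        fun σ => diffOp N c η σ - r.t (diffOp N c η σ) := by
      intro c
      funext σ
      simp only [diffOp, map_sum, map_smul, smul_sub, sum_sub_distrib]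
    refine hsig.jac_strong hκ hf.smooth_X hf.mapsTo (isTest_diffOp hD (fun p q =>
      (hc p q).sub (r.t.contDiff.comp_contDiffOn (hc p q))) hη).1.contDiffOn φ fun θ hθ => ?_
    have hθφ := hθ.smul_const hD φ
    obtain ⟨ε, hε, hin⟩ := exists_small_variation hD h.isOpen_dom hf.smooth_X hf.mapsTo hθφ
    have hv : IsTest D fun σ => ε • (θ σ • φ) := by
      exact hθφ.clm_const hD (ε • ContinuousLinearMap.id ℝ V)
    set x : ℝ × Plane → V := fun q => X q.2 + Real.sin q.1 • (ε • (θ q.2 • φ)) with hxdef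
    have hS : IsOpen (cyl D) := hD.preimage continuous_snd
    have hx := (smooth_snd hf.smooth_X).add
        ((Real.contDiff_sin.comp contDiff_fst).contDiffOn.smul (smooth_snd hv.1.contDiffOn))
    have hmx : MapsTo x (cyl D) m.dom := fun q hq =>
      hin _ ⟨Real.neg_one_le_sin _, Real.sin_le_one _⟩ _ hq
    set a1 : ℝ × Plane → W × W := fun q => r.onshell (κ q.2) (x q)
      (grad (fun σ => x (q.1, σ)) q.2) + r.kerPart (x q) (A q.2) with ha1
    have ha1s := (r.smooth_onshell hκ.smooth.snd hx (smooth_grad_family hS hx) hmx).add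
        (r.smooth_kerPart hs hx (smooth_snd hf.smooth_A) hmx)
    have hx0 : ∀ σ, x (0, σ) = X σ := fun σ => by simp [hxdef]
    have ha₁0 : ∀ σ ∈ D, a1 (0, σ) = A σ := fun σ hσ => by
      simp only [ha1, hx0]
      exact r.onshell_add_kerPart (hdev σ hσ)
    obtain ⟨C, E, hC, hE, hC0, -, hinv⟩ := hT x (fun q => A q.2 + (a1 q - a1 (0, q.2))) hx
      ((smooth_snd hf.smooth_A).add (ha1s.sub (ha1s.comp
        (contDiffOn_const.prodMk contDiffOn_snd) fun q hq => hq))) hmx hx0 (fun σ => by simp)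
    set ξ : ℝ × Plane → V := fun z => diffOp N
      (fun p q σ => C p q (z.1, σ) - r.t (C p q (z.1, σ))) η z.2 with hξ
    have hξs : C∞ ξ (cyl D) :=
      smooth_diffOp_family (fun p q => (hC p q).sub (r.t.contDiff.comp_contDiffOn (hC p q))) hη.1
    have hξ0 : ∀ σ, ξ (0, σ) = diffOp N (fun p q σ => c p q σ - r.t (c p q σ)) η σ := fun σ => by
      simp only [hξ, hC0]
    have weak := hsig.integral_jac_eq_zero hκ hf.smooth_X hf.mapsTo hξs hη.2.1 hη.2.2
      (fun q hq => diffOp_eq_zero hq) hv hin hsol ?_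
    · simp only [hξ0] at weak
      have e1 : ∀ σ ∈ D, grad (fun σ => ε • (θ σ • φ)) σ = ε • grad (fun σ => θ σ • φ) σ := by
        intro σ hσ
        have := ((hθφ.1.differentiable (by simp)) σ).hasFDerivAt.const_smul ε
        have : 𝒟 (fun σ => ε • (θ σ • φ)) σ = _ := this.fderiv
        simp [grad, pdv, this]
      have e2 : ∫ σ in D, ε * (jacA (κ σ) r.gq r.bt (X σ)
          (diffOp N (fun p q σ => c p q σ - r.t (c p q σ)) η σ) (grad X σ)
          (grad (diffOp N (fun p q σ => c p q σ - r.t (c p q σ)) η) σ) (θ σ • φ)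
        + jacB (κ σ) r.gq r.bt (X σ) (diffOp N (fun p q σ => c p q σ - r.t (c p q σ)) η σ)
          (grad X σ) (grad (diffOp N (fun p q σ => c p q σ - r.t (c p q σ)) η) σ)
          (grad (fun σ => θ σ • φ) σ)) = 0 := by
        rw [← weak]
        refine integral_congr_on hD fun σ hσ => ?_
        simp only [e1 σ hσ, jacA_smul_right]
        rw [mul_add]
        congr 1
        simp only [jacB, Conf.kin, extD, Prod.smul_fst, Prod.smul_snd, map_smul,
          _root_.smul_apply, smul_eq_mul]
        ring
      rw [integral_const_mul] at e2
      exact (mul_eq_zero.1 e2).resolve_left hε.ne'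
    · intro τ
      have hxτ : C∞ (fun σ => x (τ, σ)) D := hx.slice _
      have hmτ : MapsTo (fun σ => x (τ, σ)) D m.dom := fun σ hσ => hmx (show (τ, σ) ∈ cyl D from hσ)
      have hCτ : ∀ p q, C∞ (fun σ => C p q (τ, σ)) D := fun p q => (hC p q).slice _
      have t1 : IsTest D (diffOp N (fun p q σ => C p q (τ, σ)) η) := isTest_diffOp hD hCτ hη
      have t2 : IsTest D fun σ => ξ (τ, σ) := isTest_diffOp hD (fun p q =>
        (hCτ p q).sub (r.t.contDiff.comp_contDiffOn (hCτ p q))) hη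
      have i1 := hsig.integral_dslag_eq hκ hxτ hmτ t1
      have i2 := hsig.integral_dslag_eq hκ hxτ hmτ t2
      refine i2.trans (Eq.trans ?_ (i1.symm.trans (Eq.trans ?_ (hinv τ η hη))))
      · refine integral_congr_on hD fun σ hσ => ?_
        have : (fun σ => ξ (τ, σ)) = fun σ => diffOp N (fun p q σ => C p q (τ, σ)) η σ
          - r.t (diffOp N (fun p q σ => C p q (τ, σ)) η σ) := hop fun p q σ => C p q (τ, σ)
        simp only [this]
        rw [r.grad_sub_t (t1.1.differentiable (by simp) σ), congrFun this σ, r.el_sub_t h (hmτ hσ)]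
      · refine integral_congr_on hD fun σ hσ => ?_
        have ha : A σ + (a1 (τ, σ) - a1 (0, σ)) = a1 (τ, σ) := by rw [ha₁0 σ hσ]; abel
        simp only [Geo.firstVar, ha]
        rw [r.dlag_eq h (hmτ hσ) _ (hκ.det σ hσ),
          r.dev_onshell_add_kerPart (hmτ hσ), dslag_zero, add_zero]

/-- On shell, invariant variations preserve the equation of motion of the gauge fields. -/
lemma ddev_variation (h : m.IsGauged s) (hκ : IsConf s D κ)
    (hf : m.IsField D X A) (hst : m.IsStationary κ D X A)
    (hT : IsInvariantVariation m κ D X A N c e) {η : Plane → ℝ} (hη : IsTest D η) :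
    ∀ σ ∈ D, r.ddev (κ σ) (X σ) (grad X σ) (A σ) (diffOp N c η σ) (grad (diffOp N c η) σ)
      (diffOp N e η σ) = 0 := by
  have hs := h.toIsSmooth
  have hD := hκ.isOpen
  have hS : IsOpen (cyl D) := hD.preimage continuous_snd
  obtain ⟨hdev, hsol⟩ := (r.isStationary_iff h hκ hf).1 hst
  obtain ⟨C0, E0, hC₀, hE₀, hc0, he0, -⟩ := hT (fun q => X q.2) (fun q => A q.2)
    (smooth_snd hf.smooth_X) (smooth_snd hf.smooth_A) (fun q hq => hf.mapsTo hq)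
    (fun _ => rfl) (fun _ => rfl)
  have hc : ∀ p q, C∞ (c p q) D := fun p q => ((hC₀ p q).slice _).congr fun σ _ => (hc0 p q σ).symm
  have he : ∀ p q, C∞ (e p q) D := fun p q => ((hE₀ p q).slice _).congr fun σ _ => (he0 p q σ).symm
  have hgX := smooth_grad hD hf.smooth_X
  have hRX := hs.smooth_R.comp hf.smooth_X hf.mapsTo
  intro σ hσ
  have ht := r.t_ddev hs (hf.mapsTo hσ) (κ σ) (grad X σ) (A σ) (diffOp N c η σ)
    (grad (diffOp N c η) σ) (diffOp N e η σ)
  refine r.eq_zero_of_pf h (hf.mapsTo hσ) (hκ.det σ hσ) ht.1 ht.2 fun ζ => ?_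
  have t1 := isTest_diffOp (N := N) hD hc hη
  have t2 := isTest_diffOp (N := N) hD he hη
  have hR : C∞ (fun σ => (m.R (X σ) ζ.1, m.R (X σ) ζ.2)) D :=
    (hRX.clm_apply contDiffOn_const).prodMk (hRX.clm_apply contDiffOn_const)
  have hcont := r.smooth_pf hκ.smooth hs hf.smooth_X hR
    (r.smooth_ddev hκ.smooth hs hf.smooth_X hgX hf.smooth_A
      t1.1.contDiffOn (smooth_grad hD t1.1.contDiffOn) t2.1.contDiffOn hf.mapsTo) hf.mapsTo
  refine eq_zero_of_integral_smul_eq_zero hD hcont.continuousOn (fun θ hθ => ?_) σ hσ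
  clear ht hσ σ
  obtain ⟨C, E, hC, hE, hC0, hE0, hinv⟩ := hT (fun q => X q.2)
    (fun q => A q.2 - q.1 • (θ q.2 • ζ)) (smooth_snd hf.smooth_X)
    ((smooth_snd hf.smooth_A).sub (contDiffOn_fst.smul
      (smooth_snd (hθ.smul_const hD ζ).1.contDiffOn))) (fun q hq => hf.mapsTo hq)
    (fun _ => rfl) (fun σ => by simp)
  set ξ : ℝ × Plane → V := fun z => diffOp N (fun p q σ => C p q (z.1, σ)) η z.2 with hξ
  set δ : ℝ × Plane → W × W := fun z => diffOp N (fun p q σ => E p q (z.1, σ)) η z.2 with hδ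
  have hξs := smooth_diffOp_family (N := N) hC hη.1
  have hδs := smooth_diffOp_family (N := N) hE hη.1
  set a : ℝ × Plane → W × W := fun q => A q.2 - q.1 • (θ q.2 • ζ) with ha
  have has := (smooth_snd hf.smooth_A).sub (contDiffOn_fst.smul
      (smooth_snd (hθ.smul_const hD ζ).1.contDiffOn))
  set z : ℝ × Plane → V × V := fun q => r.ddev (κ q.2) (X q.2) (grad X q.2) (a q) (ξ q)
    (grad (fun σ => ξ (q.1, σ)) q.2) (δ q) with hz
  have hk0 := hκ.smooth.snd
  have hX2 := smooth_snd hf.smooth_X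
  have hmX : MapsTo (fun q : ℝ × Plane => X q.2) (cyl D) m.dom := fun q hq => hf.mapsTo hq
  have hzs : C∞ z (cyl D) := r.smooth_ddev hk0 hs hX2 (smooth_snd hgX) has hξs
      (smooth_grad_family hS hξs) hδs hmX
  set y : ℝ × Plane → V × V := fun q => θ q.2 • (m.R (X q.2) ζ.1, m.R (X q.2) ζ.2) with hy
  have hys : C∞ y (cyl D) := (smooth_snd hθ.1.contDiffOn).smul (smooth_snd hR)
  set f : ℝ × Plane → ℝ := fun q =>
    q.1 * slag (κ q.2) (𝒟 m.G (X q.2) (ξ q)) (𝒟 r.bb (X q.2) (ξ q)) (y q)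
      + r.pf (κ q.2) (X q.2) (y q) (z q) with hfdef
  have hslag : C∞ (fun q : ℝ × Plane => slag (κ q.2) (𝒟 m.G (X q.2) (ξ q))
      (𝒟 r.bb (X q.2) (ξ q)) (y q)) (cyl D) := by
    have dG := hs.smooth_fderiv hs.smooth_G hX2 hξs hmX
    have dB := hs.smooth_fderiv (r.smooth_bb hs) hX2 hξs hmX
    exact (contDiffOn_const.mul (Geo.smooth_kin hk0 dG hys hys)).add
      (contDiffOn_const.mul ((dB.clm₂ hys.fst hys.snd).sub (dB.clm₂ hys.snd hys.fst)))
  have hfs : C∞ f (cyl D) := (contDiffOn_fst.mul hslag).add (r.smooth_pf hk0 hs hX2 hys hzs hmX)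
  have hf0 : ∀ q : ℝ × Plane, q.2 ∉ tsupport θ → f q = 0 := by
    intro q hq
    have : y q = 0 := by simp [hy, hθ.eq_zero hq]
    simp only [hfdef, this]
    simp [slag, Conf.kin, pf]
  have hint : ∀ τ, ∫ σ in D, τ * f (τ, σ) = 0 := by
    intro τ
    have t3 : IsTest D fun σ => ξ (τ, σ) := isTest_diffOp hD (fun p q => (hC p q).slice _) hη
    have h1 := hinv τ η hη
    have h2 := hsol _ t3
    have i2 : IntegrableOn (fun σ => dslag (κ σ) r.gq r.bt (X σ) (ξ (τ, σ)) (grad X σ)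
        (grad (fun σ => ξ (τ, σ)) σ)) D := by
      refine (isTest_on hD t3.2.1 t3.2.2 (smooth_dslag hκ.smooth h.isOpen_dom (r.smooth_gq hs) (r.smooth_bt hs) hf.smooth_X
        t3.1.contDiffOn hgX (smooth_grad hD t3.1.contDiffOn) hf.mapsTo)
        fun σ hσ => ?_).integrableOn
      have : ξ (τ, σ) = 0 := image_eq_zero_of_notMem_tsupport (f := fun σ => ξ (τ, σ)) hσ
      rw [this, grad_eq_zero_of_notMem hσ]
      simp [dslag, Conf.kin]
    have i1 : IntegrableOn (fun σ => τ * f (τ, σ)) D :=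
      (isTest_on hD hθ.2.1 hθ.2.2 (contDiffOn_const.mul (hfs.slice _)) fun σ hσ => by
          show τ * f (τ, σ) = 0
          rw [hf0 (τ, σ) hσ, mul_zero]).integrableOn
    have h3 := integral_add i2 i1
    rw [h2, zero_add] at h3
    rw [← h3, ← h1]
    refine integral_congr_on hD fun σ hσ => ?_
    have hx := hf.mapsTo hσ
    simp only [Geo.firstVar]
    rw [r.dlag_eq h hx _ (hκ.det σ hσ)]
    congr 1
    have hd : r.dev (κ σ) (X σ) (grad X σ) (a (τ, σ)) = τ • y (τ, σ) := by
      simp only [ha]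
      rw [r.dev_sub, hdev σ hσ, zero_add]
      simp [hy]
    have hd' : r.dev (κ σ) (X σ) (grad X σ) (A σ - τ • θ σ • ζ) = τ • y (τ, σ) := hd
    rw [hd', dslag_bb r h hx]
    simp only [hfdef, hz, slag, pf, Conf.kin, Prod.smul_fst, Prod.smul_snd, map_smul,
      _root_.smul_apply, smul_eq_mul]
    ring
  have hfs' : C∞ (fun q : ℝ × Plane => q.1 * f (q.1, q.2)) (cyl D) := contDiffOn_fst.mul hfs
  have main := hasDerivAt_integral_variation (f := fun τ σ => τ * f (τ, σ)) hθ.2.1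
    hθ.2.2 hD hS (fun σ hσ => hσ) (hfs'.of_le (by simp)) (f' := fun σ => f (0, σ))
    (fun σ hσ => by
      have h1 := hasDerivAt_family hS hfs (show ((0 : ℝ), σ) ∈ cyl D from hσ)
      have h2 := (hasDerivAt_id' (0 : ℝ)).mul h1
      have e3 : (fun τ => τ * f (τ, σ)) = (fun τ : ℝ => τ) * fun τ => f (τ, σ) := rfl
      rw [e3]
      simpa using h2)
    (fun τ σ _ hσ => by simp only [hf0 (τ, σ) hσ, hf0 (0, σ) hσ, mul_zero])
  simp only [zero_mul, sub_zero, hint] at main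
  have hfin := main.unique (hasDerivAt_const 0 (0 : ℝ))
  rw [← hfin]
  refine integral_congr_on hD fun σ hσ => ?_
  have hξ0 : (fun σ => ξ (0, σ)) = diffOp N c η := by funext σ; simp only [hξ, hC0]
  have hδ0 : δ (0, σ) = diffOp N e η σ := by simp only [hδ, hE0]
  have ha0 : a (0, σ) = A σ := by simp [ha]
  simp only [hfdef, zero_mul, zero_add, hz, hξ0, hδ0, ha0, congrFun hξ0 σ, hy]
  simp only [pf, Conf.kin, Prod.smul_fst, Prod.smul_snd, map_smul, _root_.smul_apply, smul_eq_mul]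
  ring

end Reduction

namespace Reduction

variable {m : Geo V W} {s : ℝ} (r : Reduction m s) {D : Set Plane} {κ : Plane → Conf}
  {X : Plane → V} {A : Plane → W × W}

/-- On shell, an invariant variation is a gauge variation, up to a translation of `A` along the
kernel of the anchor. -/
lemma exists_gauge_parameters (h : m.IsGauged s) (hs0 : s ≠ 0) (hκ : IsConf s D κ)
    (hnd : ∀ x ∈ m.dom, ∀ u, (∀ v, r.gq x v u = 0) → r.t u = u)
    (hf : m.IsField D X A) (hst : m.IsStationary κ D X A) {N : ℕ} {c : ℕ → ℕ → Plane → V}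
    {e : ℕ → ℕ → Plane → W × W} (hT : IsInvariantVariation m κ D X A N c e) {η : Plane → ℝ}
    (hη : IsTest D η) :
    ∃ (ε : Plane → W) (z : Plane → W × W), IsTest D ε ∧ IsTest D z ∧ ∀ σ ∈ D,
      m.R (X σ) (ε σ) = diffOp N c η σ ∧ m.R (X σ) (z σ).1 = 0 ∧ m.R (X σ) (z σ).2 = 0 ∧
      diffOp N e η σ = m.gaugeVarA κ X A ε σ + z σ := by
  have hs := h.toIsSmooth
  have hD := hκ.isOpen
  have htr := r.transversal_eq_zero h hs0 hκ hnd hf hst hT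
  have hdd := r.ddev_variation h hκ hf hst hT hη
  have hdev := ((r.isStationary_iff h hκ hf).1 hst).1
  obtain ⟨C0, E0, hC₀, hE₀, hc0, he0, -⟩ := hT (fun q => X q.2) (fun q => A q.2)
    (smooth_snd hf.smooth_X) (smooth_snd hf.smooth_A) (fun q hq => hf.mapsTo hq)
    (fun _ => rfl) (fun _ => rfl)
  have hc : ∀ p q, C∞ (c p q) D := fun p q => ((hC₀ p q).slice _).congr fun σ _ => (hc0 p q σ).symm
  have he : ∀ p q, C∞ (e p q) D := fun p q => ((hE₀ p q).slice _).congr fun σ _ => (he0 p q σ).symm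
  have t1 := isTest_diffOp (N := N) hD hc hη
  have t2 := isTest_diffOp (N := N) hD he hη
  have htan : ∀ σ ∈ D, r.t (diffOp N c η σ) = diffOp N c η σ := fun σ hσ => by
    simp only [diffOp, map_sum, map_smul]
    exact sum_congr rfl fun p hp => sum_congr rfl fun q hq => by rw [htr p hp q hq σ hσ]
  have hε : IsTest D fun σ => r.Rp (X σ) (diffOp N c η σ) :=
    t1.clm_apply hD (r.smooth_Rp.comp hf.smooth_X hf.mapsTo)
  set ε : Plane → W := fun σ => r.Rp (X σ) (diffOp N c η σ) with hεdef
  have hRε : ∀ σ ∈ D, m.R (X σ) (ε σ) = diffOp N c η σ := fun σ hσ => by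
    rw [hεdef, r.R_Rp _ (hf.mapsTo hσ), htan σ hσ]
  have hg : IsTest D (m.gaugeVarA κ X A ε) := by
    refine isTest_on hD hε.2.1 hε.2.2 (h.smooth_gaugeA hκ.smooth hf.smooth_X (smooth_grad hD hf.smooth_X) hf.smooth_A hε.1.contDiffOn
      (smooth_grad hD hε.1.contDiffOn) hf.mapsTo) fun σ hσ => ?_
    simp only [Geo.gaugeVarA, hε.eq_zero hσ, grad_eq_zero_of_notMem hσ]
    simp [Geo.gaugeA]
  refine ⟨ε, fun σ => diffOp N e η σ - m.gaugeVarA κ X A ε σ, hε, ?_, fun σ hσ => ?_⟩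
  · have := t2.add (hg.clm_const hD (-ContinuousLinearMap.id ℝ (W × W)))
    convert this using 1
    funext σ
    simp [sub_eq_add_neg]
  have hg1 := r.ddev_gauge h (hf.mapsTo hσ) (hκ.det σ hσ) (hdev σ hσ) (ε σ) (grad ε σ)
  rw [← hs.grad_R hD hf hε.1.contDiffOn hσ, hRε σ hσ] at hg1
  have hgr : grad (fun σ => m.R (X σ) (ε σ)) σ = grad (diffOp N c η) σ := by
    have : (fun σ => m.R (X σ) (ε σ)) =ᶠ[𝓝 σ] diffOp N c η := by
      filter_upwards [hD.mem_nhds hσ] with y hy using hRε y hy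
    simp only [grad, pdv, this.fderiv_eq]
  rw [hgr] at hg1
  have hR := r.R_eq_of_ddev_eq ((hdd σ hσ).trans hg1.symm)
  exact ⟨hRε σ hσ, hR.1, hR.2, by simp⟩

/-- In Lorentzian signature the reduced metric is positive on transversal vectors. -/
lemma gq_pos (hs : s = -1) {x : V} (hx : x ∈ m.dom) (hG : ∀ v, v ≠ 0 → 0 < m.G x v v) {u : V}
    (hu : r.t u ≠ u) : 0 < r.gq x u u := by
  have hN : r.N x u ≠ 0 := fun h0 => hu (by
    have := r.t_N x hx u
    rw [h0, zero_sub, map_neg] at this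
    exact neg_injective this)
  have h1 := hG _ hN
  have h2 : 0 ≤ m.G x (r.M x u) (r.M x u) := by
    by_cases hM : r.M x u = 0
    · simp [hM]
    · exact (hG _ hM).le
  rw [gq_apply]
  subst hs
  linarith

lemma extDeriv_t (h : m.IsGauged s) {x : V} (hx : x ∈ m.dom) (ξ u v : V) :
    extD r.bt x (r.t ξ) u v = 0 := by
  rw [← r.R_Rp x hx]; exact r.extDeriv_bt_R h hx _ _ _

lemma hasFDerivAt_extDeriv (h : m.IsGauged s) {x : V} (hx : x ∈ m.dom) (u v w : V) :
    HasFDerivAt (fun x => extD r.bt x u v w) ((((𝒟 (𝒟 r.bt) x).flip u).flip v).flip w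
        + (((𝒟 (𝒟 r.bt) x).flip v).flip w).flip u
        + (((𝒟 (𝒟 r.bt) x).flip w).flip u).flip v) x := by
  have hb := r.smooth_bt h.toIsSmooth
  have h0 := (hb.smooth_fderiv h.isOpen_dom).fderivAt h.isOpen_dom hx
  have key : ∀ u v w, HasFDerivAt (fun x => 𝒟 r.bt x u v w)
      ((((𝒟 (𝒟 r.bt) x).flip u).flip v).flip w) x := fun u v w => by
    have := ((h0.app u).app v).app w
    refine this.congr_fderiv ?_
    ext ξ
    simp
  exact ((key u v w).add (key v w u)).add (key w u v)

/-- The field strength of the reduced 2-form is constant along the leaves, since it is closed and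
horizontal. -/
lemma fderiv_extDeriv_t (h : m.IsGauged s) {x : V} (hx : x ∈ m.dom) (ξ u v w : V) :
    𝒟 (fun x => extD r.bt x u v w) x (r.t ξ) = 0 := by
  have hb := r.smooth_bt h.toIsSmooth
  have hsym : ∀ a b, 𝒟 (𝒟 r.bt) x a b = 𝒟 (𝒟 r.bt) x b a := fun a b =>
    (hb.contDiffAt (h.isOpen_dom.mem_nhds hx)).isSymmSndFDerivAt (by
      rw [minSmoothness_of_isRCLikeNormedField]
      exact WithTop.coe_le_coe.2 (le_top : (2 : ℕ∞) ≤ ⊤)) a b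
  have hanti : ∀ a b u v, 𝒟 (𝒟 r.bt) x a b u v = -𝒟 (𝒟 r.bt) x a b v u := by
    intro a b u v
    have h0 := (hb.smooth_fderiv h.isOpen_dom).fderivAt h.isOpen_dom hx
    have h1 := ((h0.app b).app u).app v
    have h2 := (((h0.app b).app v).app u).neg
    have h3 :=
      eventually_of_mem (h.isOpen_dom.mem_nhds hx) fun y hy => r.antisymm_fderiv_bt h hy b u v
    have := DFunLike.congr_fun (h1.unique (h2.congr_of_eventuallyEq h3)) a
    simpa using this
  have hz : ∀ a u v, 𝒟 (fun x => extD r.bt x (r.t ξ) u v) x a = 0 := by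
    intro a u v
    have : (fun x => extD r.bt x (r.t ξ) u v) =ᶠ[𝓝 x] fun _ => 0 :=
      eventually_of_mem (h.isOpen_dom.mem_nhds hx) fun y hy => r.extDeriv_t h hy ξ u v
    rw [this.fderiv_eq]
    simp
  have z1 := hz u v w
  have z2 := hz v w u
  have z3 := hz w u v
  rw [(r.hasFDerivAt_extDeriv h hx _ _ _).fderiv] at z1 z2 z3 ⊢
  simp only [_root_.add_apply, ContinuousLinearMap.flip_apply] at *
  rw [hsym u (r.t ξ)] at z1
  rw [hsym v (r.t ξ), hsym v u] at z2
  rw [hsym w (r.t ξ), hsym w u, hsym w v] at z3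
  have a1 := hanti u v w (r.t ξ)
  have a2 := hanti u w (r.t ξ) v
  have a3 := hanti v w u (r.t ξ)
  linear_combination z1 + z2 + z3 - a1 - a2 - a3

end Reduction

/-! ### The model on the leaf space -/

/-- The leaf space of a product chart: the projection `pr` to the transversal coordinates, the
inclusion `j` of a slice through the points with tangential part `c0`, and the convexity of the
leaves. -/
structure LeafSpace {m : Geo V W} {s : ℝ} (r : Reduction m s) (Q : Type*) [NormedAddCommGroup Q]
    [NormedSpace ℝ Q] where
  pr : V ⊸ Q
  j : Q ⊸ V
  c0 : V
  pr_j : ∀ q, pr (j q) = q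
  j_pr : ∀ v, j (pr v) = v - r.t v
  pr_c₀ : pr c0 = 0
  slice_mem : ∀ x ∈ m.dom, j (pr x) + c0 ∈ m.dom
  segment : ∀ x ∈ m.dom, ∀ x' ∈ m.dom, pr x = pr x' → ∀ τ ∈ Icc (0 : ℝ) 1, x + τ • (x' - x) ∈ m.dom

namespace LeafSpace

variable {m : Geo V W} {s : ℝ} {r : Reduction m s} {Q : Type*} [NormedAddCommGroup Q]
  [NormedSpace ℝ Q] (l : LeafSpace r Q)

/-- The leaf space as an open set of transversal coordinates. -/
def dom : Set Q := {y | l.j y + l.c0 ∈ m.dom}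

/-- Restriction of a field of bilinear forms to the slice. -/
def slice (b : V → V ⊸ V ⊸ ℝ) (y : Q) : Q ⊸ Q ⊸ ℝ := (b (l.j y + l.c0)).bilinearComp l.j l.j

lemma dom_eq_image : l.dom = l.pr '' m.dom := by
  ext y
  constructor
  · intro hy
    exact ⟨_, hy, by simp [l.pr_j, l.pr_c₀]⟩
  · rintro ⟨x, hx, rfl⟩
    exact l.slice_mem x hx

lemma mem_dom {x : V} (hx : x ∈ m.dom) : l.pr x ∈ l.dom := l.slice_mem x hx

lemma t_j (q : Q) : r.t (l.j q) = 0 := by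
  have := l.j_pr (l.j q)
  rw [l.pr_j] at this
  exact sub_eq_self.1 this.symm

lemma isOpen_dom (h : m.IsSmooth) : IsOpen l.dom :=
  h.isOpen_dom.preimage (l.j.continuous.add continuous_const)

lemma hasFDerivAt_slice_point (y : Q) : HasFDerivAt (fun y => l.j y + l.c0) l.j y :=
  l.j.hasFDerivAt.add_const _

lemma smooth_slice {b : V → V ⊸ V ⊸ ℝ} (hb : C∞ b m.dom) : C∞ (l.slice b) l.dom := by
  have h1 : C∞ (fun y => b (l.j y + l.c0)) l.dom :=
    hb.comp (l.j.contDiff.add contDiff_const).contDiffOn fun y hy => hy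
  have h2 := (flipₗᵢ ℝ Q V ℝ).contDiff.comp_contDiffOn (h1.clm_comp (contDiffOn_const (c := l.j)))
  exact (flipₗᵢ ℝ Q Q ℝ).contDiff.comp_contDiffOn (h2.clm_comp (contDiffOn_const))

lemma slice_apply (b : V → V ⊸ V ⊸ ℝ) (y u v : Q) :
    l.slice b y u v = b (l.j y + l.c0) (l.j u) (l.j v) := rfl

lemma fderiv_slice (h : m.IsSmooth) {b : V → V ⊸ V ⊸ ℝ} (hb : C∞ b m.dom)
    {y : Q} (hy : y ∈ l.dom) (η u v : Q) :
    𝒟 (l.slice b) y η u v = 𝒟 b (l.j y + l.c0) (l.j η) (l.j u) (l.j v) := by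
  have h0 := (l.smooth_slice hb).fderivAt (l.isOpen_dom h) hy
  have h1 := (h0.app u).app v
  have hb0 := hb.fderivAt h.isOpen_dom hy
  have hb1 := HasFDerivAt.comp y hb0 (l.hasFDerivAt_slice_point y)
  have h2 := (hb1.app (l.j u)).app (l.j v)
  have := DFunLike.congr_fun (h1.unique h2) η
  simpa using this

lemma isSigma (h : m.IsGauged s) : IsSigma l.dom (l.slice r.gq) (l.slice r.bt) where
  isOpen := l.isOpen_dom h.toIsSmooth
  smooth_g := l.smooth_slice (r.smooth_gq h.toIsSmooth)
  smooth_b := l.smooth_slice (r.smooth_bt h.toIsSmooth)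
  symm _ hy _ _ := r.gq_symm h hy _ _
  antisymm _ hy _ _ := r.bt_antisymm h hy _ _

/-- A function on the chart with vanishing derivatives along the leaves is constant on leaves. -/
lemma eq_of_fderiv_t {F : Type*} [NormedAddCommGroup F] [NormedSpace ℝ F] (h : m.IsSmooth)
    {f : V → F} (hf : DifferentiableOn ℝ f m.dom) (h0 : ∀ x ∈ m.dom, ∀ ξ, 𝒟 f x (r.t ξ) = 0)
    {x x' : V} (hx : x ∈ m.dom) (hx' : x' ∈ m.dom) (hp : l.pr x = l.pr x') : f x = f x' := by
  have ht : r.t (x' - x) = x' - x := by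
    have := l.j_pr (x' - x)
    rw [map_sub, hp, sub_self, map_zero] at this
    exact (sub_eq_zero.1 this.symm).symm
  have hd : ∀ τ ∈ Icc (0 : ℝ) 1, HasDerivAt (fun τ : ℝ => f (x + τ • (x' - x))) 0 τ := by
    intro τ hτ
    have hm := l.segment x hx x' hx' hp τ hτ
    have h1 : HasDerivAt (fun τ : ℝ => x + τ • (x' - x)) (x' - x) τ := by
      simpa using ((hasDerivAt_id τ).smul_const (x' - x)).const_add x
    have h2 := (hf.differentiableAt (h.isOpen_dom.mem_nhds hm)).hasFDerivAt
    have h3 := HasFDerivAt.comp_hasDerivAt τ h2 h1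
    have h4 := h0 _ hm (x' - x)
    rw [ht] at h4
    rw [h4] at h3
    exact h3
  have := (convex_Icc (0 : ℝ) 1).is_const_of_fderivWithin_eq_zero
   
    (fun τ hτ => (hd τ hτ).differentiableAt.differentiableWithinAt) (fun τ hτ => by
      rw [((hd τ hτ).hasFDerivAt.hasFDerivWithinAt).fderivWithin
        (uniqueDiffOn_Icc zero_lt_one τ hτ)]
      ext; simp)
    (Set.left_mem_Icc.2 zero_le_one) (Set.right_mem_Icc.2 zero_le_one)
  simpa using this

lemma gq_eq (h : m.IsGauged s) {x : V} (hx : x ∈ m.dom) (u v : V) :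
    r.gq x u v = l.slice r.gq (l.pr x) (l.pr u) (l.pr v) := by
  have h1 := l.eq_of_fderiv_t h.toIsSmooth ((r.smooth_gq h.toIsSmooth).differentiableOn (by simp))
      (fun x hx ξ => by rw [← r.R_Rp x hx]; exact r.fderiv_gq_R h hx _) hx (l.slice_mem x hx)
      (by simp [l.pr_j, l.pr_c₀])
  have hx' := l.slice_mem x hx
  rw [slice_apply, ← h1, l.j_pr, l.j_pr, map_sub, map_sub, _root_.sub_apply, _root_.sub_apply,
    r.gq_t hx, r.gq_t hx, r.gq_symm h hx u (r.t v), r.gq_t hx]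
  ring

lemma extDeriv_eq (h : m.IsGauged s) {x : V} (hx : x ∈ m.dom) (ξ u v : V) :
    extD r.bt x ξ u v = extD (l.slice r.bt) (l.pr x) (l.pr ξ) (l.pr u) (l.pr v) := by
  have h1 := l.eq_of_fderiv_t h.toIsSmooth
      (fun y hy => (r.hasFDerivAt_extDeriv h hy _ _ _).differentiableAt.differentiableWithinAt)
      (fun x hx ζ => r.fderiv_extDeriv_t h hx ζ ξ u v) hx (l.slice_mem x hx)
      (by simp [l.pr_j, l.pr_c₀])
  have hx' := l.slice_mem x hx
  have hcyc : ∀ a b c, extD r.bt (l.j (l.pr x) + l.c0) a b c =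
      extD r.bt (l.j (l.pr x) + l.c0) b c a := fun a b c => by simp only [extD]; ring
  have hsub : ∀ a b c, extD r.bt (l.j (l.pr x) + l.c0) (a - r.t a) b c =
      extD r.bt (l.j (l.pr x) + l.c0) a b c := fun a b c => by
    have := r.extDeriv_t h hx' a b c
    simp only [extD, map_sub, _root_.sub_apply] at this ⊢
    linear_combination -this
  have hb := r.smooth_bt h.toIsSmooth
  have hs := fun a b c => l.fderiv_slice h.toIsSmooth hb hx' a b c
  rw [h1]
  conv_rhs => rw [extD, hs, hs, hs]
  clear h1 hs
  change _ = extD r.bt (l.j (l.pr x) + l.c0) (l.j (l.pr ξ)) (l.j (l.pr u)) (l.j (l.pr v))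
  have hsub2 : ∀ a b c, extD r.bt (l.j (l.pr x) + l.c0) a (b - r.t b) c =
      extD r.bt (l.j (l.pr x) + l.c0) a b c := fun a b c => by rw [hcyc, hsub, ← hcyc]
  have hsub3 : ∀ a b c, extD r.bt (l.j (l.pr x) + l.c0) a b (c - r.t c) =
      extD r.bt (l.j (l.pr x) + l.c0) a b c := fun a b c => by rw [hcyc, hsub2, ← hcyc]
  rw [l.j_pr ξ, l.j_pr u, l.j_pr v, hsub, hsub2, hsub3]

lemma fderiv_gq_eq (h : m.IsGauged s) {x : V} (hx : x ∈ m.dom) (ξ u v : V) :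
    𝒟 r.gq x ξ u v = 𝒟 (l.slice r.gq) (l.pr x) (l.pr ξ) (l.pr u) (l.pr v) := by
  have hg := r.smooth_gq h.toIsSmooth
  have h0 := hg.fderivAt h.isOpen_dom hx
  have h1 := (h0.app u).app v
  have hq0 := (l.smooth_slice hg).fderivAt (l.isOpen_dom h.toIsSmooth) (l.mem_dom hx)
  have hq1 := HasFDerivAt.comp x hq0 l.pr.hasFDerivAt
  have h2 := (hq1.app (l.pr u)).app (l.pr v)
  have h3 := eventually_of_mem (h.isOpen_dom.mem_nhds hx) fun y hy => l.gq_eq h hy u v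
  have := DFunLike.congr_fun (h1.unique (h2.congr_of_eventuallyEq h3)) ξ
  simpa using this

lemma el_eq (h : m.IsGauged s) {x : V} (hx : x ∈ m.dom) (k : Conf) (ξ : V) (u p : V × V) :
    el k r.gq r.bt x ξ u p = el k (l.slice r.gq) (l.slice r.bt) (l.pr x) (l.pr ξ)
      (l.pr u.1, l.pr u.2) (l.pr p.1, l.pr p.2) := by
  simp only [el, Conf.kin, l.gq_eq h hx, l.fderiv_gq_eq h hx, l.extDeriv_eq h hx]

lemma grad_clm {F F' : Type*} [NormedAddCommGroup F] [NormedSpace ℝ F] [NormedAddCommGroup F']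
    [NormedSpace ℝ F'] (L : F ⊸ F') {f : Plane → F} {z : Plane}
    (hf : DifferentiableAt ℝ f z) :
    grad (fun z => L (f z)) z = (L (grad f z).1, L (grad f z).2) := by
  have h : 𝒟 (fun z => L (f z)) z = _ := (L.hasFDerivAt.comp z hf.hasFDerivAt).fderiv
  simp [grad, pdv, h]

variable {D : Set Plane} {κ : Plane → Conf} {X : Plane → V} {A : Plane → W × W}

/-- The reduced equations of motion are those of the model on the leaf space. -/
lemma stationary_iff (h : m.IsGauged s) (hκ : IsConf s D κ) (hX : C∞ X D) (hm : MapsTo X D m.dom) :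
    (∀ ξ, IsTest D ξ → ∫ z in D, dslag (κ z) r.gq r.bt (X z) (ξ z) (grad X z) (grad ξ z) = 0) ↔
      ∀ ζ : Plane → Q, IsTest D ζ → ∫ z in D, dslag (κ z) (l.slice r.gq) (l.slice r.bt)
        (l.pr (X z)) (ζ z) (grad (fun z => l.pr (X z)) z) (grad ζ z) = 0 := by
  have hD := hκ.isOpen
  have hprX : C∞ (fun z => l.pr (X z)) D := l.pr.contDiff.comp_contDiffOn hX
  have hprm : MapsTo (fun z => l.pr (X z)) D l.dom := fun z hz => l.mem_dom (hm hz)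
  have key : ∀ ξ : Plane → V, IsTest D ξ →
      ∫ z in D, dslag (κ z) r.gq r.bt (X z) (ξ z) (grad X z) (grad ξ z) =
      ∫ z in D, dslag (κ z) (l.slice r.gq) (l.slice r.bt) (l.pr (X z)) (l.pr (ξ z))
        (grad (fun z => l.pr (X z)) z) (grad (fun z => l.pr (ξ z)) z) := by
    intro ξ hξ
    have hζ := hξ.clm_const hD l.pr
    rw [(r.isSigma h).integral_dslag_eq hκ hX hm hξ,
      (l.isSigma h).integral_dslag_eq hκ hprX hprm hζ]
    refine integral_congr_on hD fun z hz => ?_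
    rw [l.el_eq h (hm hz), grad_clm l.pr (hX.fderivAt hD hz).differentiableAt,
      grad_clm l.pr (hξ.1.differentiable (by simp) z)]
  constructor
  · intro H ζ hζ
    have hξ := hζ.clm_const hD l.j
    have := key _ hξ
    simp only [l.pr_j] at this
    rw [← this]
    exact H _ hξ
  · intro H ξ hξ
    rw [key ξ hξ]
    exact H _ (hξ.clm_const hD l.pr)

/-- The lift of a map to the leaf space to a field configuration satisfying the equation of motion
of the gauge fields. -/
lemma exists_lift (hκ : IsConf s D κ) {Y : Plane → Q} (hY : C∞ Y D) (hYm : MapsTo Y D l.dom) :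
    ∃ (X : Plane → V) (A : Plane → W × W), m.IsField D X A ∧
      (∀ z ∈ D, r.dev (κ z) (X z) (grad X z) (A z) = 0) ∧ ∀ z, l.pr (X z) = Y z := by
  have hX : C∞ (fun z => l.j (Y z) + l.c0) D :=
    (l.j.contDiff.comp_contDiffOn hY).add contDiffOn_const
  refine ⟨fun z => l.j (Y z) + l.c0, fun z => r.onshell (κ z) (l.j (Y z) + l.c0)
    (grad (fun z => l.j (Y z) + l.c0) z), ⟨hX, ?_, fun z hz => hYm hz⟩, ?_, ?_⟩
  · exact r.smooth_onshell hκ.smooth hX (smooth_grad hκ.isOpen hX) fun z hz => hYm hz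
  · intro z hz
    exact r.dev_onshell (hYm hz) _ _
  · simp [l.pr_j, l.pr_c₀]

lemma slice_gq_nondegenerate (h : m.IsGauged s)
    (hnd : ∀ x ∈ m.dom, ∀ u, (∀ v, r.gq x v u = 0) → r.t u = u) {y : Q} (hy : y ∈ l.dom) {q : Q}
    (hq : ∀ p, l.slice r.gq y p q = 0) : q = 0 := by
  have := hnd _ hy (l.j q) fun v => by
    have := l.gq_eq h hy v (l.j q)
    rw [this, l.pr_j]
    simpa [l.pr_j, l.pr_c₀] using hq (l.pr v)
  rw [l.t_j] at this
  rw [← l.pr_j q, ← this, map_zero]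

end LeafSpace

end

section

/-! ### Solving the equation of motion of the gauge fields -/

section Inverse

variable {V : Type*} [NormedAddCommGroup V] [NormedSpace ℝ V] [FiniteDimensional ℝ V]
  {Z : Type*} [NormedAddCommGroup Z] [NormedSpace ℝ Z] {S : Set Z}

/-- A smooth family of injective endomorphisms has a smooth family of inverses. -/
lemma exists_smooth_inverse {F : Z → V ⊸ V} (hF : C∞ F S) (hinj : ∀ x ∈ S, ∀ v, F x v = 0 → v = 0) :
    ∃ I : Z → V ⊸ V, C∞ I S ∧ ∀ x ∈ S, ∀ v, F x (I x v) = v := by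
  have : CompleteSpace V := FiniteDimensional.complete ℝ V
  have hu : ∀ x ∈ S, IsUnit (F x) := fun x hx => by
    have hi : Function.Injective (F x : V →ₗ[ℝ] V) :=
      (injective_iff_map_eq_zero _).2 fun v => hinj x hx v
    refine ⟨ContinuousLinearEquiv.toUnit
      (LinearEquiv.ofInjectiveEndo _ hi).toContinuousLinearEquiv, ?_⟩
    ext v
    rfl
  refine ⟨fun x => Ring.inverse (F x), fun x hx => ?_, fun x hx v => ?_⟩
  · obtain ⟨u, hu'⟩ := hu x hx
    have h0 := contDiffAt_ringInverse ℝ (n := ∞) u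
    rw [hu'] at h0
    exact h0.comp_contDiffWithinAt x (hF x hx)
  · exact DFunLike.congr_fun (Ring.mul_inverse_cancel _ (hu x hx)) v

end Inverse

variable {V W K : Type*} [NormedAddCommGroup V] [InnerProductSpace ℝ V] [FiniteDimensional ℝ V]
  [NormedAddCommGroup W] [InnerProductSpace ℝ W] [FiniteDimensional ℝ W]
  [NormedAddCommGroup K] [InnerProductSpace ℝ K] [FiniteDimensional ℝ K]
  {Z : Type*} [NormedAddCommGroup Z] [NormedSpace ℝ Z] {S : Set Z}

lemma exists_adjoint (f : Z → W ⊸ V) (hf : C∞ f S) :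
    ∃ g : Z → V ⊸ W, C∞ g S ∧ ∀ x v w, inner ℝ (g x v) w = inner ℝ v (f x w) := by
  have : CompleteSpace V := FiniteDimensional.complete ℝ V
  have : CompleteSpace W := FiniteDimensional.complete ℝ W
  have h : IsBoundedLinearMap ℝ fun f : W ⊸ V => ContinuousLinearMap.adjoint f :=
    ⟨⟨fun _ _ => map_add _ _ _, fun c f => by simp⟩, 1, one_pos, fun f => by simp⟩
  have h2 : ContDiff ℝ ∞ fun f : W ⊸ V => ContinuousLinearMap.adjoint f := h.contDiff
  exact ⟨_, h2.comp_contDiffOn hf, fun x v w => ContinuousLinearMap.adjoint_inner_left _ _ _⟩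

/-- A family of linear maps with constant image, the image of the projection `t`, has a smooth
right inverse. -/
lemma exists_right_inverse {R : Z → W ⊸ V} (hR : C∞ R S) (t : V ⊸ V) (tt : ∀ v, t (t v) = t v)
    (tR : ∀ x ∈ S, ∀ a, t (R x a) = R x a) (hsurj : ∀ x ∈ S, ∀ v, t v = v → ∃ a, R x a = v) :
    ∃ Rp : Z → V ⊸ W, C∞ Rp S ∧ ∀ x ∈ S, ∀ v, R x (Rp x v) = t v := by
  obtain ⟨Rt, hRt, hin⟩ := exists_adjoint R hR
  obtain ⟨I, hI, h⟩ := exists_smooth_inverse (F := fun x => R x ∘L Rt x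
    + (ContinuousLinearMap.id ℝ V - t)) (S := S) ((hR.clm_comp hRt).add contDiffOn_const)
    fun x hx v hv => by
      have hv : R x (Rt x v) + (v - t v) = 0 := by simpa using hv
      have h1 := congrArg t hv
      rw [map_add, map_sub, tR x hx, tt, sub_self, add_zero, map_zero] at h1
      have h2 : Rt x v = 0 := by rw [← inner_self_eq_zero (𝕜 := ℝ), hin, h1, inner_zero_right]
      rw [h1, zero_add, sub_eq_zero] at hv
      obtain ⟨a, ha⟩ := hsurj x hx v hv.symm
      rw [← inner_self_eq_zero (𝕜 := ℝ)]
      nth_rewrite 2 [← ha]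
      rw [← hin, h2, inner_zero_left]
  refine ⟨fun x => Rt x ∘L I x, hRt.clm_comp hI, fun x hx v => ?_⟩
  have h1 := h x hx v
  have h2 := congrArg t h1
  simp only [_root_.add_apply, _root_.sub_apply, comp_apply,
    id_apply, map_add, map_sub, tR x hx, tt, sub_self, add_zero] at h2
  exact h2

omit [FiniteDimensional ℝ V] in
/-- For an exact sequence of families of linear maps, the first map has a smooth family of right
inverses on the kernel of the second. -/
lemma exists_section_on_ker {T : Z → K ⊸ W} {R : Z → W ⊸ V} {Rp : Z → V ⊸ W}
    (hT : C∞ T S) (hR : C∞ R S) (hRp : C∞ Rp S)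
    (hRR : ∀ x ∈ S, ∀ a, R x (Rp x (R x a)) = R x a) (hRT : ∀ x ∈ S, ∀ l, R x (T x l) = 0)
    (hex : ∀ x ∈ S, ∀ a, R x a = 0 → ∃ l, T x l = a) :
    ∃ J : Z → W ⊸ K, C∞ J S ∧ ∀ x ∈ S, ∀ a, R x a = 0 → T x (J x a) = a := by
  obtain ⟨Tt, hTt, hin⟩ := exists_adjoint T hT
  obtain ⟨I, hI, h⟩ := exists_smooth_inverse (F := fun x => T x ∘L Tt x + Rp x ∘L R x) (S := S)
    ((hT.clm_comp hTt).add (hRp.clm_comp hR)) fun x hx v hv => by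
      have hv : T x (Tt x v) + Rp x (R x v) = 0 := by simpa using hv
      have h1 := congrArg (R x) hv
      rw [map_add, hRT x hx, hRR x hx, zero_add, map_zero] at h1
      rw [h1, map_zero, add_zero] at hv
      have h2 : Tt x v = 0 := by rw [← inner_self_eq_zero (𝕜 := ℝ), hin, hv, inner_zero_right]
      obtain ⟨a, ha⟩ := hex x hx v h1
      rw [← inner_self_eq_zero (𝕜 := ℝ)]
      nth_rewrite 2 [← ha]
      rw [← hin, h2, inner_zero_left]
  refine ⟨fun x => Tt x ∘L I x, hTt.clm_comp hI, fun x hx a ha => ?_⟩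
  have h1 : T x (Tt x (I x a)) + Rp x (R x (I x a)) = a := h x hx a
  have h2 := congrArg (R x) h1
  rw [map_add, hRT x hx, hRR x hx, zero_add, ha] at h2
  rwa [h2, map_zero, add_zero] at h1

/-- Smooth dependence on parameters of the solution `(y, z)` of `P y - Q z = -P v`,
`-s P z - Q y = Q v` in the image of the projection `t`. -/
lemma exists_smooth_solution {P Q : Z → V ⊸ V} {s : ℝ} (hP : C∞ P S)
    (hQ : C∞ Q S) (t : V ⊸ V) (tt : ∀ v, t (t v) = t v)
    (tP : ∀ x ∈ S, ∀ y, t (P x y) = P x y) (tQ : ∀ x ∈ S, ∀ y, t (Q x y) = Q x y)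
    (hinj : ∀ x ∈ S, ∀ y z, t y = y → t z = z → P x y - Q x z = 0 →
      -(s • P x z) - Q x y = 0 → y = 0 ∧ z = 0) :
    ∃ Y M : Z → V ⊸ V, C∞ Y S ∧ C∞ M S ∧ ∀ x ∈ S, ∀ v,
      t (Y x v) = Y x v ∧ t (M x v) = M x v ∧ P x (Y x v) - Q x (M x v) = -P x v ∧
      -(s • P x (M x v)) - Q x (Y x v) = Q x v := by
  set c : V ⊸ V := ContinuousLinearMap.id ℝ V - t with hc
  obtain ⟨a1, ha1⟩ : ∃ a : V × V ⊸ V, ∀ p, a p = p.1 := ⟨fst ℝ V V, fun _ => rfl⟩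
  obtain ⟨a2, ha2⟩ : ∃ a : V × V ⊸ V, ∀ p, a p = p.2 := ⟨snd ℝ V V, fun _ => rfl⟩
  obtain ⟨b1, hb1⟩ : ∃ b : V ⊸ V × V, ∀ p, b p = (p, 0) := ⟨inl ℝ V V, fun _ => rfl⟩
  obtain ⟨b2, hb2⟩ : ∃ b : V ⊸ V × V, ∀ p, b p = (0, p) := ⟨inr ℝ V V, fun _ => rfl⟩
  set L : Z → V × V ⊸ V × V := fun x => b1 ∘L (P x ∘L a1 - Q x ∘L a2 + c ∘L a1)
      + b2 ∘L (-(s • P x ∘L a2) - Q x ∘L a1 + c ∘L a2) with hL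
  have hLs : C∞ L S := by
    have i1 := hP.clm_comp (contDiffOn_const (c := a1))
    have i2 := hP.clm_comp (contDiffOn_const (c := a2))
    have i3 := hQ.clm_comp (contDiffOn_const (c := a1))
    have i4 := hQ.clm_comp (contDiffOn_const (c := a2))
    have j1 := (contDiffOn_const (c := b1)).clm_comp ((i1.sub i4).add
      (contDiffOn_const (c := c ∘L a1)))
    have j2 := (contDiffOn_const (c := b2)).clm_comp (((i2.const_smul s).neg.sub i3).add
      (contDiffOn_const (c := c ∘L a2)))
    exact j1.add j2
  have hLv : ∀ x y z, L x (y, z) =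
      (P x y - Q x z + (y - t y), -(s • P x z) - Q x y + (z - t z)) := fun x y z => by
    simp [hL, hc, ha1, ha2, hb1, hb2]
  have solve : ∀ x ∈ S, ∀ y z p q, t p = p → t q = q → L x (y, z) = (p, q) →
      t y = y ∧ t z = z ∧ P x y - Q x z = p ∧ -(s • P x z) - Q x y = q := by
    intro x hx y z p q hp hq he
    rw [hLv, Prod.mk.injEq] at he
    obtain ⟨e1, e2⟩ := he
    have f1 := congrArg t e1
    have f2 := congrArg t e2
    simp only [map_add, map_sub, map_neg, map_smul, tP x hx, tQ x hx, tt, hp, hq, sub_self,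
      add_zero] at f1 f2
    rw [f1, add_eq_left, sub_eq_zero] at e1
    rw [f2, add_eq_left, sub_eq_zero] at e2
    exact ⟨e1.symm, e2.symm, f1, f2⟩
  obtain ⟨I, hI, LI⟩ := exists_smooth_inverse hLs fun x hx => by
    rintro ⟨y, z⟩ h0
    obtain ⟨hy, hz, e1, e2⟩ := solve x hx y z 0 0 (map_zero _) (map_zero _) h0
    have := hinj x hx y z hy hz e1 e2
    rw [this.1, this.2]
    rfl
  set J : Z → V ⊸ V × V := fun x => I x ∘L (b1 ∘L (-P x) + b2 ∘L Q x) with hJ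
  have hJs : C∞ J S := hI.clm_comp
    ((contDiffOn_const.clm_comp hP.neg).add (contDiffOn_const.clm_comp hQ))
  refine ⟨fun x => a1 ∘L J x, fun x => a2 ∘L J x, contDiffOn_const.clm_comp hJs,
    contDiffOn_const.clm_comp hJs, fun x hx v => solve x hx _ _ _ _ (by rw [map_neg, tP x hx])
    (tQ x hx _) ?_⟩
  have h1 : J x v = I x (-P x v, Q x v) := by
    show I x (b1 (-P x v) + b2 (Q x v)) = _
    rw [hb1, hb2, Prod.mk_add_mk, add_zero, zero_add]
  show L x (a1 (J x v), a2 (J x v)) = _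
  rw [ha1, ha2, Prod.mk.eta, h1, LI x hx]

/-- The vector representing a continuous functional with respect to the inner product. -/
def sharp : (V ⊸ ℝ) ⊸ V :=
  ∑ i, (ContinuousLinearMap.apply ℝ ℝ (stdOrthonormalBasis ℝ V i)).smulRight
    (stdOrthonormalBasis ℝ V i)

lemma inner_sharp (f : V ⊸ ℝ) (v : V) : inner ℝ (sharp f) v = f v := by
  conv_rhs => rw [← (stdOrthonormalBasis ℝ V).sum_repr' v]
  simp [sharp, sum_inner, inner_smul_left, mul_comm]

/-- Nondegeneracy of the equation of motion of the gauge fields and of the reduced metric. -/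
structure Geo.LeafNondegenerate (m : Geo V W) (x : V) : Prop where
  hermitian : ∀ a b, (∀ c, m.G x (m.R x c) (m.R x a) = m.Al x b (m.R x c) ∧
    m.G x (m.R x c) (m.R x b) = -m.Al x a (m.R x c)) → m.R x a = 0 ∧ m.R x b = 0
  reduced : ∀ a Y, (∀ v, m.G x Y v = m.Al x a v) →
    (∀ c, m.G x (m.R x c) (m.R x a) = m.Al x c Y) → m.R x a = 0

omit [FiniteDimensional ℝ V] [FiniteDimensional ℝ W] in
/-- In Euclidean signature the nondegeneracy condition implies that the reduced metric is
nondegenerate on transversal vectors. -/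
lemma Reduction.t_eq_of_gq {m : Geo V W} (r : Reduction m 1) (h : m.IsGauged 1) {x : V}
    (hx : x ∈ m.dom) (hN : m.LeafNondegenerate x) (hpos : ∀ v, v ≠ 0 → 0 < m.G x v v) {u : V}
    (hu : ∀ v, r.gq x v u = 0) : r.t u = u := by
  -- the vector `N u` is the metric dual of `α(s)`, where `ρ(s) = -M u`
  have sy := h.symm_G x hx
  have e1 : ∀ v, m.G x (r.N x u) v = m.Al x (-r.Rp x (r.M x u)) v := by
    intro v
    have k1 : m.G x (r.N x u) (r.N x v) = m.Al x (-r.Rp x (r.M x u)) (r.N x v) := by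
      have g1 := r.gq_apply x v u
      have g2 := r.al_M_N hx u v
      rw [hu, sy (r.N x v), sy (r.M x v)] at g1
      rw [r.al_apply] at g2
      rw [map_neg, _root_.neg_apply, g2]
      linarith
    have k2 : ∀ w, r.t w = w → m.G x (r.N x u) w = m.Al x (-r.Rp x (r.M x u)) w := by
      intro w hw
      have g1 := r.crit₁ x hx w u
      have g2 := r.al_antisymm h hx w (r.M x u)
      rw [hw, r.t_M x hx, r.al_apply, r.al_apply] at g2
      rw [hw] at g1
      rw [map_neg, _root_.neg_apply, sy, g1, g2]
    have := k2 _ (r.t_N x hx v)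
    rw [map_sub, map_sub] at this
    linarith
  have e2 : m.R x (-r.Rp x (r.M x u)) = -r.M x u := by rw [map_neg, r.R_Rp x hx, r.t_M x hx]
  have e3 := hN.reduced _ _ e1 fun a => by
    have g1 := r.crit₂ x hx (m.R x a) u
    have g2 := r.Al_eq hx a
    rw [r.t_R x hx, ← r.al_apply, ← g2] at g1
    rw [e2, map_neg, ← g1]
    ring
  have e4 := e1 (r.N x u)
  rw [r.Al_ker x hx _ e3, _root_.zero_apply] at e4
  have := r.t_N x hx u
  have hN0 : r.N x u = 0 := by
    by_contra hne
    exact (hpos _ hne).ne' e4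
  rw [hN0, zero_sub, map_neg] at this
  exact neg_injective this

set_option maxHeartbeats 1000000 in
/-- On a chart adapted to the foliation, the gauge fields can be integrated out. -/
lemma Geo.IsGauged.exists_reduction {m : Geo V W} {s : ℝ} (h : m.IsGauged s) (t : V ⊸ V)
    (tt : ∀ v, t (t v) = t v) (tsymm : ∀ u v, inner ℝ (t u) v = inner ℝ u (t v))
    (htan : ∀ x ∈ m.dom, ∀ v, (∃ a, m.R x a = v) ↔ t v = v)
    (hker : ∀ x ∈ m.dom, ∀ a, m.R x a = 0 → m.Al x a = 0)
    (hpos : ∀ x ∈ m.dom, ∀ v, v ≠ 0 → 0 < m.G x v v)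
    (hs : s = -1 ∨ s = 1 ∧ ∀ x ∈ m.dom, m.LeafNondegenerate x) :
    ∃ r : Reduction m s, r.t = t ∧ ∀ x ∈ m.dom, ∀ u, (∀ v, r.gq x v u = 0) → r.t u = u := by
  have tR : ∀ x ∈ m.dom, ∀ a, t (m.R x a) = m.R x a := fun x hx a => (htan x hx _).1 ⟨a, rfl⟩
  obtain ⟨Rp, hRp, R_Rp⟩ := exists_right_inverse h.smooth_R t tt tR fun x hx v => (htan x hx v).2
  have hG0 : ∀ x ∈ m.dom, ∀ v, m.G x v v = 0 → v = 0 := fun x hx v hv => by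
    by_contra hne
    exact (hpos x hx v hne).ne' hv
  -- the antisymmetry of `α`, read on tangent vectors
  have iso : ∀ x ∈ m.dom, ∀ u v, m.Al x (Rp x u) (t v) = -m.Al x (Rp x v) (t u) := by
    intro x hx u v
    have := h.isotropy x hx (Rp x u) (Rp x v)
    rw [R_Rp x hx, R_Rp x hx] at this
    linarith
  have nondeg : ∀ x ∈ m.dom, ∀ y z, t y = y → t z = z →
      (∀ v, m.G x (t v) y = m.Al x (Rp x v) z ∧ -(s * m.G x (t v) z) = m.Al x (Rp x v) y) →
      y = 0 ∧ z = 0 := by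
    intro x hx y z hy hz H
    rcases hs with rfl | ⟨rfl, hN⟩
    · have h1 := (H y).1
      have h2 := (H z).2
      have h3 := iso x hx y z
      rw [hy] at h1
      rw [hz] at h2
      rw [hy, hz] at h3
      have g : ∀ v, 0 ≤ m.G x v v := fun v => by
        by_cases hv : v = 0
        · simp [hv]
        · exact (hpos x hx v hv).le
      exact ⟨hG0 x hx y (by linarith [g y, g z]), hG0 x hx z (by linarith [g y, g z])⟩
    · have ey := R_Rp x hx y
      have ez := R_Rp x hx z
      rw [hy] at ey
      rw [hz] at ez
      have := (hN x hx).hermitian (Rp x z) (Rp x y) fun c => by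
        have hc := H (m.R x c)
        rw [tR x hx] at hc
        have c1 := iso x hx (m.R x c) z
        have c2 := iso x hx (m.R x c) y
        rw [hz, tR x hx] at c1
        rw [hy, tR x hx] at c2
        rw [ez, ey]
        constructor <;> linarith [hc.1, hc.2]
      rw [ey, ez] at this
      exact ⟨this.2, this.1⟩
  -- the linear system for `N` and `M`
  have hal : C∞ (fun x => m.Al x ∘L Rp x) m.dom := h.smooth_Al.clm_comp hRp
  set P : V → V ⊸ V := fun x => sharp ∘L (m.G x ∘L t).flip with hP
  set Q : V → V ⊸ V := fun x => sharp ∘L (m.Al x ∘L Rp x).flip with hQ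
  have hPs : C∞ P m.dom :=
    contDiffOn_const.clm_comp (smooth_flip (h.smooth_G.clm_comp contDiffOn_const))
  have hQs : C∞ Q m.dom := contDiffOn_const.clm_comp (smooth_flip hal)
  have hPi : ∀ x y v, inner ℝ (P x y) v = m.G x (t v) y := fun x y v => by simp [hP, inner_sharp]
  have hQi : ∀ x y v, inner ℝ (Q x y) v = m.Al x (Rp x v) y := fun x y v => by
    simp [hQ, inner_sharp]
  have al_t : ∀ x ∈ m.dom, ∀ v, m.Al x (Rp x (t v)) = m.Al x (Rp x v) := fun x hx v => by
    have : m.R x (Rp x (t v) - Rp x v) = 0 := by rw [map_sub, R_Rp x hx, R_Rp x hx, tt, sub_self]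
    have := hker x hx _ this
    rwa [map_sub, sub_eq_zero] at this
  have tP : ∀ x y, t (P x y) = P x y := fun x y => ext_inner_right ℝ fun v => by
    rw [tsymm, hPi, hPi, tt]
  have tQ : ∀ x ∈ m.dom, ∀ y, t (Q x y) = Q x y := fun x hx y => ext_inner_right ℝ fun v => by
    rw [tsymm, hQi, hQi, al_t x hx]
  obtain ⟨Y, M, hY, hM, hYM⟩ := exists_smooth_solution (s := s) hPs hQs t tt
    (fun x _ => tP x) tQ fun x hx y z hy hz e1 e2 => nondeg x hx y z hy hz fun v => by
      have g1 := congrArg (inner ℝ · v) e1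
      have g2 := congrArg (inner ℝ · v) e2
      simp only [inner_sub_left, inner_neg_left, inner_smul_left, hPi, hQi, inner_zero_left,
        RCLike.conj_to_real] at g1 g2
      exact ⟨by linarith, by linarith⟩
  clear_value P Q
  set c : V ⊸ V := ContinuousLinearMap.id ℝ V - t with hc
  set r : Reduction m s :=
    { t := t, Rp := Rp, N := fun x => c + Y x ∘L c, M := fun x => M x ∘L c
      smooth_Rp := hRp
      smooth_N := contDiffOn_const.add (hY.clm_comp contDiffOn_const)
      smooth_M := hM.clm_comp contDiffOn_const
      t_t := tt, t_R := tR, R_Rp := R_Rp, Al_ker := hker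
      t_N := fun x hx u => by
        have : (c + Y x ∘L c) u - u = Y x (c u) - t u := by simp [hc]; abel
        rw [this, map_sub, tt, (hYM x hx _).1]
      t_M := fun x hx u => (hYM x hx _).2.1
      crit₁ := fun x hx v u => by
        have g1 := congrArg (inner ℝ · v) (hYM x hx (c u)).2.2.1
        simp only [inner_sub_left, inner_neg_left, hPi, hQi] at g1
        show m.G x (t v) (c u + Y x (c u)) = m.Al x (Rp x v) (M x (c u))
        rw [map_add]; linarith
      crit₂ := fun x hx v u => by
        have g1 := congrArg (inner ℝ · v) (hYM x hx (c u)).2.2.2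
        simp only [inner_sub_left, inner_neg_left, inner_smul_left, hPi, hQi,
          RCLike.conj_to_real] at g1
        show -(s * m.G x (t v) (M x (c u))) = m.Al x (Rp x v) (c u + Y x (c u))
        rw [map_add]; linarith
      nondeg := nondeg } with hr
  refine ⟨r, rfl, fun x hx u hu => ?_⟩
  rcases hs with hs1 | ⟨hs1, hN⟩
  · by_contra hne
    exact (r.gq_pos hs1 hx (hpos x hx) hne).ne' (hu u)
  subst hs1
  exact r.t_eq_of_gq h hx (hN x hx) (hpos x hx) hu

end

section

/-! ### From components to linear maps -/

section Coeff

variable {ι ι' ι'' : Type*} [Fintype ι] [DecidableEq ι] [Fintype ι'] [DecidableEq ι']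
  [Fintype ι''] [DecidableEq ι''] {F : Type*} [NormedAddCommGroup F] [NormedSpace ℝ F]

/-- The linear map sending the `i`-th coordinate vector to `c i`. -/
def ofCoeff (c : ι → F) : ℰ ι ⊸ F :=
  ∑ i, ContinuousLinearMap.smulRightL ℝ _ _ (proj (𝕜 := ℝ) i) (c i)

omit [DecidableEq ι] in
lemma ofCoeff_apply (c : ι → F) (u : ℰ ι) : ofCoeff c u = ∑ i, u i • c i := by simp [ofCoeff]

@[simp] lemma ofCoeff_single (c : ι → F) (i : ι) : ofCoeff c (single i 1) = c i := by
  simp [ofCoeff_apply, Finset.sum_ite_eq', ite_smul, PiLp.single_apply]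

lemma eq_ofCoeff (f : ℰ ι ⊸ F) : f = ofCoeff fun i => f (single i 1) := by
  ext u
  conv_lhs => rw [← (EuclideanSpace.basisFun ι ℝ).sum_repr u]
  simp [ofCoeff_apply]

variable {Z : Type*} [NormedAddCommGroup Z] [NormedSpace ℝ Z] {S : Set Z}

omit [DecidableEq ι] in
lemma smooth_ofCoeff {c : Z → ι → F} (hc : ∀ i, C∞ (fun x => c x i) S) :
    C∞ (fun x => ofCoeff (c x)) S :=
  ContDiffOn.sum fun i _ => (ContinuousLinearMap.contDiff _).comp_contDiffOn (hc i)

omit [DecidableEq ι] in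
lemma fderiv_ofCoeff {c : Z → ι → F} {x : Z} (hc : ∀ i, DifferentiableAt ℝ (fun x => c x i) x)
    (ξ : Z) : 𝒟 (fun x => ofCoeff (c x)) x ξ = ofCoeff fun i => 𝒟 (fun x => c x i) x ξ := by
  have : HasFDerivAt (fun x => ofCoeff (c x)) (∑ i, (ContinuousLinearMap.smulRightL ℝ _ _
      (proj (𝕜 := ℝ) i)) ∘L 𝒟 (fun x => c x i) x) x :=
    HasFDerivAt.fun_sum fun i _ => (ContinuousLinearMap.hasFDerivAt _).comp x (hc i).hasFDerivAt
  rw [this.fderiv]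
  simp [ofCoeff]

omit [DecidableEq ι] in
lemma smooth_toLp {c : Z → ι → ℝ} (hc : ∀ i, C∞ (fun x => c x i) S) :
    C∞ (fun x => toLp 2 (c x) : Z → ℰ ι) S :=
  (contDiffOn_piLp 2).2 hc

omit [DecidableEq ι] in
lemma fderiv_toLp {c : Z → ι → ℝ} {x : Z} (hc : ∀ i, DifferentiableAt ℝ (fun x => c x i) x)
    (ξ : Z) : 𝒟 (fun x => toLp 2 (c x) : Z → ℰ ι) x ξ = toLp 2 fun i => 𝒟 (fun x => c x i) x ξ := by
  have : HasFDerivAt (fun x => toLp 2 (c x) : Z → ℰ ι)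
      ((PiLp.continuousLinearEquiv 2 ℝ fun _ : ι => ℝ).symm.toContinuousLinearMap ∘L
        ContinuousLinearMap.pi fun i => 𝒟 (fun x => c x i) x) x :=
    ((PiLp.continuousLinearEquiv 2 ℝ fun _ : ι => ℝ).symm.toContinuousLinearMap.hasFDerivAt).comp x
      (hasFDerivAt_pi.2 fun i => (hc i).hasFDerivAt)
  rw [this.fderiv]
  rfl

lemma IsLinearMap.eq_zero_of_single {f : ℰ ι → F} (hf : IsLinearMap ℝ f)
    (h0 : ∀ i, f (single i 1) = 0) (u : ℰ ι) : f u = 0 := by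
  have : hf.mk' f u = 0 := by
    conv_lhs => rw [← (EuclideanSpace.basisFun ι ℝ).sum_repr u]
    rw [map_sum]
    refine Finset.sum_eq_zero fun i _ => ?_
    rw [map_smul]
    simp [h0]
  exact this

lemma eq_zero_of_single₂ {f : ℰ ι → ℰ ι' → F} (h0 : ∀ i j, f (single i 1) (single j 1) = 0)
    (u : ℰ ι) (v : ℰ ι')
    (h1 : ∀ v, IsLinearMap ℝ fun u => f u v := by
      intros; constructor <;> intros <;> simp [extD, smul_sub] <;> first | ring1 | abel1)
    (h2 : ∀ u, IsLinearMap ℝ fun v => f u v := by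
      intros; constructor <;> intros <;> simp [extD, smul_sub] <;> first | ring1 | abel1) :
    f u v = 0 :=
  IsLinearMap.eq_zero_of_single (h1 v)
    (fun i => IsLinearMap.eq_zero_of_single (h2 _) (fun j => h0 i j) v) u

lemma eq_zero_of_single₃ {f : ℰ ι → ℰ ι' → ℰ ι'' → F}
    (h0 : ∀ i j k, f (single i 1) (single j 1) (single k 1) = 0)
    (u : ℰ ι) (v : ℰ ι') (w : ℰ ι'')
    (h1 : ∀ v w, IsLinearMap ℝ fun u => f u v w := by
      intros; constructor <;> intros <;> simp [extD, smul_sub] <;> first | ring1 | abel1)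
    (h2 : ∀ u w, IsLinearMap ℝ fun v => f u v w := by
      intros; constructor <;> intros <;> simp [extD, smul_sub] <;> first | ring1 | abel1)
    (h3 : ∀ u v, IsLinearMap ℝ fun w => f u v w := by
      intros; constructor <;> intros <;> simp [extD, smul_sub] <;> first | ring1 | abel1) :
    f u v w = 0 :=
  IsLinearMap.eq_zero_of_single (h1 v w)
    (fun i => eq_zero_of_single₂ (fun j k => h0 i j k) v w (h2 _) (h3 _)) u

end Coeff

namespace LocalModel

variable {n r k : ℕ} (m : LocalModel n r)

/-- The components, assembled to linear maps. -/
def toGeo (B : 𝔼 n → Fin n → Fin n → ℝ) : Geo (𝔼 n) (𝔼 r) where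
  dom := m.dom
  G x := ofCoeff fun i => ofCoeff fun j => m.g x i j
  B x := ofCoeff fun i => ofCoeff fun j => B x i j
  R x := ofCoeff fun a => toLp 2 (m.ρ x a)
  Al x := ofCoeff fun a => ofCoeff fun i => m.α x a i
  C x := ofCoeff fun a => ofCoeff fun b => toLp 2 fun c => m.C x c a b
  Om x := ofCoeff fun i => ofCoeff fun a => toLp 2 fun b => m.conn x b a i
  Ph x := ofCoeff fun i => ofCoeff fun a => toLp 2 fun b => m.φ x b a i

/-- Smoothness and algebraic properties of components coming from global data. -/
structure IsAdmissible : Prop where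
  isOpen_dom : IsOpen m.dom
  smooth_g : ∀ i j, C∞ (fun x => m.g x i j) m.dom
  smooth_ρ : ∀ a i, C∞ (fun x => m.ρ x a i) m.dom
  smooth_C : ∀ c a b, C∞ (fun x => m.C x c a b) m.dom
  smooth_conn : ∀ b a i, C∞ (fun x => m.conn x b a i) m.dom
  smooth_φ : ∀ b a i, C∞ (fun x => m.φ x b a i) m.dom
  smooth_α : ∀ a i, C∞ (fun x => m.α x a i) m.dom
  symm_g : ∀ x ∈ m.dom, ∀ i j, m.g x i j = m.g x j i
  antisymm_C : ∀ x ∈ m.dom, ∀ c a b, m.C x c a b = -m.C x c b a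
  bracket : ∀ x ∈ m.dom, ∀ a b i, ∑ l, (m.ρ x a l * pd l (fun y => m.ρ y b i) x
    - m.ρ x b l * pd l (fun y => m.ρ y a i) x) = ∑ c, m.C x c a b * m.ρ x c i

variable {m} {B : 𝔼 n → Fin n → Fin n → ℝ}

local notation "𝖦" => m.toGeo B

section deriv

variable {ι ι' : Type*} [Fintype ι] [DecidableEq ι] [Fintype ι'] [DecidableEq ι'] {U : Set (𝔼 n)}

lemma fderiv_apply_eq_sum {f : 𝔼 n → ℝ} {x : 𝔼 n} (v : 𝔼 n) : 𝒟 f x v = ∑ l, v l * pd l f x := by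
  conv_lhs => rw [eq_ofCoeff (𝒟 f x)]
  simp [ofCoeff_apply, pd]

lemma fderiv_bilin (hU : IsOpen U) {c : 𝔼 n → ι → ι' → ℝ}
    (hc : ∀ i j, C∞ (fun x => c x i j) U) {x : 𝔼 n} (hx : x ∈ U)
    (v : 𝔼 n) (i : ι) (j : ι') :
    𝒟 (fun x => ofCoeff fun i => ofCoeff fun j => c x i j) x v (single i 1)
      (single j 1) = ∑ l, v l * pd l (fun x => c x i j) x := by
  have h1 : ∀ i j, DifferentiableAt ℝ (fun x => c x i j) x := fun i j => (hc i j).diffAt hU hx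
  have h2 : ∀ i, DifferentiableAt ℝ (fun x => ofCoeff fun j => c x i j) x := fun i =>
    (smooth_ofCoeff (hc i)).diffAt hU hx
  rw [fderiv_ofCoeff h2, ofCoeff_single, fderiv_ofCoeff (h1 i), ofCoeff_single, fderiv_apply_eq_sum]

omit [DecidableEq ι'] in
lemma fderiv_lin (hU : IsOpen U) {c : 𝔼 n → ι → ι' → ℝ}
    (hc : ∀ i j, C∞ (fun x => c x i j) U) {x : 𝔼 n} (hx : x ∈ U)
    (v : 𝔼 n) (i : ι) :
    𝒟 (fun x => ofCoeff fun i => (toLp 2 (c x i) : ℰ ι')) x v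
      (single i 1) = toLp 2 fun j => ∑ l, v l * pd l (fun x => c x i j) x := by
  have h1 : ∀ i j, DifferentiableAt ℝ (fun x => c x i j) x := fun i j => (hc i j).diffAt hU hx
  have h2 : ∀ i, DifferentiableAt ℝ (fun x => (toLp 2 (c x i) : ℰ ι')) x :=
    fun i => (smooth_toLp (hc i)).diffAt hU hx
  rw [fderiv_ofCoeff h2, ofCoeff_single, fderiv_toLp (h1 i)]
  simp only [fderiv_apply_eq_sum]

end deriv

lemma sum_single_mul (i : Fin n) (f : Fin n → ℝ) : ∑ l, (single i (1 : ℝ) : 𝔼 n) l * f l = f i := by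
  simp [PiLp.single_apply]

set_option maxHeartbeats 1000000 in
/-- The componentwise conditions, as identities between multilinear maps. -/
lemma isGauged_toGeo (h : m.IsAdmissible) (hB : m.IsPrimitive B) {sig : Signature}
    (h1 : m.MetricCondition) (h2 : m.FluxCondition sig) (h3 : m.Isotropy) (h4 : m.Equivariance) :
    𝖦.IsGauged sig.sign := by
  have hU := h.isOpen_dom
  have bil := fun {ι ι' : Type} [Fintype ι] [DecidableEq ι] [Fintype ι'] [DecidableEq ι']
    {c : 𝔼 n → ι → ι' → ℝ}
    (hc : ∀ i j, C∞ (fun x => c x i j) m.dom) =>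
      smooth_ofCoeff fun i => smooth_ofCoeff fun j => hc i j
  have dG := fun {x} (hx : x ∈ m.dom) => fderiv_bilin hU h.smooth_g hx
  have dB := fun {x} (hx : x ∈ m.dom) => fderiv_bilin hU hB.smooth hx
  have dA := fun {x} (hx : x ∈ m.dom) => fderiv_bilin hU h.smooth_α hx
  have dR := fun {x} (hx : x ∈ m.dom) => fderiv_lin hU h.smooth_ρ hx
  have sG : ∀ x ∈ m.dom, ∀ u v, 𝖦.G x u v = 𝖦.G x v u := by
    intro x hx u v
    rw [← sub_eq_zero]
    refine eq_zero_of_single₂ (f := fun u v => 𝖦.G x u v - 𝖦.G x v u) (fun i j => ?_) u v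
    simp [toGeo, h.symm_g x hx i j]
  have hflux : ∀ x ∈ m.dom, ∀ a i j, extD 𝖦.B x (𝖦.R x (single a 1)) (single i 1)
      (single j 1) = ∑ l, m.ρ x a l * m.H x l i j := by
    intro x hx a i j
    have e : 𝖦.R x (single a 1) = ∑ l, m.ρ x a l • single l (1 : ℝ) := by
      rw [← (EuclideanSpace.basisFun (Fin n) ℝ).sum_repr (𝖦.R x _)]
      simp [toGeo]
    simp only [hB.eq x hx, e, extD, map_sum, map_smul, _root_.sum_apply,
      _root_.smul_apply, smul_eq_mul, mul_add, sum_add_distrib]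
    simp only [toGeo, dB hx, sum_single_mul]
  have hsw : ∀ {x} (c : Fin r → ℝ) (f : Fin n → ℝ), ∑ l, (∑ b, c b •
      (toLp 2 (m.ρ x b) : 𝔼 n)) l * f l =
      ∑ b, c b * ∑ l, m.ρ x b l * f l := by
    intro x c f
    simp only [WithLp.ofLp_sum, WithLp.ofLp_smul, Finset.sum_apply, Pi.smul_apply, smul_eq_mul,
      Finset.sum_mul, mul_sum]
    rw [sum_comm]
    simp only [mul_assoc]
  refine ⟨⟨hU, bil h.smooth_g, bil hB.smooth, smooth_ofCoeff fun a =>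
    smooth_toLp (h.smooth_ρ a), bil h.smooth_α⟩, ?_, ?_, ?_, sG, ?_, ?_, ?_, ?_, ?_, ?_, ?_⟩
  · exact smooth_ofCoeff fun a => smooth_ofCoeff fun b => smooth_toLp fun c => h.smooth_C c a b
  · exact smooth_ofCoeff fun i => smooth_ofCoeff fun a => smooth_toLp fun b => h.smooth_conn b a i
  · exact smooth_ofCoeff fun i => smooth_ofCoeff fun a => smooth_toLp fun b => h.smooth_φ b a i
  · intro x hx u v
    rw [← sub_eq_zero]
    refine eq_zero_of_single₂ (f := fun u v => 𝖦.B x u v - -𝖦.B x v u) (fun i j => ?_) u v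
    simp [toGeo, hB.antisymm x hx i j]
  · intro x hx u v
    rw [← sub_eq_zero]
    refine eq_zero_of_single₂ (f := fun u v => 𝖦.C x u v - -𝖦.C x v u) (fun i j => ?_) u v
    ext c
    simp [toGeo, h.antisymm_C x hx c i j]
  · intro x hx u v
    rw [← sub_eq_zero]
    refine eq_zero_of_single₂ (f := fun a b => 𝒟 𝖦.R x (𝖦.R x a) b
      - 𝒟 𝖦.R x (𝖦.R x b) a - 𝖦.R x (𝖦.C x a b)) (fun a b => ?_) u v
    ext i
    have := h.bracket x hx a b i
    simp only [toGeo, dR hx, ofCoeff_single] at this ⊢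
    simp only [sum_sub_distrib] at this
    simp [ofCoeff_apply, this]
  · intro x hx a u v
    rw [← sub_eq_zero]
    refine eq_zero_of_single₃ (f := fun a u v => 𝒟 𝖦.G x (𝖦.R x a) u v + 𝖦.G x (𝒟 𝖦.R x u a) v
      + 𝖦.G x u (𝒟 𝖦.R x v a)
      - (𝖦.G x (𝖦.R x (𝖦.Om x u a)) v + 𝖦.G x (𝖦.R x (𝖦.Om x v a)) u
        + 𝖦.Al x (𝖦.Ph x u a) v + 𝖦.Al x (𝖦.Ph x v a) u)) (fun a i j => ?_) a u v
    have := h1 x hx a i j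
    rw [sG x hx (single i 1)]
    simp only [toGeo, dG hx, dR hx, sum_single_mul, ofCoeff_single, lieG, ρg] at this ⊢
    simp only [sum_add_distrib] at this
    simp only [ofCoeff_apply, smul_eq_mul, _root_.sum_apply,
      _root_.smul_apply, PiLp.single_apply, ite_mul, one_mul, zero_mul, Finset.sum_ite_eq',
      Finset.mem_univ, if_true] at this ⊢
    rw [hsw, hsw]
    simp only [mul_comm (m.g x _ _) (pd _ _ _)] at this
    linarith
  · intro x hx a u v
    rw [← sub_eq_zero]
    refine eq_zero_of_single₃ (f := fun a u v => extD 𝖦.B x (𝖦.R x a) u v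
      - (𝒟 𝖦.Al x u a v - 𝒟 𝖦.Al x v a u
      - (𝖦.Al x (𝖦.Om x u a) v - 𝖦.Al x (𝖦.Om x v a) u)
      + sig.sign * (𝖦.G x (𝖦.R x (𝖦.Ph x u a)) v - 𝖦.G x (𝖦.R x (𝖦.Ph x v a)) u)))
      (fun a i j => ?_) a u v
    have := h2 x hx a i j
    simp only [hflux x hx, ρH] at this ⊢
    simp only [toGeo, dA hx, sum_single_mul, ofCoeff_single, dα, ρg] at this ⊢
    simp only [ofCoeff_apply, smul_eq_mul, sum_sub_distrib, _root_.sum_apply,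
      _root_.smul_apply, PiLp.single_apply, ite_mul, one_mul, zero_mul, Finset.sum_ite_eq',
      Finset.mem_univ, if_true] at this ⊢
    rw [hsw, hsw]
    linarith
  · intro x hx u v
    refine eq_zero_of_single₂ (f := fun a b => 𝖦.Al x b (𝖦.R x a)
      + 𝖦.Al x a (𝖦.R x b)) (fun a b => ?_) u v
    have := h3 x hx a b
    simpa [toGeo, γ, ofCoeff_apply] using this
  · intro x hx a b v
    rw [← sub_eq_zero]
    refine eq_zero_of_single₃ (f := fun a b v => 𝒟 𝖦.Al x (𝖦.R x a) b v + 𝖦.Al x b (𝒟 𝖦.R x v a)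
      - (𝖦.Al x (𝖦.C x a b) v + 𝒟 𝖦.Al x (𝖦.R x b) a v - 𝒟 𝖦.Al x v a (𝖦.R x b)
        - extD 𝖦.B x (𝖦.R x a) (𝖦.R x b) v))
      (fun a b j => ?_) a b v
    have := h4 x hx a b j
    have e1 : ∀ w, 𝒟 𝖦.Al x (single j 1) (single a 1)
        w = ∑ l, w l * pd j (fun y => m.α y a l) x := by
      intro w
      rw [eq_ofCoeff (𝒟 𝖦.Al x (single j 1) (single a 1)), ofCoeff_apply]
      simp only [toGeo, dA hx, sum_single_mul, smul_eq_mul]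
    have e2 : ∀ w, extD 𝖦.B x (𝖦.R x (single a 1)) w
        (single j 1) = ∑ l, w l * ∑ q, m.ρ x a q * m.H x q l j := by
      intro w
      have hw : w = ∑ l, w l • single l (1 : ℝ) := by
        conv_lhs => rw [← (EuclideanSpace.basisFun (Fin n) ℝ).sum_repr w]
        simp
      conv_lhs => rw [hw]
      have : ∀ l, extD 𝖦.B x (𝖦.R x (single a 1))
        (single l 1) (single j 1) = _ := fun l => hflux x hx a l j
      simp only [← this, extD, map_sum, map_smul, _root_.sum_apply, _root_.smul_apply,
        smul_eq_mul, mul_add, sum_add_distrib]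
    simp only [e1, e2]
    simp only [toGeo, dA hx, dR hx, sum_single_mul, ofCoeff_single, dα, ρH, lieα] at this ⊢
    simp only [ofCoeff_apply, smul_eq_mul, sum_add_distrib, mul_sub,
      sum_sub_distrib, _root_.sum_apply, _root_.smul_apply, PiLp.single_apply, ite_mul,
      one_mul, zero_mul, Finset.sum_ite_eq', Finset.mem_univ, if_true, mul_comm (m.α x b _)]
      at this ⊢
    linarith

end LocalModel

end

section

/-! ### The functional in components -/

/-- The inverse density `√|det h| h^{μν}` of a world-sheet metric. -/
def Conf.ofMetric (h : Matrix (Fin 2) (Fin 2) ℝ) : Conf :=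
  ⟨√|h.det| * h⁻¹ 0 0, √|h.det| * h⁻¹ 0 1, √|h.det| * h⁻¹ 1 1⟩

lemma hodge_eq {h : Matrix (Fin 2) (Fin 2) ℝ} (hs : h.IsSymm) (η : Fin 2 → ℝ) :
    hodge h η = ![((Conf.ofMetric h).star (η 0, η 1)).1, ((Conf.ofMetric h).star (η 0, η 1)).2] := by
  have h1 : h⁻¹ 1 0 = h⁻¹ 0 1 := hs.inv.apply 0 1
  simp only [hodge, Conf.ofMetric, Conf.star, Matrix.mulVec, dotProduct, Fin.sum_univ_two, h1,
    smul_eq_mul]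
  ring_nf

namespace Worldsheet

variable {sig : Signature} (S : Worldsheet sig)

/-- The inverse metric density of a world-sheet. -/
def conf (z : Plane) : Conf := Conf.ofMetric (S.metric z)

lemma sign_mul_det {z : Plane} (hz : z ∈ S.dom) :
    0 < sig.sign * (S.metric z).det ∧ |(S.metric z).det| = sig.sign * (S.metric z).det := by
  have := S.signature z hz
  cases sig with
  | euclidean =>
    have hd : 0 < (S.metric z).det := Matrix.PosDef.det_pos this
    simp [Signature.sign, hd, abs_of_pos hd]
  | lorentzian =>
    have hd : (S.metric z).det < 0 := this
    simp [Signature.sign, hd, abs_of_neg hd]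

lemma isConf : IsConf sig.sign S.dom S.conf := by
  have hs := S.smooth
  have hdet : C∞ (fun z => (S.metric z).det) S.dom := by
    simp only [Matrix.det_fin_two]
    exact ((hs 0 0).mul (hs 1 1)).sub ((hs 0 1).mul (hs 1 0))
  have hne : ∀ z ∈ S.dom, (S.metric z).det ≠ 0 := fun z hz h0 => by
    have := (S.sign_mul_det hz).1
    rw [h0, mul_zero] at this
    exact lt_irrefl _ this
  have hsq : C∞ (fun z => √|(S.metric z).det|) S.dom := by
    have : C∞ (fun z => √(sig.sign * (S.metric z).det)) S.dom :=
      (contDiffOn_const.mul hdet).sqrt fun z hz => (S.sign_mul_det hz).1.ne'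
    exact this.congr fun z hz => by rw [(S.sign_mul_det hz).2]
  have hinv : ∀ μ ν, C∞ (fun z => (S.metric z)⁻¹ μ ν) S.dom := by
    intro μ ν
    simp only [Matrix.inv_def, Ring.inverse_eq_inv', Matrix.adjugate_fin_two, Matrix.smul_apply,
      smul_eq_mul]
    have := hdet.inv hne
    fin_cases μ <;> fin_cases ν
    · exact this.mul (hs 1 1)
    · exact this.mul (hs 0 1).neg
    · exact this.mul (hs 1 0).neg
    · exact this.mul (hs 0 0)
  refine ⟨S.isOpen_dom, ⟨hsq.mul (hinv 0 0), hsq.mul (hinv 0 1), hsq.mul (hinv 1 1)⟩,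
    fun z hz => ?_⟩
  have h1 := (S.sign_mul_det hz).2
  have h2 := hne z hz
  have h3 : √|(S.metric z).det| * √|(S.metric z).det| = |(S.metric z).det| :=
    Real.mul_self_sqrt (abs_nonneg _)
  have h4 : (S.metric z) 1 0 = (S.metric z) 0 1 := (S.symm z hz).apply 0 1
  have h5 : (S.metric z)⁻¹ 0 0 * (S.metric z)⁻¹ 1 1 - (S.metric z)⁻¹ 0 1 * (S.metric z)⁻¹ 0 1 =
      (S.metric z).det⁻¹ := by
    simp only [Matrix.inv_def, Ring.inverse_eq_inv', Matrix.adjugate_fin_two, Matrix.smul_apply,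
      smul_eq_mul]
    have h6 := Matrix.det_fin_two (S.metric z)
    rw [h4] at h6
    field_simp
    simp
    linear_combination -h6
  calc (S.conf z).det = (√|(S.metric z).det| * √|(S.metric z).det|)
      * ((S.metric z)⁻¹ 0 0 * (S.metric z)⁻¹ 1 1 - (S.metric z)⁻¹ 0 1 * (S.metric z)⁻¹ 0 1) := by
        simp only [conf, Conf.ofMetric, Conf.det]; ring
    _ = sig.sign := by rw [h3, h5, h1]; field_simp

end Worldsheet

/-- The components of a gauge field, as a pair of vectors. -/
def pairing (r : ℕ) : (Fin r → Fin 2 → ℝ) ≃L[ℝ] 𝔼 r × 𝔼 r := LinearEquiv.toContinuousLinearEquiv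
    { toFun := fun A => (toLp 2 fun a => A a 0, toLp 2 fun a => A a 1)
      invFun := fun p a => ![p.1 a, p.2 a]
      map_add' := fun _ _ => rfl
      map_smul' := fun _ _ => rfl
      left_inv := fun A => by ext a μ; fin_cases μ <;> rfl
      right_inv := fun p => rfl }

lemma pairing_apply {r : ℕ} (A : Fin r → Fin 2 → ℝ) :
    pairing r A = (toLp 2 fun a => A a 0, toLp 2 fun a => A a 1) := rfl

/-- The components of a section, as a vector. -/
abbrev vec (r : ℕ) : (Fin r → ℝ) ≃L[ℝ] 𝔼 r :=
  (PiLp.continuousLinearEquiv 2 ℝ fun _ : Fin r => ℝ).symm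

lemma dX_eq {ι : Type*} [Fintype ι] {X : Plane → ℰ ι} {z : Plane}
    (hX : DifferentiableAt ℝ X z) (i : ι) :
    dX X i z 0 = (grad X z).1 i ∧ dX X i z 1 = (grad X z).2 i := by
  have h : 𝒟 (fun z => X z i) z = proj (𝕜 := ℝ) i ∘L 𝒟 X z :=
    ((proj (𝕜 := ℝ) i).hasFDerivAt.comp z hX.hasFDerivAt).fderiv
  simp [dX, pd, grad, pdv, h]

lemma bilin_apply {ι ι' : Type*} [Fintype ι] [Fintype ι'] (c : ι → ι' → ℝ) (u : ℰ ι) (v : ℰ ι') :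
    ofCoeff (fun i => ofCoeff fun j => c i j) u v = ∑ i, ∑ j, c i j * (u i * v j) := by
  simp only [ofCoeff_apply, _root_.sum_apply, _root_.smul_apply, smul_eq_mul, mul_sum]
  exact sum_congr rfl fun i _ => sum_congr rfl fun j _ => by ring

lemma lin_apply {ι ι' : Type*} [Fintype ι] [Fintype ι'] (c : ι → ι' → ℝ) (u : ℰ ι) (j : ι') :
    ofCoeff (fun i => (toLp 2 (c i) : ℰ ι')) u j = ∑ i, u i * c i j := by
  simp [ofCoeff_apply]

lemma bilin_toLp_apply {ι ι' κ : Type*} [Fintype ι] [Fintype ι'] [Fintype κ]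
    (c : ι → ι' → κ → ℝ) (u : ℰ ι) (v : ℰ ι') (j : κ) :
    ofCoeff (fun i => ofCoeff fun i' => (toLp 2 (c i i') : ℰ κ)) u v j =
      ∑ i, ∑ i', u i * (v i' * c i i' j) := by
  simp only [ofCoeff_apply, _root_.sum_apply, _root_.smul_apply, WithLp.ofLp_sum, WithLp.ofLp_smul,
    Finset.sum_apply, Pi.smul_apply, smul_eq_mul, mul_sum]

/-- The kinetic and the topological term of the density of a sigma model. -/
lemma kin_bilin {ι : Type*} [Fintype ι] {h : Matrix (Fin 2) (Fin 2) ℝ} (hs : h.IsSymm)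
    (g : ι → ι → ℝ) {β : ι → Fin 2 → ℝ} {w : ℰ ι × ℰ ι}
    (h1 : ∀ i, β i 0 = w.1 i) (h2 : ∀ i, β i 1 = w.2 i) :
    ∑ i, ∑ j, g i j * wedge (β i) (hodge h (β j)) =
      (Conf.ofMetric h).kin (ofCoeff fun i => ofCoeff fun j => g i j) w w := by
  simp only [Conf.kin, bilin_apply, mul_sum, ← sum_add_distrib]
  refine sum_congr rfl fun i _ => sum_congr rfl fun j _ => ?_
  rw [hodge_eq hs]
  simp [wedge, Conf.star, h1, h2]
  ring

lemma wedge_bilin {ι : Type*} [Fintype ι] (b : ι → ι → ℝ) {β : ι → Fin 2 → ℝ} {w : ℰ ι × ℰ ι}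
    (h1 : ∀ i, β i 0 = w.1 i) (h2 : ∀ i, β i 1 = w.2 i) :
    ∑ i, ∑ j, b i j * wedge (β i) (β j) = (ofCoeff fun i => ofCoeff fun j => b i j) w.1 w.2
      - (ofCoeff fun i => ofCoeff fun j => b i j) w.2 w.1 := by
  simp only [bilin_apply, ← sum_sub_distrib, ← mul_sub]
  refine sum_congr rfl fun i _ => sum_congr rfl fun j _ => ?_
  simp [wedge, h1, h2]

lemma sigmaLagrangian_eq {ι : Type*} [Fintype ι] {h : Plane → Matrix (Fin 2) (Fin 2) ℝ}
    {z : Plane} (hs : (h z).IsSymm) (g B : ℰ ι → ι → ι → ℝ)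
    {X : Plane → ℰ ι} (hX : DifferentiableAt ℝ X z) :
    sigmaLagrangian h g B X z = slag (Conf.ofMetric (h z)) (ofCoeff fun i => ofCoeff (g (X z) i))
      (ofCoeff fun i => ofCoeff (B (X z) i)) (grad X z) := by
  rw [sigmaLagrangian, kin_bilin hs _ (fun i => (dX_eq hX i).1) (fun i => (dX_eq hX i).2),
    wedge_bilin _ (fun i => (dX_eq hX i).1) (fun i => (dX_eq hX i).2), slag]

namespace LocalModel

variable {n r k : ℕ} (m : LocalModel n r) (B : 𝔼 n → Fin n → Fin n → ℝ)

local notation "𝖦" => m.toGeo B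

lemma R_apply (x : 𝔼 n) (u : 𝔼 r) (i : Fin n) : 𝖦.R x u i = ∑ a, u a * m.ρ x a i := lin_apply _ _ _

lemma D_eq {a : Config n r} {z : Plane} (hX : DifferentiableAt ℝ a.1 z) (i : Fin n) :
    m.D a i z 0 = (𝖦.cov (a.1 z) (grad a.1 z) (pairing r (a.2 z))).1 i ∧
    m.D a i z 1 = (𝖦.cov (a.1 z) (grad a.1 z) (pairing r (a.2 z))).2 i := by
  simp [D, Geo.cov, (dX_eq hX i).1, (dX_eq hX i).2, R_apply, pairing_apply, mul_comm]

lemma gaugedLagrangian_eq {h : Plane → Matrix (Fin 2) (Fin 2) ℝ} {a : Config n r} {z : Plane}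
    (hs : (h z).IsSymm) (hX : DifferentiableAt ℝ a.1 z) :
    m.gaugedLagrangian h B a z = 𝖦.lag (Conf.ofMetric (h z)) (a.1 z) (grad a.1 z)
      (pairing r (a.2 z)) := by
  rw [gaugedLagrangian, kin_bilin hs _ (fun i => (m.D_eq B hX i).1) (fun i => (m.D_eq B hX i).2),
    wedge_bilin _ (fun i => (dX_eq hX i).1) (fun i => (dX_eq hX i).2), Geo.lag]
  have e1 : ∀ b μ, (∑ i, m.α (a.1 z) b i * dX a.1 i z μ) =
      ∑ i, m.α (a.1 z) b i * (![(grad a.1 z).1, (grad a.1 z).2] μ) i := by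
    intro b μ
    fin_cases μ
    · simp [(dX_eq hX _).1]
    · simp [(dX_eq hX _).2]
  congr 1
  · congr 1
    simp only [wedge, e1, toGeo, bilin_apply, pairing_apply, ← sum_sub_distrib, mul_sum]
    refine sum_congr rfl fun b _ => sum_congr rfl fun i _ => ?_
    simp
    ring
  · congr 1
    have e2 : ∀ u v : 𝔼 r, 𝖦.Al (a.1 z) v (𝖦.R (a.1 z) u) =
        ∑ b, ∑ c, m.γ (a.1 z) b c * (u b * v c) := by
      intro u v
      simp only [toGeo, bilin_apply, lin_apply, γ, mul_sum, Finset.sum_mul]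
      rw [sum_comm]
      simp only [sum_comm (s := (Finset.univ : Finset (Fin n)))]
      rw [sum_comm]
      refine sum_congr rfl fun b _ => sum_congr rfl fun c _ => sum_congr rfl fun i _ => ?_
      ring
    rw [e2, e2, ← sum_sub_distrib]
    refine sum_congr rfl fun b _ => ?_
    rw [← sum_sub_distrib]
    refine sum_congr rfl fun c _ => ?_
    simp only [wedge, pairing_apply]
    ring

lemma gaugeVariation_fst (h : Plane → Matrix (Fin 2) (Fin 2) ℝ) (a : Config n r)
    (ε : Plane → Fin r → ℝ) (z : Plane) :
    (m.gaugeVariation h a ε).1 z = 𝖦.R (a.1 z) (vec r (ε z)) := by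
  ext i
  rw [R_apply]
  simp [gaugeVariation, mul_comm]

lemma gaugeVariation_snd {h : Plane → Matrix (Fin 2) (Fin 2) ℝ} {a : Config n r}
    {ε : Plane → Fin r → ℝ} {z : Plane} (hs : (h z).IsSymm) (hX : DifferentiableAt ℝ a.1 z)
    (hε : DifferentiableAt ℝ ε z) :
    pairing r ((m.gaugeVariation h a ε).2 z) = 𝖦.gaugeVarA (fun z => Conf.ofMetric (h z))
      a.1 (fun z => pairing r (a.2 z)) (fun z => vec r (ε z)) z := by
  have hd : ∀ μ c, pdv μ (fun z => vec r (ε z)) z c = pd μ (fun z' => ε z' c) z := by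
    intro μ c
    have h1 : HasFDerivAt (fun z => vec r (ε z)) ((vec r).toContinuousLinearMap ∘L 𝒟 ε z) z :=
      (vec r).toContinuousLinearMap.hasFDerivAt.comp z hε.hasFDerivAt
    have h2 : HasFDerivAt (fun z => ε z c) (ContinuousLinearMap.proj (R := ℝ) c ∘L 𝒟 ε z) z :=
      (ContinuousLinearMap.proj (R := ℝ) (φ := fun _ => ℝ) c).hasFDerivAt.comp z hε.hasFDerivAt
    rw [pdv, pd, h1.fderiv, h2.fderiv]
    rfl
  have hw := m.D_eq B hX
  have hst : ∀ i, hodge (h z) (m.D a i z) 0 = ((Conf.ofMetric (h z)).star (𝖦.cov (a.1 z)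
      (grad a.1 z) (pairing r (a.2 z)))).1 i ∧ hodge (h z) (m.D a i z) 1 = ((Conf.ofMetric
      (h z)).star (𝖦.cov (a.1 z) (grad a.1 z) (pairing r (a.2 z)))).2 i := by
    intro i
    rw [hodge_eq hs, (hw i).1, (hw i).2]
    simp [Conf.star]
  have key : ∀ (d : Fin r → Fin r → Fin n → ℝ) (w : 𝔼 n) (c : Fin r),
      ∑ b, ∑ i, d c b i * ε z b * w i = (ofCoeff fun i => ofCoeff fun a =>
        (toLp 2 fun b => d b a i : 𝔼 r)) w (vec r (ε z)) c := by
    intro d w c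
    rw [bilin_toLp_apply, sum_comm]
    refine sum_congr rfl fun b _ => sum_congr rfl fun i _ => ?_
    simp
    ring
  have hC : ∀ (w : 𝔼 r) (c : Fin r),
      ∑ b, ∑ d, m.C (a.1 z) c b d * w b * ε z d = 𝖦.C (a.1 z) w (vec r (ε z)) c := by
    intro w c
    simp only [toGeo, bilin_toLp_apply]
    refine sum_congr rfl fun b _ => sum_congr rfl fun i _ => ?_
    simp
    ring
  rw [pairing_apply]
  refine Prod.ext ?_ ?_ <;> ext c
  · simp only [gaugeVariation, Geo.gaugeVarA, Geo.gaugeA, PiLp.add_apply, grad, hd, (hw _).1,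
      (hst _).1, key, ← hC]
    rfl
  · simp only [gaugeVariation, Geo.gaugeVarA, Geo.gaugeA, PiLp.add_apply, grad, hd, (hw _).2,
      (hst _).2, key, ← hC]
    rfl

lemma pairing_shift (T : 𝔼 n → Fin k → Fin r → ℝ) (a : Config n r)
    (lam : Plane → Fin k → Fin 2 → ℝ) (z : Plane) :
    pairing r ((shiftVariation T a lam).2 z) =
      ((ofCoeff fun I => toLp 2 (T (a.1 z) I)) (pairing k (lam z)).1,
       (ofCoeff fun I => toLp 2 (T (a.1 z) I)) (pairing k (lam z)).2) := by
  rw [pairing_apply, pairing_apply]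
  refine Prod.ext ?_ ?_ <;> ext c <;> simp [shiftVariation, lin_apply, mul_comm]

end LocalModel

end

section

/-! ### The variational principle in components -/

lemma smooth_pairing {r : ℕ} {Z : Type*} [NormedAddCommGroup Z] [NormedSpace ℝ Z] {S : Set Z}
    {f : Z → Fin r → Fin 2 → ℝ} (hf : C∞ f S) :
    C∞ (fun z => pairing r (f z)) S :=
  (pairing r).toContinuousLinearMap.contDiff.comp_contDiffOn hf

lemma smooth_pairing_symm {r : ℕ} {Z : Type*} [NormedAddCommGroup Z] [NormedSpace ℝ Z]
    {S : Set Z} {f : Z → 𝔼 r × 𝔼 r}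
    (hf : C∞ f S) : C∞ (fun z => (pairing r).symm (f z)) S :=
  (pairing r).symm.toContinuousLinearMap.contDiff.comp_contDiffOn hf

/-- The ungauged model, as a gauged model with a gauge field that does not couple. -/
def sigmaGeo {V : Type*} [NormedAddCommGroup V] [NormedSpace ℝ V] (U : Set V)
    (g b : V → V ⊸ V ⊸ ℝ) : Geo V ℝ := ⟨U, g, b, 0, 0, 0, 0, 0⟩

lemma isSigmaSolution_iff {ι : Type*} [Fintype ι] {sig : Signature} (S : Worldsheet sig)
    {U : Set (ℰ ι)} {g B : ℰ ι → ι → ι → ℝ}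
    (h : IsSigma U (fun y => ofCoeff fun i => ofCoeff (g y i)) fun y => ofCoeff fun i =>
      ofCoeff (B y i)) {Y : Plane → ℰ ι} :
    IsSigmaSolution S U g B Y ↔ C∞ Y S.dom ∧ MapsTo Y S.dom U ∧
      ∀ ζ, IsTest S.dom ζ → ∫ σ in S.dom, dslag (S.conf σ) (fun y => ofCoeff fun i => ofCoeff (g y i))
        (fun y => ofCoeff fun i => ofCoeff (B y i)) (Y σ) (ζ σ) (grad Y σ) (grad ζ σ) = 0 := by
  have key : C∞ Y S.dom → MapsTo Y S.dom U → ∀ ζ, IsTest S.dom ζ →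
      HasDerivAt (fun s : ℝ => ∫ σ in S.dom, (sigmaLagrangian S.metric g B (Y + s • ζ) σ
        - sigmaLagrangian S.metric g B Y σ))
      (∫ σ in S.dom, dslag (S.conf σ) (fun y => ofCoeff fun i => ofCoeff (g y i))
        (fun y => ofCoeff fun i => ofCoeff (B y i)) (Y σ) (ζ σ) (grad Y σ) (grad ζ σ)) 0 := by
    intro hY hm ζ hζ
    have hsm : (sigmaGeo U (fun y => ofCoeff fun i => ofCoeff (g y i)) fun y => ofCoeff fun i =>
      ofCoeff (B y i)).IsSmooth :=
      ⟨h.isOpen, h.smooth_g, h.smooth_b, contDiffOn_const, contDiffOn_const⟩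
    have h0 := hsm.hasDerivAt_integral_lag S.isConf hY (A := 0) contDiffOn_const hm hζ
      (isTest_zero (D := S.dom) (V := ℝ × ℝ))
    have hz : 𝒟 (0 : ℰ ι → ℝ ⊸ ℰ ι) = 0 := by ext1 x; exact (hasFDerivAt_const _ _).fderiv
    have hz' : 𝒟 (0 : ℰ ι → ℝ ⊸ ℰ ι ⊸ ℝ) = 0 := by ext1 x; exact (hasFDerivAt_const _ _).fderiv
    refine (h0.congr_deriv ?_).congr_of_eventuallyEq (Filter.Eventually.of_forall fun s => ?_)
    · refine setIntegral_congr_fun S.isOpen_dom.measurableSet fun σ _ => ?_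
      simp [Geo.firstVar, Geo.dlag, Geo.dcov, Geo.cov, sigmaGeo, dslag, hz, hz']
    · refine setIntegral_congr_fun S.isOpen_dom.measurableSet fun σ hσ => ?_
      have hd := (hY.fderivAt S.isOpen_dom hσ).differentiableAt
      have hd' := hd.add ((hζ.1.differentiable (by simp) σ).const_smul s)
      rw [sigmaLagrangian_eq (S.symm σ hσ) g B hd, sigmaLagrangian_eq (S.symm σ hσ) g B hd']
      simp [Geo.lag, Geo.cov, sigmaGeo, slag, Worldsheet.conf]
  constructor
  · intro H
    refine ⟨H.smooth, H.mapsTo, fun ζ hζ => ?_⟩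
    exact (key H.smooth H.mapsTo ζ hζ).unique (H.stationary ζ hζ)
  · rintro ⟨h1, h2, h3⟩
    exact ⟨h1, h2, fun ζ hζ => (key h1 h2 ζ hζ).congr_deriv (h3 ζ hζ)⟩

namespace LocalModel

variable {n r k : ℕ} {m : LocalModel n r} {B : 𝔼 n → Fin n → Fin n → ℝ}
  {sig : Signature} {S : Worldsheet sig} {a δ : Config n r}

local notation "𝖦" => m.toGeo B

lemma IsField.toGeo {D : Set Plane} (h : m.IsField D a) :
    𝖦.IsField D a.1 fun z => pairing r (a.2 z) :=
  ⟨h.smooth_fst, smooth_pairing h.smooth_snd, h.mapsTo⟩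

lemma firstVariationVanishes_iff (hs : 𝖦.IsSmooth) (hf : m.IsField S.dom a)
    (h1 : IsTest S.dom δ.1) (h2 : IsTest S.dom δ.2) :
    FirstVariationVanishes S.dom (m.gaugedLagrangian S.metric B) a δ ↔
      ∫ z in S.dom, 𝖦.firstVar S.conf a.1 (fun z => pairing r (a.2 z)) δ.1
        (fun z => pairing r (δ.2 z)) z = 0 := by
  have h0 := hs.hasDerivAt_integral_lag S.isConf hf.smooth_fst (smooth_pairing hf.smooth_snd)
    hf.mapsTo h1 (h2.clm_const S.isOpen_dom (pairing r).toContinuousLinearMap)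
  have key : HasDerivAt (fun s : ℝ => ∫ z in S.dom, (m.gaugedLagrangian S.metric B (a + s • δ) z
      - m.gaugedLagrangian S.metric B a z)) (∫ z in S.dom, 𝖦.firstVar S.conf a.1
        (fun z => pairing r (a.2 z)) δ.1 (fun z => pairing r (δ.2 z)) z) 0 := by
    refine h0.congr_of_eventuallyEq (Filter.Eventually.of_forall fun s => ?_)
    refine setIntegral_congr_fun S.isOpen_dom.measurableSet fun z hz => ?_
    have hd := (hf.smooth_fst.fderivAt S.isOpen_dom hz).differentiableAt
    have hd' : DifferentiableAt ℝ (a + s • δ).1 z :=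
      hd.add ((h1.1.differentiable (by simp) z).const_smul s)
    rw [m.gaugedLagrangian_eq B (S.symm z hz) hd, m.gaugedLagrangian_eq B (S.symm z hz) hd']
    have e : pairing r ((a + s • δ).2 z) = pairing r (a.2 z) + s • pairing r (δ.2 z) := by
      rw [← map_smul, ← map_add]; rfl
    rw [e]
    rfl
  exact ⟨fun H => key.unique H, fun H => key.congr_deriv H⟩

lemma isSolution_iff (hs : 𝖦.IsSmooth) : m.IsSolution S B a ↔ m.IsField S.dom a ∧
    𝖦.IsStationary S.conf S.dom a.1 fun z => pairing r (a.2 z) := by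
  constructor
  · intro H
    refine ⟨H.isField, fun ξ δ hξ hδ => ?_⟩
    have h2 : IsTest S.dom fun z => (pairing r).symm (δ z) :=
      hδ.clm_const S.isOpen_dom (pairing r).symm.toContinuousLinearMap
    have := (firstVariationVanishes_iff hs H.isField (δ := (ξ, fun z => (pairing r).symm (δ z)))
      hξ h2).1 (H.stationary _ hξ h2)
    simpa using this
  · rintro ⟨h1, h2⟩
    exact ⟨h1, fun δ hδ hδ' => (firstVariationVanishes_iff hs h1 hδ hδ').2
      (h2 _ _ hδ (hδ'.clm_const S.isOpen_dom (pairing r).toContinuousLinearMap))⟩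

/-- The anchor `t : F → E` in components, as a family of linear maps. -/
def shiftMap (T : 𝔼 n → Fin k → Fin r → ℝ) (x : 𝔼 n) : 𝔼 k ⊸ 𝔼 r := ofCoeff fun I => toLp 2 (T x I)

section invariance

variable (h : (m.toGeo B).IsGauged sig.sign)
include h

lemma smooth_gaugeVarA (hf : m.IsField S.dom a) {ε : Plane → Fin r → ℝ}
    (hε : C∞ ε S.dom) : C∞ (𝖦.gaugeVarA S.conf a.1
      (fun z => pairing r (a.2 z)) fun z => vec r (ε z)) S.dom := by
  have hD := S.isOpen_dom
  have hε' : C∞ (fun z => vec r (ε z)) S.dom :=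
    (vec r).toContinuousLinearMap.contDiff.comp_contDiffOn hε
  exact h.smooth_gaugeA S.isConf.smooth hf.smooth_fst
    (smooth_grad hD hf.smooth_fst) (smooth_pairing hf.smooth_snd) hε'
    (smooth_grad hD hε') hf.mapsTo

lemma isTest_gaugeVariation (hf : m.IsField S.dom a) {ε : Plane → Fin r → ℝ}
    (hε : IsTest S.dom ε) : IsTest S.dom (m.gaugeVariation S.metric a ε).1 ∧
      IsTest S.dom (m.gaugeVariation S.metric a ε).2 := by
  have hD := S.isOpen_dom
  constructor
  · have h1 : IsTest S.dom fun z => 𝖦.R (a.1 z) (vec r (ε z)) :=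
      (hε.clm_const hD (vec r).toContinuousLinearMap).clm_apply hD
        (h.smooth_R.comp hf.smooth_fst hf.mapsTo)
    convert h1 using 1
    ext1 z
    exact m.gaugeVariation_fst B _ _ _ _
  · refine isTest_on hD hε.2.1 hε.2.2 ?_ fun z hz => ?_
    · refine (smooth_pairing_symm (smooth_gaugeVarA h hf hε.1.contDiffOn)).congr fun z hz => ?_
      rw [ContinuousLinearEquiv.eq_symm_apply]
      exact m.gaugeVariation_snd B (S.symm z hz) (hf.smooth_fst.fderivAt hD hz).differentiableAt
        (hε.1.differentiable (by simp) z)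
    · have h0 := notMem_tsupport_iff_eventuallyEq.1 hz
      have h1 : ∀ c, (fun z' => ε z' c) =ᶠ[𝓝 z] fun _ => 0 := fun c => by
        filter_upwards [h0] with y hy
        rw [hy]; rfl
      ext c μ
      simp [gaugeVariation, pd, (h1 _).fderiv_eq, hε.eq_zero hz]

lemma integral_gaugeVariation (hf : m.IsField S.dom a) {ε : Plane → Fin r → ℝ}
    (hε : IsTest S.dom ε) : ∫ z in S.dom, 𝖦.firstVar S.conf a.1
      (fun z => pairing r (a.2 z)) (m.gaugeVariation S.metric a ε).1
      (fun z => pairing r ((m.gaugeVariation S.metric a ε).2 z)) z = 0 := by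
  have hD := S.isOpen_dom
  rw [← h.integral_gauge S.isConf hf.toGeo (hε.clm_const hD (vec r).toContinuousLinearMap)]
  refine integral_congr_on hD fun z hz => ?_
  have e : (m.gaugeVariation S.metric a ε).1 = fun z => 𝖦.R (a.1 z) (vec r (ε z)) := by
    ext1 z
    exact m.gaugeVariation_fst B _ _ _ _
  simp only [Geo.firstVar]
  rw [m.gaugeVariation_snd B (S.symm z hz) (hf.smooth_fst.fderivAt hD hz).differentiableAt
    (hε.1.differentiable (by simp) z), e]
  rfl

lemma isGauging : m.IsGauging sig B where
  reduces S X z _ := by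
    have hD : ∀ i, m.D (X, 0) i z = dX X i z := fun i => by ext μ; simp [D]
    simp [gaugedLagrangian, sigmaLagrangian, hD, wedge]
  lifts _ _ _ _ _ := rfl
  invariant S a ε hf hε := by
    obtain ⟨h1, h2⟩ := isTest_gaugeVariation h hf hε
    exact (firstVariationVanishes_iff h.toIsSmooth hf h1 h2).2 (integral_gaugeVariation h hf hε)

lemma isInvariant {T : 𝔼 n → Fin k → Fin r → ℝ} (hT : C∞ (shiftMap T) m.dom)
    (hRT : ∀ x ∈ m.dom, ∀ l, 𝖦.R x (shiftMap T x l) = 0)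
    (hAT : ∀ x ∈ m.dom, ∀ l, 𝖦.Al x (shiftMap T x l) = 0) : m.IsInvariant sig B T := by
  intro S a ε lam hf hε hlam
  have hD := S.isOpen_dom
  obtain ⟨h1, h2⟩ := isTest_gaugeVariation h hf hε
  have hp := hlam.clm_const hD (pairing k).toContinuousLinearMap
  have hTX := hT.comp hf.smooth_fst hf.mapsTo
  have h3 : IsTest S.dom (shiftVariation T a lam).2 := by
    have : IsTest S.dom fun z => (pairing r).symm
        (shiftMap T (a.1 z) (pairing k (lam z)).1, shiftMap T (a.1 z) (pairing k (lam z)).2) :=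
      ((((hp.clm_const hD (fst ℝ _ _)).clm_apply hD hTX).prodMk
        ((hp.clm_const hD (snd ℝ _ _)).clm_apply hD hTX) hD).clm_const hD
        (pairing r).symm.toContinuousLinearMap)
    convert this using 1
    ext1 z
    rw [ContinuousLinearEquiv.eq_symm_apply]
    exact pairing_shift _ _ _ _
  have h4 : (m.gaugeVariation S.metric a ε + shiftVariation T a lam).1 =
      (m.gaugeVariation S.metric a ε).1 := add_zero _
  rw [firstVariationVanishes_iff h.toIsSmooth hf (by rw [h4]; exact h1) (h2.add h3), h4,
    ← integral_gaugeVariation h hf hε]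
  refine integral_congr_on hD fun z hz => ?_
  have e : pairing r ((m.gaugeVariation S.metric a ε + shiftVariation T a lam).2 z) =
      pairing r ((m.gaugeVariation S.metric a ε).2 z) + (shiftMap T (a.1 z) (pairing k (lam z)).1,
        shiftMap T (a.1 z) (pairing k (lam z)).2) := by
    rw [shiftMap, ← pairing_shift T a lam z, ← map_add]; rfl
  have hx := hf.mapsTo hz
  simp only [Geo.firstVar]
  rw [e]
  exact Geo.dlag_add_of_ker (hRT _ hx _) (hRT _ hx _) (hAT _ hx _) (hAT _ hx _)

end invariance

end LocalModel

end

section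

/-! ### Strictness and completeness in foliated coordinates -/

namespace LocalModel

variable {n r k : ℕ}

/-- The projection to the coordinate directions along the leaves. -/
def leafProj (leaf : Finset (Fin n)) : 𝔼 n ⊸ 𝔼 n := LinearMap.toContinuousLinearMap
    { toFun := fun v => toLp 2 fun i => if i ∈ leaf then v i else 0
      map_add' := fun u v => by ext i; by_cases h : i ∈ leaf <;> simp [h]
      map_smul' := fun c v => by ext i; by_cases h : i ∈ leaf <;> simp [h] }

lemma leafProj_apply (leaf : Finset (Fin n)) (v : 𝔼 n) (i : Fin n) :
    leafProj leaf v i = if i ∈ leaf then v i else 0 := rfl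

lemma leafProj_eq_iff {leaf : Finset (Fin n)} {v : 𝔼 n} :
    leafProj leaf v = v ↔ ∀ i ∉ leaf, v i = 0 := by
  constructor
  · intro h i hi
    rw [← h, leafProj_apply, if_neg hi]
  · intro h
    ext i
    rw [leafProj_apply]
    split_ifs with hi
    · rfl
    · exact (h i hi).symm

/-- `transversal` as a linear map. -/
def transversalL (leaf : Finset (Fin n)) : 𝔼 n ⊸ ℰ {i : Fin n // i ∉ leaf} :=
  LinearMap.toContinuousLinearMap
    { toFun := transversal leaf, map_add' := fun _ _ => rfl, map_smul' := fun _ _ => rfl }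

lemma transversalL_apply (leaf : Finset (Fin n)) (v : 𝔼 n) :
    transversalL leaf v = transversal leaf v := rfl

/-- Extension of transversal vectors by zero. -/
def zeroExt (leaf : Finset (Fin n)) : ℰ {i : Fin n // i ∉ leaf} ⊸ 𝔼 n :=
  LinearMap.toContinuousLinearMap
    { toFun := fun v => toLp 2 fun i => if h : i ∈ leaf then 0 else v ⟨i, h⟩
      map_add' := fun u v => by ext i; by_cases h : i ∈ leaf <;> simp [h]
      map_smul' := fun c v => by ext i; by_cases h : i ∈ leaf <;> simp [h] }

lemma zeroExt_apply (leaf : Finset (Fin n)) (v : ℰ {i : Fin n // i ∉ leaf})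
    (i : Fin n) : zeroExt leaf v i = if h : i ∈ leaf then 0 else v ⟨i, h⟩ := rfl

variable {m : LocalModel n r} {B : 𝔼 n → Fin n → Fin n → ℝ}
  {sig : Signature} {leaf : Finset (Fin n)}

local notation "𝖦" => m.toGeo B

lemma IsFoliated.tangent_iff (hfol : m.IsFoliated leaf) {x : 𝔼 n} (hx : x ∈ m.dom) (v : 𝔼 n) :
    (∃ a, 𝖦.R x a = v) ↔ leafProj leaf v = v := by
  rw [leafProj_eq_iff, ← hfol.tangent x hx]
  constructor
  · rintro ⟨a, rfl⟩
    exact ⟨a, fun i => m.R_apply B x a i⟩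
  · rintro ⟨c, hc⟩
    exact ⟨toLp 2 c, by ext i; rw [R_apply]; exact (hc i).symm⟩

/-- The slice passes through the leaf coordinates of a point of the domain. -/
lemma IsFoliated.exists_leafSpace (hfol : m.IsFoliated leaf) {s : ℝ}
    (ρ : Reduction 𝖦 s) (ht : ρ.t = leafProj leaf) :
    ∃ l : LeafSpace ρ (ℰ {i : Fin n // i ∉ leaf}), l.pr = transversalL leaf := by
  obtain ⟨P, R, hP, hR, hRc, hdom⟩ := hfol.box
  have hpj : ∀ q, transversalL leaf (zeroExt leaf q) = q := fun q => by
    ext i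
    exact (zeroExt_apply leaf q i).trans (dif_neg i.2)
  have hjp : ∀ v, zeroExt leaf (transversalL leaf v) = v - ρ.t v := fun v => by
    ext i
    rw [ht, PiLp.sub_apply, leafProj_apply, zeroExt_apply]
    by_cases h : i ∈ leaf
    · simp [h]
    · simp only [h, dite_false, if_false, sub_zero]; rfl
  have hc : ∃ c0 : 𝔼 n, transversalL leaf c0 = 0 ∧
      ∀ x ∈ m.dom, zeroExt leaf (transversalL leaf x) + c0 ∈ m.dom := by
    rcases Set.eq_empty_or_nonempty m.dom with h0 | ⟨x0, hx0⟩
    · exact ⟨0, map_zero _, fun x hx => by simp [h0] at hx⟩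
    have h1 : transversalL leaf (leafProj leaf x0) = 0 := by
      ext i
      exact (leafProj_apply leaf x0 i).trans (if_neg i.2)
    refine ⟨leafProj leaf x0, h1, fun x hx => ?_⟩
    have e1 : transversal leaf (zeroExt leaf (transversalL leaf x) + leafProj leaf x0) =
        transversal leaf x := by
      rw [← transversalL_apply, map_add, hpj, h1, add_zero]; rfl
    have e2 : tangential leaf (zeroExt leaf (transversalL leaf x) + leafProj leaf x0) =
        tangential leaf x0 := by
      ext i
      show zeroExt leaf (transversalL leaf x) i + leafProj leaf x0 i = x0 i
      rw [zeroExt_apply, leafProj_apply, dif_pos i.2, if_pos i.2, zero_add]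
    rw [hdom] at hx hx0 ⊢
    exact ⟨e1 ▸ hx.1, e2 ▸ hx0.2⟩
  obtain ⟨c0, h0, hc0⟩ := hc
  refine ⟨⟨transversalL leaf, zeroExt leaf, c0, hpj, hjp, h0, hc0, ?_⟩, rfl⟩
  intro x hx x' hx' he τ hτ
  replace hx : x ∈ m.dom := hx
  replace hx' : x' ∈ m.dom := hx'
  show x + τ • (x' - x) ∈ m.dom
  rw [hdom] at hx hx' ⊢
  refine ⟨?_, ?_⟩
  · have : transversalL leaf (x + τ • (x' - x)) = transversalL leaf x := by
      rw [map_add, map_smul, map_sub, he, sub_self, smul_zero, add_zero]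
    rw [transversalL_apply, transversalL_apply] at this
    exact this ▸ hx.1
  · have : tangential leaf (x + τ • (x' - x)) = (1 - τ) • tangential leaf x
        + τ • tangential leaf x' := by
      ext i
      simp [tangential]
      ring
    rw [this]
    exact hRc hx.2 hx'.2 (by linarith [hτ.2]) hτ.1 (by ring)

/-- The nondegeneracy of the leaves needed in the given signature. -/
def LeafCondition (m : LocalModel n r) (B : 𝔼 n → Fin n → Fin n → ℝ) (sig : Signature) : Prop :=
  (∀ x ∈ m.dom, ∀ v, v ≠ 0 → 0 < (m.toGeo B).G x v v) ∧
    (sig = .euclidean → ∀ x ∈ m.dom, (m.toGeo B).LeafNondegenerate x)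

/-- The sequence `F → E → TM` is exact, and `α` vanishes on the image of `F`. -/
structure IsExactShift (m : LocalModel n r) (B : 𝔼 n → Fin n → Fin n → ℝ)
    (T : 𝔼 n → Fin k → Fin r → ℝ) : Prop where
  smooth : C∞ (shiftMap T) m.dom
  anchor : ∀ x ∈ m.dom, ∀ l, (m.toGeo B).R x (shiftMap T x l) = 0
  exact : ∀ x ∈ m.dom, ∀ a, (m.toGeo B).R x a = 0 → ∃ l, shiftMap T x l = a
  pairing : ∀ x ∈ m.dom, ∀ l, (m.toGeo B).Al x (shiftMap T x l) = 0

section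

variable (h : (m.toGeo B).IsGauged sig.sign) (hfol : m.IsFoliated leaf)
  (hL : m.LeafCondition B sig) {T : 𝔼 n → Fin k → Fin r → ℝ}
  (hT : m.IsExactShift B T)
include h hfol hL hT

lemma exists_foliated_reduction : ∃ ρ : Reduction 𝖦 sig.sign, ρ.t = leafProj leaf ∧
    ∀ x ∈ m.dom, ∀ u, (∀ v, ρ.gq x v u = 0) → ρ.t u = u := by
  refine h.exists_reduction (leafProj leaf) ?_ ?_ (fun x hx v => hfol.tangent_iff hx v) ?_ hL.1 ?_
  · intro v
    exact leafProj_eq_iff.2 fun i hi => by rw [leafProj_apply, if_neg hi]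
  · intro u v
    simp only [PiLp.inner_apply, leafProj_apply]
    refine sum_congr rfl fun i _ => ?_
    split_ifs <;> simp
  · intro x hx a ha
    obtain ⟨l, rfl⟩ := hT.exact x hx a ha
    exact hT.pairing x hx l
  · cases sig with
    | euclidean => exact Or.inr ⟨rfl, hL.2 rfl⟩
    | lorentzian => exact Or.inl rfl

omit hfol hL in
/-- A smooth choice of preimages under `t` of the elements of the kernel of the anchor. -/
lemma exists_shift_section (ρ : Reduction 𝖦 sig.sign) : ∃ J : 𝔼 n → 𝔼 r ⊸ 𝔼 k, C∞ J m.dom ∧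
      ∀ x ∈ m.dom, ∀ a, 𝖦.R x a = 0 → shiftMap T x (J x a) = a :=
  exists_section_on_ker hT.smooth h.smooth_R ρ.smooth_Rp
    (fun x hx a => by rw [ρ.R_Rp x hx, ρ.t_R x hx]) hT.anchor hT.exact

omit h hfol hL hT in
lemma sign_ne_zero (sig : Signature) : sig.sign ≠ 0 := by cases sig <;> simp [Signature.sign]

/-- On shell an invariant variation is, by the reduced model, a gauge variation up to a translation
of `A` along the kernel of the anchor; exactness writes the translation as `t(λ)`. -/
lemma isComplete : m.IsComplete sig B T := by
  intro S G a η hsol hη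
  obtain ⟨ρ, ht, hnd⟩ := exists_foliated_reduction h hfol hL hT
  obtain ⟨J, hJ, hTJ⟩ := exists_shift_section h hT ρ
  have hD := S.isOpen_dom
  obtain ⟨hf, hst⟩ := (isSolution_iff h.toIsSmooth).1 hsol
  have hS : ∀ z : ℝ × Plane, z ∈ Set.univ ×ˢ S.dom ↔ z ∈ {q : ℝ × Plane | q.2 ∈ S.dom} :=
    fun z => by simp
  have hS' := Set.ext hS
  have hinv : Reduction.IsInvariantVariation 𝖦 S.conf S.dom a.1 (fun σ => pairing r (a.2 σ)) G.order
      (fun p q σ => (G.coeff a p q).1 σ) (fun p q σ => pairing r ((G.coeff a p q).2 σ)) := by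
    intro x y hx hy hm hx0 hy0
    set b : ℝ → Config n r := fun τ => (fun σ => x (τ, σ), fun σ => (pairing r).symm (y (τ, σ)))
      with hb
    have hb0 : b 0 = a := by
      refine Prod.ext (funext fun σ => hx0 σ) (funext fun σ => ?_)
      simp [hb, hy0]
    have hfam : m.IsFieldFamily Set.univ S.dom b :=
      ⟨by rw [hS']; exact hx, by rw [hS']; exact smooth_pairing_symm hy, fun τ _ σ hσ => hm hσ⟩
    have h1 := G.smooth_fst b hfam
    have h2 := fun p q => smooth_pairing (G.smooth_snd b hfam p q)
    rw [hS'] at h1 h2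
    refine ⟨fun p q z => (G.coeff (b z.1) p q).1 z.2,
      fun p q z => pairing r ((G.coeff (b z.1) p q).2 z.2), h1, h2, fun p q σ => by
        simp only [hb0], fun p q σ => by simp only [hb0], fun τ η hη => ?_⟩
    have sl : C∞ (fun σ : Plane => (τ, σ)) S.dom := contDiffOn_const.prodMk contDiffOn_id
    have hft : m.IsField S.dom (b τ) :=
      ⟨hx.comp sl fun σ hσ => hσ, smooth_pairing_symm (hy.comp sl fun σ hσ => hσ),
        fun σ hσ => hm hσ⟩
    have e1 : (G.variation (b τ) η).1 = diffOp G.order (fun p q σ => (G.coeff (b τ) p q).1 σ) η :=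
      funext fun σ => G.variation_fst _ _ σ
    have e2 : (fun σ => pairing r ((G.variation (b τ) η).2 σ)) =
        diffOp G.order (fun p q σ => pairing r ((G.coeff (b τ) p q).2 σ)) η := by
      ext1 σ
      rw [G.variation_snd, diffOp]
      simp only [map_sum, map_smul]
    have t1 : IsTest S.dom (G.variation (b τ) η).1 := by
      rw [e1]
      exact isTest_diffOp hD (fun p q => (h1 p q).comp sl fun σ hσ => hσ) hη
    have t2 : IsTest S.dom (G.variation (b τ) η).2 := by
      have : IsTest S.dom fun σ => pairing r ((G.variation (b τ) η).2 σ) := by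
        rw [e2]
        exact isTest_diffOp hD (fun p q => (h2 p q).comp sl fun σ hσ => hσ) hη
      simpa using this.clm_const hD (pairing r).symm.toContinuousLinearMap
    have := (firstVariationVanishes_iff h.toIsSmooth hft t1 t2).1 (G.invariant _ _ hft hη)
    rw [e1, e2] at this
    simpa [hb] using this
  obtain ⟨ε, z, hε, hz, H⟩ := ρ.exists_gauge_parameters h (sign_ne_zero sig) S.isConf hnd
    hf.toGeo hst hinv hη
  have hJX := hJ.comp hf.smooth_fst hf.mapsTo
  refine ⟨fun σ => (vec r).symm (ε σ),
    fun σ => (pairing k).symm (J (a.1 σ) (z σ).1, J (a.1 σ) (z σ).2),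
    hε.clm_const hD (vec r).symm.toContinuousLinearMap,
    (((hz.clm_const hD (fst ℝ _ _)).clm_apply hD hJX).prodMk
      ((hz.clm_const hD (snd ℝ _ _)).clm_apply hD hJX) hD).clm_const hD
      (pairing k).symm.toContinuousLinearMap, fun σ hσ => ?_⟩
  obtain ⟨H1, H2, H3, H4⟩ := H σ hσ
  have hx := hf.mapsTo hσ
  constructor
  · show _ = (m.gaugeVariation S.metric a _).1 σ + 0
    rw [add_zero, m.gaugeVariation_fst B, G.variation_fst]
    simpa [diffOp] using H1.symm
  · apply (pairing r).injective
    have e : ∀ lam : Plane → Fin k → Fin 2 → ℝ, pairing r ((m.gaugeVariation S.metric a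
        (fun σ => (vec r).symm (ε σ)) + shiftVariation T a lam).2 σ) =
        pairing r ((m.gaugeVariation S.metric a (fun σ => (vec r).symm (ε σ))).2 σ)
        + pairing r ((shiftVariation T a lam).2 σ) := fun lam => by rw [← map_add]; rfl
    have hεd : DifferentiableAt ℝ (fun σ => (vec r).symm (ε σ)) σ :=
      (hε.clm_const hD (vec r).symm.toContinuousLinearMap).1.differentiable (by simp) σ
    have hsnd := m.gaugeVariation_snd B (S.symm σ hσ)
      (hf.smooth_fst.fderivAt hD hσ).differentiableAt hεd
    rw [e, pairing_shift, hsnd]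
    have e3 : (pairing r ((G.variation a η).2 σ)) =
        diffOp G.order (fun p q σ => pairing r ((G.coeff a p q).2 σ)) η σ := by
      rw [G.variation_snd, diffOp]
      simp only [map_sum, map_smul]
    rw [e3, H4]
    have z1 := hTJ _ hx _ H2
    have z2 := hTJ _ hx _ H3
    simp only [shiftMap] at z1 z2
    simp only [ContinuousLinearEquiv.apply_symm_apply, z1, z2]
    rfl

omit h hT hL in
/-- Gauge transformations move `X` along the leaves. -/
lemma GaugeEquivalent.transversal_eq {S : Worldsheet sig} {a a' : Config n r}
    (he : m.GaugeEquivalent S T a a') {z : Plane} (hz : z ∈ S.dom) :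
    transversal leaf (a.1 z) = transversal leaf (a'.1 z) := by
  obtain ⟨p, ε, lam, hp, -, -, h0, h1, hd⟩ := he
  have key : ∀ s ∈ Icc (0 : ℝ) 1, HasDerivWithinAt (fun s => transversalL leaf ((p s).1 z)) 0
      (Icc 0 1) s := by
    intro s hs
    have hx := hp.mapsTo s hs hz
    have := (transversalL leaf).hasFDerivAt.comp_hasDerivWithinAt s (hd s hs z hz).1
    refine this.congr_deriv ?_
    have e : (m.gaugeVariation S.metric (p s) (ε s) + shiftVariation T (p s) (lam s)).1 z =
        (m.toGeo 0).R ((p s).1 z) (vec r (ε s z)) := by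
      rw [← m.gaugeVariation_fst 0 S.metric]
      exact add_zero _
    rw [e]
    ext i
    exact leafProj_eq_iff.1 ((hfol.tangent_iff hx _).1 ⟨_, rfl⟩) i i.2
  have := constant_of_derivWithin_zero (fun s hs => (key s hs).differentiableWithinAt)
    (fun s hs => (key s (Set.Ico_subset_Icc_self hs)).derivWithin
      (uniqueDiffOn_Icc one_pos s (Set.Ico_subset_Icc_self hs))) 1 (Set.right_mem_Icc.2 zero_le_one)
  rw [(h0 z hz).1, (h1 z hz).1] at this
  exact this.symm

/-- Gauge transformations preserve the leaf, and `exists_gauge_path` gives the converse. -/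
lemma gaugeEquivalent_iff {S : Worldsheet sig} {a a' : Config n r} (ha : m.IsSolution S B a)
    (ha' : m.IsSolution S B a') : m.GaugeEquivalent S T a a' ↔
      ∀ σ ∈ S.dom, transversal leaf (a.1 σ) = transversal leaf (a'.1 σ) := by
  refine ⟨fun he σ hσ => he.transversal_eq hfol hσ, fun he => ?_⟩
  obtain ⟨ρ, ht, -⟩ := exists_foliated_reduction h hfol hL hT
  obtain ⟨l, hl⟩ := hfol.exists_leafSpace ρ ht
  obtain ⟨J, hJ, hTJ⟩ := exists_shift_section h hT ρ
  have hD := S.isOpen_dom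
  obtain ⟨hf, hst⟩ := (isSolution_iff h.toIsSmooth).1 ha
  obtain ⟨hf', hst'⟩ := (isSolution_iff h.toIsSmooth).1 ha'
  have hpr : ∀ σ ∈ S.dom, l.pr (a.1 σ) = l.pr (a'.1 σ) := fun σ hσ => by rw [hl]; exact he σ hσ
  obtain ⟨Ω, x, y, ε, z, hΩ, hsub, hx, hy, hε, hz, hm, hend, H⟩ := ρ.exists_gauge_path h S.isConf
    hf.toGeo hf'.toGeo ((ρ.isStationary_iff h S.isConf hf.toGeo).1 hst).1
    ((ρ.isStationary_iff h S.isConf hf'.toGeo).1 hst').1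
    (fun σ hσ => by
      have h1 := l.j_pr (a'.1 σ - a.1 σ)
      rw [map_sub, hpr σ hσ, sub_self, map_zero] at h1
      exact (sub_eq_zero.1 h1.symm).symm)
    (fun σ hσ => l.segment _ (hf.mapsTo hσ) _ (hf'.mapsTo hσ) (hpr σ hσ))
  have hJx := (hJ.comp hx hm)
  refine ⟨fun τ => (fun σ => x (τ, σ), fun σ => (pairing r).symm (y (τ, σ))),
    fun τ σ => (vec r).symm (ε (τ, σ)), fun τ σ => (pairing k).symm (J (x (τ, σ)) (z (τ, σ)).1,
      J (x (τ, σ)) (z (τ, σ)).2), ⟨hx.mono hsub, (smooth_pairing_symm hy).mono hsub,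
      fun τ hτ σ hσ => hm (hsub (Set.mk_mem_prod hτ hσ))⟩,
    ((vec r).symm.toContinuousLinearMap.contDiff.comp_contDiffOn hε).mono hsub,
    (smooth_pairing_symm ((hJx.clm_apply hz.fst).prodMk (hJx.clm_apply hz.snd))).mono hsub,
    fun σ hσ => ?_, fun σ hσ => ?_, fun τ hτ σ hσ => ?_⟩
  · obtain ⟨e1, e2, -, -⟩ := hend σ hσ
    simp [e1, e2]
  · obtain ⟨-, -, e1, e2⟩ := hend σ hσ
    simp [e1, e2]
  obtain ⟨z1, z2, d1, d2⟩ := H τ hτ σ hσ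
  have hxm : x (τ, σ) ∈ m.dom := hm (hsub ⟨hτ, hσ⟩)
  have sl : ContDiffAt ℝ ∞ (fun σ : Plane => (τ, σ)) σ := contDiffAt_const.prodMk contDiffAt_id
  have hxd := ((hx.contDiffAt (hΩ.mem_nhds (hsub ⟨hτ, hσ⟩))).comp σ sl).diffAt
  have hεd : DifferentiableAt ℝ (fun σ => (vec r).symm (ε (τ, σ))) σ :=
    ((vec r).symm.toContinuousLinearMap.contDiff.contDiffAt.comp σ
      ((hε.contDiffAt (hΩ.mem_nhds (hsub ⟨hτ, hσ⟩))).comp σ sl)).diffAt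
  constructor
  · refine HasDerivAt.hasDerivWithinAt (d1.congr_deriv ?_)
    show _ = (m.gaugeVariation S.metric _ _).1 σ + 0
    rw [add_zero, m.gaugeVariation_fst B]
    simp
  · have d3 := (pairing r).symm.toContinuousLinearMap.hasFDerivAt.comp_hasDerivAt τ d2
    refine HasDerivAt.hasDerivWithinAt (d3.congr_deriv ?_)
    show (pairing r).symm _ = _
    rw [ContinuousLinearEquiv.symm_apply_eq]
    have hsnd := m.gaugeVariation_snd B (a := (fun σ => x (τ, σ), fun σ => (pairing r).symm
      (y (τ, σ)))) (S.symm σ hσ) hxd hεd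
    rw [show ∀ c d : Config n r, (c + d).2 σ = c.2 σ + d.2 σ from fun _ _ => rfl, map_add, hsnd,
      pairing_shift]
    have z3 := hTJ _ hxm _ z1
    have z4 := hTJ _ hxm _ z2
    simp only [shiftMap] at z3 z4
    simp only [ContinuousLinearEquiv.apply_symm_apply, z3, z4]
    rfl

/-- The metric and the 2-form on the leaf space are the restrictions of the reduced ones to a slice;
surjectivity comes from lifting maps to the slice and solving for the gauge field. -/
lemma isStrict : m.IsStrict sig B T leaf := by
  obtain ⟨ρ, ht, hnd⟩ := exists_foliated_reduction h hfol hL hT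
  obtain ⟨l, hl⟩ := hfol.exists_leafSpace ρ ht
  have hdom : transversal leaf '' m.dom = l.dom := by rw [l.dom_eq_image, hl]; rfl
  have hco : ∀ (f : ℰ {i : Fin n // i ∉ leaf} ⊸ ℰ {i : Fin n // i ∉ leaf} ⊸ ℝ),
      (ofCoeff fun I => ofCoeff fun J => f (single I 1) (single J 1)) = f := fun f => by
    conv_rhs => rw [eq_ofCoeff f]
    exact congrArg _ (funext fun I => (eq_ofCoeff _).symm)
  have hsig := l.isSigma h
  have hent : ∀ {b : ℰ {i : Fin n // i ∉ leaf} → ℰ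
      {i : Fin n // i ∉ leaf} ⊸ ℰ {i : Fin n // i ∉ leaf} ⊸ ℝ},
      C∞ b l.dom → ∀ I J, C∞ (fun y => b y (single I 1) (single J 1)) l.dom := fun hb I J =>
    hb.clm₂ contDiffOn_const contDiffOn_const
  set gQ : ℰ {i : Fin n // i ∉ leaf} → {i : Fin n // i ∉ leaf} →
    {i : Fin n // i ∉ leaf} → ℝ := fun y I J => l.slice ρ.gq y (single I 1) (single J 1) with hgQ
  set BQ : ℰ {i : Fin n // i ∉ leaf} → {i : Fin n // i ∉ leaf} →
    {i : Fin n // i ∉ leaf} → ℝ := fun y I J => l.slice ρ.bt y (single I 1) (single J 1) with hBQ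
  have eg : (fun y => ofCoeff fun i => ofCoeff (gQ y i)) = l.slice ρ.gq := funext fun y => hco _
  have eb : (fun y => ofCoeff fun i => ofCoeff (BQ y i)) = l.slice ρ.bt := funext fun y => hco _
  have hmv : ∀ y (v w : {i : Fin n // i ∉ leaf} → ℝ), w ⬝ᵥ (Matrix.of (gQ y) *ᵥ v) =
      l.slice ρ.gq y (toLp 2 w) (toLp 2 v) := by
    intro y v w
    rw [← congrFun eg y, bilin_apply]
    simp only [dotProduct, Matrix.mulVec, Matrix.of_apply, mul_sum]
    exact sum_congr rfl fun I _ => sum_congr rfl fun J _ => by ring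
  refine ⟨gQ, BQ, ?_, ?_, ?_, fun S => ⟨?_, ?_, ?_⟩⟩
  · rw [hdom]; exact hent hsig.smooth_g
  · rw [hdom]; exact hent hsig.smooth_b
  · rw [hdom]
    intro y hy
    have hsym : (Matrix.of (gQ y)).IsSymm := Matrix.IsSymm.ext fun I J => hsig.symm y hy _ _
    refine ⟨hsym, fun h0 => ?_, fun hs => ?_, fun I J => hsig.antisymm y hy _ _⟩
    · obtain ⟨v, hv, hv0⟩ := Matrix.exists_mulVec_eq_zero_iff.2 h0
      have := l.slice_gq_nondegenerate h hnd hy fun p => by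
        have := hmv y v p
        rw [hv0, dotProduct_zero] at this
        exact this.symm
      exact hv (congrArg WithLp.ofLp this)
    · subst hs
      refine Matrix.PosDef.of_dotProduct_mulVec_pos ?_ fun v hv => ?_
      · rw [Matrix.IsHermitian, Matrix.conjTranspose_eq_transpose_of_trivial]; exact hsym
      · rw [star_trivial, hmv, l.slice_apply]
        refine ρ.gq_pos rfl hy (hL.1 _ hy) fun h0 => hv ?_
        rw [l.t_j] at h0
        have := l.pr_j (toLp 2 v)
        rw [← h0, map_zero] at this
        exact (congrArg WithLp.ofLp this).symm
  · intro a ha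
    obtain ⟨hf, hst⟩ := (isSolution_iff h.toIsSmooth).1 ha
    rw [isSigmaSolution_iff S (by rw [eg, eb, hdom]; exact hsig), eg, eb, hdom]
    have h1 : ∀ z, transversal leaf (a.1 z) = l.pr (a.1 z) := fun z => by rw [hl]; rfl
    simp only [h1]
    exact ⟨l.pr.contDiff.comp_contDiffOn hf.smooth_fst, fun z hz => l.mem_dom (hf.mapsTo hz),
      (l.stationary_iff h S.isConf hf.smooth_fst hf.mapsTo).1
        ((ρ.isStationary_iff h S.isConf hf.toGeo).1 hst).2⟩
  · intro Y hY
    rw [isSigmaSolution_iff S (by rw [eg, eb, hdom]; exact hsig), eg, eb, hdom] at hY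
    obtain ⟨hY1, hY2, hY3⟩ := hY
    obtain ⟨X, A, hf, hdev, hpr⟩ := l.exists_lift S.isConf hY1 hY2
    have hprX := funext hpr
    refine ⟨(X, fun z => (pairing r).symm (A z)), (isSolution_iff h.toIsSmooth).2
      ⟨⟨hf.smooth_X, smooth_pairing_symm hf.smooth_A, hf.mapsTo⟩, ?_⟩, fun z _ => ?_⟩
    · simp only [ContinuousLinearEquiv.apply_symm_apply]
      refine (ρ.isStationary_iff h S.isConf hf).2 ⟨hdev,
        (l.stationary_iff h S.isConf hf.smooth_X hf.mapsTo).2 fun ζ hζ => ?_⟩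
      rw [hprX]
      simpa only [hpr] using hY3 ζ hζ
    · rw [← hpr z, hl]; rfl
  · exact fun a a' ha ha' => gaugeEquivalent_iff h hfol hL hT ha ha'

end

end LocalModel

end

section

/-! ### Smooth dependence of integral curves on parameters -/

section nemytskii

variable {X : Type} [TopologicalSpace X] [CompactSpace X]
  {E : Type} [NormedAddCommGroup E] [NormedSpace ℝ E]

/-- Pointwise application of a continuous family of linear maps. -/
def pointwiseApply (X : Type) [TopologicalSpace X] [CompactSpace X] (E F : Type)
    [NormedAddCommGroup E] [NormedSpace ℝ E] [NormedAddCommGroup F] [NormedSpace ℝ F] :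
    C(X, E ⊸ F) ⊸ C(X, E) ⊸ C(X, F) :=
  LinearMap.mkContinuous₂ (LinearMap.mk₂ ℝ
    (fun A y => (⟨fun x => A x (y x), by fun_prop⟩ : C(X, F))) (fun _ _ _ => by ext; simp)
    (fun _ _ _ => by ext; simp) (fun _ _ _ => by ext; simp) fun _ _ _ => by ext; simp) 1
    fun A y => (ContinuousMap.norm_le _ (by positivity)).2 fun x => by
      rw [one_mul]
      exact ((A x).le_opNorm _).trans (mul_le_mul (A.norm_coe_le_norm x) (y.norm_coe_le_norm x)
        (norm_nonneg _) (norm_nonneg _))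

/-- Composition with a smooth map is differentiable on spaces of continuous functions: along the
segment from `y` to `y + h` the derivative of the outer map is uniformly close to the one at `y`,
by continuity of composition with it. -/
lemma hasFDerivAt_postcomp {F : Type} [NormedAddCommGroup F] [NormedSpace ℝ F] {f : E → F}
    {f' : E → E ⊸ F} (hf : ∀ x, HasFDerivAt f (f' x) x) (hc : Continuous f) (hc' : Continuous f')
    (y : C(X, E)) : HasFDerivAt (fun y : C(X, E) => (ContinuousMap.mk f hc).comp y)
      (pointwiseApply X E F ((ContinuousMap.mk f' hc').comp y)) y := by
  rw [hasFDerivAt_iff_isLittleO_nhds_zero, Asymptotics.isLittleO_iff]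
  intro c hc0
  have h1 := ((ContinuousMap.continuous_postcomp (X := X) ⟨f', hc'⟩).tendsto y)
  obtain ⟨δ, hδ, h2⟩ := Metric.eventually_nhds_iff.1 (h1.eventually (Metric.ball_mem_nhds _ hc0))
  filter_upwards [Metric.ball_mem_nhds (0 : C(X, E)) hδ] with h hh
  refine (ContinuousMap.norm_le _ (by positivity)).2 fun x => ?_
  have h3 : ∀ z ∈ segment ℝ (y x) (y x + h x), ‖f' z - f' (y x)‖ ≤ c := by
    intro z hz
    obtain ⟨s, ⟨hs0, hs1⟩, rfl⟩ := (segment_eq_image' ℝ (y x) (y x + h x)) ▸ hz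
    have h4 : dist (y + s • h) y < δ := by
      rw [dist_eq_norm, add_sub_cancel_left, norm_smul, Real.norm_of_nonneg hs0]
      rw [mem_ball_zero_iff] at hh
      nlinarith [norm_nonneg h]
    have h5 := (h2 h4).le
    rw [dist_eq_norm] at h5
    simpa using (ContinuousMap.norm_coe_le_norm _ x).trans h5
  have h4 := Convex.norm_image_sub_le_of_norm_hasFDerivWithin_le'
    (fun z _ => (hf z).hasFDerivWithinAt) h3 (convex_segment _ _) (left_mem_segment ℝ _ _)
    (right_mem_segment ℝ _ _)
  rw [add_sub_cancel_left] at h4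
  exact h4.trans (mul_le_mul_of_nonneg_left (h.norm_coe_le_norm x) hc0.le)

lemma contDiff_postcomp {F : Type} [NormedAddCommGroup F] [NormedSpace ℝ F] {f : E → F}
    (hf : ContDiff ℝ ∞ f) :
    ContDiff ℝ ∞ fun y : C(X, E) => (ContinuousMap.mk f hf.continuous).comp y := by
  have key : ∀ (k : ℕ) (F : Type) [NormedAddCommGroup F] [NormedSpace ℝ F] (f : E → F)
      (hf : ContDiff ℝ ∞ f),
      ContDiff ℝ k fun y : C(X, E) => (ContinuousMap.mk f hf.continuous).comp y := by
    intro k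
    induction k with
    | zero =>
      intro F _ _ f hf
      exact contDiff_zero.2 (ContinuousMap.continuous_postcomp _)
    | succ k ih =>
      intro F _ _ f hf
      have h1 : ContDiff ℝ ∞ (𝒟 f) := hf.fderiv_right (by simp)
      push_cast
      exact contDiff_succ_iff_hasFDerivAt.2 ⟨_, (pointwiseApply X E F).contDiff.comp
        (ih _ _ h1), hasFDerivAt_postcomp (fun x => (hf.differentiable (by simp) x).hasFDerivAt)
          _ h1.continuous⟩
  exact contDiff_infty.2 fun k => key k F f hf

end nemytskii

variable {E : Type} [NormedAddCommGroup E] [NormedSpace ℝ E]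

/-- The primitive vanishing at `0` of a continuous curve on the unit interval. -/
def primitiveCLM (E : Type) [NormedAddCommGroup E] [NormedSpace ℝ E] :
    C(unitInterval, E) ⊸ C(unitInterval, E) :=
  LinearMap.mkContinuous
    { toFun := fun y => ⟨fun t => ∫ s in (0 : ℝ)..t, IccExtend zero_le_one y s,
        (intervalIntegral.continuous_primitive (fun _ _ =>
          (y.continuous.Icc_extend').intervalIntegrable _ _) 0).comp continuous_subtype_val⟩
      map_add' := fun y z => by
        ext t
        exact intervalIntegral.integral_add ((y.continuous.Icc_extend').intervalIntegrable _ _)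
          ((z.continuous.Icc_extend').intervalIntegrable _ _)
      map_smul' := fun c y => by
        ext t
        exact intervalIntegral.integral_smul _ _ } 1 fun y =>
    (ContinuousMap.norm_le _ (by positivity)).2 fun t => by
      refine (intervalIntegral.norm_integral_le_of_norm_le_const (C := ‖y‖) fun s _ =>
        y.norm_coe_le_norm _).trans ?_
      rw [sub_zero, abs_of_nonneg t.2.1, one_mul]
      exact mul_le_of_le_one_right (norm_nonneg _) t.2.2

lemma primitiveCLM_apply (y : C(unitInterval, E)) (t : unitInterval) :
    primitiveCLM E y t = ∫ s in (0 : ℝ)..t, IccExtend zero_le_one y s := rfl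

lemma contDiff_parametric_integral {P : Type} [NormedAddCommGroup P] [NormedSpace ℝ P]
    {f : ℝ × P → E} (hf : ContDiff ℝ ∞ f) :
    ContDiff ℝ ∞ (fun p => ∫ s in (0 : ℝ)..1, f (s, p)) ∧
    ∀ p v, 𝒟 (fun p => ∫ s in (0 : ℝ)..1, f (s, p)) p v =
      ∫ s in (0 : ℝ)..1, 𝒟 (fun p => f (s, p)) p v := by
  let L : P ⊸ C(unitInterval, ℝ × P) := (ContinuousLinearMap.compLeftContinuous ℝ unitInterval
    (inr ℝ ℝ P)) ∘L const ℝ unitInterval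
  let c : C(unitInterval, ℝ × P) := ⟨fun s => ((s : ℝ), (0 : P)), by fun_prop⟩
  let D : C(unitInterval, E) ⊸ E := (ContinuousMap.evalCLM ℝ (1 : unitInterval)) ∘L primitiveCLM E
  have hf' : ContDiff ℝ ∞ (𝒟 f) := hf.fderiv_right (by simp)
  have hcL : ∀ p (s : unitInterval), (c + L p) s = ((s : ℝ), p) := fun p s => by simp [c, L]
  have h1 : ∀ p, D ((ContinuousMap.mk f hf.continuous).comp (c + L p)) =
      ∫ s in (0 : ℝ)..1, f (s, p) := fun p => by
    refine intervalIntegral.integral_congr fun s hs => ?_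
    rw [Set.uIcc_of_le (show (0 : ℝ) ≤ (1 : unitInterval) from zero_le_one)] at hs
    rw [Set.IccExtend_of_mem _ _ hs, ContinuousMap.comp_apply, hcL]
    rfl
  rw [← funext h1]
  refine ⟨D.contDiff.comp ((contDiff_postcomp hf).comp (contDiff_const.add L.contDiff)),
    fun p v => ?_⟩
  have h2 := D.hasFDerivAt.comp p ((hasFDerivAt_postcomp (fun x =>
    (hf.differentiable (by simp) x).hasFDerivAt) hf.continuous hf'.continuous (c + L p)).comp p
      (L.hasFDerivAt.const_add c))
  refine (DFunLike.congr_fun h2.fderiv v).trans (intervalIntegral.integral_congr fun s hs => ?_)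
  rw [Set.uIcc_of_le (show (0 : ℝ) ≤ (1 : unitInterval) from zero_le_one)] at hs
  have h3 : HasFDerivAt (fun p => f (s, p)) _ p := (hf.differentiable (by simp)
    (s, p)).hasFDerivAt.comp p ((hasFDerivAt_const s p).prodMk (hasFDerivAt_id p))
  rw [Set.IccExtend_of_mem _ _ hs, h3.fderiv]
  show 𝒟 f ((c + L p) _) (L v _) = _
  rw [hcL]
  simp [L]

/-- The inverse function theorem, with smoothness of both maps on the whole domains. -/
lemma exists_inverse_contDiffOn {F : Type} [NormedAddCommGroup F] [NormedSpace ℝ F] [CompleteSpace E]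
    {f : E → F} {s : Set E} (hs : IsOpen s) (hf : C∞ f s) {a : E} (ha : a ∈ s)
    {f' : E ≃L[ℝ] F} (hf' : HasFDerivAt f (f' : E ⊸ F) a) :
    ∃ Φ : OpenPartialHomeomorph E F, a ∈ Φ.source ∧ Φ.source ⊆ s ∧ (∀ x, Φ x = f x) ∧
      C∞ Φ.symm Φ.target := by
  have h1 := hf.contDiffAt (hs.mem_nhds ha)
  have h2 : ContinuousOn (𝒟 f) s := hf.continuousOn_fderiv_of_isOpen hs (by simp)
  have h3 := (h2.continuousAt (hs.mem_nhds ha)).eventually (by rw [hf'.fderiv]; exact f'.nhds)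
  obtain ⟨u, hu, huo, hau⟩ := eventually_nhds_iff.1 h3
  have hi : ∀ y ∈ u ∩ s, ∃ A : E ≃L[ℝ] F, HasFDerivAt f (A : E ⊸ F) y := fun y hy => by
    obtain ⟨A, hA⟩ := hu y hy.1
    exact ⟨A, hA ▸ (hf.fderivAt hs hy.2)⟩
  refine ⟨(h1.toOpenPartialHomeomorph f hf' (by simp)).restrOpen (u ∩ s) (huo.inter hs),
    ⟨h1.mem_toOpenPartialHomeomorph_source hf' (by simp), hau, ha⟩, fun y hy => hy.2.2,
    fun y => rfl, fun z hz => ?_⟩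
  have hz' := OpenPartialHomeomorph.map_target _ hz
  obtain ⟨A, hA⟩ := hi _ hz'.2
  exact (OpenPartialHomeomorph.contDiffAt_symm _ hz hA
    (hf.contDiffAt (hs.mem_nhds hz'.2.2))).contDiffWithinAt

/-- The solutions of `y' = V(y) w`, `y(0) = x0 + A w` on the unit interval exist and depend smoothly
on `w` for small `w`: for `w = 0` the linearisation of the integral equation is the identity. -/
lemma exists_smooth_flow [CompleteSpace E] {V : E → E ⊸ E} (hV : ContDiff ℝ ∞ V) (x0 : E)
    (A : E ⊸ E) : ∃ (u : Set E) (Y : E → C(unitInterval, E)), IsOpen u ∧ 0 ∈ u ∧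
      C∞ Y u ∧ Y 0 = ContinuousMap.const _ x0 ∧ ∀ w ∈ u,
      Y w = const ℝ unitInterval (x0 + A w) + primitiveCLM E
        (pointwiseApply _ E E ((ContinuousMap.mk V hV.continuous).comp (Y w))
          (const ℝ unitInterval w)) := by
  set K := const (M := E) ℝ unitInterval
  set c : C(unitInterval, E) := K x0
  set N : C(unitInterval, E) → C(unitInterval, E ⊸ E) := fun y =>
    (ContinuousMap.mk V hV.continuous).comp y with hN
  have hNc : ContDiff ℝ ∞ N := contDiff_postcomp hV
  set Ψ : E × C(unitInterval, E) → E × C(unitInterval, E) := fun p =>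
    (p.1, p.2 - (K (x0 + A p.1) + primitiveCLM E (pointwiseApply _ E E (N p.2) (K p.1)))) with hΨ
  have hΨc : ContDiff ℝ ∞ Ψ := by
    have h1 : ContDiff ℝ ∞ fun p : E × C(unitInterval, E) => pointwiseApply _ E E (N p.2) :=
      (pointwiseApply _ E E).contDiff.comp (hNc.comp contDiff_snd)
    exact contDiff_fst.prodMk (contDiff_snd.sub ((K.contDiff.comp (contDiff_const.add
      (A.contDiff.comp contDiff_fst))).add ((primitiveCLM E).contDiff.comp
        (h1.clm_apply (K.contDiff.comp contDiff_fst)))))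
  set L : E ⊸ C(unitInterval, E) := -(K ∘L A + primitiveCLM E ∘L (pointwiseApply _ E E (N c)) ∘L K)
  have hΨd : HasFDerivAt Ψ (((ContinuousLinearEquiv.refl ℝ E).skewProd
      (ContinuousLinearEquiv.refl ℝ C(unitInterval, E)) L :
      (E × C(unitInterval, E)) ≃L[ℝ] _) : _ ⊸ _) (0, c) := by
    have hf : HasFDerivAt (fun p : E × C(unitInterval, E) => p.1)
      (fst ℝ E C(unitInterval, E)) (0, c) := hasFDerivAt_fst
    have hs : HasFDerivAt (fun p : E × C(unitInterval, E) => p.2)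
      (snd ℝ E C(unitInterval, E)) (0, c) := hasFDerivAt_snd
    have h1 : HasFDerivAt (fun p : E × C(unitInterval, E) => pointwiseApply _ E E (N p.2))
        (𝒟 (fun p : E × C(unitInterval, E) => pointwiseApply _ E E (N p.2)) (0, c)) (0, c) :=
      (((pointwiseApply _ E E).contDiff.comp (hNc.comp contDiff_snd)).differentiable
        (n := ∞) (by simp) _).hasFDerivAt
    have h2 := h1.clm_apply (K.hasFDerivAt.comp (0, c) hf)
    have h3 := hf.prodMk (hs.sub ((K.hasFDerivAt.comp (0, c)
      ((A.hasFDerivAt.comp (0, c) hf).const_add x0)).add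
      ((primitiveCLM E).hasFDerivAt.comp (0, c) h2)))
    exact HasFDerivAt.congr_fderiv (f := Ψ) h3 (by ext p <;> simp [L, sub_eq_add_neg])
  obtain ⟨Φ, h0, -, hΦ, hΦs⟩ := exists_inverse_contDiffOn isOpen_univ hΨc.contDiffOn
    (Set.mem_univ _) hΨd
  have hΨ0 : Ψ (0, c) = (0, 0) := by simp [hΨ, c]
  have h4 : (0, 0) ∈ Φ.target := by rw [← hΨ0, ← hΦ]; exact Φ.map_source h0
  refine ⟨(fun w => (w, 0)) ⁻¹' Φ.target, fun w => (Φ.symm (w, 0)).2,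
    Φ.open_target.preimage (by fun_prop), h4, contDiff_snd.comp_contDiffOn (hΦs.comp
      (contDiff_id.prodMk contDiff_const).contDiffOn fun w hw => hw), ?_, fun w hw => ?_⟩
  · show (Φ.symm (0, 0)).2 = c
    rw [← hΨ0, ← hΦ, Φ.left_inv h0]
  · have h5 := Φ.right_inv hw
    rw [hΦ] at h5
    have h6 : (Φ.symm (w, 0)).1 = w := congrArg Prod.fst h5
    have h7 := sub_eq_zero.1 (congrArg Prod.snd h5)
    rwa [h6] at h7

end

section

/-! ### Integral manifolds of involutive families of vector fields -/

lemma exists_transversal_coordinates {n : ℕ} (L : Submodule ℝ (𝔼 n)) :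
    ∃ leaf : Finset (Fin n), (∀ l ∈ L, (∀ i ∈ leaf, l i = 0) → l = 0) ∧
      ∀ v : 𝔼 n, ∃ l ∈ L, ∀ i ∈ leaf, l i = v i := by
  obtain ⟨s, hs, hmax⟩ := (Set.toFinite {s : Finset (Fin n) | ∀ v : 𝔼 n,
    ∃ l ∈ L, ∀ i ∈ s, l i = v i}).exists_maximal ⟨∅, fun v => ⟨0, L.zero_mem, by simp⟩⟩
  refine ⟨s, fun l hl h0 => ?_, hs⟩
  by_contra hne
  obtain ⟨j, hj⟩ : ∃ j, l j ≠ 0 := by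
    by_contra! h
    exact hne (by ext j; simpa using h j)
  have h1 : insert j s ∈ {s : Finset (Fin n) | ∀ v : 𝔼 n,
      ∃ l ∈ L, ∀ i ∈ s, l i = v i} := fun v => by
    obtain ⟨m, hm, h⟩ := hs v
    refine ⟨m + ((v j - m j) / l j) • l, L.add_mem hm (L.smul_mem _ hl), fun i hi => ?_⟩
    rcases Finset.mem_insert.1 hi with rfl | hi
    · simp [hj]
    · simp [h0 i hi, h i hi]
  exact hj (h0 j (hmax h1 (Finset.subset_insert _ _) (Finset.mem_insert_self _ _)))

variable {E W : Type} [NormedAddCommGroup E] [NormedSpace ℝ E] [NormedAddCommGroup W]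
  [NormedSpace ℝ W]

lemma hasDerivWithinAt_of_eq_primitive [CompleteSpace E] {y g : C(unitInterval, E)} {c : E}
    (h : y = const ℝ unitInterval c + primitiveCLM E g) {t : ℝ}
    (ht : t ∈ Set.Ico (0 : ℝ) 1) : HasDerivWithinAt (IccExtend zero_le_one y)
      (IccExtend zero_le_one g t) (Set.Ici t) t := by
  have hg := g.continuous.Icc_extend' (h := zero_le_one)
  have h1 := ((intervalIntegral.integral_hasDerivAt_right (hg.intervalIntegrable 0 t)
    (hg.stronglyMeasurableAtFilter _ _) hg.continuousAt).const_add c).hasDerivWithinAt (s := Set.Ici t)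
  refine h1.congr_of_eventuallyEq_of_mem ?_ Set.self_mem_Ici
  filter_upwards [Icc_mem_nhdsGE ht.2] with s hs
  have hs' : s ∈ Icc (0 : ℝ) 1 := ⟨ht.1.trans hs.1, hs.2⟩
  rw [Set.IccExtend_of_mem _ _ hs', h]
  rfl

/-- The linearised integral equation along a smooth family of solutions. -/
lemma exists_fderiv_flow {V : E → E ⊸ E} (hV : ContDiff ℝ ∞ V) {x0 : E} {A : E ⊸ E}
    {u : Set E} {Y : E → C(unitInterval, E)} (hu : IsOpen u) (hY : C∞ Y u)
    (hYe : ∀ w ∈ u, Y w = const ℝ unitInterval (x0 + A w) + primitiveCLM E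
        (pointwiseApply _ E E ((ContinuousMap.mk V hV.continuous).comp (Y w))
          (const ℝ unitInterval w))) {w : E} (hw : w ∈ u) (h : E) :
    ∃ g : C(unitInterval, E), 𝒟 Y w h = const ℝ unitInterval (A h) + primitiveCLM E g ∧
      ∀ s, g s = 𝒟 V (Y w s) (𝒟 Y w h s) w + V (Y w s) h := by
  have hV' : ContDiff ℝ ∞ (𝒟 V) := hV.fderiv_right (by simp)
  set K := const (M := E) ℝ unitInterval
  have h1 : HasFDerivAt Y (𝒟 Y w) w := hY.fderivAt hu hw
  have h0 : HasFDerivAt (fun w => (ContinuousMap.mk V hV.continuous).comp (Y w))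
      (pointwiseApply _ E (E ⊸ E) ((ContinuousMap.mk _ hV'.continuous).comp (Y w)) ∘L
        𝒟 Y w) w := (hasFDerivAt_postcomp
    (fun x => (hV.differentiable (by simp) x).hasFDerivAt) hV.continuous hV'.continuous
      (Y w)).comp w h1
  have h2 := ((pointwiseApply unitInterval E E).hasFDerivAt.comp w h0).clm_apply K.hasFDerivAt
  have h3 := (K.hasFDerivAt.comp w (A.hasFDerivAt.const_add x0)).add
    ((primitiveCLM E).hasFDerivAt.comp w h2)
  have h4 := DFunLike.congr_fun (h1.unique (h3.congr_of_eventuallyEq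
    (eventually_of_mem (hu.mem_nhds hw) hYe))) h
  refine ⟨pointwiseApply _ E E (pointwiseApply _ E (E ⊸ E)
    ((ContinuousMap.mk _ hV'.continuous).comp (Y w)) (𝒟 Y w h)) (K w) +
    pointwiseApply _ E E ((ContinuousMap.mk V hV.continuous).comp (Y w)) (K h), ?_, fun s => rfl⟩
  rw [add_comm (pointwiseApply _ E E _ _)]
  exact h4

/-- Vector fields `R a1`, `R a2` in the image of `R` with constant components along `P` have a
bracket in the image of `N = R - R a R`, which generates the part of the image of `R` in the kernel
of `P`. -/
lemma bracket_eq_of_eventually_const {R : E → W ⊸ E} {P : E ⊸ E} {c : W ⊸ W ⊸ W}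
    {a1 a2 : E → W} {x c1 c2 : E} {a : E ⊸ W} (hR : DifferentiableAt ℝ R x)
    (h₁ : DifferentiableAt ℝ a1 x) (h2 : DifferentiableAt ℝ a2 x)
    (hc : ∀ b b', 𝒟 R x (R x b) b' - 𝒟 R x (R x b') b = R x (c b b'))
    (hP1 : ∀ᶠ y in 𝓝 x, P (R y (a1 y)) = c1) (hP2 : ∀ᶠ y in 𝓝 x, P (R y (a2 y)) = c2)
    (haP : ∀ v, a (P v) = a v) :
    𝒟 (fun y => R y (a2 y)) x (R x (a1 x)) - 𝒟 (fun y => R y (a1 y)) x (R x (a2 x)) =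
      (R x - R x ∘L a ∘L R x) (c (a1 x) (a2 x) + 𝒟 a2 x (R x (a1 x)) - 𝒟 a1 x (R x (a2 x))) := by
  have hP : ∀ {b : E → W} {d : E}, DifferentiableAt ℝ b x → (∀ᶠ y in 𝓝 x, P (R y (b y)) = d) →
      ∀ v, P (𝒟 (fun y => R y (b y)) x v) = 0 := fun {b d} hb hd v => by
    have h1 := (P.hasFDerivAt.comp x (hR.clm_apply hb).hasFDerivAt).unique
      ((hasFDerivAt_const d x).congr_of_eventuallyEq hd)
    exact DFunLike.congr_fun h1 v
  have h3 : 𝒟 (fun y => R y (a2 y)) x (R x (a1 x))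
      - 𝒟 (fun y => R y (a1 y)) x (R x (a2 x)) = R x (c (a1 x) (a2 x)
        + 𝒟 a2 x (R x (a1 x)) - 𝒟 a1 x (R x (a2 x))) := by
    rw [(hR.hasFDerivAt.clm_apply h₁.hasFDerivAt).fderiv,
      (hR.hasFDerivAt.clm_apply h2.hasFDerivAt).fderiv, map_sub, map_add, ← hc]
    simp only [_root_.add_apply, comp_apply, ContinuousLinearMap.flip_apply]
    abel
  have h4 := congrArg a (congrArg P h3)
  rw [map_sub, hP h2 hP2, hP h₁ hP1, sub_zero, map_zero, haP] at h4
  rw [h3, _root_.sub_apply, comp_apply, comp_apply, ← h4, map_zero, sub_zero]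

/-- Near a point where `P` maps the image of `R` onto the image of `P`, a smooth family of lifts
of the vectors `P v` to the image of `R`. -/
lemma exists_adapted_lift [FiniteDimensional ℝ E] {R : E → W ⊸ E} {U : Set E} (hU : IsOpen U)
    (hR : C∞ R U) {x0 : E} (hx0 : x0 ∈ U) {P : E ⊸ E} (hPP : ∀ v, P (P v) = P v)
    (q : E ⊸ W) (hq : ∀ v, P (R x0 (q v)) = P v) :
    ∃ (U' : Set E) (a : E → E ⊸ W), IsOpen U' ∧ x0 ∈ U' ∧ U' ⊆ U ∧ C∞ a U' ∧
      ∀ x ∈ U', ∀ v, P (R x (a x v)) = P v ∧ a x (P v) = a x v := by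
  have := FiniteDimensional.complete ℝ E
  set S : E → E ⊸ E := fun x => P ∘L R x ∘L q + (ContinuousLinearMap.id ℝ E - P) with hS
  have hSc : C∞ S U :=
    (contDiffOn_const.clm_comp (hR.clm_comp contDiffOn_const)).add contDiffOn_const
  have hS0 : S x0 = 1 := by ext v; simp [hS, hq]
  obtain ⟨I, hI, hSI⟩ := exists_smooth_inverse (F := S) (S := U ∩ S ⁻¹' {B | IsUnit B})
    (hSc.mono Set.inter_subset_left) fun x hx v hv => by
      obtain ⟨B, hB⟩ := hx.2
      have h1 : (↑B⁻¹ * ↑B : E ⊸ E) v = 0 := by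
        rw [hB]; exact (congrArg (↑B⁻¹ : E ⊸ E) hv).trans (map_zero _)
      simpa using h1
  refine ⟨_, fun x => q ∘L I x ∘L P, hSc.continuousOn.isOpen_inter_preimage hU Units.isOpen,
    ⟨hx0, show IsUnit (S x0) by rw [hS0]; exact isUnit_one⟩, Set.inter_subset_left,
    contDiffOn_const.clm_comp (hI.clm_comp contDiffOn_const), fun x hx v => ⟨?_, by simp [hPP]⟩⟩
  have h1 : P (R x (q (I x (P v)))) + (I x (P v) - P (I x (P v))) = P v := hSI x hx (P v)
  have h2 := congrArg P h1
  rw [map_add, map_sub, hPP, hPP, hPP, sub_self, add_zero] at h2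
  exact h2

lemma exists_contDiff_extension [FiniteDimensional ℝ E] {f : E → W} {U : Set E} (hU : IsOpen U)
    (hf : C∞ f U) {x : E} (hx : x ∈ U) : ∃ (f' : E → W) (δ : ℝ), ContDiff ℝ ∞ f' ∧
      0 < δ ∧ ball x δ ⊆ U ∧ ∀ y ∈ ball x δ, f' y = f y := by
  obtain ⟨δ, hδ, hs⟩ := Metric.nhds_basis_closedBall.mem_iff.1 (hU.mem_nhds hx)
  let χ : ContDiffBump x := ⟨δ / 2, δ, by positivity, by linarith⟩
  refine ⟨fun y => χ y • f y, δ / 2, contDiff_iff_contDiffAt.2 fun y => ?_, by positivity,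
    (Metric.ball_subset_closedBall.trans (Metric.closedBall_subset_closedBall (by linarith))).trans
      hs, fun y hy => ?_⟩
  · by_cases hy : y ∈ U
    · exact χ.contDiff.contDiffAt.smul (hf.contDiffAt (hU.mem_nhds hy))
    · have h1 : y ∉ tsupport χ := fun h => hy (hs (χ.tsupport_eq ▸ h))
      refine (contDiffAt_const (c := (0 : W))).congr_of_eventuallyEq ?_
      filter_upwards [notMem_tsupport_iff_eventuallyEq.1 h1] with z hz
      simp [hz]
  · have h1 := χ.one_of_mem_closedBall (Metric.ball_subset_closedBall hy)
    show χ y • f y = f y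
    rw [h1, one_smul]

lemma eq_zero_of_norm_deriv_le {Q Q' : ℝ → E} {k : ℝ → ℝ} (hQ : ContinuousOn Q (Icc 0 1))
    (hk : ContinuousOn k (Icc 0 1))
    (hd : ∀ t ∈ Set.Ico (0 : ℝ) 1, HasDerivWithinAt Q (Q' t) (Set.Ici t) t) (h0 : Q 0 = 0)
    (hb : ∀ t ∈ Set.Ico (0 : ℝ) 1, ‖Q' t‖ ≤ k t * ‖Q t‖) : ∀ t ∈ Icc (0 : ℝ) 1, Q t = 0 := by
  obtain ⟨K, hK⟩ := isCompact_Icc.exists_bound_of_continuousOn hk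
  exact eq_zero_of_abs_deriv_le_mul_abs_self_of_eq_zero_right hQ hd h0 fun t ht =>
    (hb t ht).trans (mul_le_mul_of_nonneg_right ((le_abs_self _).trans
      (hK t (Set.Ico_subset_Icc_self ht))) (norm_nonneg _))

/-- Along a curve on which the fields `V h` commute with `V w`, the solution of the linearised
equation in the direction `h` is `t V(y) h`. -/
lemma linearised_flow_eq [CompleteSpace E] {V : E → E ⊸ E} (hV : ContDiff ℝ ∞ V)
    {y g0 Z g : C(unitInterval, E)} {c w h : E}
    (hy : y = const ℝ unitInterval c + primitiveCLM E g0)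
    (hg0 : ∀ s, g0 s = V (y s) w)
    (hZ : Z = const ℝ unitInterval 0 + primitiveCLM E g)
    (hg : ∀ s, g s = 𝒟 V (y s) (Z s) w + V (y s) h)
    (hc : ∀ s, 𝒟 V (y s) (V (y s) h) w = 𝒟 V (y s) (V (y s) w) h) :
    Z 1 = V (y 1) h := by
  set e := IccExtend (zero_le_one (α := ℝ)) with he
  have hV' := hV.continuous_fderiv (by simp)
  have hyc : Continuous (e y) := y.continuous.Icc_extend'
  have hZc : Continuous (e Z) := Z.continuous.Icc_extend'
  have h1 := eq_zero_of_norm_deriv_le (Q := fun t => e Z t - t • V (e y t) h)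
    (Q' := fun t => 𝒟 V (e y t) (e Z t - t • V (e y t) h) w)
    (k := fun t => ‖𝒟 V (e y t)‖ * ‖w‖) ?_ ?_ (fun t ht => ?_) ?_ (fun t _ => ?_) 1
    (by simp)
  · simp only [he, one_smul] at h1
    rw [Set.IccExtend_right, Set.IccExtend_right] at h1
    exact sub_eq_zero.1 h1
  · exact (hZc.sub (continuous_id.smul ((hV.continuous.comp hyc).clm_apply
      continuous_const))).continuousOn
  · exact ((hV'.comp hyc).norm.mul continuous_const).continuousOn
  · have h2 := hasDerivWithinAt_of_eq_primitive hy ht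
    have h3 := hasDerivWithinAt_of_eq_primitive hZ ht
    have h4 := ((hV.differentiable (by simp) (e y t)).hasFDerivAt.comp_hasDerivWithinAt t h2)
    have h5 := h3.sub ((hasDerivWithinAt_id t _).smul (h4.clm_apply (hasDerivWithinAt_const t _ h)))
    refine HasDerivWithinAt.congr_deriv h5 ?_
    have h6 : IccExtend zero_le_one g t = 𝒟 V (e y t) (e Z t) w + V (e y t) h := hg _
    have h7 : 𝒟 V (e y t) (IccExtend zero_le_one g0 t) h = 𝒟 V (e y t) (V (e y t) h) w := by
      rw [show IccExtend zero_le_one g0 t = V (e y t) w from hg0 _]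
      exact (hc _).symm
    simp only [h6, h7, map_zero, add_zero, id, one_smul, Function.comp_apply, map_sub, map_smul,
      _root_.sub_apply, _root_.smul_apply]
    abel
  · have h2 : e Z 0 = Z 0 := Set.IccExtend_left _ _
    show e Z 0 - (0 : ℝ) • V (e y 0) h = 0
    rw [h2, hZ, zero_smul, sub_zero]
    simp [primitiveCLM_apply]
  · refine ((le_opNorm _ _).trans (mul_le_mul_of_nonneg_right
      (le_opNorm _ _) (norm_nonneg _))).trans (le_of_eq (by ring))

/-- Frobenius' theorem, including the singular case. If the image of `R` is involutive and `P`
projects its fibre at `x0` isomorphically, then solving `y' = V(y) w`, `y(0) = x0 + w - P w`, where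
`V` is the lift of `P` to the image of `R`, defines coordinates `w` around `x0` in which the image
of `R` is the image of `P`: on the slice through `x0`, and everywhere if the rank is constant. -/
lemma exists_rectification [FiniteDimensional ℝ E] {R : E → W ⊸ E} {U : Set E}
    (hU : IsOpen U) (hR : C∞ R U) {C : E → W ⊸ W ⊸ W} (hC : ContinuousOn C U)
    (hc : ∀ x ∈ U, ∀ b b', 𝒟 R x (R x b) b' - 𝒟 R x (R x b') b = R x (C x b b'))
    {x0 : E} (hx0 : x0 ∈ U) {P : E ⊸ E} (hPP : ∀ v, P (P v) = P v)
    (hinj : ∀ b, P (R x0 b) = 0 → R x0 b = 0) (q : E ⊸ W) (hq : ∀ v, P (R x0 (q v)) = P v) :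
    ∃ Φ : OpenPartialHomeomorph E E, 0 ∈ Φ.source ∧ Φ 0 = x0 ∧ Φ.target ⊆ U ∧
      C∞ Φ Φ.source ∧ C∞ Φ.symm Φ.target ∧
      ∀ w ∈ Φ.source, (P w = w ∨ ∀ x ∈ U, Module.finrank ℝ (R x).range =
        Module.finrank ℝ (R x0).range) →
        ∀ v, (∃ b, R (Φ w) b = v) ↔ ∃ h, 𝒟 Φ w (P h) = v := by
  have := FiniteDimensional.complete ℝ E
  obtain ⟨U1, a, hU1, hx1, hU1U, ha, hPa⟩ := exists_adapted_lift hU hR hx0 hPP q hq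
  obtain ⟨V, δ, hV, hδ, hδU, hVe⟩ := exists_contDiff_extension hU1 ((hR.mono hU1U).clm_comp ha) hx1
  set U2 := ball x0 δ
  have hU2o : IsOpen U2 := isOpen_ball
  have hx2 : x0 ∈ U2 := Metric.mem_ball_self hδ
  have hU2U := hδU.trans hU1U
  have hRd : ∀ x ∈ U2, DifferentiableAt ℝ R x := fun x hx => hR.diffAt hU (hU2U hx)
  have had : ∀ x ∈ U2, DifferentiableAt ℝ a x := fun x hx => ha.diffAt hU1 (hδU hx)
  have hVap : ∀ x ∈ U2, ∀ v, V x v = R x (a x v) := fun x hx v => by rw [hVe x hx]; rfl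
  have hPV : ∀ x ∈ U2, ∀ v, P (V x v) = P v := fun x hx v => by
    rw [hVap x hx]; exact (hPa x (hδU hx) v).1
  have hVP : ∀ x ∈ U2, ∀ v, V x (P v) = V x v := fun x hx v => by
    rw [hVap x hx, hVap x hx, (hPa x (hδU hx) v).2]
  have hVd : ∀ x ∈ U2, ∀ v h, 𝒟 V x v h = 𝒟 (fun y => R y (a y h)) x v := fun x hx v h => by
      have h1 := ((hV.differentiable (by simp) x).hasFDerivAt.app h)
      have h2 : (fun y => R y (a y h)) =ᶠ[𝓝 x] fun y => V y h := by
        filter_upwards [hU2o.mem_nhds hx] with y hy using (hVap y hy h).symm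
      rw [h2.fderiv_eq, h1.fderiv]
      simp
  set N : E → W ⊸ E := fun x => R x - R x ∘L a x ∘L R x with hN
  have hPVe : ∀ x ∈ U2, ∀ v, ∀ᶠ y in 𝓝 x, P (R y (a y v)) = P v := fun x hx v => by
    filter_upwards [hU2o.mem_nhds hx] with y hy using (hPa y (hδU hy) v).1
  have hbrV : ∀ x ∈ U2, N x = 0 → ∀ h k, 𝒟 V x (V x h) k = 𝒟 V x (V x k) h := fun x hx hNx h k => by
      have h1 := bracket_eq_of_eventually_const
        (hRd x hx) ((had x hx).clm_apply (differentiableAt_const h))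
        ((had x hx).clm_apply (differentiableAt_const k)) (hc x (hU2U hx)) (hPVe x hx h)
        (hPVe x hx k) fun v => (hPa x (hδU hx) v).2
      rw [show R x - R x ∘L a x ∘L R x = 0 from hNx, _root_.zero_apply, sub_eq_zero] at h1
      rw [hVd x hx, hVd x hx, hVap x hx, hVap x hx, h1]
  have hN0 : N x0 = 0 := by
    ext b
    have h1 : P (N x0 b) = 0 := by
      simp only [hN, _root_.sub_apply, comp_apply, map_sub]
      rw [(hPa x0 (hδU hx2) _).1, sub_self]
    have h2 : N x0 b = R x0 (b - a x0 (R x0 b)) := by simp [hN]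
    rw [h2] at h1 ⊢
    exact hinj _ h1
  -- the flow
  set A : E ⊸ E := ContinuousLinearMap.id ℝ E - P with hA
  have hAP : ∀ v, A (P v) = 0 := fun v => by simp [hA, hPP]
  obtain ⟨u1, Y, hu1, h0u₁, hYc, hY0, hYe⟩ := exists_smooth_flow hV x0 A
  set u := u1 ∩ Y ⁻¹' {y | MapsTo y Set.univ U2}
  have huo : IsOpen u := hYc.continuousOn.isOpen_inter_preimage hu1
    (ContinuousMap.isOpen_setOfPred_mapsTo isCompact_univ hU2o)
  have h0u : 0 ∈ u := ⟨h0u₁, fun s _ => by rw [hY0]; exact hx2⟩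
  have hNz : ∀ w ∈ u, (P w = w ∨ ∀ x ∈ U, Module.finrank ℝ (R x).range =
      Module.finrank ℝ (R x0).range) → ∀ s, N (Y w s) = 0 := by
    rintro w ⟨hw, hwU⟩ (hPw | hreg) s
    · set y := IccExtend (zero_le_one) (Y w) with hy
      have hyc : Continuous y := (Y w).continuous.Icc_extend'
      have hyU : ∀ t, y t ∈ U2 := fun t => hwU (Set.mem_univ _)
      set β : E → W ⊸ W := fun x => ContinuousLinearMap.id ℝ W - a x ∘L R x with hβ
      have hRc := hR.mono hU2U
      have hac := ha.mono hδU
      have hβc : C∞ β U2 := contDiffOn_const.sub (hac.clm_comp hRc)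
      have hNβ : ∀ x b, N x b = R x (β x b) := fun x b => by simp [hN, hβ]
      have hNc : C∞ N U2 := hRc.sub (hRc.clm_comp (hac.clm_comp hRc))
      have hNd : ∀ x ∈ U2, HasFDerivAt N (𝒟 N x) x := fun x hx => hNc.fderivAt hU2o hx
      set T : E → W ⊸ W := fun x => (C x (a x w)).comp (β x) + 𝒟 β x (V x w) -
        ((𝒟 a x).flip w).comp (N x) with hT
      have hTc : ContinuousOn T U2 := by
        have h1 := hac.continuousOn_fderiv_of_isOpen hU2o (by simp)
        have h2 : ContinuousOn (fun x => (𝒟 a x).flip w) U2 :=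
          ((flipₗᵢ ℝ E E W).continuous.comp_continuousOn h1).clm_apply continuousOn_const
        exact ((((hC.mono hU2U).clm_apply (hac.continuousOn.clm_apply
          continuousOn_const)).clm_comp hβc.continuousOn).add
          ((hβc.continuousOn_fderiv_of_isOpen hU2o (by simp)).clm_apply
            (hV.continuous.continuousOn.clm_apply continuousOn_const))).sub
          (h2.clm_comp hNc.continuousOn)
      have hND : ∀ x ∈ U2, ∀ b, 𝒟 N x (V x w) b = 𝒟 V x (N x b) w + N x (T x b) := fun x hx b => by
        have hβd := hβc.diffAt hU2o hx
        have h1 := bracket_eq_of_eventually_const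
          (hRd x hx) ((had x hx).clm_apply (differentiableAt_const w))
          (hβd.clm_apply (differentiableAt_const b)) (hc x (hU2U hx)) (hPVe x hx w)
          (by
            filter_upwards [hU2o.mem_nhds hx] with z hz
            simp only [hβ, _root_.sub_apply, comp_apply, map_sub, id_apply]
            rw [(hPa z (hδU hz) _).1, sub_self]) fun v => (hPa x (hδU hx) v).2
        have h2 : 𝒟 (fun y => R y (β y b)) x = (𝒟 N x).flip b := by
          rw [← funext fun y => hNβ y b]
          simpa using ((hNd x hx).app b).fderiv
        have h3 : 𝒟 (fun y => β y b) x = (𝒟 β x).flip b := by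
          simpa using (hβd.hasFDerivAt.app b).fderiv
        have h4 : 𝒟 (fun y => a y w) x = (𝒟 a x).flip w := by
          simpa using ((had x hx).hasFDerivAt.app w).fderiv
        rw [h2, h3, h4, ← hVap x hx, ← hNβ, ← hVd x hx] at h1
        exact eq_add_of_sub_eq' h1
      have h1 := eq_zero_of_norm_deriv_le (Q := fun t => N (y t))
        (Q' := fun t => 𝒟 N (y t) (V (y t) w))
        (k := fun t => ‖𝒟 V (y t)‖ * ‖w‖ + ‖T (y t)‖)
        (hNc.continuousOn.comp_continuous hyc hyU).continuousOn
        (((((hV.continuous_fderiv (by simp)).comp hyc).norm.mul continuous_const).add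
          (hTc.comp_continuous hyc hyU).norm).continuousOn)
        (fun t ht => (hNd _ (hyU t)).comp_hasDerivWithinAt t
          (hasDerivWithinAt_of_eq_primitive (hYe w hw) ht)) ?_ (fun t _ => ?_) s s.2
      · rwa [hy, Set.IccExtend_of_mem _ _ s.2] at h1
      · have h2 : y 0 = x0 := by
          rw [hy, Set.IccExtend_left, hYe w hw, ← hPw, hAP]
          simp [primitiveCLM_apply]
        show N (y 0) = 0
        rw [h2, hN0]
      · refine ContinuousLinearMap.opNorm_le_bound _ (by positivity) fun b => ?_
        rw [hND _ (hyU t)]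
        have h2 := (le_opNorm _ _).trans (mul_le_mul_of_nonneg_right
          ((𝒟 V (y t)).le_opNorm (N (y t) b)) (norm_nonneg w))
        have h3 := mul_le_mul_of_nonneg_left ((N (y t)).le_opNorm b) (norm_nonneg (𝒟 V (y t)))
        have h4 := ((N (y t)).le_opNorm (T (y t) b)).trans (mul_le_mul_of_nonneg_left
          ((T (y t)).le_opNorm b) (norm_nonneg _))
        refine (norm_add_le _ _).trans ?_
        nlinarith [mul_le_mul_of_nonneg_right h3 (norm_nonneg w)]
    · have hx := hwU (Set.mem_univ s)
      set x := Y w s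
      have hd : ∀ z, (∀ v, ∃ b, P (R z b) = P v) → Module.finrank ℝ P.range + Module.finrank ℝ
          (LinearMap.ker (P.toLinearMap.domRestrict (R z).range)) =
          Module.finrank ℝ (R z).range := fun z hz => by
        rw [← LinearMap.finrank_range_add_finrank_ker (P.toLinearMap.domRestrict (R z).range)]
        suffices h : P.range = (P.toLinearMap.domRestrict (R z).range).range by rw [h]
        ext v
        constructor
        · rintro ⟨v, rfl⟩
          obtain ⟨b, hb⟩ := hz v
          exact ⟨⟨R z b, b, rfl⟩, hb⟩
        · rintro ⟨⟨_, b, rfl⟩, rfl⟩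
          exact ⟨R z b, rfl⟩
      have h1 := hd x fun v => ⟨_, (hPa x (hδU hx) v).1⟩
      have h2 := hd x0 fun v => ⟨_, hq v⟩
      have h3 : LinearMap.ker (P.toLinearMap.domRestrict (R x0).range) = ⊥ := by
        rw [LinearMap.ker_eq_bot']
        rintro ⟨_, b, rfl⟩ hb
        exact Subtype.ext (hinj b hb)
      rw [h3, finrank_bot, ← hreg x (hU2U hx)] at h2
      have h4 : LinearMap.ker (P.toLinearMap.domRestrict (R x).range) = ⊥ :=
        Submodule.finrank_eq_zero.1 (by omega)
      ext b
      have h5 : (⟨R x (b - a x (R x b)), _, rfl⟩ : (R x).range) = 0 :=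
        (LinearMap.ker_eq_bot'.1 h4) _ (by
          show P (R x (b - a x (R x b))) = 0
          rw [map_sub, map_sub, (hPa x (hδU hx) _).1, sub_self])
      have h6 : R x (b - a x (R x b)) = 0 := congrArg Subtype.val h5
      simpa [hN] using h6
  -- the endpoint map and its derivative
  set F : E → E := fun w => Y w 1
  let ev : C(unitInterval, E) ⊸ E := ContinuousMap.evalCLM ℝ 1
  have hFc : C∞ F u := ev.contDiff.comp_contDiffOn (hYc.mono Set.inter_subset_left)
  have hFd : ∀ w ∈ u, ∀ h, 𝒟 F w h = 𝒟 Y w h 1 := fun w hw h =>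
    DFunLike.congr_fun (HasFDerivAt.fderiv (f := F) (ev.hasFDerivAt.comp w
      (hYc.fderivAt hu1 hw.1))) h
  have htan : ∀ w ∈ u, (∀ s, N (Y w s) = 0) → ∀ h, 𝒟 F w (P h) = V (F w) h := by
    intro w hw hNw h
    obtain ⟨g, hg, hgs⟩ := exists_fderiv_flow hV hu1 hYc hYe hw.1 (P h)
    have hw2 : ∀ s, Y w s ∈ U2 := fun s => hw.2 (Set.mem_univ s)
    rw [hAP] at hg
    rw [hFd w hw]
    exact linearised_flow_eq hV (hYe w hw.1) (fun s => rfl) hg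
      (fun s => by rw [hgs, hVP _ (hw2 s)]) fun s => hbrV _ (hw2 s) (hNw s) h w
  have hF0 : ∀ h, 𝒟 F 0 h = A h + V x0 h := fun h => by
    obtain ⟨g, hg, hgs⟩ := exists_fderiv_flow hV hu1 hYc hYe h0u₁ h
    have h1 : ∀ s, g s = V x0 h := fun s => by rw [hgs, hY0]; simp
    rw [hFd 0 h0u, hg]
    simp [primitiveCLM_apply, IccExtend, h1]
  have hker : LinearMap.ker (𝒟 F 0).toLinearMap = ⊥ := by
    refine LinearMap.ker_eq_bot'.2 fun h hh => ?_
    have h1 : A h + V x0 h = 0 := (hF0 h).symm.trans hh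
    have h2 := congrArg P h1
    rw [map_add, hPV x0 hx2, map_zero, hA, _root_.sub_apply, map_sub, hPP] at h2
    have h3 : P h = 0 := by simpa using h2
    rw [← hVP x0 hx2, h3, map_zero, hA, _root_.sub_apply, h3] at h1
    simpa using h1
  obtain ⟨Φ, hΦ0, hΦu, hΦF, hΦs⟩ := exists_inverse_contDiffOn huo hFc h0u
    (f' := (LinearEquiv.ofInjectiveEndo _ (LinearMap.ker_eq_bot.1 hker)).toContinuousLinearEquiv)
    (hFc.fderivAt huo h0u)
  have hΦe : (Φ : E → E) = F := funext hΦF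
  refine ⟨Φ, hΦ0, by rw [hΦF]; show Y 0 1 = x0; rw [hY0]; rfl, fun z hz => ?_,
    hΦe ▸ hFc.mono hΦu, hΦs, fun w hw hcond v => ?_⟩
  · have h1 := (hΦu (Φ.map_target hz)).2 (Set.mem_univ 1)
    rw [← Φ.right_inv hz, hΦF]
    exact hU2U h1
  · have h1 := hNz w (hΦu hw) hcond
    have h2 : F w ∈ U2 := (hΦu hw).2 (Set.mem_univ 1)
    have h3 := htan w (hΦu hw) h1
    rw [hΦe]
    constructor
    · rintro ⟨b, rfl⟩
      refine ⟨R (F w) b, ?_⟩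
      have h4 : N (F w) b = 0 := by rw [show N (F w) = 0 from h1 1]; rfl
      rw [h3, hVap _ h2]
      exact (sub_eq_zero.1 h4).symm
    · rintro ⟨h, rfl⟩
      exact ⟨_, ((h3 h).trans (hVap _ h2 h)).symm⟩

end

section

/-! ### Local primitives of closed 3-forms -/

variable {n r k : ℕ}

lemma pd_add_sum {x0 x : 𝔼 n} {f : Fin n → 𝔼 n → ℝ}
    (hf : ∀ l, Differentiable ℝ (f l)) (s : ℝ) (m : Fin n) :
    pd m (fun x => s ^ 2 * ∑ l, (x l - x0 l) * f l (x0 + s • (x - x0))) x =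
      s ^ 2 * f m (x0 + s • (x - x0)) +
        s ^ 3 * ∑ l, (x l - x0 l) * pd m (f l) (x0 + s • (x - x0)) := by
  have h1 : ∀ l, HasFDerivAt (fun x : 𝔼 n => (x l - x0 l) * f l (x0 + s • (x - x0))) _ x := fun l =>
    ((proj (𝕜 := ℝ) l).hasFDerivAt.sub_const (x0 l)).mul ((hf l _).hasFDerivAt.comp x
        ((((hasFDerivAt_id x).sub_const x0).const_smul s).const_add x0))
  rw [pd, ((HasFDerivAt.fun_sum fun l _ => h1 l).const_mul (s ^ 2)).fderiv]
  simp only [_root_.smul_apply, _root_.sum_apply, _root_.add_apply, comp_apply,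
    id_apply, smul_eq_mul, map_smul, sum_add_distrib, mul_add]
  rw [add_comm, show s ^ 3 = s ^ 2 * s by ring, mul_assoc, mul_sum Finset.univ _ s]
  congr 2
  · simp [PiLp.single_apply]
  · exact sum_congr rfl fun l _ => by simp only [pd, PiLp.proj_apply]; ring

/-- The Poincaré lemma for 3-forms, `B_ij(x) = ∫₀¹ s² (x - x0)^l H_lij(x0 + s (x - x0)) ds`. -/
lemma exists_primitive {U : Set (𝔼 n)} (hU : IsOpen U) {H : 𝔼 n → Fin n → Fin n → Fin n → ℝ}
    (hH : ∀ i j l, C∞ (fun y => H y i j l) U)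
    (h12 : ∀ y ∈ U, ∀ i j l, H y i j l = -H y j i l)
    (h23 : ∀ y ∈ U, ∀ i j l, H y i j l = -H y i l j)
    (hc : ∀ y ∈ U, ∀ i j l q, pd i (fun y => H y j l q) y - pd j (fun y => H y i l q) y +
      pd l (fun y => H y i j q) y - pd q (fun y => H y i j l) y = 0)
    {x0 : 𝔼 n} (hx0 : x0 ∈ U) :
    ∃ (B : 𝔼 n → Fin n → Fin n → ℝ) (δ : ℝ), 0 < δ ∧
      (∀ i j, ContDiff ℝ ∞ fun x => B x i j) ∧ ball x0 δ ⊆ U ∧ ∀ x ∈ ball x0 δ,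
        (∀ i j, B x i j = -B x j i) ∧ ∀ i j l, H x i j l =
        pd i (fun y => B y j l) x + pd j (fun y => B y l i) x + pd l (fun y => B y i j) x := by
  obtain ⟨h, δ, hh, hδ, hδU, hhH⟩ := exists_contDiff_extension (f := H) hU
    (contDiffOn_pi.2 fun i => contDiffOn_pi.2 fun j => contDiffOn_pi.2 fun l => hH i j l) hx0
  have hhc : ∀ i j l, ContDiff ℝ ∞ fun x => h x i j l := fun i j l =>
    contDiff_pi.1 (contDiff_pi.1 (contDiff_pi.1 hh i) j) l
  have hhd : ∀ i j l, Differentiable ℝ fun x => h x i j l := fun i j l =>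
    (hhc i j l).differentiable (by simp)
  set c : ℝ → 𝔼 n → 𝔼 n := fun s x => x0 + s • (x - x0)
  set b : Fin n → Fin n → ℝ × 𝔼 n → ℝ := fun i j p =>
    p.1 ^ 2 * ∑ l, (p.2 l - x0 l) * h (c p.1 p.2) l i j with hb
  have hcc : ContDiff ℝ ∞ fun p : ℝ × 𝔼 n => c p.1 p.2 :=
    contDiff_const.add (contDiff_fst.smul (contDiff_snd.sub contDiff_const))
  have hbc : ∀ i j, ContDiff ℝ ∞ (b i j) := fun i j => (contDiff_fst.pow 2).mul
    (ContDiff.sum fun l _ => (((proj (𝕜 := ℝ) l).contDiff.comp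
      contDiff_snd).sub contDiff_const).mul ((hhc l i j).comp hcc))
  have hball : ∀ x ∈ ball x0 δ, ∀ s ∈ Icc (0 : ℝ) 1, c s x ∈ ball x0 δ := fun x hx s hs => by
      rw [mem_ball_iff_norm] at hx ⊢
      rw [add_sub_cancel_left, norm_smul, Real.norm_of_nonneg hs.1]
      nlinarith [norm_nonneg (x - x0), hs.2]
  refine ⟨fun x i j => ∫ s in (0 : ℝ)..1, b i j (s, x), δ, hδ,
    fun i j => (contDiff_parametric_integral (hbc i j)).1, hδU, fun x hx => ⟨fun i j => ?_,
      fun i j l => ?_⟩⟩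
  · rw [← intervalIntegral.integral_neg]
    refine intervalIntegral.integral_congr fun s hs => ?_
    rw [Set.uIcc_of_le zero_le_one] at hs
    simp only [hb]
    rw [← mul_neg, ← sum_neg_distrib]
    congr 1
    refine sum_congr rfl fun l _ => ?_
    rw [hhH _ (hball x hx s hs), h23 _ (hδU (hball x hx s hs))]
    ring
  · have hpd : ∀ m i j, pd m (fun x => ∫ s in (0 : ℝ)..1, b i j (s, x)) x = ∫ s in (0 : ℝ)..1,
        (s ^ 2 * h (c s x) m i j + s ^ 3 * ∑ l, (x l - x0 l) * pd m (fun y => h y l i j) (c s x)) :=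
      fun m i j => ((contDiff_parametric_integral (hbc i j)).2 x _).trans
        (intervalIntegral.integral_congr fun s _ => pd_add_sum (fun l => hhd l i j) s m)
    have hcs : Continuous fun s : ℝ => c s x := by fun_prop
    have hpc : ∀ m i j l, Continuous fun s => pd m (fun y => h y i j l) (c s x) := fun m i j l =>
      (((hhc i j l).continuous_fderiv (by simp)).comp hcs).clm_apply continuous_const
    have hhcs : ∀ i j l, Continuous fun s => h (c s x) i j l := fun i j l =>
      (hhc i j l).continuous.comp hcs
    have hint : ∀ m i j, IntervalIntegrable (fun s => s ^ 2 * h (c s x) m i j +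
        s ^ 3 * ∑ l, (x l - x0 l) * pd m (fun y => h y l i j) (c s x)) volume 0 1 := fun m i j =>
      (((continuous_pow 2).mul (hhcs m i j)).add ((continuous_pow 3).mul
        (continuous_finsetSum _ fun l _ => continuous_const.mul (hpc m l i j)))).intervalIntegrable
          _ _
    rw [hpd, hpd, hpd, ← intervalIntegral.integral_add (hint _ _ _) (hint _ _ _),
      ← intervalIntegral.integral_add ((hint _ _ _).add (hint _ _ _)) (hint _ _ _)]
    have hder : ∀ s ∈ Set.uIcc (0 : ℝ) 1, HasDerivAt (fun s => s ^ 3 * h (c s x) i j l)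
        (3 * s ^ 2 * h (c s x) i j l + s ^ 3 * ∑ m, (x m - x0 m) *
          pd m (fun y => h y i j l) (c s x)) s := fun s _ => by
      have h1 : HasDerivAt (fun s => c s x) (x - x0) s := by
        have h2 := ((hasDerivAt_id s).smul_const (x - x0)).const_add x0
        rwa [one_smul] at h2
      have h2 := (hasDerivAt_pow 3 s).mul ((hhd i j l (c s x)).hasFDerivAt.comp_hasDerivAt s h1)
      rw [LocalModel.fderiv_apply_eq_sum] at h2
      exact h2.congr_deriv (by simp)
    have hFTC := intervalIntegral.integral_eq_sub_of_hasDerivAt hder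
      ((((continuous_const.mul (continuous_pow 2)).mul (hhcs i j l)).add ((continuous_pow 3).mul
        (continuous_finsetSum _ fun m _ => continuous_const.mul
          (hpc m i j l)))).intervalIntegrable _ _)
    have hc1 : c 1 x = x := by simp [c]
    rw [one_pow, one_mul, hc1, zero_pow three_ne_zero, zero_mul, sub_zero, hhH x hx] at hFTC
    rw [← hFTC]
    refine intervalIntegral.integral_congr fun s hs => ?_
    rw [Set.uIcc_of_le zero_le_one] at hs
    have hm := hball x hx s hs
    have hpdH : ∀ m i j l, pd m (fun y => h y i j l) (c s x) = pd m (fun y => H y i j l) (c s x) :=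
      fun m i j l => by
        have h1 : (fun y => h y i j l) =ᶠ[𝓝 (c s x)] fun y => H y i j l := by
          filter_upwards [isOpen_ball.mem_nhds hm] with y hy
          rw [hhH y hy]
        rw [pd, h1.fderiv_eq, pd]
    have hpd23 : ∀ m i j l, pd m (fun y => H y i j l) (c s x) =
        -pd m (fun y => H y i l j) (c s x) := fun m i j l => by
      have h1 : (fun y => H y i j l) =ᶠ[𝓝 (c s x)] fun y => -H y i l j := by
        filter_upwards [hU.mem_nhds (hδU hm)] with y hy using h23 y hy i j l
      rw [pd, h1.fderiv_eq, fderiv_fun_neg, _root_.neg_apply, pd]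
    have e1 : H (c s x) j l i = H (c s x) i j l := by rw [h23 _ (hδU hm), h12 _ (hδU hm), neg_neg]
    have e2 : H (c s x) l i j = H (c s x) i j l := by rw [h12 _ (hδU hm), h23 _ (hδU hm), neg_neg]
    have e3 : ∀ m, (x m - x0 m) * pd m (fun y => H y i j l) (c s x) =
        (x m - x0 m) * pd i (fun y => H y m j l) (c s x) +
        (x m - x0 m) * pd j (fun y => H y m l i) (c s x) +
        (x m - x0 m) * pd l (fun y => H y m i j) (c s x) := fun m => by
      have h1 := hc _ (hδU hm) m i j l
      rw [hpd23 j m l i]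
      linear_combination (x m - x0 m) * h1
    simp only [hpdH, hhH _ hm, e1, e2]
    rw [sum_congr rfl fun m _ => e3 m, sum_add_distrib, sum_add_distrib]
    ring

end

section

-- `t` is a smooth vector bundle map over the identity, with model fibres `V` and `W`.
local notation "Hom∞" n:max V:max W:max t:max =>
  ContMDiff (𝓡 n) (ModelWithCorners.prod (𝓡 n) 𝓘(ℝ, V ⊸ W)) ∞ fun x => Bundle.TotalSpace.mk' (V ⊸ W) x (t x)

/-! ### Components of smooth sections in charts and frames -/

/-- Smoothness of a section at a point. -/
abbrev SmoothAt (n : ℕ) {M : Type*} [TopologicalSpace M] [ChartedSpace (𝔼 n) M]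
    (F : Type*) [NormedAddCommGroup F] [NormedSpace ℝ F] {E : M → Type*}
    [TopologicalSpace (TotalSpace F E)] [∀ x, TopologicalSpace (E x)] [FiberBundle F E]
    (s : ∀ x, E x) (x : M) : Prop :=
  ContMDiffAt (𝓡 n) ((𝓡 n).prod 𝓘(ℝ, F)) ∞ (fun y => TotalSpace.mk' F y (s y)) x

variable {n r k : ℕ} {M : Type*} [TopologicalSpace M] [ChartedSpace (𝔼 n) M] [IsManifold (𝓡 n) ∞ M]
  {E : M → Type*} [TopologicalSpace (TotalSpace (𝔼 r) E)]
  [∀ x, AddCommGroup (E x)] [∀ x, Module ℝ (E x)] [∀ x, TopologicalSpace (E x)]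
  [FiberBundle (𝔼 r) E] [VectorBundle ℝ (𝔼 r) E]
  {κ : OpenPartialHomeomorph M (𝔼 n)}

local notation "𝒹" => mfderiv (𝓡 n) (𝓡 n)

section chart

variable (hκ : κ ∈ maximalAtlas (𝓡 n) ∞ M)
include hκ

lemma mdifferentiable_chart : κ.MDifferentiable (𝓡 n) (𝓡 n) :=
  ⟨(contMDiffOn_of_mem_maximalAtlas hκ).mdifferentiableOn (by simp),
    (contMDiffOn_symm_of_mem_maximalAtlas hκ).mdifferentiableOn (by simp)⟩

lemma contDiffAt_comp_symm {G : Type*} [NormedAddCommGroup G] [NormedSpace ℝ G] {f : M → G}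
    {y : 𝔼 n} (hy : y ∈ κ.target)
    (hf : ContMDiffAt (𝓡 n) 𝓘(ℝ, G) ∞ f (κ.symm y)) : ContDiffAt ℝ ∞ (fun z => f (κ.symm z)) y :=
  contMDiffAt_iff_contDiffAt.1 (hf.comp y (contMDiffAt_symm_of_mem_maximalAtlas hκ hy))

lemma mfderiv_symm_apply {y : 𝔼 n} (hy : y ∈ κ.target) : (∀ v, 𝒹 κ (κ.symm y) (𝒹 κ.symm y v) = v) ∧
    ∀ v, 𝒹 κ.symm y (𝒹 κ (κ.symm y) v) = v := by
  have h := mdifferentiable_chart hκ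
  constructor
  · exact fun v => DFunLike.congr_fun (h.comp_symm_deriv hy) v
  · intro v
    have := DFunLike.congr_fun (h.symm_comp_deriv (κ.map_target hy)) v
    rw [κ.right_inv hy] at this
    exact this

lemma isInvertible_mfderiv {y : 𝔼 n} (hy : y ∈ κ.target) : (𝒹 κ.symm y).IsInvertible ∧
      (𝒹 κ (κ.symm y)).IsInvertible := by
  obtain ⟨h1, h2⟩ := mfderiv_symm_apply hκ hy
  exact ⟨⟨ContinuousLinearEquiv.equivOfInverse _ _ h1 h2, rfl⟩,
    ⟨ContinuousLinearEquiv.equivOfInverse _ _ h2 h1, rfl⟩⟩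

/-- The components of a smooth vector field in a chart. -/
lemma contDiffAt_mfderiv_apply {V : ∀ x : M, TangentSpace (𝓡 n) x} {y : 𝔼 n} (hy : y ∈ κ.target)
    (hV : SmoothAt n (𝔼 n) V (κ.symm y)) :
    ContDiffAt ℝ ∞ (mpullback (𝓡 n) (𝓡 n) κ.symm V) y ∧
    ∀ z ∈ κ.target, mpullback (𝓡 n) (𝓡 n) κ.symm V z = 𝒹 κ (κ.symm z) (V (κ.symm z)) := by
  constructor
  · have := ContMDiffAt.mpullback_vectorField_preimage (m := ∞) (n := ∞) hV
      (contMDiffAt_symm_of_mem_maximalAtlas hκ hy) (isInvertible_mfderiv hκ hy).1 (by simp)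
    exact contMDiffAt_vectorSpace_iff_contDiffAt.1 this
  · intro z hz
    exact (isInvertible_mfderiv hκ hz).1.inverse_apply_eq.2 ((mfderiv_symm_apply hκ hz).2 _).symm

/-- The coordinate vector field `∂_i`, as a section of the tangent bundle. -/
lemma exists_coordField (i : Fin n) : ∃ V : ∀ x : M, TangentSpace (𝓡 n) x,
    (∀ x ∈ κ.source, SmoothAt n (𝔼 n) V x) ∧
    ∀ y ∈ κ.target, V (κ.symm y) = coordVec κ y i := by
  refine ⟨mpullback (𝓡 n) (𝓡 n) κ fun _ => (single i (1 : ℝ) : 𝔼 n), fun x hx => ?_, fun y hy => ?_⟩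
  · refine ContMDiffAt.mpullback_vectorField_preimage (m := ∞) (n := ∞) ?_
      (contMDiffAt_of_mem_maximalAtlas hκ hx) ?_ (by simp)
    · exact contMDiffAt_vectorSpace_iff_contDiffAt.2 contDiffAt_const
    · have := (isInvertible_mfderiv hκ (κ.map_source hx)).2
      rwa [κ.left_inv hx] at this
  · exact (isInvertible_mfderiv hκ hy).2.inverse_apply_eq.2 ((mfderiv_symm_apply hκ hy).1 _).symm

end chart

section frame

variable [ContMDiffVectorBundle ∞ (𝔼 r) E (𝓡 n)] {e : Fin r → ∀ x, E x} {u : Set M}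
  (he : IsLocalFrameOn (𝓡 n) (𝔼 r) ∞ e u) (hu : IsOpen u)
include hu

lemma contMDiffAt_coeff {s : ∀ x, E x} {x : M} (hx : x ∈ u)
    (hs : SmoothAt n (𝔼 r) s x) (c : Fin r) :
    ContMDiffAt (𝓡 n) 𝓘(ℝ, ℝ) ∞ (fun y => he.coeff c y (s y)) x := by
  set τ := trivializationAt (𝔼 r) E x
  have hb : x ∈ τ.baseSet := FiberBundle.mem_baseSet_trivializationAt' x
  set Φ : M → 𝔼 r ⊸ 𝔼 r := fun y => ofCoeff fun a => (τ ⟨y, e a y⟩).2 with hΦ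
  have h1 : ContMDiffAt (𝓡 n) 𝓘(ℝ, 𝔼 r) ∞ (fun y => (τ ⟨y, s y⟩).2) x :=
    (Bundle.contMDiffAt_section x).1 hs
  have h2 : ContMDiffAt (𝓡 n) 𝓘(ℝ, 𝔼 r ⊸ 𝔼 r) ∞ Φ x := by
    refine contMDiffAt_finsetSum fun a _ => ?_
    exact (ContinuousLinearMap.contDiff _).contMDiff.contMDiffAt.comp x
      ((Bundle.contMDiffAt_section x).1 (he.contMDiffAt hu hx a))
  -- in the trivialization, the coefficients solve a linear system with matrix `Φ`
  have h3 : ∀ y ∈ u ∩ τ.baseSet, ∀ v : E y,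
      Φ y (toLp 2 fun c => he.coeff c y v) = (τ ⟨y, v⟩).2 := by
    rintro y ⟨hy, hyb⟩ v
    have hv : v = ∑ c, he.coeff c y v • e c y := by
      conv_lhs => rw [← (he.toBasisAt hy).sum_repr v]
      simp [IsLocalFrameOn.coeff, hy]
    have hlin : ∀ w : E y, (τ ⟨y, w⟩).2 = τ.continuousLinearEquivAt ℝ y hyb w := fun w => rfl
    calc Φ y _ = ∑ c, he.coeff c y v • τ.continuousLinearEquivAt ℝ y hyb (e c y) := by
          simp only [hΦ, ofCoeff_apply]; rfl
      _ = (τ ⟨y, v⟩).2 := by rw [hlin]; conv_rhs => rw [hv, map_sum]; simp only [map_smul]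
  have h4 : (Φ x).IsInvertible := by
    have hsurj : Function.Surjective (Φ x : 𝔼 r →ₗ[ℝ] _) := fun w =>
      ⟨_, (h3 x ⟨hx, hb⟩ ((τ.continuousLinearEquivAt ℝ x hb).symm w)).trans
        ((τ.continuousLinearEquivAt ℝ x hb).apply_symm_apply w)⟩
    refine ⟨(LinearEquiv.ofBijective _ ⟨LinearMap.injective_iff_surjective.2 hsurj, hsurj⟩
      ).toContinuousLinearEquiv, ?_⟩
    ext v
    rfl
  have h5 : ContMDiffAt (𝓡 n) 𝓘(ℝ, 𝔼 r ⊸ 𝔼 r) ∞ (fun y => (Φ y).inverse) x := by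
    obtain ⟨eq, heq⟩ := h4
    exact (heq ▸ contDiffAt_map_inverse (n := ∞) eq).contMDiffAt.comp x h2
  have h6 := (proj (𝕜 := ℝ) c).contDiff.contMDiff.contMDiffAt.comp x (h5.clm_apply h1)
  refine h6.congr_of_eventuallyEq ?_
  have h7 : ∀ᶠ y in 𝓝 x, (Φ y).IsInvertible := by
    obtain ⟨eq, heq⟩ := h4
    have : ∀ᶠ f in 𝓝 (Φ x), f.IsInvertible := heq ▸ eq.nhds
    exact h2.continuousAt.eventually this
  filter_upwards [hu.mem_nhds hx, τ.open_baseSet.mem_nhds hb, h7] with y hy hyb hinv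
  have := (hinv.inverse_apply_eq).2 (h3 y ⟨hy, hyb⟩ (s y)).symm
  simp [this]

lemma exists_smooth_extension [T2Space M] {s : ∀ x, E x} {x : M}
    (hx : x ∈ u) (hs : ∀ y ∈ u, SmoothAt n (𝔼 r) s y) :
    ∃ χ : M → ℝ, ContMDiff (𝓡 n) 𝓘(ℝ, ℝ) ∞ χ ∧ χ =ᶠ[𝓝 x] 1 ∧ tsupport χ ⊆ u ∧
      ∀ y, SmoothAt n (𝔼 r) (χ • s) y := by
  obtain ⟨f, -, hf⟩ := ((SmoothBumpFunction.nhds_basis_tsupport (I := 𝓡 n) x).mem_iff).1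
    (hu.mem_nhds hx)
  refine ⟨f, f.contMDiff, f.eventuallyEq_one, hf, fun y => ?_⟩
  exact (ContMDiffOn.smul_section_of_tsupport f.contMDiff.contMDiffOn hu hf
    fun y hy => (hs y hy).contMDiffWithinAt) y

lemma contMDiffAt_nabla [T2Space M] [∀ x, IsTopologicalAddGroup (E x)]
    [∀ x, ContinuousSMul ℝ (E x)] (nabla : CovariantDerivative (𝓡 n) (𝔼 r) E)
    (hn : CovariantDerivative.ContMDiffCovariantDerivative nabla ∞) {s : ∀ x, E x} {x : M}
    (hx : x ∈ u) (hs : ∀ y ∈ u, SmoothAt n (𝔼 r) s y) :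
    SmoothAt n (𝔼 n ⊸ 𝔼 r) (nabla s) x := by
  obtain ⟨χ, hχ, h1, -, h2⟩ := exists_smooth_extension hu hx hs
  have h3 := (hn.contMDiff.contMDiff (σ := χ • s) fun y _ => (h2 y).contMDiffWithinAt).contMDiffAt
    (Filter.univ_mem (f := 𝓝 x))
  refine h3.congr_of_eventuallyEq ?_
  filter_upwards [h1.eventually_nhds, hu.mem_nhds hx] with y hy hyu
  have e1 : mfderiv (𝓡 n) 𝓘(ℝ, ℝ) χ y = 0 := by
    rw [Filter.EventuallyEq.mfderiv_eq hy]
    exact mfderiv_const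
  have e2 := nabla.isCovariantDerivativeOnUniv.leibniz (x := y) (g := χ)
    ((hs y hyu).mdifferentiableAt (by simp)) (hχ.mdifferentiableAt (by simp))
  have e4 : mvfderiv (𝓡 n) χ y = 0 := by ext v; simp [mvfderiv, e1]
  rw [e4, hy.self_of_nhds] at e2
  have e3 : nabla.toFun (χ • s) y = nabla.toFun s y := by
    refine e2.trans ?_
    ext v
    simp
  exact congrArg _ e3.symm

end frame

/-! ### The local model of global data -/

variable [∀ x, IsTopologicalAddGroup (E x)] [∀ x, ContinuousSMul ℝ (E x)]
  [ContMDiffVectorBundle ∞ (𝔼 r) E (𝓡 n)]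
  {e : Fin r → ∀ x, E x} {u : Set M}

/-- The element of a fibre with given components. -/
def fr (e : Fin r → ∀ x, E x) (x : M) (w : 𝔼 r) : E x := ∑ a, w a • e a x

lemma fr_coeff (he : IsLocalFrameOn (𝓡 n) (𝔼 r) ∞ e u) {x : M} (hx : x ∈ u)
    (v : E x) : fr e x (toLp 2 fun c => he.coeff c x v) = v := by
  conv_rhs => rw [← (he.toBasisAt hx).sum_repr v]
  simp [IsLocalFrameOn.coeff, hx, fr]

lemma coeff_fr (he : IsLocalFrameOn (𝓡 n) (𝔼 r) ∞ e u) {x : M} (hx : x ∈ u)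
    (w : 𝔼 r) (c : Fin r) : he.coeff c x (fr e x w) = w c := by
  have h : ∀ a, he.coeff c x (e a x) = if c = a then 1 else 0 := fun a => by
    rw [he.coeff_apply_of_mem hx (fun y => e a y), ← he.toBasisAt_coe hx a,
      Module.Basis.repr_self, Finsupp.single_apply]
    simp [eq_comm]
  simp [fr, h]

lemma smoothAt_fr (he : IsLocalFrameOn (𝓡 n) (𝔼 r) ∞ e u) (hu : IsOpen u)
    {x : M} (hx : x ∈ u) {w : M → 𝔼 r}
    (hw : ContMDiffAt (𝓡 n) 𝓘(ℝ, 𝔼 r) ∞ w x) :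
    SmoothAt n (𝔼 r) (fun y => fr e y (w y)) x := by
  refine ContMDiffAt.sum_section fun a _ => ContMDiffAt.smul_section ?_ (he.contMDiffAt hu hx a)
  exact (proj a).contDiff.contMDiff.contMDiffAt.comp x hw

lemma contMDiffAt_pairing {F1 : Type*} [NormedAddCommGroup F1] [NormedSpace ℝ F1] {E1 : M → Type*}
    [TopologicalSpace (TotalSpace F1 E1)] [∀ x, AddCommGroup (E1 x)] [∀ x, Module ℝ (E1 x)]
    [∀ x, TopologicalSpace (E1 x)] [FiberBundle F1 E1] [VectorBundle ℝ F1 E1]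
    {β : ∀ x : M, E1 x ⊸ TangentSpace (𝓡 n) x ⊸ ℝ} {x : M}
    (hβ : ContMDiffAt (𝓡 n) ((𝓡 n).prod 𝓘(ℝ, F1 ⊸ 𝔼 n ⊸ ℝ)) ∞
      (fun x => TotalSpace.mk' (F1 ⊸ 𝔼 n ⊸ ℝ) x (β x)) x)
    {s : ∀ x, E1 x} {v : ∀ x : M, TangentSpace (𝓡 n) x} (hs : SmoothAt n F1 s x)
    (hv : SmoothAt n (𝔼 n) v x) :
    ContMDiffAt (𝓡 n) 𝓘(ℝ, ℝ) ∞ (fun x => β x (s x) (v x)) x := by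
  have := ContMDiffAt.clm_bundle_apply₂ hβ hs hv
  simp only [Bundle.contMDiffAt_totalSpace] at this
  exact this.2

/-- The anchor and the structure functions in a chart and a frame, with all other data zero. -/
def anchorModel (ρ : ∀ x : M, E x ⊸ TangentSpace (𝓡 n) x) (br : (∀ x, E x) → (∀ x, E x) → ∀ x, E x)
    (κ : OpenPartialHomeomorph M (𝔼 n))
    (he : IsLocalFrameOn (𝓡 n) (𝔼 r) ∞ e κ.source) : LocalModel n r where
  dom := κ.target
  g := 0
  H := 0
  ρ y a i := (show 𝔼 n from 𝒹 κ (κ.symm y) (ρ (κ.symm y) (e a (κ.symm y)))) i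
  C y c a b := he.coeff c (κ.symm y) (br (e a) (e b) (κ.symm y))
  conn := 0
  φ := 0
  α := 0

section model

variable {g : PseudoMetric n M} {H : ClosedThreeForm n M}
  {ρ : ∀ x : M, E x ⊸ TangentSpace (𝓡 n) x} {br : (∀ x, E x) → (∀ x, E x) → ∀ x, E x}
  {nabla : CovariantDerivative (𝓡 n) (𝔼 r) E}
  {φ : ∀ x : M, TangentSpace (𝓡 n) x ⊸ E x ⊸ E x}
  {α : ∀ x : M, E x ⊸ TangentSpace (𝓡 n) x ⊸ ℝ}
  (hκ : κ ∈ maximalAtlas (𝓡 n) ∞ M)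
  (he : IsLocalFrameOn (𝓡 n) (𝔼 r) ∞ e κ.source)
include hκ

lemma isAdmissible_anchorModel (hρ : Hom∞ n (𝔼 r) (𝔼 n) ρ)
    (hbr : IsAlmostLieBracket (r := r) ρ br) :
    (anchorModel ρ br κ he).IsAdmissible := by
  have hu := κ.open_source
  have hmem : ∀ {y}, y ∈ κ.target → κ.symm y ∈ κ.source := fun hy => κ.map_target hy
  have hes : ∀ a, ∀ x ∈ κ.source, SmoothAt n (𝔼 r) (e a) x := fun a x hx => he.contMDiffAt hu hx a
  have hW : ∀ a, ∀ x ∈ κ.source, SmoothAt n (𝔼 n) (fun y => ρ y (e a y)) x :=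
    fun a x hx => hρ.contMDiffAt.clm_bundle_apply (hes a x hx)
  set Wt : Fin r → 𝔼 n → 𝔼 n := fun a => mpullback (𝓡 n) (𝓡 n) κ.symm fun y => ρ y (e a y)
  have hW1 : ∀ a, C∞ (Wt a) κ.target := fun a y hy =>
    (contDiffAt_mfderiv_apply hκ hy (hW a _ (hmem hy))).1.contDiffWithinAt
  have hW2 : ∀ a i, ∀ y ∈ κ.target, (anchorModel ρ br κ he).ρ y a i = Wt a y i :=
    fun a i y hy => congrArg (fun w : 𝔼 n => w i)
      ((contDiffAt_mfderiv_apply hκ hy (hW a _ (hmem hy))).2 y hy).symm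
  refine ⟨κ.open_target, fun _ _ => contDiffOn_const, fun a i => ?_, fun c a b => ?_,
    fun _ _ _ => contDiffOn_const, fun _ _ _ => contDiffOn_const, fun _ _ => contDiffOn_const,
    fun _ _ _ _ => rfl, fun y hy c a b => ?_, fun y hy a b i => ?_⟩
  · exact ((contDiffOn_piLp 2).1 (hW1 a) i).congr (hW2 a i)
  · exact fun y hy => (contDiffAt_comp_symm hκ hy (contMDiffAt_coeff he hu (hmem hy)
      (hbr.smooth _ _ _ (hes a _ (hmem hy)) (hes b _ (hmem hy))) c)).contDiffWithinAt
  · have := hbr.antisymm (e a) (e b) _ (hes a _ (hmem hy)) (hes b _ (hmem hy))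
    show he.coeff c _ (br (e a) (e b) _) = -he.coeff c _ (br (e b) (e a) _)
    rw [this, map_neg]
  · have hD : ∀ b, ∀ v : 𝔼 n, ∑ l, v l * pd l (fun z =>
        (anchorModel ρ br κ he).ρ z b i) y = 𝒟 (Wt b) y v i := by
      intro b v
      have h1 : (fun z => (anchorModel ρ br κ he).ρ z b i) =ᶠ[𝓝 y] fun z => Wt b z i := by
        filter_upwards [κ.open_target.mem_nhds hy] with z hz using hW2 b i z hz
      have h2 := (hW1 b).fderivAt κ.open_target hy
      have h3 : HasFDerivAt (fun z => Wt b z i) (proj (𝕜 := ℝ) i ∘L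
        𝒟 (Wt b) y) y := (proj (𝕜 := ℝ) i).hasFDerivAt.comp y h2
      rw [← LocalModel.fderiv_apply_eq_sum, h1.fderiv_eq, h3.fderiv]
      rfl
    have h1 : lieBracket ℝ (Wt a) (Wt b) y = mpullback (𝓡 n) (𝓡 n) κ.symm
          (mlieBracket (𝓡 n) (fun y => ρ y (e a y)) fun y => ρ y (e b y)) y := by
      have h2 : minSmoothness ℝ 2 ≤ ∞ := by
        rw [minSmoothness_of_isRCLikeNormedField]
        exact WithTop.coe_le_coe.2 (le_top : (2 : ℕ∞) ≤ ⊤)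
      have : IsManifold (𝓡 n) (minSmoothness ℝ 2) M := IsManifold.of_le h2
      rw [VectorField.mpullback_mlieBracket ((hW a _ (hmem hy)).mdifferentiableAt (by simp))
        ((hW b _ (hmem hy)).mdifferentiableAt (by simp))
        (contMDiffAt_symm_of_mem_maximalAtlas hκ hy) h2]
      rw [← VectorField.mlieBracketWithin_univ, VectorField.mlieBracketWithin_eq_lieBracketWithin]
      exact (congrFun (VectorField.lieBracketWithin_univ) y).symm
    have h2 : lieBracket ℝ (Wt a) (Wt b) y =
        ∑ c, he.coeff c (κ.symm y) (br (e a) (e b) (κ.symm y)) • Wt c y := by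
      rw [h1, VectorField.mpullback_apply, ← hbr.map_anchor _ _ _ (hes a _ (hmem hy))
        (hes b _ (hmem hy))]
      conv_lhs => rw [← fr_coeff he (hmem hy) (br (e a) (e b) (κ.symm y))]
      simp only [fr, map_sum, map_smul]
      rfl
    have h3 := congrArg (fun w : 𝔼 n => w i) h2
    simp only [lieBracket, PiLp.sub_apply, ← hD] at h3
    rw [sum_sub_distrib]
    simp only [hW2 _ _ y hy]
    refine h3.trans ?_
    simp only [WithLp.ofLp_sum, WithLp.ofLp_smul, Finset.sum_apply, Pi.smul_apply, smul_eq_mul]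
    rfl

lemma isAdmissible_localModel [T2Space M] (hρ : Hom∞ n (𝔼 r) (𝔼 n) ρ)
    (hbr : IsAlmostLieBracket (r := r) ρ br)
    (hn : CovariantDerivative.ContMDiffCovariantDerivative nabla ∞)
    (hφ : Hom∞ n (𝔼 n) (𝔼 r ⊸ 𝔼 r) φ)
    (hα : Hom∞ n (𝔼 r) (𝔼 n ⊸ ℝ) α) :
    (localModel g H ρ br nabla φ α κ he).IsAdmissible := by
  have hu := κ.open_source
  choose V hV hVc using exists_coordField hκ
  have hmem : ∀ {y}, y ∈ κ.target → κ.symm y ∈ κ.source := fun hy => κ.map_target hy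
  have hes : ∀ a, ∀ x ∈ κ.source, SmoothAt n (𝔼 r) (e a) x := fun a x hx => he.contMDiffAt hu hx a
  -- scalar functions of the base point, read in the chart
  have hsm : ∀ {f : M → ℝ} {f' : 𝔼 n → ℝ}, (∀ x ∈ κ.source, ContMDiffAt (𝓡 n) 𝓘(ℝ, ℝ) ∞ f x) →
      (∀ y ∈ κ.target, f' y = f (κ.symm y)) → C∞ f' κ.target := fun hf hf' =>
    ContDiffOn.congr (fun y hy => (contDiffAt_comp_symm hκ hy (hf _ (hmem hy))).contDiffWithinAt) hf'
  have h0 := isAdmissible_anchorModel hκ he hρ hbr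
  refine ⟨κ.open_target, fun i j => ?_, h0.smooth_ρ, h0.smooth_C, fun b a i => ?_,
    fun b a i => ?_, fun a i => ?_, fun y hy i j => g.symm _ _ _, h0.antisymm_C, h0.bracket⟩
  · exact hsm (fun x hx =>
      contMDiffAt_pairing g.smooth.contMDiffAt (hV i x hx) (hV j x hx)) fun y hy => by
        rw [hVc i y hy, hVc j y hy]; rfl
  · exact hsm (fun x hx =>
      contMDiffAt_coeff he hu hx ((contMDiffAt_nabla hu nabla hn hx (hes a)).clm_bundle_apply
        (hV i x hx)) b) fun y hy => by rw [hVc i y hy]; rfl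
  · exact hsm (fun x hx =>
      contMDiffAt_coeff he hu hx (hφ.contMDiffAt.clm_bundle_apply₂ (hV i x hx) (hes a x hx)) b)
      fun y hy => by rw [hVc i y hy]; rfl
  · exact hsm (fun x hx =>
      contMDiffAt_pairing hα.contMDiffAt (hes a x hx) (hV i x hx)) fun y hy => by
        rw [hVc i y hy]; rfl

local notation "𝖫" => localModel g H ρ br nabla φ α κ he

variable {B : 𝔼 n → Fin n → Fin n → ℝ} {y : 𝔼 n} (hy : y ∈ κ.target)

omit hκ in
lemma R_localModel (w : 𝔼 r) : (𝖫.toGeo B).R y w =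
    𝒹 κ (κ.symm y) (ρ (κ.symm y) (fr e (κ.symm y) w)) := by
  simp only [fr, map_sum, map_smul]
  exact ofCoeff_apply _ _

omit hκ in
lemma Al_localModel (w : 𝔼 r) (v : 𝔼 n) : (𝖫.toGeo B).Al y w v = α (κ.symm y) (fr e (κ.symm y) w)
      (𝒹 κ.symm y v) := by
  have h1 : ∀ b : E (κ.symm y), (ofCoeff fun i => α (κ.symm y) b (coordVec κ y i)) v =
      α (κ.symm y) b (𝒹 κ.symm y v) := fun b =>
    (DFunLike.congr_fun (eq_ofCoeff ((α (κ.symm y) b).comp (𝒹 κ.symm y : 𝔼 n ⊸ _))) v).symm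
  simp only [LocalModel.toGeo, ofCoeff_apply (F := 𝔼 n ⊸ ℝ),
    _root_.sum_apply, _root_.smul_apply, fr, map_sum, map_smul]
  exact sum_congr rfl fun a _ => congrArg _ (h1 _)

omit hκ in
lemma G_localModel (v w : 𝔼 n) : (𝖫.toGeo B).G y v w =
    g.inner (κ.symm y) (𝒹 κ.symm y v) (𝒹 κ.symm y w) := by
  have key : ∀ (b : 𝔼 n ⊸ 𝔼 n ⊸ ℝ) (D : 𝔼 n ⊸ 𝔼 n), (ofCoeff fun i => ofCoeff
        fun j => b (D (single i 1)) (D (single j 1))) v w =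
        b (D v) (D w) := by
    intro b D
    have h3 := fun i => eq_ofCoeff (b.bilinearComp D D (single i 1))
    have h2 := eq_ofCoeff (b.bilinearComp D D)
    rw [funext h3] at h2
    exact (DFunLike.congr_fun (DFunLike.congr_fun h2 v) w).symm
  exact key (g.inner (κ.symm y)) (𝒹 κ.symm y)

include hy

lemma R_localModel_eq_zero (w : 𝔼 r) :
    (𝖫.toGeo B).R y w = 0 ↔ ρ (κ.symm y) (fr e (κ.symm y) w) = 0 := by
  rw [R_localModel]
  constructor
  · intro h
    rw [← (mfderiv_symm_apply hκ hy).2 (ρ _ _)]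
    exact (congrArg (𝒹 κ.symm y) h).trans (map_zero _)
  · intro h
    rw [h]
    exact map_zero _

lemma pos_localModel (hg : ∀ x (v : TangentSpace (𝓡 n) x), v ≠ 0 → 0 < g.inner x v v)
    {v : 𝔼 n} (hv : v ≠ 0) : 0 < (𝖫.toGeo B).G y v v := by
  rw [G_localModel]
  refine hg _ _ fun h => hv ?_
  rw [← (mfderiv_symm_apply hκ hy).1 v]
  exact (congrArg (𝒹 κ (κ.symm y)) h).trans (map_zero _)

lemma leafNondegenerate_localModel (hN : LeafNondegenerate g ρ α (κ.symm y)) :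
    (𝖫.toGeo B).LeafNondegenerate y := by
  obtain ⟨m1, m2⟩ := mfderiv_symm_apply hκ hy
  have hfr : ∀ w : E (κ.symm y), ∃ c, fr e (κ.symm y) c = w := fun w =>
    ⟨_, fr_coeff he (κ.map_target hy) w⟩
  have hR : ∀ w, 𝒹 κ.symm y ((𝖫.toGeo B).R y w) =
      ρ (κ.symm y) (fr e (κ.symm y) w) := fun w => by rw [R_localModel]; exact m2 _
  constructor
  · intro a b hab
    rw [R_localModel_eq_zero hκ he hy, R_localModel_eq_zero hκ he hy]
    refine hN.hermitian _ _ fun w => ?_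
    obtain ⟨c, rfl⟩ := hfr w
    have := hab c
    simpa only [G_localModel, Al_localModel, hR] using this
  · intro a Y h1 h2
    rw [R_localModel_eq_zero hκ he hy]
    refine hN.reduced _ (𝒹 κ.symm y Y) (fun v => ?_) fun w => ?_
    · obtain ⟨v, rfl⟩ : ∃ v' : 𝔼 n, 𝒹 κ.symm y v' = v := ⟨_, m2 v⟩
      exact (G_localModel he Y v).symm.trans ((h1 v).trans (Al_localModel he a v))
    · obtain ⟨c, rfl⟩ := hfr w
      have := h2 c
      rwa [G_localModel, Al_localModel, hR, hR] at this

omit hy in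
lemma leafCondition_localModel {sig : Signature}
    (hg : ∀ x (v : TangentSpace (𝓡 n) x), v ≠ 0 → 0 < g.inner x v v)
    (hN : sig = Signature.euclidean → ∀ x ∈ κ.source, LeafNondegenerate g ρ α x) :
    𝖫.LeafCondition B sig :=
  ⟨fun _ hy _ hv => pos_localModel hκ he hy hg hv,
    fun hs _ hy => leafNondegenerate_localModel hκ he hy (hN hs _ (κ.map_target hy))⟩

section shift

omit hy

variable {F : M → Type*} [TopologicalSpace (TotalSpace (𝔼 k) F)]
  [∀ x, AddCommGroup (F x)] [∀ x, Module ℝ (F x)] [∀ x, TopologicalSpace (F x)]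
  [∀ x, IsTopologicalAddGroup (F x)] [∀ x, ContinuousSMul ℝ (F x)]
  [FiberBundle (𝔼 k) F] [VectorBundle ℝ (𝔼 k) F]
  [ContMDiffVectorBundle ∞ (𝔼 k) F (𝓡 n)]
  {t : ∀ x : M, F x ⊸ E x}
  {f : Fin k → ∀ x, F x} (hf : IsLocalFrameOn (𝓡 n) (𝔼 k) ∞ f κ.source)

omit hκ in
lemma fr_shiftMap (hy : y ∈ κ.target) (l : 𝔼 k) :
    fr e (κ.symm y) (LocalModel.shiftMap (localShift t κ he f) y l) =
      t (κ.symm y) (fr f (κ.symm y) l) := by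
  have h1 : LocalModel.shiftMap (localShift t κ he f) y l = toLp 2 fun c =>
      he.coeff c (κ.symm y) (t (κ.symm y) (fr f (κ.symm y) l)) := by
    ext c
    simp only [LocalModel.shiftMap, fr, map_sum, map_smul, lin_apply]
    rfl
  rw [h1, fr_coeff he (κ.map_target hy)]

include hf in
lemma smooth_shiftMap (ht : Hom∞ n (𝔼 k) (𝔼 r) t) :
    C∞ (LocalModel.shiftMap (localShift t κ he f)) κ.target :=
  smooth_ofCoeff fun I => smooth_toLp fun a _ hy => (contDiffAt_comp_symm hκ hy
    (contMDiffAt_coeff he κ.open_source (κ.map_target hy) (ht.contMDiffAt.clm_bundle_apply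
      (hf.contMDiffAt κ.open_source (κ.map_target hy) I)) a)).contDiffWithinAt

include hf in
/-- In foliated coordinates the kernel of the anchor is the image of a smooth projection, so that
exactness on sections implies exactness in each fibre. -/
lemma isExactShift_localModel [T2Space M] {leaf : Finset (Fin n)} (ht : Hom∞ n (𝔼 k) (𝔼 r) t)
    (hs : (𝖫.toGeo B).IsSmooth) (hfol : 𝖫.IsFoliated leaf)
    (hex : IsExactOnSections (r := r) (k := k) t ρ) (hα : ∀ x v, α x (t x v) = 0) :
    𝖫.IsExactShift B (localShift t κ he f) := by
  refine ⟨smooth_shiftMap hκ he hf ht, fun y hy l => ?_, fun y hy a ha => ?_, fun y hy l => ?_⟩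
  · rw [R_localModel_eq_zero hκ he hy, fr_shiftMap he hy, hex.1]
  · have tR : ∀ x ∈ κ.target, ∀ a, LocalModel.leafProj leaf ((𝖫.toGeo B).R x a) =
        (𝖫.toGeo B).R x a := fun x hx a => (hfol.tangent_iff hx _).1 ⟨a, rfl⟩
    obtain ⟨Rp, hRp, hRR⟩ := exists_right_inverse hs.smooth_R (LocalModel.leafProj leaf)
      (fun v => LocalModel.leafProj_eq_iff.2 fun i hi => by
        rw [LocalModel.leafProj_apply, if_neg hi]) tR
      fun x hx v hv => (hfol.tangent_iff hx v).2 hv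
    set w : 𝔼 n → 𝔼 r := fun z => a - Rp z ((𝖫.toGeo B).R z a) with hw
    have hw1 : C∞ w κ.target := contDiffOn_const.sub
      (hRp.clm_apply (hs.smooth_R.clm_apply contDiffOn_const))
    have hw2 : ∀ z ∈ κ.target, (𝖫.toGeo B).R z (w z) = 0 := fun z hz => by
      rw [hw]
      simp only [map_sub]
      rw [hRR z hz, tR z hz, sub_self]
    have hsm : ∀ x ∈ κ.source, SmoothAt n (𝔼 r) (fun x => fr e x (w (κ x))) x :=
      fun x hx => smoothAt_fr he κ.open_source hx ((hw1.contDiffAt (κ.open_target.mem_nhds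
        (κ.map_source hx))).contMDiffAt.comp x (contMDiffAt_of_mem_maximalAtlas hκ hx))
    obtain ⟨χ, hχ, h1, hsupp, h2⟩ := exists_smooth_extension κ.open_source (κ.map_target hy) hsm
    obtain ⟨f', hf'⟩ := hex.2 ⟨_, fun x => h2 x⟩ fun x => by
      show ρ x (χ x • fr e x (w (κ x))) = 0
      by_cases hx : x ∈ κ.source
      · have := (R_localModel_eq_zero hκ he (κ.map_source hx) (w (κ x))).1 (hw2 _ (κ.map_source hx))
        rw [κ.left_inv hx] at this
        rw [map_smul, this, smul_zero]
      · rw [image_eq_zero_of_notMem_tsupport fun h => hx (hsupp h), zero_smul, map_zero]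
    have h3 : t (κ.symm y) (f' (κ.symm y)) = fr e (κ.symm y) a := by
      rw [hf']
      show χ (κ.symm y) • fr e (κ.symm y) (w (κ (κ.symm y))) = _
      rw [h1.self_of_nhds, κ.right_inv hy]
      simp only [hw]
      rw [ha, map_zero, sub_zero]
      exact one_smul _ _
    refine ⟨toLp 2 fun I => hf.coeff I (κ.symm y) (f' (κ.symm y)), ?_⟩
    have h4 := fr_shiftMap (t := t) (f := f) he hy
      (toLp 2 fun I => hf.coeff I (κ.symm y) (f' (κ.symm y)))
    rw [fr_coeff hf (κ.map_target hy), h3] at h4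
    ext c
    rw [← coeff_fr he (κ.map_target hy) _ c, h4, coeff_fr he (κ.map_target hy)]
  · ext v
    rw [Al_localModel, fr_shiftMap he hy, hα]
    rfl

end shift

end model

/-! ### Charts adapted to the foliation -/

omit [IsManifold (𝓡 n) ∞ M] in
lemma trans_mem_maximalAtlas (hκ : κ ∈ maximalAtlas (𝓡 n) ∞ M)
    {φ : OpenPartialHomeomorph (𝔼 n) (𝔼 n)}
    (hφ : C∞ φ φ.source) (hφ' : C∞ φ.symm φ.target) :
    κ ≫ₕ φ ∈ maximalAtlas (𝓡 n) ∞ M := by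
  have h : φ ∈ contDiffGroupoid ∞ (𝓡 n) := by
    rw [contDiffGroupoid, mem_groupoid_of_pregroupoid]
    simp only [contDiffPregroupoid, modelWithCornersSelf_coe, modelWithCornersSelf_coe_symm,
      Set.preimage_id, Set.range_id, Set.inter_univ, Function.comp_id, Function.id_comp]
    exact ⟨hφ, hφ'⟩
  rw [maximalAtlas, mem_maximalAtlas_iff] at hκ ⊢
  refine fun e' he' => ⟨?_, ?_⟩
  · rw [OpenPartialHomeomorph.trans_symm_eq_symm_trans_symm, OpenPartialHomeomorph.trans_assoc]
    exact (contDiffGroupoid ∞ (𝓡 n)).trans ((contDiffGroupoid ∞ (𝓡 n)).symm h) (hκ e' he').1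
  · rw [← OpenPartialHomeomorph.trans_assoc]
    exact (contDiffGroupoid ∞ (𝓡 n)).trans (hκ e' he').2 h

/-- The restriction of a chart to an open set of coordinates. -/
def restrChart (κ : OpenPartialHomeomorph M (𝔼 n)) {S : Set (𝔼 n)} (hS : IsOpen S) :
    OpenPartialHomeomorph M (𝔼 n) :=
  κ ≫ₕ OpenPartialHomeomorph.ofSet S hS

section restr

variable {S : Set (𝔼 n)} (hS : IsOpen S)

omit [IsManifold (𝓡 n) ∞ M] in
lemma restrChart_mem (hκ : κ ∈ maximalAtlas (𝓡 n) ∞ M) : restrChart κ hS ∈ maximalAtlas (𝓡 n) ∞ M :=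
  trans_mem_maximalAtlas hκ contDiffOn_id contDiffOn_id

omit [IsManifold (𝓡 n) ∞ M] in
lemma restrChart_source : (restrChart κ hS).source = κ.source ∩ κ ⁻¹' S := by simp [restrChart]

omit [IsManifold (𝓡 n) ∞ M] in
lemma restrChart_target (h : S ⊆ κ.target) : (restrChart κ hS).target = S := by
  simp [restrChart, Set.inter_eq_left.2 h]

end restr

/-- Primitives of `H` exist on all sufficiently small restrictions of a chart. -/
lemma exists_isPrimitive (g : PseudoMetric n M) (H : ClosedThreeForm n M)
    (ρ : ∀ x : M, E x ⊸ TangentSpace (𝓡 n) x) (br : (∀ x, E x) → (∀ x, E x) → ∀ x, E x)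
    (nabla : CovariantDerivative (𝓡 n) (𝔼 r) E)
    (φ : ∀ x : M, TangentSpace (𝓡 n) x ⊸ E x ⊸ E x)
    (α : ∀ x : M, E x ⊸ TangentSpace (𝓡 n) x ⊸ ℝ)
    (hκ : κ ∈ maximalAtlas (𝓡 n) ∞ M) {x : M} (hx : x ∈ κ.source) :
    ∃ (B : 𝔼 n → Fin n → Fin n → ℝ) (δ : ℝ), 0 < δ ∧
      ball (κ x) δ ⊆ κ.target ∧ ∀ {S : Set (𝔼 n)} (hS : IsOpen S),
      S ⊆ ball (κ x) δ → ∀ {e : Fin r → ∀ x, E x} (he : IsLocalFrameOn (𝓡 n)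
        (𝔼 r) ∞ e (restrChart κ hS).source),
      (localModel g H ρ br nabla φ α (restrChart κ hS) he).IsPrimitive B := by
  have hadd12 : ∀ y (u v w : TangentSpace (𝓡 n) y), H.form y u v w = -H.form y v u w :=
    fun y u v w => by
      have h := H.alt₁₂ y (u + v) w
      simp only [map_add, _root_.add_apply, H.alt₁₂, zero_add, add_zero] at h
      linarith
  have hadd23 : ∀ y (u v w : TangentSpace (𝓡 n) y), H.form y u v w = -H.form y u w v :=
    fun y u v w => by
      have h := H.alt₂₃ y u (v + w)
      simp only [map_add, _root_.add_apply, H.alt₂₃, zero_add, add_zero] at h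
      linarith
  obtain ⟨B, δ, hδ, hB, hU, h⟩ := exists_primitive κ.open_target
    (H := fun y i j l => H.form (κ.symm y) (coordVec κ y i) (coordVec κ y j) (coordVec κ y l))
    (H.smooth κ hκ) (fun y _ i j l => hadd12 _ _ _ _) (fun y _ i j l => hadd23 _ _ _ _)
    (H.closed κ hκ) (κ.map_source hx)
  refine ⟨B, δ, hδ, hU, fun {S} hS hSδ {e} he => ?_⟩
  have ht := restrChart_target hS (hSδ.trans hU)
  refine ⟨fun i j => (hB i j).contDiffOn, fun y hy => (h y ?_).1, fun y hy => (h y ?_).2⟩ <;>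
  · have hy : y ∈ (restrChart κ hS).target := hy
    rw [ht] at hy
    exact hSδ hy

/-- Every neighbourhood of a point contains a chart domain with a frame. -/
lemma exists_chart_frame (E : M → Type*) [TopologicalSpace (TotalSpace (𝔼 r) E)]
    [∀ x, AddCommGroup (E x)] [∀ x, Module ℝ (E x)] [∀ x, TopologicalSpace (E x)]
    [FiberBundle (𝔼 r) E] [VectorBundle ℝ (𝔼 r) E]
    [ContMDiffVectorBundle ∞ (𝔼 r) E (𝓡 n)]
    (hκ : κ ∈ maximalAtlas (𝓡 n) ∞ M) {x : M} (hx : x ∈ κ.source) {N : Set M}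
    (hN : N ∈ 𝓝 x) : ∃ κ' ∈ maximalAtlas (𝓡 n) ∞ M, x ∈ κ'.source ∧
      κ'.source ⊆ N ∩ κ.source ∧ ∃ e : Fin r → ∀ x, E x,
        IsLocalFrameOn (𝓡 n) (𝔼 r) ∞ e κ'.source := by
  let τ := trivializationAt (𝔼 r) E x
  have hN' : N ∩ τ.baseSet ∈ 𝓝 x :=
    Filter.inter_mem hN (τ.open_baseSet.mem_nhds (FiberBundle.mem_baseSet_trivializationAt' x))
  obtain ⟨u, huN, hu, hxu⟩ := mem_nhds_iff.1 hN'
  have hS : IsOpen (κ.target ∩ κ.symm ⁻¹' u) := κ.isOpen_inter_preimage_symm hu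
  have hsub : (restrChart κ hS).source ⊆ u ∩ κ.source := by
    rw [restrChart_source]
    rintro y ⟨hy, -, hyu⟩
    exact ⟨by rwa [Set.mem_preimage, κ.left_inv hy] at hyu, hy⟩
  refine ⟨_, restrChart_mem hS hκ, ?_, hsub.trans
    (Set.inter_subset_inter_left _ (huN.trans Set.inter_subset_left)), _,
    (τ.isLocalFrameOn_localFrame_baseSet (𝓡 n) ∞ (EuclideanSpace.basisFun (Fin r) ℝ).toBasis).mono
      (hsub.trans (Set.inter_subset_left.trans (huN.trans Set.inter_subset_right)))⟩
  rw [restrChart_source]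
  exact ⟨hx, κ.map_source hx, by rwa [Set.mem_preimage, κ.left_inv hx]⟩

/-- Charts around `x`, with `x` as origin, in which the image of the anchor is a coordinate
subspace: on the slice through `x`, and everywhere if the rank is constant. -/
lemma exists_adapted_chart {ρ : ∀ x : M, E x ⊸ TangentSpace (𝓡 n) x}
    {br : (∀ x, E x) → (∀ x, E x) → ∀ x, E x} {e : Fin r → ∀ x, E x}
    (hκ : κ ∈ maximalAtlas (𝓡 n) ∞ M)
    (he : IsLocalFrameOn (𝓡 n) (𝔼 r) ∞ e κ.source)
    (hρ : Hom∞ n (𝔼 r) (𝔼 n) ρ)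
    (hbr : IsAlmostLieBracket (r := r) ρ br) {x : M} (hx : x ∈ κ.source) :
    ∃ ψ ∈ maximalAtlas (𝓡 n) ∞ M, ∃ leaf : Finset (Fin n),
      x ∈ ψ.source ∧ ψ.source ⊆ κ.source ∧ ψ x = 0 ∧ ∀ w ∈ ψ.target,
        (LocalModel.leafProj leaf w = w ∨ ∀ y ∈ κ.source, Module.finrank ℝ (LinearMap.range
          (ρ y).toLinearMap) = Module.finrank ℝ (LinearMap.range (ρ x).toLinearMap)) →
        ∀ v, (∃ b, ρ (ψ.symm w) b = 𝒹 ψ.symm w v) ↔ LocalModel.leafProj leaf v = v := by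
  set G := (anchorModel ρ br κ he).toGeo 0 with hG
  have hg : G.IsGauged Signature.euclidean.sign := by
    refine LocalModel.isGauged_toGeo (isAdmissible_anchorModel hκ he hρ hbr) ⟨fun _ _ =>
      contDiffOn_const, fun _ _ _ _ => neg_zero.symm, fun y _ i j l => ?_⟩ (fun y _ a i j => ?_)
      (fun y _ a i j => ?_) (fun y _ a b => ?_) fun y _ a b i => ?_
    · simp [anchorModel, pd]
    · simp [anchorModel, pd, LocalModel.lieG]
    · simp [anchorModel, pd, LocalModel.ρH, LocalModel.dα]
    · simp [anchorModel, LocalModel.γ]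
    · simp [anchorModel, pd, LocalModel.lieα, LocalModel.ρH, LocalModel.dα]
  have hR : ∀ y w, G.R y w = 𝒹 κ (κ.symm y) (ρ (κ.symm y) (fr e (κ.symm y) w)) := fun y w => by
    simp only [fr, map_sum, map_smul]
    exact ofCoeff_apply _ _
  obtain ⟨leaf, hl1, hl2⟩ := exists_transversal_coordinates (G.R (κ x)).range
  set P := LocalModel.leafProj leaf with hP
  have hPa : ∀ v i, P v i = if i ∈ leaf then v i else 0 := LocalModel.leafProj_apply leaf
  have hPP : ∀ v, P (P v) = P v := fun v => by ext i; simp only [hPa]; split_ifs <;> rfl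
  have hex : ∀ v, ∃ w, P (G.R (κ x) w) = P v := fun v => by
    obtain ⟨_, ⟨w, rfl⟩, hw⟩ := hl2 v
    refine ⟨w, ?_⟩
    ext i
    rw [hPa, hPa]
    split_ifs with hi
    · exact hw i hi
    · rfl
  choose q hq using hex
  have hrank : ∀ y ∈ κ.target, Module.finrank ℝ (G.R y).range =
      Module.finrank ℝ (LinearMap.range (ρ (κ.symm y)).toLinearMap) := fun y hy => by
    let D : 𝔼 n ⊸ 𝔼 n := 𝒹 κ (κ.symm y)
    let L : Submodule ℝ (𝔼 n) := LinearMap.range (ρ (κ.symm y)).toLinearMap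
    have h1 : (G.R y).range = L.map D.toLinearMap := by
      ext v
      constructor
      · rintro ⟨w, rfl⟩
        exact ⟨_, ⟨_, rfl⟩, (hR y w).symm⟩
      · rintro ⟨_, ⟨b, rfl⟩, rfl⟩
        exact ⟨_, (hR y _).trans (by rw [fr_coeff he (κ.map_target hy)]; rfl)⟩
    rw [h1]
    exact LinearEquiv.finrank_eq (Submodule.equivMapOfInjective D.toLinearMap
      (Function.LeftInverse.injective (mfderiv_symm_apply hκ hy).2) L).symm
  obtain ⟨Φ, hΦ0, hΦx, hΦU, hΦc, hΦs, hΦ⟩ := exists_rectification κ.open_target hg.smooth_R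
    hg.smooth_C.continuousOn hg.bracket (κ.map_source hx) hPP
    (fun b hb => hl1 _ ⟨b, rfl⟩ fun i hi => by
      have h1 := congrArg (fun v : 𝔼 n => v i) hb
      simpa [hPa, hi] using h1)
    (ofCoeff fun i => q (single i 1)) (fun v => by
      have h1 : ∀ v, P (G.R (κ x) (ofCoeff (fun i => q (single i 1)) v)) = P v := fun v => by
          rw [ofCoeff_apply, map_sum, map_sum, eq_ofCoeff P, ofCoeff_apply]
          exact sum_congr rfl fun i _ => by rw [← eq_ofCoeff P, map_smul, map_smul, hq]
      exact h1 v)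
  have hψ := trans_mem_maximalAtlas hκ (φ := Φ.symm) hΦs hΦc
  have hΦ0' : Φ.symm (κ x) = 0 := by rw [← hΦx, Φ.left_inv hΦ0]
  have hκx : κ x ∈ Φ.target := hΦx ▸ Φ.map_source hΦ0
  refine ⟨κ ≫ₕ Φ.symm, hψ, leaf, ⟨hx, hκx⟩, fun y hy => hy.1, hΦ0', fun w hw hcond v => ?_⟩
  have hwΦ : w ∈ Φ.source := hw.1
  have hΦw : Φ w ∈ Φ.target := Φ.map_source hwΦ
  have hwκ : Φ w ∈ κ.target := hΦU hΦw
  have hd : HasFDerivAt Φ (𝒟 Φ w) w := hΦc.fderivAt Φ.open_source hwΦ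
  have hds : HasFDerivAt Φ.symm (𝒟 Φ.symm (Φ w)) (Φ w) := hΦs.fderivAt Φ.open_target hΦw
  have hinj : Function.Injective (𝒟 Φ w) := by
    refine Function.LeftInverse.injective (g := 𝒟 Φ.symm (Φ w)) fun v => ?_
    exact DFunLike.congr_fun ((hds.comp w hd).unique ((hasFDerivAt_id w).congr_of_eventuallyEq
      (eventually_of_mem (Φ.open_source.mem_nhds hwΦ) fun z hz => Φ.left_inv hz))) v
  have h1 : 𝒹 (κ ≫ₕ Φ.symm).symm w v = 𝒹 κ.symm (Φ w) (𝒟 Φ w v) := by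
    have h2 := ((contMDiffAt_symm_of_mem_maximalAtlas hκ hwκ).mdifferentiableAt
      (by simp)).hasMFDerivAt.comp w hd.hasMFDerivAt
    exact DFunLike.congr_fun h2.mfderiv v
  have h3 := hΦ w hwΦ (hcond.imp_right fun h y hy => (hrank y hy).trans ((h _
    (κ.map_target hy)).trans (by rw [hrank _ (κ.map_source hx), κ.left_inv hx]))) (𝒟 Φ w v)
  have h4 : (∃ b, ρ (κ.symm (Φ w)) b = 𝒹 κ.symm (Φ w) (𝒟 Φ w v)) ↔ ∃ b, G.R (Φ w) b = 𝒟 Φ w v := by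
    constructor
    · rintro ⟨b, hb⟩
      refine ⟨toLp 2 fun c => he.coeff c _ b, (hR _ _).trans ?_⟩
      · rw [fr_coeff he (κ.map_target hwκ)]
        exact (congrArg _ hb).trans ((mfderiv_symm_apply hκ hwκ).1 _)
    · rintro ⟨b, hb⟩
      exact ⟨_, ((mfderiv_symm_apply hκ hwκ).2 _).symm.trans
        (congrArg (𝒹 κ.symm (Φ w)) ((hR _ b).symm.trans hb))⟩
  have h5 : (∃ h, 𝒟 Φ w (P h) = 𝒟 Φ w v) ↔ P v = v :=
    ⟨fun ⟨h, hh⟩ => by rw [← hinj hh, hPP], fun h => ⟨v, by rw [h]⟩⟩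
  refine Iff.trans ?_ (h4.trans (h3.trans h5))
  exact exists_congr fun b => ⟨fun h => h.trans h1, fun h => h.trans h1.symm⟩

/-! ### Existence of almost Lie brackets -/

lemma contMDiffAt_mvfderiv_apply {f : M → ℝ} {V : ∀ x : M, TangentSpace (𝓡 n) x} {x : M}
    (hf : ContMDiffAt (𝓡 n) 𝓘(ℝ, ℝ) ∞ f x) (hV : SmoothAt n (𝔼 n) V x) :
    ContMDiffAt (𝓡 n) 𝓘(ℝ, ℝ) ∞ (fun y => mvfderiv (𝓡 n) f y (V y)) x := by
  set κ := chartAt (𝔼 n) x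
  have hκ : κ ∈ maximalAtlas (𝓡 n) ∞ M := chart_mem_maximalAtlas x
  have hx : x ∈ κ.source := mem_chart_source _ x
  have hκx := κ.map_source hx
  have h1 : ContDiffAt ℝ ∞ (fun z => f (κ.symm z)) (κ x) :=
    contDiffAt_comp_symm hκ hκx (by rwa [κ.left_inv hx])
  obtain ⟨h2, h3⟩ := contDiffAt_mfderiv_apply hκ hκx (V := V) (by rwa [κ.left_inv hx])
  have h4 := ((h1.fderiv_right (m := ∞) (by simp)).clm_apply h2).contMDiffAt.comp x
    (contMDiffAt_of_mem_maximalAtlas hκ hx)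
  refine h4.congr_of_eventuallyEq ?_
  filter_upwards [κ.open_source.mem_nhds hx, contMDiffAt_iff_contMDiffAt_nhds (by simp) |>.1
    (hf.of_le (m := 1) (by exact_mod_cast le_top))] with y hy hfy
  have hκy := κ.map_source hy
  have h5 : MDifferentiableAt (𝓡 n) 𝓘(ℝ, ℝ) f (κ.symm (κ y)) := by
    rw [κ.left_inv hy]; exact hfy.mdifferentiableAt (by simp)
  have h6 := (h5.hasMFDerivAt.comp (κ y) ((contMDiffAt_symm_of_mem_maximalAtlas hκ
    hκy).mdifferentiableAt (by simp)).hasMFDerivAt).mfderiv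
  rw [mfderiv_eq_fderiv] at h6
  have h7 := DFunLike.congr_fun h6 (mpullback (𝓡 n) (𝓡 n) κ.symm V (κ y))
  refine Eq.trans ?_ h7.symm
  have h8 : 𝒹 κ.symm (κ y) (mpullback (𝓡 n) (𝓡 n) κ.symm V (κ y)) = V (κ.symm (κ y)) := by
    rw [h3 _ hκy]; exact (mfderiv_symm_apply hκ hκy).2 _
  refine Eq.trans ?_ (congrArg (mfderiv (𝓡 n) 𝓘(ℝ, ℝ) f (κ.symm (κ y))) h8).symm
  rw [κ.left_inv hy]
  rfl

lemma mlieBracket_sum_smul {ι : Type*} (s : Finset ι) {V : ∀ x : M, TangentSpace (𝓡 n) x}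
    {f : ι → M → ℝ} {W : ι → ∀ x : M, TangentSpace (𝓡 n) x} {x : M}
    (hf : ∀ b, MDifferentiableAt (𝓡 n) 𝓘(ℝ, ℝ) (f b) x)
    (hW : ∀ b, SmoothAt n (𝔼 n) (W b) x) :
    mlieBracket (𝓡 n) V (fun y => ∑ b ∈ s, f b y • W b y) x =
      ∑ b ∈ s, (mvfderiv (𝓡 n) (f b) x (V x) • W b x + f b x • mlieBracket (𝓡 n) V (W b) x) := by
  have : IsManifold (𝓡 n) 2 M := IsManifold.of_le (n := ∞)
    (WithTop.coe_le_coe.2 (le_top : (2 : ℕ∞) ≤ ⊤))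
  have hd : ∀ b, MDifferentiableAt (𝓡 n) ((𝓡 n).prod 𝓘(ℝ, 𝔼 n))
      (fun y => (⟨y, f b y • W b y⟩ : TangentBundle (𝓡 n) M)) x := fun b =>
    MDifferentiableAt.smul_section (hf b) ((hW b).mdifferentiableAt (by simp))
  induction s using Finset.cons_induction with
  | empty =>
    simp only [Finset.sum_empty]
    exact congrFun VectorField.mlieBracket_zero_right x
  | cons b s hb ih =>
    simp only [Finset.sum_cons]
    rw [← ih, ← VectorField.mlieBracket_smul_right (hf b) ((hW b).mdifferentiableAt (by simp))]
    exact VectorField.mlieBracket_add_right (hd b) (MDifferentiableAt.sum_section fun c _ => hd c)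

variable {ρ : ∀ x : M, E x ⊸ TangentSpace (𝓡 n) x}

/-- The axioms of an almost Lie bracket at the points of a set. -/
structure IsAlmostLieBracketOn (ρ : ∀ x : M, E x ⊸ TangentSpace (𝓡 n) x)
    (br : (∀ x, E x) → (∀ x, E x) → ∀ x, E x) (u : Set M) : Prop where
  smooth : ∀ s s', ∀ x ∈ u, SmoothAt n (𝔼 r) s x →
    SmoothAt n (𝔼 r) s' x → SmoothAt n (𝔼 r) (br s s') x
  antisymm : ∀ s s', ∀ x ∈ u, br s s' x = -br s' s x
  add : ∀ s s' s'', ∀ x ∈ u, SmoothAt n (𝔼 r) s' x →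
    SmoothAt n (𝔼 r) s'' x → br s (s' + s'') x = br s s' x + br s s'' x
  leibniz : ∀ s s' (f : M → ℝ), ∀ x ∈ u, SmoothAt n (𝔼 r) s' x → ContMDiffAt (𝓡 n) 𝓘(ℝ, ℝ) ∞ f x →
    br s (fun y => f y • s' y) x = f x • br s s' x + mvfderiv (𝓡 n) f x (ρ x (s x)) • s' x
  map_anchor : ∀ s s', ∀ x ∈ u, SmoothAt n (𝔼 r) s x → SmoothAt n (𝔼 r) s' x → ρ x (br s s' x) =
      mlieBracket (𝓡 n) (fun y => ρ y (s y)) (fun y => ρ y (s' y)) x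

section localBracket

variable {e : Fin r → ∀ x, E x} {u : Set M} (he : IsLocalFrameOn (𝓡 n) (𝔼 r) ∞ e u)

/-- The flat connection of a frame. -/
def flatDeriv (s : ∀ x, E x) (x : M) (v : TangentSpace (𝓡 n) x) : E x :=
  ∑ b, mvfderiv (𝓡 n) (fun y => he.coeff b y (s y)) x v • e b x

/-- The bracket with structure functions `c a b = [e_a, e_b]`. -/
def localBracket (ρ : ∀ x : M, E x ⊸ TangentSpace (𝓡 n) x) (c : Fin r → Fin r → ∀ x, E x)
    (s s' : ∀ x, E x) (x : M) : E x :=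
  ∑ a, ∑ b, (he.coeff a x (s x) * he.coeff b x (s' x)) • c a b x +
    (flatDeriv he s' x (ρ x (s x)) - flatDeriv he s x (ρ x (s' x)))

/-- The Leibniz rule holds by construction, and compatibility with the anchor extends from the frame
to all sections since both sides satisfy the same Leibniz rule. -/
lemma isAlmostLieBracketOn_localBracket (hu : IsOpen u) (hρ : Hom∞ n (𝔼 r) (𝔼 n) ρ)
    {c : Fin r → Fin r → ∀ x, E x} (hc : ∀ a b x, SmoothAt n (𝔼 r) (c a b) x)
    (hca : ∀ a b x, c a b x = -c b a x) (hcρ : ∀ a b, ∀ x ∈ u, ρ x (c a b x) =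
      mlieBracket (𝓡 n) (fun y => ρ y (e a y)) (fun y => ρ y (e b y)) x) :
    IsAlmostLieBracketOn (r := r) ρ (localBracket he ρ c) u := by
  have hsum : ∀ x ∈ u, ∀ v : E x, ∑ b, he.coeff b x v • e b x = v := fun x hx v => fr_coeff he hx v
  have hcs : ∀ {s : ∀ x, E x} {x}, x ∈ u → SmoothAt n (𝔼 r) s x → ∀ b,
      MDifferentiableAt (𝓡 n) 𝓘(ℝ, ℝ) (fun y => he.coeff b y (s y)) x := fun hx hs b =>
    (contMDiffAt_coeff he hu hx hs b).mdifferentiableAt (by simp)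
  have hρs : ∀ {s : ∀ x, E x} {x}, SmoothAt n (𝔼 r) s x →
      SmoothAt n (𝔼 n) (fun y => ρ y (s y)) x := fun hs =>
    hρ.contMDiffAt.clm_bundle_apply hs
  have hfl : ∀ {s s' : ∀ x, E x} {x}, x ∈ u → SmoothAt n (𝔼 r) s x → SmoothAt n (𝔼 r) s' x →
      SmoothAt n (𝔼 r) (fun y => flatDeriv he s y (ρ y (s' y))) x :=
    fun hx hs hs' => ContMDiffAt.sum_section fun b _ => (contMDiffAt_mvfderiv_apply
      (contMDiffAt_coeff he hu hx hs b) (hρs hs')).smul_section (he.contMDiffAt hu hx b)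
  have h0 : ∀ (s : ∀ x, E x) x v v', flatDeriv he s x (v + v') =
      flatDeriv he s x v + flatDeriv he s x v' := fun s x v v' => by
    simp only [flatDeriv, map_add, add_smul, sum_add_distrib]
  have h0' : ∀ (s : ∀ x, E x) x (f : ℝ) v, flatDeriv he s x (f • v) = f • flatDeriv he s x v :=
    fun s x f v => by simp only [flatDeriv, map_smul, smul_assoc, smul_sum]
  refine ⟨fun s s' x hx hs hs' => ?_, fun s s' x hx => ?_, fun s s' s'' x hx hs' hs'' => ?_,
    fun s s' f x hx hs' hf => ?_, fun s s' x hx hs hs' => ?_⟩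
  · exact (ContMDiffAt.sum_section fun a _ => ContMDiffAt.sum_section fun b _ =>
      ((contMDiffAt_coeff he hu hx hs a).mul (contMDiffAt_coeff he hu hx hs' b)).smul_section
        (hc a b x)).add_section ((hfl hx hs' hs).sub_section (hfl hx hs hs'))
  · rw [localBracket, localBracket, sum_comm, neg_add, neg_sub, ← sum_neg_distrib]
    congr 1
    refine sum_congr rfl fun a _ => ?_
    rw [← sum_neg_distrib]
    exact sum_congr rfl fun b _ => by rw [hca b a, smul_neg, mul_comm]
  · have h1 : flatDeriv he (s' + s'') x (ρ x (s x)) =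
        flatDeriv he s' x (ρ x (s x)) + flatDeriv he s'' x (ρ x (s x)) := by
      simp only [flatDeriv, ← sum_add_distrib, ← add_smul]
      refine sum_congr rfl fun b _ => congrArg (· • _) ?_
      simp only [Pi.add_apply, map_add]
      exact DFunLike.congr_fun (mvfderiv_add (hcs hx hs' b) (hcs hx hs'' b)) _
    rw [localBracket, localBracket, localBracket, h1]
    simp only [Pi.add_apply, map_add, mul_add, add_smul, sum_add_distrib, h0]
    abel
  · have h1 : flatDeriv he (fun y => f y • s' y) x (ρ x (s x)) =
        f x • flatDeriv he s' x (ρ x (s x)) + mvfderiv (𝓡 n) f x (ρ x (s x)) • s' x := by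
      conv_rhs => rw [← hsum x hx (s' x)]
      simp only [flatDeriv, smul_sum, ← sum_add_distrib, smul_smul, ← add_smul]
      refine sum_congr rfl fun b _ => congrArg (· • _) ?_
      simp only [map_smul, smul_eq_mul]
      refine (DFunLike.congr_fun (mvfderiv_mul (hf.mdifferentiableAt (by simp)) (hcs hx hs' b))
        (ρ x (s x))).trans ?_
      simp [mul_comm]
    rw [localBracket, localBracket, h1]
    have h2 : ∀ a b, he.coeff a x (s x) * (f x * he.coeff b x (s' x)) =
        f x * (he.coeff a x (s x) * he.coeff b x (s' x)) := fun a b => by ring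
    simp only [map_smul, smul_eq_mul, smul_add, smul_sub, smul_sum, smul_smul, h2, h0']
    abel
  · have hW : ∀ b, SmoothAt n (𝔼 n) (fun y => ρ y (e b y)) x := fun b =>
      hρs (he.contMDiffAt hu hx b)
    have hexp : ∀ s : ∀ x, E x, (fun y => ρ y (s y)) =ᶠ[𝓝 x]
        fun y => ∑ b, he.coeff b y (s y) • ρ y (e b y) := fun s => by
      filter_upwards [hu.mem_nhds hx] with y hy
      conv_lhs => rw [← hsum y hy (s y)]
      simp only [map_sum, map_smul]
      rfl
    have h1 := (Filter.EventuallyEq.rfl.mlieBracket_vectorField_eq (hexp s')).trans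
      (mlieBracket_sum_smul (V := fun y => ρ y (s y)) Finset.univ (hcs hx hs') hW)
    have h2 : ∀ b, mlieBracket (𝓡 n) (fun y => ρ y (s y)) (fun y => ρ y (e b y)) x =
        -∑ a, (mvfderiv (𝓡 n) (fun y => he.coeff a y (s y)) x (ρ x (e b x)) • ρ x (e a x) +
          he.coeff a x (s x) • ρ x (c b a x)) := fun b => by
      rw [VectorField.mlieBracket_swap_apply]
      refine congrArg Neg.neg ((Filter.EventuallyEq.rfl.mlieBracket_vectorField_eq
        (hexp s)).trans ((mlieBracket_sum_smul Finset.univ (hcs hx hs) hW).trans ?_))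
      exact sum_congr rfl fun a _ => by rw [hcρ b a x hx]
    have h3 : ∀ a, ∑ b, he.coeff b x (s' x) *
        mvfderiv (𝓡 n) (fun y => he.coeff a y (s y)) x (ρ x (e b x)) =
        mvfderiv (𝓡 n) (fun y => he.coeff a y (s y)) x (ρ x (s' x)) := fun a => by
      conv_rhs => rw [← hsum x hx (s' x)]
      simp only [map_sum, map_smul, smul_eq_mul]
    rw [h1]
    simp only [h2, localBracket, flatDeriv, map_add, map_sub, map_sum, map_smul, ← h3]
    simp only [sum_add_distrib, smul_neg, smul_add, smul_sum, smul_smul, neg_add,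
      sum_neg_distrib, Finset.sum_smul]
    rw [sum_comm (f := fun b a => (he.coeff b x (s' x) *
      mvfderiv (𝓡 n) (fun y => he.coeff a y (s y)) x (ρ x (e b x))) • ρ x (e a x)),
      sum_comm (f := fun b a => (he.coeff b x (s' x) * he.coeff a x (s x)) • ρ x (c b a x))]
    have h4 : ∀ a b, (he.coeff b x (s' x) * he.coeff a x (s x)) • ρ x (c b a x) =
        -((he.coeff a x (s x) * he.coeff b x (s' x)) • ρ x (c a b x)) := fun a b => by
      rw [hca b a, map_neg, smul_neg, mul_comm]
    simp only [h4, sum_neg_distrib, neg_neg]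
    abel

end localBracket

variable {ρ : ∀ x : M, E x ⊸ TangentSpace (𝓡 n) x}

/-- Involutivity yields structure functions for a frame extended by a bump function; they can be
made antisymmetric because the Lie bracket is. -/
lemma exists_isAlmostLieBracketOn [T2Space M] (hρ : Hom∞ n (𝔼 r) (𝔼 n) ρ)
    (hinv : IsInvolutive (r := r) ρ) (x : M) : ∃ u, IsOpen u ∧ x ∈ u ∧
      ∃ br, IsAlmostLieBracketOn (r := r) ρ br u := by
  obtain ⟨κ, hκ, hx, -, e, he⟩ := exists_chart_frame (n := n) (r := r) E (chart_mem_maximalAtlas x)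
    (mem_chart_source _ x) Filter.univ_mem
  choose χ hχ hχ1 hχu hχe using fun a => exists_smooth_extension κ.open_source hx
    fun y hy => he.contMDiffAt κ.open_source hy a
  choose c0 hc0 using fun a b => hinv ⟨fun y => (χ a • e a) y, hχe a⟩ ⟨fun y => (χ b • e b) y, hχe b⟩ x
  let c : Fin r → Fin r → ∀ x, E x := fun a b => (1 / 2 : ℝ) • ((c0 a b : ∀ x, E x) - c0 b a)
  have hev : ∀ᶠ y in 𝓝 x, y ∈ κ.source ∧ ∀ a, (χ a =ᶠ[𝓝 y] 1) ∧ ∀ b,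
      mlieBracket (𝓡 n) (fun z => ρ z ((χ a • e a) z)) (fun z => ρ z ((χ b • e b) z)) y =
        ρ y (c0 a b y) :=
    Filter.Eventually.and (κ.open_source.mem_nhds hx) (Filter.eventually_all.2 fun a =>
      (Filter.Eventually.eventually_nhds (hχ1 a)).and (Filter.eventually_all.2 fun b => hc0 a b))
  obtain ⟨u, hu, huo, hxu⟩ := mem_nhds_iff.1 hev
  refine ⟨u, huo, hxu, _, isAlmostLieBracketOn_localBracket (he.mono fun y hy => (hu hy).1) huo hρ
    (c := c) (fun a b y => ?_) (fun a b y => ?_) fun a b y hy => ?_⟩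
  · exact ContMDiffAt.const_smul_section (((c0 a b).contMDiff y).sub_section ((c0 b a).contMDiff y))
  · show (1 / 2 : ℝ) • (c0 a b y - c0 b a y) = -((1 / 2 : ℝ) • (c0 b a y - c0 a b y))
    rw [← smul_neg, neg_sub]
  · have h1 : ∀ a, (fun z => ρ z (e a z)) =ᶠ[𝓝 y] fun z => ρ z ((χ a • e a) z) := fun a => by
      filter_upwards [((hu hy).2 a).1] with z hz
      simp only [Pi.smul_apply', hz, Pi.one_apply, one_smul]
      rfl
    have h2 := (h1 a).mlieBracket_vectorField_eq (I := 𝓡 n) (h1 b)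
    rw [h2]
    show ρ y ((1 / 2 : ℝ) • (c0 a b y - c0 b a y)) = _
    rw [map_smul, map_sub, ← ((hu hy).2 a).2 b, ← ((hu hy).2 b).2 a,
      VectorField.mlieBracket_swap_apply (W := fun z => ρ z ((χ a • e a) z)), sub_neg_eq_add,
      ← two_smul ℝ, smul_smul]
    norm_num

/-- Almost Lie brackets form an affine space, so local ones can be glued with a partition of
unity. -/
lemma exists_isAlmostLieBracket [T2Space M] [SigmaCompactSpace M] (hρ : Hom∞ n (𝔼 r) (𝔼 n) ρ)
    (hinv : IsInvolutive (r := r) ρ) : ∃ br, IsAlmostLieBracket (r := r) ρ br := by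
  choose u hu hxu br hbr using exists_isAlmostLieBracketOn hρ hinv
  obtain ⟨f, hf⟩ := SmoothPartitionOfUnity.exists_isSubordinate (𝓡 n) isClosed_univ u hu
    fun x _ => Set.mem_iUnion_of_mem x (hxu x)
  have hmem : ∀ {x i}, i ∈ f.fintsupport x → x ∈ u i := fun {x i} hi =>
    hf i ((f.mem_fintsupport_iff x i).1 hi)
  have hmem' : ∀ {x i}, i ∈ f.finsupport x → x ∈ u i := fun {x i} hi =>
    hmem (f.finsupport_subset_fintsupport x hi)
  refine ⟨fun s s' x => ∑ i ∈ f.finsupport x, f i x • br i s s' x, fun s s' x hs hs' => ?_,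
    fun s s' x _ _ => ?_, fun s s' s'' x _ hs' hs'' => ?_, fun s s' g x _ hs' hg => ?_,
    fun s s' x hs hs' => ?_⟩
  · refine ContMDiffAt.congr_of_eventuallyEq (f := fun y => TotalSpace.mk'
      (𝔼 r) y (∑ i ∈ f.fintsupport x, f i y • br i s s' y)) ?_ ?_
    · exact ContMDiffAt.sum_section fun i hi => (f i).contMDiff.contMDiffAt.smul_section
        ((hbr i).smooth s s' x (hmem hi) hs hs')
    · filter_upwards [f.eventually_finsupport_subset x] with y hy
      refine congrArg _ (Finset.sum_subset hy fun i _ hi => ?_)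
      rw [f.mem_finsupport, Function.notMem_support] at hi
      rw [hi, zero_smul]
  · rw [← sum_neg_distrib]
    exact sum_congr rfl fun i hi => by rw [(hbr i).antisymm s s' x (hmem' hi), smul_neg]
  · rw [← sum_add_distrib]
    exact sum_congr rfl fun i hi => by rw [(hbr i).add s s' s'' x (hmem' hi) hs' hs'', smul_add]
  · refine (sum_congr rfl fun i hi => congrArg (f i x • ·)
      ((hbr i).leibniz s s' g x (hmem' hi) hs' hg)).trans ?_
    simp only [smul_add, sum_add_distrib]
    refine congrArg₂ _ ?_ ?_
    · rw [smul_sum]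
      exact sum_congr rfl fun i _ => smul_comm _ _ _
    · rw [← Finset.sum_smul, f.sum_finsupport x (Set.mem_univ x), one_smul]
      rfl
  · simp only [map_sum, map_smul]
    rw [sum_congr rfl fun i hi => by rw [(hbr i).map_anchor s s' x (hmem' hi) hs hs'],
      ← Finset.sum_smul, f.sum_finsupport x (Set.mem_univ x), one_smul]

/-- The coordinate plane along the leaves, as a linear embedding. -/
lemma exists_leaf_embedding (leaf : Finset (Fin n)) : ∃ J : 𝔼 leaf.card ⊸ 𝔼 n,
      Function.Injective J ∧ ∀ v, LocalModel.leafProj leaf v = v ↔ ∃ u, J u = v := by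
  let J : 𝔼 leaf.card ⊸ 𝔼 n := LinearMap.toContinuousLinearMap
      { toFun := fun u => toLp 2 fun i => if h : i ∈ leaf then u (leaf.equivFin ⟨i, h⟩) else 0
        map_add' := fun u v => by ext i; by_cases h : i ∈ leaf <;> simp [h]
        map_smul' := fun c v => by ext i; by_cases h : i ∈ leaf <;> simp [h] }
  have hJ : ∀ u i, J u i = if h : i ∈ leaf then u (leaf.equivFin ⟨i, h⟩) else 0 := fun _ _ => rfl
  have hJ' : ∀ u a, J u (leaf.equivFin.symm a) = u a := fun u a => by
    rw [hJ, dif_pos (leaf.equivFin.symm a).2]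
    simp
  refine ⟨J, fun u v h => ?_, fun v => ⟨fun h => ⟨toLp 2 fun a => v (leaf.equivFin.symm a),
    ?_⟩, ?_⟩⟩
  · ext a
    rw [← hJ' u, h, hJ']
  · ext i
    rw [hJ]
    split_ifs with hi
    · simp
    · rw [LocalModel.leafProj_eq_iff.1 h i hi]
  · rintro ⟨u, rfl⟩
    exact LocalModel.leafProj_eq_iff.2 fun i hi => by rw [hJ, dif_neg hi]

variable [T2Space M] {ρ : ∀ x : M, E x ⊸ TangentSpace (𝓡 n) x} (hρ : Hom∞ n (𝔼 r) (𝔼 n) ρ)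
  {br : (∀ x, E x) → (∀ x, E x) → ∀ x, E x} (hbr : IsAlmostLieBracket (r := r) ρ br)

include hρ hbr in
/-- The integral manifold is the coordinate plane along the leaves of an adapted chart. -/
lemma isIntegrable : IsIntegrable ρ := by
  intro x
  obtain ⟨κ, hκ, hx, -, e, he⟩ := exists_chart_frame (n := n) (r := r) E
    (chart_mem_maximalAtlas x) (mem_chart_source _ x) Filter.univ_mem
  obtain ⟨ψ, hψ, leaf, hxψ, -, hψ0, h⟩ := exists_adapted_chart hκ he hρ hbr hx
  obtain ⟨J0, hJ0, hJl⟩ := exists_leaf_embedding leaf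
  have h0 : J0 ⁻¹' ψ.target ∈ 𝓝 0 := J0.continuous.continuousAt.preimage_mem_nhds
    (by rw [map_zero, ← hψ0]; exact ψ.open_target.mem_nhds (ψ.map_source hxψ))
  obtain ⟨c, hc, hball⟩ := Metric.mem_nhds_iff.1 h0
  let J := c • J0
  have hJm : ∀ u ∈ ball (0 : 𝔼 leaf.card) 1, J u ∈ ψ.target := by
    intro u hu
    have h1 : c • u ∈ ball (0 : 𝔼 leaf.card) c := by
      rw [mem_ball_zero_iff] at hu ⊢
      rw [norm_smul, Real.norm_of_nonneg hc.le]
      nlinarith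
    have h2 := hball h1
    rw [Set.mem_preimage, map_smul] at h2
    exact h2
  have hJ : Function.Injective J := fun u v huv => hJ0 (smul_right_injective _ hc.ne' huv)
  have hJl' : ∀ v, LocalModel.leafProj leaf v = v ↔ ∃ u, J u = v := fun v => by
    rw [hJl]
    constructor
    · rintro ⟨u, rfl⟩
      exact ⟨c⁻¹ • u, by
        rw [map_smul, _root_.smul_apply, smul_smul, inv_mul_cancel₀ hc.ne', one_smul]⟩
    · rintro ⟨u, rfl⟩
      exact ⟨c • u, by rw [map_smul]; rfl⟩
  have hs : ∀ w ∈ ψ.target, ContMDiffAt (𝓡 n) (𝓡 n) ∞ ψ.symm w := fun w hw =>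
    contMDiffAt_symm_of_mem_maximalAtlas hψ hw
  have hd : ∀ u ∈ ball (0 : 𝔼 leaf.card) 1, ∀ v,
      mfderiv (𝓡 leaf.card) (𝓡 n) (fun u => ψ.symm (J u)) u v =
        𝒹 ψ.symm (J u) (J v) := fun u hu v =>
    DFunLike.congr_fun (HasMFDerivAt.comp u ((hs _ (hJm u hu)).mdifferentiableAt
      (by simp)).hasMFDerivAt J.hasMFDerivAt).mfderiv v
  refine ⟨leaf.card, fun u => ψ.symm (J u), ?_, fun u hu => ?_, fun u hu v hv huv => ?_,
    fun u hu => ⟨fun v v' hv => ?_, ?_⟩⟩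
  · show ψ.symm (J 0) = x
    rw [map_zero, ← hψ0, ψ.left_inv hxψ]
  · exact ((hs _ (hJm u hu)).comp u J.contDiff.contMDiff.contMDiffAt).contMDiffWithinAt
  · exact hJ (ψ.symm.injOn (hJm u hu) (hJm v hv) huv)
  · rw [hd u hu, hd u hu] at hv
    have h1 := congrArg (𝒹 ψ (ψ.symm (J u))) hv
    obtain ⟨m1, -⟩ := mfderiv_symm_apply hψ (hJm u hu)
    exact hJ ((m1 (J v)).symm.trans (h1.trans (m1 (J v'))))
  · have h1 := h (J u) (hJm u hu) (Or.inl ((hJl' _).2 ⟨u, rfl⟩))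
    obtain ⟨-, m2⟩ := mfderiv_symm_apply hψ (hJm u hu)
    ext w
    constructor
    · rintro ⟨v, rfl⟩
      obtain ⟨b, hb⟩ := (h1 (J v)).2 ((hJl' _).2 ⟨v, rfl⟩)
      exact ⟨b, hb.trans (hd u hu v).symm⟩
    · rintro ⟨b, rfl⟩
      obtain ⟨v, hv⟩ := (hJl' _).1 ((h1 (𝒹 ψ (ψ.symm (J u))
        (ρ (ψ.symm (J u)) b))).1 ⟨b, (m2 _).symm⟩)
      refine ⟨v, (hd u hu v).trans ?_⟩
      exact (congrArg (𝒹 ψ.symm (J u)) hv).trans (m2 _)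

variable (g : PseudoMetric n M) (H : ClosedThreeForm n M)
  (nabla : CovariantDerivative (𝓡 n) (𝔼 r) E)
  (φ : ∀ x : M, TangentSpace (𝓡 n) x ⊸ E x ⊸ E x)
  (α : ∀ x : M, E x ⊸ TangentSpace (𝓡 n) x ⊸ ℝ)

lemma exists_chart_frame_primitive (br : (∀ x, E x) → (∀ x, E x) → ∀ x, E x) (x : M) {N : Set M}
    (hN : N ∈ 𝓝 x) : ∃ κ ∈ maximalAtlas (𝓡 n) ∞ M,
      x ∈ κ.source ∧ κ.source ⊆ N ∧ ∃ (e : Fin r → ∀ x, E x)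
      (he : IsLocalFrameOn (𝓡 n) (𝔼 r) ∞ e κ.source)
      (B : 𝔼 n → Fin n → Fin n → ℝ),
      (localModel g H ρ br nabla φ α κ he).IsPrimitive B := by
  obtain ⟨κ, hκ, hx, hκN, e, he⟩ := exists_chart_frame (n := n) (r := r) E
    (chart_mem_maximalAtlas x) (mem_chart_source _ x) hN
  obtain ⟨B, δ, hδ, -, h⟩ := exists_isPrimitive (r := r) g H ρ br nabla φ α hκ hx
  have hs := restrChart_source (κ := κ) (isOpen_ball (x := κ x) (ε := δ))
  have hsub : (restrChart κ (isOpen_ball (x := κ x) (ε := δ))).source ⊆ κ.source := by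
    rw [hs]; exact Set.inter_subset_left
  exact ⟨_, restrChart_mem isOpen_ball hκ, by rw [hs]; exact ⟨hx, Metric.mem_ball_self hδ⟩,
    fun y hy => (hκN (hsub hy)).1, e, he.mono hsub, B, h _ subset_rfl _⟩

include hρ hbr in
/-- Restricting an adapted chart at a regular point to a small box makes it foliated. -/
lemma exists_foliated_chart {F : M → Type*} [TopologicalSpace (TotalSpace (𝔼 k) F)]
    [∀ x, AddCommGroup (F x)] [∀ x, Module ℝ (F x)] [∀ x, TopologicalSpace (F x)]
    [FiberBundle (𝔼 k) F] [VectorBundle ℝ (𝔼 k) F]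
    [ContMDiffVectorBundle ∞ (𝔼 k) F (𝓡 n)]
    {x : M} (hx : IsRegular ρ x) {N : Set M} (hN : N ∈ 𝓝 x) :
    ∃ κ ∈ maximalAtlas (𝓡 n) ∞ M, x ∈ κ.source ∧ κ.source ⊆ N ∧ ∃ (e : Fin r → ∀ x, E x)
      (he : IsLocalFrameOn (𝓡 n) (𝔼 r) ∞ e κ.source)
      (f : Fin k → ∀ x, F x)
      (_ : IsLocalFrameOn (𝓡 n) (𝔼 k) ∞ f κ.source)
      (B : 𝔼 n → Fin n → Fin n → ℝ) (leaf : Finset (Fin n)),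
      (localModel g H ρ br nabla φ α κ he).IsPrimitive B ∧
      (localModel g H ρ br nabla φ α κ he).IsFoliated leaf := by
  obtain ⟨κ1, hκ1, hx1, hN1, e, he1⟩ := exists_chart_frame (n := n) (r := r) E
    (chart_mem_maximalAtlas x) (mem_chart_source _ x) (Filter.inter_mem hN hx)
  obtain ⟨κ2, hκ2, hx2, hN2, f, hf2⟩ := exists_chart_frame (n := n) (r := k) F hκ1 hx1
    Filter.univ_mem
  have h21 : κ2.source ⊆ κ1.source := fun y hy => (hN2 hy).2
  obtain ⟨ψ, hψ, leaf, hxψ, hψ2, hψ0, h⟩ := exists_adapted_chart hκ2 (he1.mono h21) hρ hbr hx2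
  obtain ⟨B, δ, hδ, hballψ, hB⟩ := exists_isPrimitive (r := r) g H ρ br nabla φ α hψ hxψ
  set S : Set (𝔼 n) := {y | LocalModel.transversal leaf y ∈ ball 0 (δ / 2) ∧
    LocalModel.tangential leaf y ∈ ball 0 (δ / 2)} with hSdef
  have hS : IsOpen S := by
    refine (isOpen_ball.preimage ?_).inter (isOpen_ball.preimage ?_)
    · exact (LocalModel.transversalL leaf).continuous
    · exact (PiLp.continuous_toLp 2 _).comp (continuous_pi fun i =>
        (proj (𝕜 := ℝ) (i : Fin n)).continuous)
  have hSδ : S ⊆ ball (ψ x) δ := fun y hy => by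
    rw [hψ0]
    simp only [hSdef, Set.mem_ofPred_eq, mem_ball_zero_iff] at hy
    rw [mem_ball_zero_iff]
    refine abs_lt_of_sq_lt_sq' ?_ hδ.le |>.2
    have h1 : ‖y‖ ^ 2 = ‖LocalModel.tangential leaf y‖ ^ 2 + ‖LocalModel.transversal leaf y‖ ^ 2 := by
      simp only [EuclideanSpace.norm_sq_eq]
      exact (Fintype.sum_subtype_add_sum_subtype (· ∈ leaf) fun i => ‖y i‖ ^ 2).symm.trans
        (congrArg₂ (· + ·) (sum_congr (by ext; simp) fun _ _ => rfl) rfl)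
    have h2 := pow_lt_pow_left₀ hy.1 (norm_nonneg _) two_ne_zero
    have h3 := pow_lt_pow_left₀ hy.2 (norm_nonneg _) two_ne_zero
    rw [h1]
    nlinarith
  have hsrc := restrChart_source (κ := ψ) hS
  have hsub : (restrChart ψ hS).source ⊆ κ2.source := by
    rw [hsrc]; exact Set.inter_subset_left.trans hψ2
  have htar := restrChart_target hS (hSδ.trans hballψ)
  have hκ := restrChart_mem hS hψ
  have he := he1.mono (hsub.trans h21)
  refine ⟨restrChart ψ hS, hκ, ?_, fun y hy => (hN1 (h21 (hsub hy))).1.1, e, he, f, hf2.mono hsub,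
    B, leaf, hB hS hSδ _, ⟨ball 0 (δ / 2), ball 0 (δ / 2), isOpen_ball,
    isOpen_ball, convex_ball _ _, htar⟩, fun y hy v => ?_⟩
  · rw [hsrc]
    refine ⟨hxψ, ?_⟩
    rw [Set.mem_preimage, hψ0]
    have h1 : LocalModel.transversal leaf (0 : 𝔼 n) = 0 := rfl
    have h2 : LocalModel.tangential leaf (0 : 𝔼 n) = 0 := rfl
    refine ⟨?_, ?_⟩
    · rw [h1]; exact Metric.mem_ball_self (by positivity)
    · rw [h2]; exact Metric.mem_ball_self (by positivity)
  · have hy : y ∈ (restrChart ψ hS).target := hy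
    have hyS : y ∈ S := htar ▸ hy
    obtain ⟨m1, m2⟩ := mfderiv_symm_apply hκ hy
    have h1 := h y (hballψ (hSδ hyS)) (Or.inr fun z hz => (hN1 (h21 hz)).1.2) (toLp 2 v)
    rw [LocalModel.leafProj_eq_iff] at h1
    refine Iff.trans ?_ h1
    set m := localModel g H ρ br nabla φ α (restrChart ψ hS) he
    have hR := R_localModel (g := g) (H := H) (ρ := ρ) (br := br) (nabla := nabla) (φ := φ) (α := α)
      he (y := y) (B := B)
    constructor
    · rintro ⟨c, hc⟩
      have h2 : (m.toGeo B).R y (toLp 2 c) = toLp 2 v := by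
        ext i
        rw [LocalModel.R_apply]
        exact (hc i).symm
      refine ⟨fr e _ (toLp 2 c), (m2 _).symm.trans ?_⟩
      exact congrArg (𝒹 (restrChart ψ hS).symm y) ((hR _).symm.trans h2)
    · rintro ⟨b, hb⟩
      refine ⟨fun a => he.coeff a ((restrChart ψ hS).symm y) b, fun i => ?_⟩
      have h2 : (m.toGeo B).R y (toLp 2 fun a => he.coeff a ((restrChart ψ hS).symm y) b) =
          toLp 2 v := by
        refine (hR _).trans ?_
        exact (congrArg (𝒹 (restrChart ψ hS) _) ((congrArg (ρ _)
          (fr_coeff he ((restrChart ψ hS).map_target hy) b)).trans hb)).trans (m1 _)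
      rw [← LocalModel.R_apply (m := m) (B := B) (u := toLp 2 fun a =>
        he.coeff a ((restrChart ψ hS).symm y) b), h2]

end

end GaugedSigma

end

theorem mainTheorem3 {n r k : ℕ}
    {M : Type*} [TopologicalSpace M] [T2Space M] [SigmaCompactSpace M]
    [ChartedSpace (EuclideanSpace ℝ (Fin n)) M] [IsManifold (𝓡 n) ∞ M]
    {E : M → Type*} [TopologicalSpace (Bundle.TotalSpace (EuclideanSpace ℝ (Fin r)) E)]
    [∀ x, AddCommGroup (E x)] [∀ x, Module ℝ (E x)] [∀ x, TopologicalSpace (E x)]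
    [∀ x, IsTopologicalAddGroup (E x)] [∀ x, ContinuousSMul ℝ (E x)]
    [FiberBundle (EuclideanSpace ℝ (Fin r)) E] [VectorBundle ℝ (EuclideanSpace ℝ (Fin r)) E]
    [ContMDiffVectorBundle ∞ (EuclideanSpace ℝ (Fin r)) E (𝓡 n)]
    {F : M → Type*} [TopologicalSpace (Bundle.TotalSpace (EuclideanSpace ℝ (Fin k)) F)]
    [∀ x, AddCommGroup (F x)] [∀ x, Module ℝ (F x)] [∀ x, TopologicalSpace (F x)]
    [∀ x, IsTopologicalAddGroup (F x)] [∀ x, ContinuousSMul ℝ (F x)]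
    [FiberBundle (EuclideanSpace ℝ (Fin k)) F] [VectorBundle ℝ (EuclideanSpace ℝ (Fin k)) F]
    [ContMDiffVectorBundle ∞ (EuclideanSpace ℝ (Fin k)) F (𝓡 n)]
    (ρ : ∀ x : M, E x →L[ℝ] TangentSpace (𝓡 n) x)
    (hρ : ContMDiff (𝓡 n)
      ((𝓡 n).prod 𝓘(ℝ, EuclideanSpace ℝ (Fin r) →L[ℝ] EuclideanSpace ℝ (Fin n))) ∞
      (fun x => Bundle.TotalSpace.mk'
        (EuclideanSpace ℝ (Fin r) →L[ℝ] EuclideanSpace ℝ (Fin n)) x (ρ x)))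
    (hinv : IsInvolutive (r := r) ρ)
    (t : ∀ x : M, F x →L[ℝ] E x)
    (ht : ContMDiff (𝓡 n)
      ((𝓡 n).prod 𝓘(ℝ, EuclideanSpace ℝ (Fin k) →L[ℝ] EuclideanSpace ℝ (Fin r))) ∞
      (fun x => Bundle.TotalSpace.mk'
        (EuclideanSpace ℝ (Fin k) →L[ℝ] EuclideanSpace ℝ (Fin r)) x (t x))) :
    IsIntegrable ρ ∧ (∃ br, IsAlmostLieBracket (r := r) ρ br) ∧
    ∀ (sig : Signature) (g : PseudoMetric n M) (H : ClosedThreeForm n M)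
      (br : (∀ x, E x) → (∀ x, E x) → ∀ x, E x) (_ : IsAlmostLieBracket (r := r) ρ br)
      (nabla : CovariantDerivative (𝓡 n) (EuclideanSpace ℝ (Fin r)) E)
      (_ : CovariantDerivative.ContMDiffCovariantDerivative nabla ∞)
      (φ : ∀ x : M, TangentSpace (𝓡 n) x →L[ℝ] E x →L[ℝ] E x)
      (_ : ContMDiff (𝓡 n) ((𝓡 n).prod 𝓘(ℝ, EuclideanSpace ℝ (Fin n) →L[ℝ]
          EuclideanSpace ℝ (Fin r) →L[ℝ] EuclideanSpace ℝ (Fin r))) ∞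
        (fun x => Bundle.TotalSpace.mk' (EuclideanSpace ℝ (Fin n) →L[ℝ]
          EuclideanSpace ℝ (Fin r) →L[ℝ] EuclideanSpace ℝ (Fin r)) x (φ x)))
      (α : ∀ x : M, E x →L[ℝ] TangentSpace (𝓡 n) x →L[ℝ] ℝ)
      (_ : ContMDiff (𝓡 n) ((𝓡 n).prod 𝓘(ℝ, EuclideanSpace ℝ (Fin r) →L[ℝ]
          EuclideanSpace ℝ (Fin n) →L[ℝ] ℝ)) ∞
        (fun x => Bundle.TotalSpace.mk' (EuclideanSpace ℝ (Fin r) →L[ℝ]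
          EuclideanSpace ℝ (Fin n) →L[ℝ] ℝ) x (α x))),
      (∀ κ ∈ IsManifold.maximalAtlas (𝓡 n) ∞ M, ∀ (e : Fin r → ∀ x, E x)
        (he : IsLocalFrameOn (𝓡 n) (EuclideanSpace ℝ (Fin r)) ∞ e κ.source),
        (localModel g H ρ br nabla φ α κ he).MetricCondition ∧
        (localModel g H ρ br nabla φ α κ he).FluxCondition sig ∧
        (localModel g H ρ br nabla φ α κ he).Isotropy ∧
        (localModel g H ρ br nabla φ α κ he).Equivariance) →
      -- the local lift
      (∀ x : M, ∀ N ∈ 𝓝 x, ∃ κ ∈ IsManifold.maximalAtlas (𝓡 n) ∞ M,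
        x ∈ κ.source ∧ κ.source ⊆ N ∧ ∃ (e : Fin r → ∀ x, E x)
        (he : IsLocalFrameOn (𝓡 n) (EuclideanSpace ℝ (Fin r)) ∞ e κ.source)
        (B : EuclideanSpace ℝ (Fin n) → Fin n → Fin n → ℝ),
        (localModel g H ρ br nabla φ α κ he).IsPrimitive B) ∧
      (∀ κ ∈ IsManifold.maximalAtlas (𝓡 n) ∞ M, ∀ (e : Fin r → ∀ x, E x)
        (he : IsLocalFrameOn (𝓡 n) (EuclideanSpace ℝ (Fin r)) ∞ e κ.source)
        (B : EuclideanSpace ℝ (Fin n) → Fin n → Fin n → ℝ),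
        (localModel g H ρ br nabla φ α κ he).IsPrimitive B →
        (localModel g H ρ br nabla φ α κ he).IsGauging sig B) ∧
      -- strictness and completeness
      (IsExactOnSections (r := r) (k := k) t ρ → (∀ x v, α x (t x v) = 0) →
        (∀ κ ∈ IsManifold.maximalAtlas (𝓡 n) ∞ M, ∀ (e : Fin r → ∀ x, E x)
          (he : IsLocalFrameOn (𝓡 n) (EuclideanSpace ℝ (Fin r)) ∞ e κ.source)
          (f : Fin k → ∀ x, F x)
          (_ : IsLocalFrameOn (𝓡 n) (EuclideanSpace ℝ (Fin k)) ∞ f κ.source)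
          (B : EuclideanSpace ℝ (Fin n) → Fin n → Fin n → ℝ),
          (localModel g H ρ br nabla φ α κ he).IsPrimitive B →
          (localModel g H ρ br nabla φ α κ he).IsInvariant sig B (localShift t κ he f)) ∧
        ((∀ x (v : TangentSpace (𝓡 n) x), v ≠ 0 → 0 < g.inner x v v) →
          (∀ x : M, IsRegular ρ x → ∀ N ∈ 𝓝 x, ∃ κ ∈ IsManifold.maximalAtlas (𝓡 n) ∞ M,
            x ∈ κ.source ∧ κ.source ⊆ N ∧ ∃ (e : Fin r → ∀ x, E x)
            (he : IsLocalFrameOn (𝓡 n) (EuclideanSpace ℝ (Fin r)) ∞ e κ.source)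
            (f : Fin k → ∀ x, F x)
            (_ : IsLocalFrameOn (𝓡 n) (EuclideanSpace ℝ (Fin k)) ∞ f κ.source)
            (B : EuclideanSpace ℝ (Fin n) → Fin n → Fin n → ℝ) (leaf : Finset (Fin n)),
            (localModel g H ρ br nabla φ α κ he).IsPrimitive B ∧
            (localModel g H ρ br nabla φ α κ he).IsFoliated leaf) ∧
          (∀ κ ∈ IsManifold.maximalAtlas (𝓡 n) ∞ M, ∀ (e : Fin r → ∀ x, E x)
            (he : IsLocalFrameOn (𝓡 n) (EuclideanSpace ℝ (Fin r)) ∞ e κ.source)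
            (f : Fin k → ∀ x, F x)
            (_ : IsLocalFrameOn (𝓡 n) (EuclideanSpace ℝ (Fin k)) ∞ f κ.source)
            (B : EuclideanSpace ℝ (Fin n) → Fin n → Fin n → ℝ) (leaf : Finset (Fin n)),
            (localModel g H ρ br nabla φ α κ he).IsPrimitive B →
            (localModel g H ρ br nabla φ α κ he).IsFoliated leaf →
            (sig = Signature.euclidean → ∀ x ∈ κ.source, LeafNondegenerate g ρ α x) →
            (localModel g H ρ br nabla φ α κ he).IsStrict sig B (localShift t κ he f) leaf ∧
            (localModel g H ρ br nabla φ α κ he).IsComplete sig B (localShift t κ he f)))) := by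
  obtain ⟨br₀, hbr₀⟩ := exists_isAlmostLieBracket hρ hinv
  refine ⟨isIntegrable hρ hbr₀, ⟨br₀, hbr₀⟩, ?_⟩
  intro sig g H br hbr nabla hn φ hφ α hα hcond
  have hG : ∀ κ ∈ IsManifold.maximalAtlas (𝓡 n) ∞ M, ∀ (e : Fin r → ∀ x, E x)
      (he : IsLocalFrameOn (𝓡 n) (EuclideanSpace ℝ (Fin r)) ∞ e κ.source)
      (B : EuclideanSpace ℝ (Fin n) → Fin n → Fin n → ℝ),
      (localModel g H ρ br nabla φ α κ he).IsPrimitive B →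
      ((localModel g H ρ br nabla φ α κ he).toGeo B).IsGauged sig.sign := by
    intro κ hκ e he B hB
    obtain ⟨h1, h2, h3, h4⟩ := hcond κ hκ e he
    exact LocalModel.isGauged_toGeo (isAdmissible_localModel hκ he hρ hbr hn hφ hα) hB h1 h2 h3 h4
  refine ⟨fun x N hN => exists_chart_frame_primitive g H nabla φ α br x hN,
    fun κ hκ e he B hB => LocalModel.isGauging (hG κ hκ e he B hB), fun hex hαt => ⟨?_, fun hg =>
    ⟨fun x hx N hN => exists_foliated_chart hρ hbr g H nabla φ α hx hN, ?_⟩⟩⟩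
  · intro κ hκ e he f hf B hB
    refine LocalModel.isInvariant (hG κ hκ e he B hB) (smooth_shiftMap hκ he hf ht)
      (fun y hy l => ?_) (fun y hy l => ?_)
    · rw [R_localModel_eq_zero hκ he hy, fr_shiftMap he hy, hex.1]
    · ext v
      rw [Al_localModel, fr_shiftMap he hy, hαt]
      rfl
  · intro κ hκ e he f hf B leaf hB hfol hN
    have h := hG κ hκ e he B hB
    have hL := leafCondition_localModel (H := H) (br := br) (nabla := nabla) (φ := φ) (B := B)
      hκ he hg hN
    have hT := isExactShift_localModel hκ he hf ht h.toIsSmooth hfol hex hαt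
    exact ⟨LocalModel.isStrict h hfol hL hT, LocalModel.isComplete h hfol hL hT⟩
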